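/- **Setting.** Let $\nu,d\ge 1$ be integers, $\tau,\mathtt d,\sigma>0$, and put $s_0=[\frac{\nu+d}{2}]+1$, $\mathfrak s_0=2s_0$, $\bar\mu=\frac{d-1}{2}+\sigma+2\tau+1$, $\mathtt a=4\tau+8\mathtt d+3$, $\mathtt b=\mathtt a+1$, and, for $q\in\mathbb R$, $S_q=[q/2]-\bar\mu-\mathtt b$. Functions in $L^2_0(\mathbb T^d)$ (complex, zero average) are identified with their Fourier coefficients $(u_j)_{j\in\mathbb Z^d\setminus\{0\}}$, with $\|u\|^2=\sum|u_j|^2$. Let $\sigma_0=\{|j|:j\in\mathbb Z^d\setminus\{0\}\}$ ($|\cdot|$ Euclidean), $\mathbb E_\alpha=\mathrm{span}\{e^{ij\cdot x}:|j|=\alpha\}$, and let $[R]_\alpha^\beta=(R_j^{j'})_{|j|=\alpha,|j'|=\beta}\in\mathcal B(\mathbb E_\beta,\mathbb E_\alpha)$ be the blocks of an operator $R$, with Hilbert–Schmidt norm $\|\cdot\|_{HS}$; $\|\cdot\|_{\mathrm{Op}(\alpha,\beta)}$ is the operator norm of linear maps of $(\mathcal B(\mathbb E_\beta,\mathbb E_\alpha),\|\cdot\|_{HS})$,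 and $\mathcal S(\mathbb E_\alpha)$ is the space of self-adjoint operators on $\mathbb E_\alpha$. Write $\overline R u=\overline{R\bar u}$, $R^T$ for the transpose with respect to $\langle u,v\rangle=\int uv\,dx$, $\langle\ell\rangle=\max\{1,|\ell|\}$, $\langle\ell,\alpha,\beta\rangle=\max\{1,|\ell|,\alpha,\beta\}$. For $R:\mathbb T^\nu\to\mathcal B(L^2_0)$ with Fourier coefficients $\widehat R(\ell)$, $$|R|_s=\sup_{\alpha,\beta\in\sigma_0}\Big(\sum_{\ell\in\mathbb Z^\nu}\langle\ell,\alpha,\beta\rangle^{2s}\|[\widehat R(\ell)]_\alpha^\beta\|_{HS}^2\Big)^{1/2}.$$ For an operator matrix $\begin{pmatrix}R_1&R_2\\ \overline R_2&\overline R_1\end{pmatrix}$ one sums the norms of $R_1$ and $R_2$. For functions of $\omega$ in a set $S\subseteq\mathbb R^\nu$ and $\gamma>0$, $\|f\|^{\mathrm{Lip}(\gamma)}=\sup_{S}\|f\|+\gamma\sup_{\omega_1\ne\omega_2\in S}\|f(\omega_1)-f(\omega_2)\|/|\omega_1-\omega_2|$ (for matrices, again the sum over $R_1,R_2$). A family of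 bounded operators $X(\varphi)$ is a *Hamiltonian vector field* if $X=\mathrm i\begin{pmatrix}R_1&R_2\\-\overline R_2&-\overline R_1\end{pmatrix}$ with $R_1=R_1^*$, $R_2=R_2^T$ for every $\varphi$. A map is *symplectic* if it preserves $\{(u,\bar u)\}$ and on it the form $\mathrm i\int(u_1\bar u_2-\bar u_1u_2)dx$. The push-forward of $X$ by $\Phi$ is $\Phi_{\omega*}X=\Phi^{-1}X\Phi-\Phi^{-1}\,\omega\cdot\partial_\varphi\Phi$. For $N_0\in\mathbb N$ let $N_{-1}=1$, $N_k=N_0^{(3/2)^k}$. For a compact $\Omega\subset\mathbb R^\nu$ let $DC(\gamma,\tau)=\{\omega\in\Omega:|\omega\cdot\ell|\ge\gamma|\ell|^{-\tau}\ \forall\ell\in\mathbb Z^\nu\setminus\{0\}\}$. **Theorem (KAM reducibility).** There is $C_1=C_1(\nu,d,\tau,\mathtt d,\sigma)$ such that for every $q>2(\mathfrak s_0+\bar\mu+\mathtt b)$ and $K>0$ there is $C>0$ such that for every sufficiently large $N_0\in\mathbb N$ (all depending only on $q,K,\tau,\mathtt d,\sigma,\nu,d$) there is $\delta\in(0,1)$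 (depending on the same quantities and on $N_0$) with the following property. Let $\gamma\in(0,1)$, $\varepsilon>0$, $\varepsilon\gamma^{-1}\le\delta$, let $\Omega\subset\mathbb R^\nu$ be compact, and let $$\mathcal L_0(\varphi)=\mathcal D_0+\mathcal R_0(\varphi),\qquad \mathcal D_0=\mathrm i\begin{pmatrix}-\mathcal D_0^{(1)}&0\\0&\mathcal D_0^{(1)}\end{pmatrix},\quad \mathcal D_0^{(1)}=\mathrm{diag}_{j\ne0}(m|j|+c(|j|)),$$ where $m\in\mathbb R$ does not depend on $\omega$, $c(\alpha)=c(\alpha;\omega)\in\mathbb R$, $|m-1|\le K\varepsilon$, $|c(\alpha)|^{\mathrm{Lip}(\gamma)}\alpha\le K\varepsilon$ for all $\alpha\in\sigma_0$, and, for $\omega\in DC(\gamma,\tau)$, $\mathcal R_0(\varphi)=\mathcal R_0(\varphi;\omega)$ is a Hamiltonian vector field, continuous in $\varphi\in\mathbb T^\nu$, with $|\mathcal R_0|_s^{\mathrm{Lip}(\gamma)}\le K\varepsilon$ on $DC(\gamma,\tau)$ for all $s_0\le s\le[q/2]-\bar\mu$. Then there are, for all $k\ge0$: **(S1)** Hamiltonian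 vector fields $\mathcal L_k=\mathcal D_k+\mathcal R_k(\varphi)$, equal to $\mathcal L_0$ for $k=0$, with $$\mathcal D_k=\mathrm i\begin{pmatrix}-\mathcal D_k^{(1)}&0\\0&\overline{\mathcal D_k^{(1)}}\end{pmatrix},\quad\mathcal D_k^{(1)}=\mathrm{diag}_{\alpha\in\sigma_0}[\mathcal D_k^{(1)}]_\alpha^\alpha,\quad[\mathcal D_k^{(1)}]_\alpha^\alpha\in\mathcal S(\mathbb E_\alpha),$$ $\mathcal R_k$ Hamiltonian and continuous in $\varphi$, defined for $\omega\in\Omega_k^\gamma$, where $\Omega_0^\gamma=DC(\gamma,\tau)$ and, for $k\ge1$, $\Omega_k^\gamma$ is the set of $\omega\in\Omega_{k-1}^\gamma$ such that the maps $$\mathbb A^-_{k-1}(\ell,\alpha,\beta)X=\omega\cdot\ell\,X+[\mathcal D^{(1)}_{k-1}]_\alpha^\alpha X-X[\mathcal D^{(1)}_{k-1}]_\beta^\beta,\qquad \mathbb A^+_{k-1}(\ell,\alpha,\beta)X=\omega\cdot\ell\,X+[\mathcal D^{(1)}_{k-1}]_\alpha^\alpha X+X[\overline{\mathcal D^{(1)}_{k-1}}]_\beta^\beta$$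 of $\mathcal B(\mathbb E_\beta,\mathbb E_\alpha)$ are invertible with $$\|\mathbb A^-_{k-1}(\ell,\alpha,\beta)^{-1}\|_{\mathrm{Op}(\alpha,\beta)}\le\frac{\alpha^{\mathtt d}\beta^{\mathtt d}\langle\ell\rangle^\tau}{\gamma}\ \text{ if }(\ell,\alpha,\beta)\ne(0,\alpha,\alpha),\qquad\|\mathbb A^+_{k-1}(\ell,\alpha,\beta)^{-1}\|_{\mathrm{Op}(\alpha,\beta)}\le\frac{\langle\ell\rangle^\tau}{\gamma\langle\alpha+\beta\rangle},$$ for all $(\ell,\alpha,\beta)\in\mathbb Z^\nu\times\sigma_0\times\sigma_0$ with $\langle\ell,\alpha,\beta\rangle\le N_{k-1}$. On $\Omega_k^\gamma$, for all $\alpha\in\sigma_0$ and $s\in[\mathfrak s_0,S_q]$, $$\|[\mathcal D_k^{(1)}-\mathcal D_0^{(1)}]_\alpha^\alpha\|_{HS}^{\mathrm{Lip}(\gamma)}\le C\varepsilon\alpha^{-S_q},\qquad|\mathcal R_k|_s^{\mathrm{Lip}(\gamma)}\le|\mathcal R_0|_{s+\mathtt b}^{\mathrm{Lip}(\gamma)}N_{k-1}^{-\mathtt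 a},\qquad|\mathcal R_k|_{s+\mathtt b}^{\mathrm{Lip}(\gamma)}\le|\mathcal R_0|_{s+\mathtt b}^{\mathrm{Lip}(\gamma)}N_{k-1}.$$ Moreover, for $k\ge1$ and $\omega\in\Omega_k^\gamma$, $\mathcal L_k=(\Phi_{k-1})_{\omega*}\mathcal L_{k-1}$ (on the domain $H^1_0\times H^1_0$, which $\Phi_{k-1}(\varphi)$ preserves), where $\Phi_{k-1}=\exp(\Psi_{k-1})$ is symplectic and $\Psi_{k-1}$ is a Hamiltonian vector field, $C^1$ in $\varphi$, such that on $\Omega_k^\gamma$, for $s\in[\mathfrak s_0,S_q]$, $$|\Psi_{k-1}|_s^{\mathrm{Lip}(\gamma)}\le|\mathcal R_0|_{s+\mathtt b}^{\mathrm{Lip}(\gamma)}\gamma^{-1}N_{k-1}^{2\tau+4\mathtt d+1}N_{k-2}^{-\mathtt a}.$$ **(S2)** Lipschitz extensions $[\widetilde{\mathcal D}_k^{(1)}]_\alpha^\alpha:DC(\gamma,\tau)\to\mathcal S(\mathbb E_\alpha)$ of $[\mathcal D_k^{(1)}]_\alpha^\alpha:\Omega_k^\gamma\to\mathcal S(\mathbb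 E_\alpha)$, $\alpha\in\sigma_0$, such that for $k\ge1$ $$\|[\widetilde{\mathcal D}_k^{(1)}]_\alpha^\alpha-[\widetilde{\mathcal D}_{k-1}^{(1)}]_\alpha^\alpha\|_{HS}^{\mathrm{Lip}(\gamma)}\le C_1\alpha^{-S_q}|\mathcal R_{k-1}|_{S_q}^{\mathrm{Lip}(\gamma)},\qquad \alpha^{-S_q}|\mathcal R_{k-1}|_{S_q}^{\mathrm{Lip}(\gamma)}\le C_1N_{k-2}^{-\mathtt a}\alpha^{-S_q}|\mathcal R_0|_{S_q+\mathtt b}^{\mathrm{Lip}(\gamma)}.$$ In particular, for each $\alpha$, $[\widetilde{\mathcal D}_k^{(1)}]_\alpha^\alpha$ converges, as $k\to\infty$, in $\|\cdot\|_{HS}^{\mathrm{Lip}(\gamma)}$ on $DC(\gamma,\tau)$ to a function with values in $\mathcal S(\mathbb E_\alpha)$. -/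

import Mathlib

open scoped ENNReal

noncomputable section

namespace KAM

/-! ### Fourier modes, spectrum, eigenspaces -/

/-- Nonzero Fourier modes `j ∈ ℤ^d ∖ {0}`. -/
def Modes (d : ℕ) : Type := {j : Fin d → ℤ // j ≠ 0}

instance (d : ℕ) : Neg (Modes d) := ⟨fun j => ⟨-j.1, neg_ne_zero.mpr j.2⟩⟩

instance (d : ℕ) : InvolutiveNeg (Modes d) where
  neg_neg j := Subtype.ext (neg_neg j.1)

/-- Euclidean length of an integer vector. -/
def intNorm {n : ℕ} (j : Fin n → ℤ) : ℝ := Real.sqrt (∑ i, (j i : ℝ) ^ 2)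

theorem abs_le_intNorm {n : ℕ} (j : Fin n → ℤ) (i : Fin n) : |(j i : ℝ)| ≤ intNorm j :=
  Real.abs_le_sqrt (Finset.single_le_sum (f := fun i => (j i : ℝ) ^ 2)
    (fun _ _ => sq_nonneg _) (Finset.mem_univ i))

theorem intNorm_neg {n : ℕ} (j : Fin n → ℤ) : intNorm (-j) = intNorm j := by
  simp [intNorm]

/-- The spectrum `σ₀(√-Δ) = {|j| : j ∈ ℤ^d ∖ {0}}` on zero-average functions. -/
def Spec (d : ℕ) : Type := {α : ℝ // ∃ j : Modes d, intNorm j.1 = α}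

/-- The modes with `|j| = α`; the exponentials `e^{i j·x}` over them are a basis of the
eigenspace `E_α`. -/
def Shell {d : ℕ} (α : Spec d) : Type := {j : Modes d // intNorm j.1 = α.1}

instance {d : ℕ} (α : Spec d) : Finite (Shell α) := by
  have hfin : (Set.univ.pi fun _ : Fin d => Set.Icc (-⌈α.1⌉) ⌈α.1⌉).Finite :=
    Set.Finite.pi fun _ => Set.finite_Icc _ _
  have := hfin.to_subtype
  refine Finite.of_injective (β := (Set.univ.pi fun _ : Fin d => Set.Icc (-⌈α.1⌉) ⌈α.1⌉))
    (fun j => ⟨j.1.1, fun i _ => ?_⟩) ?_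
  · have h := abs_le.mp ((abs_le_intNorm j.1.1 i).trans (j.2.le.trans (Int.le_ceil α.1)))
    constructor
    · exact_mod_cast h.1
    · exact_mod_cast h.2
  · intro a b h
    injection h with h'
    exact Subtype.ext (Subtype.ext h')

instance {d : ℕ} (α : Spec d) : Fintype (Shell α) := Fintype.ofFinite _

instance {d : ℕ} (α : Spec d) : DecidableEq (Shell α) := Classical.decEq _

/-- The eigenvalue `|j|` of the mode `j`. -/
def Modes.level {d : ℕ} (j : Modes d) : Spec d := ⟨intNorm j.1, j, rfl⟩

/-- `j` as an element of its own shell. -/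
def Modes.self {d : ℕ} (j : Modes d) : Shell j.level := ⟨j, rfl⟩

/-- `j ↦ -j` inside a shell. -/
def Shell.neg {d : ℕ} {α : Spec d} (j : Shell α) : Shell α :=
  ⟨-j.1, (intNorm_neg j.1.1).trans j.2⟩

/-! ### Blocks -/

/-- `B(E_β, E_α)`, identified with matrices of Fourier coefficients. -/
abbrev Block {d : ℕ} (α β : Spec d) : Type := Matrix (Shell α) (Shell β) ℂ

/-- Hilbert–Schmidt norm of a block. -/
def hsNorm {d : ℕ} {α β : Spec d} (X : Block α β) : ℝ :=
  Real.sqrt (∑ j, ∑ j', ‖X j j'‖ ^ 2)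

/-- Hilbert–Schmidt norm with values in `[0, ∞]`. -/
def hsENorm {d : ℕ} {α β : Spec d} (X : Block α β) : ℝ≥0∞ := ENNReal.ofReal (hsNorm X)

/-- The conjugate block: `(M̄)_j^{j'} = conj (M_{-j}^{-j'})`. -/
def conjBlock {d : ℕ} {α β : Spec d} (M : Block α β) : Block α β :=
  Matrix.of fun j j' => starRingEnd ℂ (M j.neg j'.neg)

/-- `M_L(A) X = A X`. -/
def mulL {d : ℕ} {α : Spec d} (β : Spec d) (A : Block α α) : Block α β →ₗ[ℂ] Block α β where
  toFun X := A * X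
  map_add' := Matrix.mul_add A
  map_smul' c X := Matrix.mul_smul A c X

/-- `M_R(B) X = X B`. -/
def mulR {d : ℕ} (α : Spec d) {β : Spec d} (B : Block β β) : Block α β →ₗ[ℂ] Block α β where
  toFun X := X * B
  map_add' X Y := Matrix.add_mul X Y B
  map_smul' c X := Matrix.smul_mul c X B

/-- Operator norm `‖·‖_{Op(α,β)}` of a linear map on blocks with the Hilbert–Schmidt norm. -/
def opENorm {d : ℕ} {α β : Spec d} (L : Block α β →ₗ[ℂ] Block α β) : ℝ≥0∞ :=
  ⨆ M : Block α β, ⨆ _ : hsNorm M ≤ 1, hsENorm (L M)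

/-- `L` is invertible and `‖L⁻¹‖_{Op(α,β)} ≤ r`. -/
def InvBound {d : ℕ} {α β : Spec d} (L : Block α β →ₗ[ℂ] Block α β) (r : ℝ) : Prop :=
  ∃ e : Block α β ≃ₗ[ℂ] Block α β, e.toLinearMap = L ∧
    opENorm e.symm.toLinearMap ≤ ENNReal.ofReal r

/-- A block-diagonal operator `diag_α [D]_α^α`. -/
abbrev BlockDiag (d : ℕ) : Type := (α : Spec d) → Block α α

/-- The frequency parameters `ω ∈ ℝ^ν`, with the Euclidean norm. -/
abbrev Freq (ν : ℕ) : Type := EuclideanSpace ℝ (Fin ν)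

/-- `ω · ℓ`. -/
def freqDot {ν : ℕ} (ω : Freq ν) (l : Fin ν → ℤ) : ℝ := ∑ i, ω i * (l i : ℝ)

/-- `A⁻(ℓ,α,β) = ω·ℓ I + M_L([D]_α^α) - M_R([D]_β^β)`. -/
def melnikovMinus {ν d : ℕ} (D : BlockDiag d) (ω : Freq ν) (l : Fin ν → ℤ) (α β : Spec d) :
    Block α β →ₗ[ℂ] Block α β :=
  (freqDot ω l : ℂ) • LinearMap.id + mulL β (D α) - mulR α (D β)

/-- `A⁺(ℓ,α,β) = ω·ℓ I + M_L([D]_α^α) + M_R([D̄]_β^β)`. -/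
def melnikovPlus {ν d : ℕ} (D : BlockDiag d) (ω : Freq ν) (l : Fin ν → ℤ) (α β : Spec d) :
    Block α β →ₗ[ℂ] Block α β :=
  (freqDot ω l : ℂ) • LinearMap.id + mulL β (D α) + mulR α (conjBlock (D β))

/-- `⟨ℓ⟩ = max {1, |ℓ|}`. -/
def jap {ν : ℕ} (l : Fin ν → ℤ) : ℝ := max 1 (intNorm l)

/-- `⟨ℓ,α,β⟩ = max {1, |ℓ|, α, β}`. -/
def jap3 {ν d : ℕ} (l : Fin ν → ℤ) (α β : Spec d) : ℝ := max (jap l) (max α.1 β.1)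

/-! ### Scales and parameter sets -/

/-- `N_k = N₀^{(3/2)^k}`. -/
def scale (N₀ : ℕ) (k : ℕ) : ℝ := (N₀ : ℝ) ^ (((3 : ℝ) / 2) ^ k)

/-- `N_{k-1}`, with `N_{-1} = 1`. -/
def scalePred (N₀ : ℕ) : ℕ → ℝ
  | 0 => 1
  | k + 1 => scale N₀ k

/-- Diophantine frequencies `DC(γ,τ)` inside `Ω`. -/
def DC {ν : ℕ} (Ω : Set (Freq ν)) (γ τ : ℝ) : Set (Freq ν) :=
  {ω | ω ∈ Ω ∧ ∀ l : Fin ν → ℤ, l ≠ 0 → γ / intNorm l ^ τ ≤ |freqDot ω l|}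

/-- The second Melnikov conditions on `D` at `ω`, for all indices with `⟨ℓ,α,β⟩ ≤ N`. -/
def MelnikovCond {ν d : ℕ} (γ τ e N : ℝ) (D : BlockDiag d) (ω : Freq ν) : Prop :=
  (∀ (l : Fin ν → ℤ) (α β : Spec d), ¬ (l = 0 ∧ α = β) → jap3 l α β ≤ N →
    InvBound (melnikovMinus D ω l α β) (α.1 ^ e * β.1 ^ e * jap l ^ τ / γ)) ∧
  (∀ (l : Fin ν → ℤ) (α β : Spec d), jap3 l α β ≤ N →
    InvBound (melnikovPlus D ω l α β) (jap l ^ τ / (γ * max 1 (α.1 + β.1))))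

/-- The nested sets `Ω_k^γ` attached to a sequence of block-diagonal operators. -/
def goodSet {ν d : ℕ} (Ω : Set (Freq ν)) (γ τ e : ℝ) (N₀ : ℕ)
    (D : ℕ → Freq ν → BlockDiag d) : ℕ → Set (Freq ν)
  | 0 => DC Ω γ τ
  | k + 1 => {ω | ω ∈ goodSet Ω γ τ e N₀ D k ∧ MelnikovCond γ τ e (scale N₀ k) (D k ω) ω}

/-- `‖f‖^{Lip(γ)} = sup_S n(f) + γ sup_{ω₁ ≠ ω₂} n(f(ω₁) - f(ω₂)) / |ω₁ - ω₂|` on the set `S`,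
for a norm `n` with values in `[0, ∞]`. -/
def lipNorm {ν : ℕ} {E : Type*} [Sub E] (γ : ℝ) (S : Set (Freq ν)) (n : E → ℝ≥0∞)
    (f : Freq ν → E) : ℝ≥0∞ :=
  (⨆ ω ∈ S, n (f ω)) + ENNReal.ofReal γ *
    ⨆ ω₁ ∈ S, ⨆ ω₂ ∈ S, ⨆ _ : ω₁ ≠ ω₂, n (f ω₁ - f ω₂) / edist ω₁ ω₂

/-! ### The space `L²₀(𝕋^d)` and its operators -/

/-- `L²₀(𝕋^d)`, through Fourier coefficients `(u_j)_{j ≠ 0}`, with `‖u‖² = ∑ |u_j|²`. -/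
abbrev L20 (d : ℕ) : Type := lp (fun _ : Modes d => ℂ) 2

/-- Complex conjugation of functions: `(ū)_j = conj (u_{-j})`. -/
def conjL {d : ℕ} (u : L20 d) : L20 d :=
  ⟨fun j => starRingEnd ℂ (u (-j)), by
    have h := (memℓp_gen_iff (p := 2) (by norm_num)).mp (lp.memℓp u)
    refine (memℓp_gen_iff (p := 2) (by norm_num)).mpr ?_
    have h' := (Equiv.neg (Modes d)).summable_iff.mpr h
    refine h'.congr fun j => ?_
    simp⟩

/-- The bilinear pairing `⟨u, v⟩ = ∫ u v dx = ∑ u_j v_{-j}` (normalized measure). -/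
def pairing {d : ℕ} (u v : L20 d) : ℂ := inner ℂ (conjL v) u

/-- `u ∈ H¹₀(𝕋^d)`. -/
def MemH1 {d : ℕ} (u : L20 d) : Prop := Summable fun j : Modes d => (intNorm j.1 * ‖u j‖) ^ 2

/-- Bounded operators on `L²₀`. -/
abbrev Op (d : ℕ) : Type := L20 d →L[ℂ] L20 d

/-- Bounded operators on `L²₀ × L²₀`, i.e. `2 × 2` matrices of bounded operators on `L²₀`. -/
abbrev Op2 (d : ℕ) : Type := (L20 d × L20 d) →L[ℂ] (L20 d × L20 d)

/-- The `(1,1)` entry. -/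
def entry11 {d : ℕ} (X : Op2 d) : Op d :=
  (ContinuousLinearMap.fst ℂ _ _).comp (X.comp (ContinuousLinearMap.inl ℂ _ _))

/-- The `(1,2)` entry. -/
def entry12 {d : ℕ} (X : Op2 d) : Op d :=
  (ContinuousLinearMap.fst ℂ _ _).comp (X.comp (ContinuousLinearMap.inr ℂ _ _))

/-- The matrix coefficient `R_j^{j'}`. -/
def coeff {d : ℕ} (R : Op d) (j j' : Modes d) : ℂ :=
  letI : DecidableEq (Modes d) := Classical.decEq _
  R (lp.single 2 j' (1 : ℂ)) j

/-- A function of `φ ∈ ℝ^ν` that is `2π`-periodic in each variable, i.e. a function on `𝕋^ν`. -/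
def TorusPeriodic {ν : ℕ} {E : Type*} (F : (Fin ν → ℝ) → E) : Prop :=
  ∀ (φ : Fin ν → ℝ) (n : Fin ν → ℤ), F (fun i => φ i + 2 * Real.pi * n i) = F φ

/-- Fourier coefficient `(2π)^{-ν} ∫_{𝕋^ν} f(φ) e^{-i ℓ·φ} dφ`. -/
def fourierCoef {ν : ℕ} (f : (Fin ν → ℝ) → ℂ) (l : Fin ν → ℤ) : ℂ :=
  ((2 * Real.pi : ℝ) ^ ν : ℂ)⁻¹ *
    ∫ φ in Set.Icc (0 : Fin ν → ℝ) (fun _ => 2 * Real.pi),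
      f φ * Complex.exp (-(Complex.I * ((∑ i, (l i : ℝ) * φ i : ℝ) : ℂ)))

/-- The block `[R̂(ℓ)]_α^β` of a family `φ ↦ R(φ)`. -/
def hatBlock {ν d : ℕ} (F : (Fin ν → ℝ) → Op d) (l : Fin ν → ℤ) (α β : Spec d) : Block α β :=
  Matrix.of fun j j' => fourierCoef (fun φ => coeff (F φ) j.1 j'.1) l

/-- The block-decay norm `|R|_s` of a family of operators on `L²₀`. -/
def decayNorm {ν d : ℕ} (s : ℝ) (F : (Fin ν → ℝ) → Op d) : ℝ≥0∞ :=
  ⨆ (α : Spec d) (β : Spec d),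
    (∑' l : Fin ν → ℤ, ENNReal.ofReal (jap3 l α β ^ (2 * s)) * hsENorm (hatBlock F l α β) ^ 2)
      ^ ((1 : ℝ) / 2)

/-- The norm `|R|_s^{Lip(γ)}` on `S` of a family of operators of the form
`(R₁, R₂; R̄₂, R̄₁)`, namely `|R₁|_s^{Lip(γ)} + |R₂|_s^{Lip(γ)}`. -/
def decayLip {ν d : ℕ} (γ : ℝ) (S : Set (Freq ν)) (s : ℝ)
    (X : Freq ν → (Fin ν → ℝ) → Op2 d) : ℝ≥0∞ :=
  lipNorm γ S (decayNorm s) (fun ω φ => entry11 (X ω φ)) +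
    lipNorm γ S (decayNorm s) (fun ω φ => entry12 (X ω φ))

/-! ### Hamiltonian structure -/

/-- A (bounded) linear Hamiltonian vector field in complex coordinates:
`X = i (R₁, R₂; -R̄₂, -R̄₁)` with `R₁ = R₁^*`, `R₂ = R₂^T`, where `R̄ u = conj (R (conj u))`. -/
def IsHamiltonian {d : ℕ} (X : Op2 d) : Prop :=
  ∃ R₁ R₂ : Op d, IsSelfAdjoint R₁ ∧ (∀ u v, pairing (R₂ u) v = pairing u (R₂ v)) ∧
    ∀ u v, X (u, v) = (Complex.I • (R₁ u + R₂ v),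
      -(Complex.I • (conjL (R₂ (conjL u)) + conjL (R₁ (conjL v)))))

/-- The real subspace `{(u, ū)}` of `L²₀ × L²₀`. -/
def realSubspace (d : ℕ) : Set (L20 d × L20 d) := {u | u.2 = conjL u.1}

/-- The symplectic form `Γ[u₁, u₂] = i ∫ (u₁ ū₂ - ū₁ u₂) dx` on pairs `(u, ū)`. -/
def symplForm {d : ℕ} (u v : L20 d × L20 d) : ℂ :=
  Complex.I * (pairing u.1 v.2 - pairing u.2 v.1)

/-- Symplectic maps of the real subspace `{(u, ū)}`. -/
def IsSymplectic {d : ℕ} (Φ : Op2 d) : Prop :=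
  (∀ u ∈ realSubspace d, Φ u ∈ realSubspace d) ∧
    ∀ u ∈ realSubspace d, ∀ v ∈ realSubspace d, symplForm (Φ u) (Φ v) = symplForm u v

/-! ### The vector field `D + R` and its push-forward -/

/-- Action of a block-diagonal operator on Fourier coefficients. -/
def blockApply {d : ℕ} (D : BlockDiag d) (u : Modes d → ℂ) : Modes d → ℂ :=
  fun j => ∑ j' : Shell j.level, D j.level j.self j' * u j'.1

/-- Fourier coefficients of `(D + X)(u, v)`, where the (unbounded) operator `D` is
`i (-D⁽¹⁾, 0; 0, conj D⁽¹⁾)` and `X` is bounded. -/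
def fieldApply {d : ℕ} (D : BlockDiag d) (X : Op2 d) (w : L20 d × L20 d) :
    (Modes d → ℂ) × (Modes d → ℂ) :=
  (fun j => -(Complex.I * blockApply D w.1 j) + (X w).1 j,
   fun j => Complex.I * blockApply (fun α => conjBlock (D α)) w.2 j + (X w).2 j)

/-- `ω · ∂_φ Φ (φ)`. -/
def omegaDeriv {ν d : ℕ} (ω : Freq ν) (Φ : (Fin ν → ℝ) → Op2 d) (φ : Fin ν → ℝ) : Op2 d :=
  fderiv ℝ Φ φ (fun i => ω i)

/-- `D' + R'(φ) = Φ(φ)⁻¹ (D + R(φ)) Φ(φ) - Φ(φ)⁻¹ ω·∂_φ Φ(φ)` on the domain `H¹₀ × H¹₀`,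
which `Φ(φ)` maps to itself and `D + R(φ)` maps to `L²₀ × L²₀`. -/
def IsPushForward {ν d : ℕ} (ω : Freq ν) (Φ : (Fin ν → ℝ) → Op2 d)
    (D : BlockDiag d) (R : (Fin ν → ℝ) → Op2 d)
    (D' : BlockDiag d) (R' : (Fin ν → ℝ) → Op2 d) : Prop :=
  ∀ φ : Fin ν → ℝ, IsUnit (Φ φ) ∧
    ∀ w : L20 d × L20 d, MemH1 w.1 → MemH1 w.2 →
      MemH1 (Φ φ w).1 ∧ MemH1 (Φ φ w).2 ∧
      ∃ z z' : L20 d × L20 d,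
        ((z.1 : Modes d → ℂ), (z.2 : Modes d → ℂ)) = fieldApply D (R φ) (Φ φ w) ∧
        ((z'.1 : Modes d → ℂ), (z'.2 : Modes d → ℂ)) = fieldApply D' (R' φ) w ∧
        z' = Ring.inverse (Φ φ) z - Ring.inverse (Φ φ) (omegaDeriv ω Φ φ w)

/-! ### Constants -/

/-- `s₀ = [(ν+d)/2] + 1`. -/
def sZero (ν d : ℕ) : ℝ := ((ν + d) / 2 + 1 : ℕ)

/-- `μ̄ = (d-1)/2 + σ + 2τ + 1`. -/
def muBar (d : ℕ) (σ τ : ℝ) : ℝ := ((d : ℝ) - 1) / 2 + σ + 2 * τ + 1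

/-- `a = 4τ + 8𝚍 + 3`. -/
def aExp (τ e : ℝ) : ℝ := 4 * τ + 8 * e + 3

/-- `b = a + 1`. -/
def bExp (τ e : ℝ) : ℝ := aExp τ e + 1

/-- `S_q = [q/2] - μ̄ - b`. -/
def sTop (d : ℕ) (σ τ e q : ℝ) : ℝ := (⌊q / 2⌋ : ℝ) - muBar d σ τ - bExp τ e

end KAM

end

/-!
The vector field `D + R` is reduced by a Newton scheme. At the scale `N` the generator `Ψ` solves the
homological equation `[D, Ψ] - ω·∂Ψ = -(ΠR - Z)`, where `ΠR` consists of the Fourier blocks with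
`⟨ℓ, α, β⟩ ≤ N` and `Z` of the averages of its diagonal blocks (`homological_equation`). Block by
block this inverts a Melnikov operator, so `Ψ` is a trigonometric polynomial with finitely many
nonzero blocks, and estimates for it and for its dependence on `ω` lose the power `2 τ + 4 e + 1` of
`⟨ℓ, α, β⟩` (`decayLip_generator_le`). Conjugation by `exp Ψ` moves `Z` into the normal form and leaves
as perturbation the high modes of `R` and a quadratic remainder (`isPushForward_exp_generator`). The
diagonal part is unbounded, but `exp Ψ` is the identity off finitely many modes; this preserves the
domain `H¹₀ × H¹₀` and reduces the conjugation to bounded operators.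

The remainder is quadratic because the decay norm satisfies a tame product estimate
(`decayNorm_mul_le`): a block of a product is a convolution of blocks, to which Young's inequality
applies once the `ℓ¹` norms are summed over the intermediate eigenvalue. For every weight `θ` the
combination `|R|_s + θ |R|_t` is then, up to a constant factor, an algebra norm (`algNorm_mul_le`), and
the exponential series can be estimated as in a Banach algebra (`algNorm_remainder_le`); the choices
`θ = 0` and `θ = M ^ (-b)` give the bounds in the low norm and in the high norm. With smoothing of the
high modes and interpolation between the two norms, the low norm decays like `N ^ (-a)` as long as the
high norm grows no faster than `N` (`step_estimates`), and the bounds reproduce themselves along the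
iteration (`KamData.pertBound`). One smallness condition suffices for all exponents: the constants
depend on an upper bound for the exponent only, and the estimates are linear in `|R₀|_{s+b}`.

Hamiltonian operators are the real operators that are skew for the symplectic form
(`isHamiltonian_iff`). Exponentials of such operators are symplectic, and conjugation and the
logarithmic derivative of the exponential preserve the class. The solution of the homological equation
is Hamiltonian because the Melnikov operators respect the symmetries of the blocks
(`isHamiltonian_generator`).

A step adds to the block `α` of the normal form the average of a diagonal block of `R`, of size
`α ^ (-s) |R|_s` (`lipNorm_nextDiag_sub_le`). These increments are summable, so the normal form remains
close to the initial one and multiplication by it has a Lipschitz constant in `ω` of at most `1`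
(`hsENorm_diag_sub_mul_le`). Each increment is extended separately to all frequencies: blocks form a
Euclidean space, Kirszbraun's theorem (`exists_lipschitz_extension`) preserves both the supremum and
the Lipschitz constant, and taking the Hermitian part is a contraction. The extended blocks are the
partial sums of the extended increments, and they converge (`tendsto_lipNorm_partialSum`).
-/

noncomputable section

namespace KAM

/-! ### The `ℓ²` norm with values in `[0, ∞]` -/

/-- The `ℓ²` norm of a family with values in `[0, ∞]`. -/
def l2 {ι : Type*} (u : ι → ℝ≥0∞) : ℝ≥0∞ := (∑' i, u i ^ 2) ^ ((1 : ℝ) / 2)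

theorem l2_sq {ι : Type*} (u : ι → ℝ≥0∞) : l2 u ^ 2 = ∑' i, u i ^ 2 := by
  rw [l2, ← ENNReal.rpow_natCast, ← ENNReal.rpow_mul]
  norm_num

theorem sqrt_sq_ennreal (x : ℝ≥0∞) : (x ^ 2) ^ ((1 : ℝ) / 2) = x := by
  rw [← ENNReal.rpow_natCast, ← ENNReal.rpow_mul]
  norm_num

theorem le_of_sq_le_sq_ennreal {x y : ℝ≥0∞} (h : x ^ 2 ≤ y ^ 2) : x ≤ y := by
  rw [← sqrt_sq_ennreal x, ← sqrt_sq_ennreal y]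
  exact ENNReal.rpow_le_rpow h (by norm_num)

theorem l2_mono {ι : Type*} {u v : ι → ℝ≥0∞} (h : ∀ i, u i ≤ v i) : l2 u ≤ l2 v := by
  refine ENNReal.rpow_le_rpow (ENNReal.tsum_le_tsum fun i => ?_) (by norm_num)
  exact pow_le_pow_left' (h i) 2

theorem le_l2 {ι : Type*} (u : ι → ℝ≥0∞) (i : ι) : u i ≤ l2 u := by
  apply le_of_sq_le_sq_ennreal
  rw [l2_sq]
  exact ENNReal.le_tsum (f := fun i => u i ^ 2) i

theorem l2_smul {ι : Type*} (c : ℝ≥0∞) (u : ι → ℝ≥0∞) : l2 (fun i => c * u i) = c * l2 u := by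
  rw [l2]
  simp_rw [mul_pow]
  rw [ENNReal.tsum_mul_left, ENNReal.mul_rpow_of_nonneg _ _ (by norm_num), sqrt_sq_ennreal, l2]

theorem l2_equiv {ι κ : Type*} (e : ι ≃ κ) (u : κ → ℝ≥0∞) : l2 (fun i => u (e i)) = l2 u := by
  rw [l2, l2, e.tsum_eq (fun k => u k ^ 2)]

/-- The Cauchy–Schwarz inequality. -/
theorem tsum_mul_le_l2 {ι : Type*} (u v : ι → ℝ≥0∞) : ∑' i, u i * v i ≤ l2 u * l2 v := by
  rw [ENNReal.tsum_eq_iSup_sum]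
  refine iSup_le fun s => ?_
  refine (ENNReal.inner_le_Lp_mul_Lq s u v Real.HolderConjugate.two_two).trans ?_
  have key : ∀ w : ι → ℝ≥0∞, (∑ i ∈ s, w i ^ (2 : ℝ)) ^ ((1 : ℝ) / 2) ≤ l2 w := fun w => by
    refine ENNReal.rpow_le_rpow ?_ (by norm_num)
    simp only [ENNReal.rpow_two]
    exact ENNReal.sum_le_tsum s
  exact mul_le_mul' (key u) (key v)

/-- Minkowski's inequality for arbitrary sums. -/
theorem l2_tsum_le {ι κ : Type*} (u : κ → ι → ℝ≥0∞) :
    l2 (fun i => ∑' k, u k i) ≤ ∑' k, l2 (u k) := by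
  apply le_of_sq_le_sq_ennreal
  rw [l2_sq]
  have hsq : ∀ f : κ → ℝ≥0∞, (∑' k, f k) ^ 2 = ∑' k, ∑' m, f k * f m := fun f => by
    simp_rw [sq, ENNReal.tsum_mul_left, ENNReal.tsum_mul_right]
  simp_rw [hsq]
  rw [ENNReal.tsum_comm]
  refine ENNReal.tsum_le_tsum fun k => ?_
  rw [ENNReal.tsum_comm]
  exact ENNReal.tsum_le_tsum fun m => tsum_mul_le_l2 _ _

theorem l2_add_le {ι : Type*} (u v : ι → ℝ≥0∞) : l2 (fun i => u i + v i) ≤ l2 u + l2 v := by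
  simpa [tsum_fintype] using l2_tsum_le (fun b : Bool => if b then u else v)

/-- Young's inequality `ℓ² ∗ ℓ¹ → ℓ²`. -/
theorem l2_conv_le {G : Type*} [AddCommGroup G] (u v : G → ℝ≥0∞) :
    l2 (fun l => ∑' k, u (l - k) * v k) ≤ l2 u * ∑' k, v k := by
  refine (l2_tsum_le fun k l => u (l - k) * v k).trans ?_
  rw [← ENNReal.tsum_mul_left]
  refine ENNReal.tsum_le_tsum fun k => ?_
  simp_rw [mul_comm _ (v k)]
  rw [l2_smul]
  exact mul_le_mul_right (l2_equiv (Equiv.subRight k) u).le _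

/-- Young's inequality `ℓ¹ ∗ ℓ² → ℓ²`. -/
theorem l2_conv_le' {G : Type*} [AddCommGroup G] (u v : G → ℝ≥0∞) :
    l2 (fun l => ∑' k, u (l - k) * v k) ≤ (∑' k, u k) * l2 v := by
  have h : ∀ l, ∑' k, u (l - k) * v k = ∑' k, v (l - k) * u k := fun l => by
    rw [← (Equiv.subLeft l).tsum_eq]
    refine tsum_congr fun k => ?_
    simp [mul_comm]
  simp_rw [h]
  rw [mul_comm]
  exact l2_conv_le v u

/-! ### The Hilbert–Schmidt norm -/

section HilbertSchmidt

variable {d : ℕ} {α β δ : Spec d}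

/-- A block as a vector of its entries in Euclidean space, so that `‖·‖_HS` becomes the
Euclidean norm. -/
def blockVec (α β : Spec d) : Block α β ≃ₗ[ℂ] EuclideanSpace ℂ (Shell α × Shell β) where
  toFun X := WithLp.toLp 2 fun p => X p.1 p.2
  invFun v := Matrix.of fun j j' => v (j, j')
  map_add' _ _ := rfl
  map_smul' _ _ := rfl
  left_inv _ := rfl
  right_inv _ := rfl

theorem norm_blockVec (X : Block α β) : ‖blockVec α β X‖ = hsNorm X := by
  rw [EuclideanSpace.norm_eq, hsNorm, Fintype.sum_prod_type]
  rfl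

theorem hsNorm_nonneg (X : Block α β) : 0 ≤ hsNorm X := Real.sqrt_nonneg _

theorem hsNorm_zero : hsNorm (0 : Block α β) = 0 := by simp [← norm_blockVec]

theorem hsNorm_smul (c : ℂ) (X : Block α β) : hsNorm (c • X) = ‖c‖ * hsNorm X := by
  simp only [← norm_blockVec, map_smul, norm_smul]

theorem norm_entry_le_hsNorm (X : Block α β) (j : Shell α) (j' : Shell β) :
    ‖X j j'‖ ≤ hsNorm X := by
  rw [← norm_blockVec]
  exact PiLp.norm_apply_le (blockVec α β X) (j, j')

theorem eq_zero_of_hsNorm_eq_zero {X : Block α β} (h : hsNorm X = 0) : X = 0 := by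
  rw [← norm_blockVec, norm_eq_zero] at h
  exact (LinearEquiv.map_eq_zero_iff _).mp h

theorem hsNorm_mul_le (X : Block α δ) (Y : Block δ β) :
    hsNorm (X * Y) ≤ hsNorm X * hsNorm Y := by
  have key : ∀ {α β : Spec d} (Z : Block α β),
      @norm _ Matrix.frobeniusNormedAddCommGroup.toNorm Z = hsNorm Z := fun Z => by
    rw [Matrix.frobenius_norm_def, hsNorm, Real.sqrt_eq_rpow]
    simp
  rw [← key, ← key, ← key]
  exact Matrix.frobenius_norm_mul X Y

theorem hsNorm_conjTranspose (X : Block α β) : hsNorm X.conjTranspose = hsNorm X := by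
  rw [hsNorm, hsNorm, Finset.sum_comm]
  simp [Matrix.conjTranspose_apply]

/-- The involution `j ↦ -j` of a shell. -/
def Shell.negEquiv (α : Spec d) : Shell α ≃ Shell α where
  toFun := Shell.neg
  invFun := Shell.neg
  left_inv j := Subtype.ext (neg_neg j.1)
  right_inv j := Subtype.ext (neg_neg j.1)

theorem Shell.neg_neg (j : Shell α) : j.neg.neg = j := (Shell.negEquiv α).left_inv j

theorem hsNorm_conjBlock (X : Block α β) : hsNorm (conjBlock X) = hsNorm X := by
  rw [hsNorm, hsNorm, ← (Shell.negEquiv α).sum_comp]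
  congr 1
  refine Finset.sum_congr rfl fun j _ => ?_
  rw [← (Shell.negEquiv β).sum_comp]
  refine Finset.sum_congr rfl fun j' _ => ?_
  change ‖starRingEnd ℂ (X j.neg.neg j'.neg.neg)‖ ^ 2 = _
  rw [Shell.neg_neg, Shell.neg_neg, RCLike.norm_conj]

theorem conjBlock_conjBlock (X : Block α β) : conjBlock (conjBlock X) = X := by
  ext j j'
  change starRingEnd ℂ (starRingEnd ℂ (X j.neg.neg j'.neg.neg)) = _
  rw [Shell.neg_neg, Shell.neg_neg, Complex.conj_conj]

theorem hsENorm_eq (X : Block α β) : hsENorm X = ‖blockVec α β X‖ₑ := by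
  rw [hsENorm, ← norm_blockVec, ofReal_norm]

theorem hsENorm_add_le (X Y : Block α β) : hsENorm (X + Y) ≤ hsENorm X + hsENorm Y := by
  simp only [hsENorm_eq, map_add]
  exact enorm_add_le _ _

theorem hsENorm_smul (c : ℂ) (X : Block α β) : hsENorm (c • X) = ‖c‖ₑ * hsENorm X := by
  simp only [hsENorm_eq, map_smul, enorm_smul]

theorem hsENorm_neg (X : Block α β) : hsENorm (-X) = hsENorm X := by
  simp only [hsENorm_eq, map_neg, enorm_neg]

theorem hsENorm_sub_le (X Y : Block α β) : hsENorm (X - Y) ≤ hsENorm X + hsENorm Y := by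
  simpa [sub_eq_add_neg, hsENorm_neg] using hsENorm_add_le X (-Y)

theorem hsENorm_zero : hsENorm (0 : Block α β) = 0 := by simp [hsENorm, hsNorm_zero]

theorem hsENorm_lt_top (X : Block α β) : hsENorm X < ⊤ := ENNReal.ofReal_lt_top

theorem hsENorm_mul_le (X : Block α δ) (Y : Block δ β) :
    hsENorm (X * Y) ≤ hsENorm X * hsENorm Y := by
  rw [hsENorm, hsENorm, hsENorm, ← ENNReal.ofReal_mul (hsNorm_nonneg _)]
  exact ENNReal.ofReal_le_ofReal (hsNorm_mul_le X Y)

theorem hsENorm_sum_le {ι : Type*} (s : Finset ι) (f : ι → Block α β) :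
    hsENorm (∑ i ∈ s, f i) ≤ ∑ i ∈ s, hsENorm (f i) := by
  simp only [hsENorm_eq, map_sum]
  exact enorm_sum_le _ _

/-- Convergence of a block is convergence of its entries; the Hilbert–Schmidt norm of an
entrywise limit is at most any common bound. -/
theorem hsENorm_le_of_tendsto {ι : Type*} {F : Filter ι} [F.NeBot] {X : ι → Block α β}
    {Y : Block α β} (h : ∀ j j', Filter.Tendsto (fun i => X i j j') F (nhds (Y j j')))
    {C : ℝ≥0∞} (hC : ∀ᶠ i in F, hsENorm (X i) ≤ C) : hsENorm Y ≤ C := by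
  have h1 : Filter.Tendsto (fun i => hsENorm (X i)) F (nhds (hsENorm Y)) := by
    refine (ENNReal.continuous_ofReal.tendsto _).comp ?_
    refine (Real.continuous_sqrt.tendsto _).comp ?_
    exact tendsto_finsetSum _ fun j _ => tendsto_finsetSum _ fun j' _ => (h j j').norm.pow 2
  exact le_of_tendsto h1 hC

theorem hsENorm_le_tsum_of_hasSum {ι : Type*} {X : ι → Block α β}
    {Y : Block α β} (h : ∀ j j', HasSum (fun i => X i j j') (Y j j')) :
    hsENorm Y ≤ ∑' i, hsENorm (X i) := by
  refine hsENorm_le_of_tendsto (F := Filter.atTop) (X := fun s : Finset ι => ∑ i ∈ s, X i)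
    (fun j j' => ?_) (Filter.Eventually.of_forall fun s =>
      (hsENorm_sum_le s X).trans (ENNReal.sum_le_tsum s))
  simpa [Matrix.sum_apply, HasSum] using h j j'

end HilbertSchmidt

/-! ### Fourier coefficients on the torus -/

section Fourier

open MeasureTheory Filter Topology
open scoped Pointwise

variable {ν : ℕ}

/-- The exponential `φ ↦ e^{i ℓ·φ}`. -/
def expMode (l : Fin ν → ℤ) (φ : Fin ν → ℝ) : ℂ :=
  Complex.exp (Complex.I * ((∑ i, (l i : ℝ) * φ i : ℝ) : ℂ))

theorem continuous_expMode (l : Fin ν → ℤ) : Continuous (expMode l) := by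
  unfold expMode
  fun_prop

theorem norm_expMode (l : Fin ν → ℤ) (φ : Fin ν → ℝ) : ‖expMode l φ‖ = 1 := by
  rw [expMode, mul_comm, Complex.norm_exp_ofReal_mul_I]

theorem expMode_neg (l : Fin ν → ℤ) (φ : Fin ν → ℝ) :
    expMode (-l) φ = starRingEnd ℂ (expMode l φ) := by
  rw [expMode, expMode, ← Complex.exp_conj]
  congr 1
  simp

theorem expMode_periodic (l : Fin ν → ℤ) : TorusPeriodic (expMode l) := by
  intro φ n
  unfold expMode
  rw [Complex.exp_eq_exp_iff_exists_int]
  refine ⟨∑ i, l i * n i, ?_⟩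
  push_cast
  simp only [mul_add, Finset.sum_add_distrib, Finset.mul_sum, Finset.sum_mul]
  congr 1
  exact Finset.sum_congr rfl fun i _ => by ring

theorem fourierCoef_eq (f : (Fin ν → ℝ) → ℂ) (l : Fin ν → ℤ) :
    fourierCoef f l = ((2 * Real.pi : ℝ) ^ ν : ℂ)⁻¹ *
      ∫ φ in Set.Icc (0 : Fin ν → ℝ) (fun _ => 2 * Real.pi), f φ * expMode (-l) φ := by
  rw [fourierCoef]
  congr 2
  ext φ
  congr 1
  rw [expMode]
  congr 1
  simp

theorem isOpenQuotientMap_torus :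
    IsOpenQuotientMap (fun (x : Fin ν → ℝ) (i : Fin ν) => (x i : UnitAddCircle)) :=
  IsOpenQuotientMap.piMap fun _ => QuotientAddGroup.isOpenQuotientMap_mk

/-- A continuous function of period `2π` in each variable, rescaled to period `1`, as a continuous
function on Mathlib's torus `UnitAddTorus`. -/
theorem exists_torus_lift {f : (Fin ν → ℝ) → ℂ} (hf : Continuous f) (hp : TorusPeriodic f) :
    ∃ g : C(UnitAddTorus (Fin ν), ℂ), ∀ x : Fin ν → ℝ,
      g (fun i => (x i : UnitAddCircle)) = f (fun i => 2 * Real.pi * x i) := by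
  have hq := isOpenQuotientMap_torus (ν := ν)
  have key : ∀ x y : Fin ν → ℝ, (fun i => (x i : UnitAddCircle)) = (fun i => (y i : UnitAddCircle)) →
      f (fun i => 2 * Real.pi * x i) = f (fun i => 2 * Real.pi * y i) := by
    intro x y h
    have h1 : ∀ i, ∃ n : ℤ, x i = y i + n := fun i => by
      have h2 := congrFun h i
      rw [← sub_eq_zero, ← AddCircle.coe_sub, AddCircle.coe_eq_zero_iff] at h2
      obtain ⟨n, hn⟩ := h2
      exact ⟨n, by rw [zsmul_eq_mul, mul_one] at hn; linarith⟩
    choose n hn using h1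
    rw [← hp (fun i => 2 * Real.pi * y i) n]
    congr 1
    ext i
    rw [hn i]
    ring
  let G : UnitAddTorus (Fin ν) → ℂ := fun t =>
    f (fun i => 2 * Real.pi * (hq.surjective t).choose i)
  have hG : ∀ x : Fin ν → ℝ, G (fun i => (x i : UnitAddCircle)) = f (fun i => 2 * Real.pi * x i) :=
    fun x => key _ _ (hq.surjective (fun i => (x i : UnitAddCircle))).choose_spec
  refine ⟨⟨G, ?_⟩, hG⟩
  rw [hq.isQuotientMap.continuous_iff]
  have : G ∘ (fun (x : Fin ν → ℝ) (i : Fin ν) => (x i : UnitAddCircle)) =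
      fun x => f (fun i => 2 * Real.pi * x i) := funext hG
  rw [this]
  fun_prop

theorem mFourier_coe (l : Fin ν → ℤ) (x : Fin ν → ℝ) :
    UnitAddTorus.mFourier l (fun i => (x i : UnitAddCircle)) =
      expMode l (fun i => 2 * Real.pi * x i) := by
  rw [expMode, UnitAddTorus.mFourier]
  simp only [ContinuousMap.coe_mk, fourier_coe_apply]
  rw [← Complex.exp_sum]
  congr 1
  push_cast
  rw [Finset.mul_sum]
  exact Finset.sum_congr rfl fun i _ => by ring

/-- The Fourier coefficients over the cube `[0, 2π]^ν` are those of Mathlib on the unit torus, for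
which Parseval's identity is available. -/
theorem fourierCoef_eq_mFourierCoeff {f : (Fin ν → ℝ) → ℂ} {g : UnitAddTorus (Fin ν) → ℂ}
    (h : ∀ x : Fin ν → ℝ, g (fun i => (x i : UnitAddCircle)) = f (fun i => 2 * Real.pi * x i))
    (l : Fin ν → ℤ) : fourierCoef f l = UnitAddTorus.mFourierCoeff g l := by
  have h2 : (0 : ℝ) < 2 * Real.pi := by positivity
  rw [fourierCoef_eq, UnitAddTorus.mFourierCoeff_eq_integral g l 0]
  have hset : {x : Fin ν → ℝ | ∀ i, x i ∈ Set.Ioc ((0 : Fin ν → ℝ) i) ((0 : Fin ν → ℝ) i + 1)} =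
      Set.univ.pi fun _ => Set.Ioc (0 : ℝ) 1 := by
    ext x; simp [Set.mem_pi]
  have hae : (Set.univ.pi fun _ : Fin ν => Set.Ioc (0 : ℝ) 1) =ᵐ[volume]
      Set.Icc (0 : Fin ν → ℝ) (fun _ => 1) := by
    have := Measure.univ_pi_Ioc_ae_eq_Icc (μ := fun _ : Fin ν => (volume : Measure ℝ))
      (f := (0 : Fin ν → ℝ)) (g := fun _ => 1)
    exact this
  rw [hset, setIntegral_congr_set hae]
  have hfun : ∀ x : Fin ν → ℝ, UnitAddTorus.mFourier (-l) (fun i => (x i : UnitAddCircle)) •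
      g (fun i => (x i : UnitAddCircle)) =
      (fun φ => f φ * expMode (-l) φ) ((2 * Real.pi) • x) := fun x => by
    rw [mFourier_coe, h, smul_eq_mul, mul_comm]
    rfl
  simp_rw [hfun]
  rw [Measure.setIntegral_comp_smul_of_pos volume (fun φ => f φ * expMode (-l) φ) _ h2]
  have himg : (2 * Real.pi) • Set.Icc (0 : Fin ν → ℝ) (fun _ => 1) =
      Set.Icc (0 : Fin ν → ℝ) (fun _ => 2 * Real.pi) := by
    ext x
    rw [Set.mem_smul_set_iff_inv_smul_mem₀ h2.ne']
    simp only [Set.mem_Icc, Pi.le_def, Pi.smul_apply, smul_eq_mul, Pi.zero_apply]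
    refine and_congr (forall_congr' fun i => ?_) (forall_congr' fun i => ?_)
    · exact mul_nonneg_iff_of_pos_left (inv_pos.mpr h2)
    · rw [inv_mul_le_iff₀ h2, mul_one]
  rw [himg]
  simp [Complex.real_smul]

attribute [local instance] instMeasureSpaceUnitAddCircle in
/-- The Fourier coefficients of a product are the convolution of the Fourier coefficients. -/
theorem hasSum_fourierCoef_mul {f g : (Fin ν → ℝ) → ℂ} (hf : Continuous f) (hg : Continuous g)
    (pf : TorusPeriodic f) (pg : TorusPeriodic g) (l : Fin ν → ℤ) :
    HasSum (fun k => fourierCoef f (l - k) * fourierCoef g k)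
      (fourierCoef (fun φ => f φ * g φ) l) := by
  have : IsProbabilityMeasure (volume : Measure UnitAddCircle) :=
    inferInstanceAs (IsProbabilityMeasure AddCircle.haarAddCircle)
  obtain ⟨F, hF⟩ := exists_torus_lift hf pf
  obtain ⟨G, hG⟩ := exists_torus_lift hg pg
  let F' : C(UnitAddTorus (Fin ν), ℂ) := star F * UnitAddTorus.mFourier l
  have key := UnitAddTorus.hasSum_prod_mFourierCoeff (d := Fin ν) (F'.toLp 2 _ ℂ) (G.toLp 2 _ ℂ)
  simp only [UnitAddTorus.mFourierCoeff_toLp] at key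
  have h1 : fourierCoef (fun φ => f φ * g φ) l =
      ∫ t, starRingEnd ℂ ((F'.toLp 2 volume ℂ) t) * (G.toLp 2 volume ℂ) t := by
    rw [fourierCoef_eq_mFourierCoeff (g := fun t => F t * G t) (fun x => by rw [hF, hG]) l]
    rw [UnitAddTorus.mFourierCoeff]
    refine integral_congr_ae ?_
    filter_upwards [F'.coeFn_toLp (p := 2) (𝕜 := ℂ) volume, G.coeFn_toLp (p := 2) (𝕜 := ℂ) volume] with t h1 h2
    rw [h1, h2]
    simp [F', UnitAddTorus.mFourier_neg]
    ring
  rw [h1]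
  refine key.congr_fun fun k => ?_
  rw [fourierCoef_eq_mFourierCoeff hF, fourierCoef_eq_mFourierCoeff hG]
  congr 1
  rw [UnitAddTorus.mFourierCoeff, UnitAddTorus.mFourierCoeff, ← integral_conj]
  refine integral_congr_ae (Eventually.of_forall fun t => ?_)
  simp only [F', smul_eq_mul, map_mul, ContinuousMap.mul_apply, ContinuousMap.star_apply,
    RCLike.star_def, Complex.conj_conj]
  rw [← UnitAddTorus.mFourier_neg, ← UnitAddTorus.mFourier_neg, neg_neg, neg_sub, sub_eq_add_neg,
    UnitAddTorus.mFourier_add]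
  ring

attribute [local instance] instMeasureSpaceUnitAddCircle in
theorem fourierCoef_expMode (k l : Fin ν → ℤ) :
    fourierCoef (expMode k) l = if l = k then 1 else 0 := by
  have : IsProbabilityMeasure (volume : Measure UnitAddCircle) :=
    inferInstanceAs (IsProbabilityMeasure AddCircle.haarAddCircle)
  rw [fourierCoef_eq_mFourierCoeff (g := UnitAddTorus.mFourier k) (mFourier_coe k)]
  have h := orthonormal_iff_ite.mp (UnitAddTorus.orthonormal_mFourier (d := Fin ν)) l k
  rw [← h, ContinuousMap.inner_toLp, UnitAddTorus.mFourierCoeff]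
  refine integral_congr_ae (Eventually.of_forall fun t => ?_)
  simp [UnitAddTorus.mFourier_neg, mul_comm]

theorem integrableOn_fourier {f : (Fin ν → ℝ) → ℂ} (hf : Continuous f) (l : Fin ν → ℤ) :
    IntegrableOn (fun φ => f φ * expMode (-l) φ)
      (Set.Icc (0 : Fin ν → ℝ) (fun _ => 2 * Real.pi)) :=
  (hf.mul (continuous_expMode _)).continuousOn.integrableOn_compact isCompact_Icc

theorem fourierCoef_add {f g : (Fin ν → ℝ) → ℂ} (hf : Continuous f) (hg : Continuous g)
    (l : Fin ν → ℤ) :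
    fourierCoef (fun φ => f φ + g φ) l = fourierCoef f l + fourierCoef g l := by
  simp only [fourierCoef_eq, add_mul]
  rw [integral_add (integrableOn_fourier hf l) (integrableOn_fourier hg l), mul_add]

theorem fourierCoef_const_mul (c : ℂ) (f : (Fin ν → ℝ) → ℂ) (l : Fin ν → ℤ) :
    fourierCoef (fun φ => c * f φ) l = c * fourierCoef f l := by
  simp only [fourierCoef_eq, mul_assoc]
  rw [integral_const_mul]
  ring

theorem fourierCoef_sum {ι : Type*} (s : Finset ι) {f : ι → (Fin ν → ℝ) → ℂ}
    (hf : ∀ i ∈ s, Continuous (f i)) (l : Fin ν → ℤ) :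
    fourierCoef (fun φ => ∑ i ∈ s, f i φ) l = ∑ i ∈ s, fourierCoef (f i) l := by
  simp only [fourierCoef_eq, Finset.sum_mul]
  rw [integral_finsetSum _ fun i hi => integrableOn_fourier (hf i hi) l, Finset.mul_sum]

theorem fourierCoef_conj (f : (Fin ν → ℝ) → ℂ) (l : Fin ν → ℤ) :
    fourierCoef (fun φ => starRingEnd ℂ (f φ)) l = starRingEnd ℂ (fourierCoef f (-l)) := by
  simp only [fourierCoef_eq, map_mul, ← integral_conj, neg_neg, expMode_neg]
  congr 1
  rw [map_inv₀, map_pow, Complex.conj_ofReal]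

/-- Dominated convergence for Fourier coefficients. -/
theorem tendsto_fourierCoef {ι : Type*} {𝓕 : Filter ι} [𝓕.IsCountablyGenerated]
    {f : ι → (Fin ν → ℝ) → ℂ} {g : (Fin ν → ℝ) → ℂ} {C : ℝ}
    (hf : ∀ n, Continuous (f n)) (hC : ∀ n φ, ‖f n φ‖ ≤ C)
    (h : ∀ φ, Tendsto (fun n => f n φ) 𝓕 (𝓝 (g φ))) (l : Fin ν → ℤ) :
    Tendsto (fun n => fourierCoef (f n) l) 𝓕 (𝓝 (fourierCoef g l)) := by
  simp only [fourierCoef_eq]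
  refine Tendsto.const_mul _ ?_
  refine tendsto_integral_filter_of_dominated_convergence (fun _ => C)
    (Eventually.of_forall fun n => ?_) (Eventually.of_forall fun n => ?_) ?_ ?_
  · exact ((hf n).mul (continuous_expMode _)).aestronglyMeasurable
  · refine Eventually.of_forall fun φ => ?_
    rw [norm_mul, norm_expMode, mul_one]
    exact hC n φ
  · exact integrableOn_const (isCompact_Icc.measure_lt_top.ne)
  · exact Eventually.of_forall fun φ => (h φ).mul_const _

/-- Fourier coefficients may be taken term by term in a series whose partial sums are uniformly
bounded; the series need not converge absolutely. -/
theorem hasSum_fourierCoef {ι : Type*} [Countable ι]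
    {f : ι → (Fin ν → ℝ) → ℂ} {g : (Fin ν → ℝ) → ℂ} {C : ℝ}
    (hf : ∀ n, Continuous (f n)) (hC : ∀ (s : Finset ι) φ, ‖∑ n ∈ s, f n φ‖ ≤ C)
    (h : ∀ φ, HasSum (fun n => f n φ) (g φ)) (l : Fin ν → ℤ) :
    HasSum (fun n => fourierCoef (f n) l) (fourierCoef g l) := by
  have key := tendsto_fourierCoef (𝓕 := atTop) (f := fun (s : Finset ι) φ => ∑ n ∈ s, f n φ)
    (g := g) (C := C) (fun s => continuous_finsetSum _ fun n _ => hf n) hC h l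
  refine key.congr fun s => ?_
  exact fourierCoef_sum s (fun n _ => hf n) l

end Fourier

/-! ### Matrix coefficients of bounded operators -/

section Coefficients

open Filter Topology

variable {ν d : ℕ}

instance (d : ℕ) : Countable (Modes d) := inferInstanceAs (Countable {j : Fin d → ℤ // j ≠ 0})

instance (d : ℕ) : DecidableEq (Modes d) := Classical.decEq _

/-- The basis vector `e^{i j·x}`. -/
def basisVec (j : Modes d) : L20 d := lp.single 2 j (1 : ℂ)

theorem coeff_eq (R : Op d) (j j' : Modes d) : coeff R j j' = R (basisVec j') j := rfl

theorem norm_basisVec (j : Modes d) : ‖basisVec j‖ = 1 := by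
  rw [basisVec, lp.norm_single (by norm_num)]
  simp

theorem basisVec_apply (j k : Modes d) : basisVec j k = if k = j then 1 else 0 := by
  rw [basisVec, lp.single_apply]
  simp [Pi.single_apply]

theorem single_eq_smul (k : Modes d) (c : ℂ) :
    (lp.single 2 k c : L20 d) = c • basisVec k := by
  rw [basisVec, ← lp.single_smul]
  simp

theorem hasSum_basisVec (u : L20 d) : HasSum (fun j => u j • basisVec j) u := by
  have h := lp.hasSum_single (E := fun _ : Modes d => ℂ) (p := 2) (by norm_num) u
  exact h.congr_fun fun j => (single_eq_smul j _).symm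

/-- The `j`-th Fourier coefficient as a continuous functional. -/
def evalCLM (j : Modes d) : L20 d →L[ℂ] ℂ :=
  LinearMap.mkContinuous
    { toFun := fun u => u j, map_add' := fun _ _ => rfl, map_smul' := fun _ _ => rfl } 1
    fun u => by rw [one_mul]; exact lp.norm_apply_le_norm (by norm_num) u j

theorem evalCLM_apply (j : Modes d) (u : L20 d) : evalCLM j u = u j := rfl

/-- The matrix coefficient as a continuous functional. -/
def coeffCLM (j j' : Modes d) : Op d →L[ℂ] ℂ :=
  (evalCLM j).comp (ContinuousLinearMap.apply ℂ (L20 d) (basisVec j'))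

theorem coeffCLM_apply (j j' : Modes d) (R : Op d) : coeffCLM j j' R = coeff R j j' := rfl

theorem coeff_add (R T : Op d) (j j' : Modes d) : coeff (R + T) j j' = coeff R j j' + coeff T j j' :=
  rfl

theorem coeff_sub (R T : Op d) (j j' : Modes d) : coeff (R - T) j j' = coeff R j j' - coeff T j j' :=
  rfl

theorem coeff_smul (c : ℂ) (R : Op d) (j j' : Modes d) : coeff (c • R) j j' = c * coeff R j j' :=
  rfl

theorem norm_coeff_le (R : Op d) (j j' : Modes d) : ‖coeff R j j'‖ ≤ ‖R‖ := by
  rw [coeff_eq]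
  refine (lp.norm_apply_le_norm (by norm_num) _ _).trans ?_
  simpa [norm_basisVec] using R.le_opNorm (basisVec j')

theorem op_ext {R T : Op d} (h : ∀ j j', coeff R j j' = coeff T j j') : R = T := by
  ext1 u
  have h1 : ∀ j, R (basisVec j) = T (basisVec j) := fun j => lp.ext (funext fun k => h k j)
  have hR := (hasSum_basisVec u).mapL R
  have hT := (hasSum_basisVec u).mapL T
  simp only [map_smul, h1] at hR hT
  exact hR.unique hT

theorem hasSum_coeff_mul (R T : Op d) (j j' : Modes d) :
    HasSum (fun k => coeff R j k * coeff T k j') (coeff (R * T) j j') := by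
  have h := ((hasSum_basisVec (T (basisVec j'))).mapL R).mapL (evalCLM j)
  simpa [evalCLM_apply, coeff_eq, mul_comm] using! h

/-- The partial sums of the series for the entries of `R * T` are bounded uniformly, since they
correspond to orthogonal projections of the image of a basis vector under `T`. With this domination
the series over the modes commutes with the Fourier integrals. -/
theorem norm_sum_coeff_mul_le (R T : Op d) (j j' : Modes d) (s : Finset (Modes d)) :
    ‖∑ k ∈ s, coeff R j k * coeff T k j'‖ ≤ ‖R‖ * ‖T‖ := by
  have h1 : ∑ k ∈ s, coeff R j k * coeff T k j' =
      R (∑ k ∈ s, lp.single 2 k (T (basisVec j') k)) j := by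
    rw [map_sum, ← evalCLM_apply, map_sum]
    refine Finset.sum_congr rfl fun k _ => ?_
    rw [single_eq_smul, map_smul, map_smul, evalCLM_apply, coeff_eq, coeff_eq, smul_eq_mul, mul_comm]
  rw [h1]
  refine (lp.norm_apply_le_norm (by norm_num) _ _).trans ((R.le_opNorm _).trans ?_)
  refine mul_le_mul_of_nonneg_left ?_ (norm_nonneg _)
  have h2 : ‖∑ k ∈ s, lp.single 2 k (T (basisVec j') k)‖ ≤ ‖T (basisVec j')‖ := by
    have h3 := lp.norm_sum_single (E := fun _ : Modes d => ℂ) (p := 2) (by norm_num)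
      (T (basisVec j')) s
    have h4 := lp.sum_rpow_le_norm_rpow (E := fun _ : Modes d => ℂ) (p := 2) (by norm_num)
      (T (basisVec j')) s
    rw [← h3] at h4
    simp only [ENNReal.toReal_ofNat, Real.rpow_two] at h4
    exact abs_le_of_sq_le_sq' h4 (norm_nonneg _) |>.2
  exact h2.trans (by simpa [norm_basisVec] using T.le_opNorm (basisVec j'))

/-- Every mode lies in exactly one shell. -/
def shellSigma (d : ℕ) : (Σ α : Spec d, Shell α) ≃ Modes d where
  toFun p := p.2.1
  invFun j := ⟨j.level, j.self⟩
  left_inv := by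
    rintro ⟨⟨a, ha⟩, ⟨j, hj⟩⟩
    obtain rfl : intNorm j.1 = a := hj
    rfl
  right_inv _ := rfl

end Coefficients

/-! ### Families of operators on the torus -/

section Decay

open Filter Topology

variable {ν d : ℕ}

/-- Continuous functions on the torus. -/
def TorusCont {E : Type*} [TopologicalSpace E] (F : (Fin ν → ℝ) → E) : Prop :=
  Continuous F ∧ TorusPeriodic F

theorem TorusCont.comp {E E' : Type*} [TopologicalSpace E] [TopologicalSpace E']
    {F : (Fin ν → ℝ) → E} (hF : TorusCont F) {g : E → E'} (hg : Continuous g) :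
    TorusCont fun φ => g (F φ) :=
  ⟨hg.comp hF.1, fun φ n => congrArg g (hF.2 φ n)⟩

theorem TorusCont.comp₂ {E E' E'' : Type*} [TopologicalSpace E] [TopologicalSpace E']
    [TopologicalSpace E''] {F : (Fin ν → ℝ) → E} {G : (Fin ν → ℝ) → E'} (hF : TorusCont F)
    (hG : TorusCont G) {g : E → E' → E''} (hg : Continuous fun p : E × E' => g p.1 p.2) :
    TorusCont fun φ => g (F φ) (G φ) :=
  ⟨hg.comp (hF.1.prodMk hG.1), fun φ n => congrArg₂ g (hF.2 φ n) (hG.2 φ n)⟩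

theorem TorusCont.coeff {F : (Fin ν → ℝ) → Op d} (hF : TorusCont F) (j j' : Modes d) :
    TorusCont fun φ => coeff (F φ) j j' :=
  hF.comp (coeffCLM j j').continuous

theorem TorusCont.exists_bound {E : Type*} [SeminormedAddCommGroup E] {F : (Fin ν → ℝ) → E}
    (hF : TorusCont F) : ∃ C, ∀ φ, ‖F φ‖ ≤ C := by
  obtain ⟨C, hC⟩ := (isCompact_Icc (a := (0 : Fin ν → ℝ)) (b := fun _ => 2 * Real.pi)).exists_bound_of_continuousOn
    hF.1.continuousOn
  refine ⟨C, fun φ => ?_⟩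
  have h2 : (0 : ℝ) < 2 * Real.pi := by positivity
  rw [← hF.2 φ fun i => -⌊φ i / (2 * Real.pi)⌋]
  apply hC
  constructor
  · intro i
    have := Int.floor_le (φ i / (2 * Real.pi))
    rw [le_div_iff₀ h2] at this
    push_cast
    simp only [Pi.zero_apply]
    linarith
  · intro i
    have := (Int.lt_floor_add_one (φ i / (2 * Real.pi))).le
    rw [div_le_iff₀ h2] at this
    push_cast
    linarith

theorem hatBlock_add {F G : (Fin ν → ℝ) → Op d} (hF : Continuous F) (hG : Continuous G)
    (l : Fin ν → ℤ) (α β : Spec d) :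
    hatBlock (F + G) l α β = hatBlock F l α β + hatBlock G l α β := by
  ext j j'
  exact fourierCoef_add ((coeffCLM j.1 j'.1).continuous.comp hF)
    ((coeffCLM j.1 j'.1).continuous.comp hG) l

theorem hatBlock_smul (c : ℂ) (F : (Fin ν → ℝ) → Op d) (l : Fin ν → ℤ) (α β : Spec d) :
    hatBlock (c • F) l α β = c • hatBlock F l α β := by
  ext j j'
  exact fourierCoef_const_mul c _ l

theorem hatBlock_neg (F : (Fin ν → ℝ) → Op d) (l : Fin ν → ℤ) (α β : Spec d) :
    hatBlock (-F) l α β = -hatBlock F l α β := by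
  have := hatBlock_smul (-1) F l α β
  simpa using this

theorem hatBlock_sub {F G : (Fin ν → ℝ) → Op d} (hF : Continuous F) (hG : Continuous G)
    (l : Fin ν → ℤ) (α β : Spec d) :
    hatBlock (F - G) l α β = hatBlock F l α β - hatBlock G l α β := by
  rw [sub_eq_add_neg, hatBlock_add hF hG.neg, hatBlock_neg, sub_eq_add_neg]

/-- The block of a product is the convolution of the blocks; in norm. -/
theorem hsENorm_hatBlock_mul_le {F G : (Fin ν → ℝ) → Op d} (hF : TorusCont F) (hG : TorusCont G)
    (l : Fin ν → ℤ) (α β : Spec d) :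
    hsENorm (hatBlock (F * G) l α β) ≤
      ∑' δ : Spec d, ∑' k : Fin ν → ℤ, hsENorm (hatBlock F (l - k) α δ) *
        hsENorm (hatBlock G k δ β) := by
  let B : Spec d → Block α β := fun δ => Matrix.of fun j j' =>
    ∑ k : Shell δ, fourierCoef (fun φ => coeff (F φ) j.1 k.1 * coeff (G φ) k.1 j'.1) l
  have h1 : hsENorm (hatBlock (F * G) l α β) ≤ ∑' δ, hsENorm (B δ) := by
    refine hsENorm_le_tsum_of_hasSum fun j j' => ?_
    obtain ⟨CF, hCF⟩ := hF.exists_bound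
    obtain ⟨CG, hCG⟩ := hG.exists_bound
    have h2 := hasSum_fourierCoef (C := CF * CG)
      (f := fun (k : Modes d) φ => coeff (F φ) j.1 k * coeff (G φ) k j'.1)
      (g := fun φ => coeff ((F * G) φ) j.1 j'.1)
      (fun k => (hF.coeff _ _).1.mul (hG.coeff _ _).1)
      (fun s φ => (norm_sum_coeff_mul_le _ _ _ _ s).trans
        (mul_le_mul (hCF φ) (hCG φ) (norm_nonneg _) ((norm_nonneg _).trans (hCF φ))))
      (fun φ => hasSum_coeff_mul _ _ _ _) l
    have h3 := (shellSigma d).hasSum_iff.mpr h2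
    exact h3.sigma fun δ => hasSum_fintype _
  refine h1.trans (ENNReal.tsum_le_tsum fun δ => ?_)
  have h4 : hsENorm (B δ) ≤ ∑' k, hsENorm (hatBlock F (l - k) α δ * hatBlock G k δ β) := by
    refine hsENorm_le_tsum_of_hasSum fun j j' => ?_
    simp only [Matrix.mul_apply]
    refine hasSum_sum fun k _ => ?_
    exact hasSum_fourierCoef_mul (hF.coeff _ _).1 (hG.coeff _ _).1 (hF.coeff _ _).2
      (hG.coeff _ _).2 l
  exact h4.trans (ENNReal.tsum_le_tsum fun k => hsENorm_mul_le _ _)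

/-- Countable subadditivity of the norm of a Fourier block, for series that converge uniformly. -/
theorem hsENorm_hatBlock_le_tsum {F : ℕ → (Fin ν → ℝ) → Op d} {G : (Fin ν → ℝ) → Op d}
    {c : ℕ → ℝ} (hF : ∀ n, Continuous (F n)) (hc : Summable c) (hle : ∀ n φ, ‖F n φ‖ ≤ c n)
    (h : ∀ φ, HasSum (fun n => F n φ) (G φ)) (l : Fin ν → ℤ) (α β : Spec d) :
    hsENorm (hatBlock G l α β) ≤ ∑' n, hsENorm (hatBlock (F n) l α β) := by
  refine hsENorm_le_tsum_of_hasSum fun j j' => ?_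
  refine hasSum_fourierCoef (C := ∑' n, c n)
    (fun n => (coeffCLM j.1 j'.1).continuous.comp (hF n)) (fun s φ => ?_)
    (fun φ => (h φ).mapL (coeffCLM j.1 j'.1)) l
  have h0 : ∀ n, 0 ≤ c n := fun n => (norm_nonneg _).trans (hle n 0)
  refine (norm_sum_le _ _).trans ((Finset.sum_le_sum fun n _ => ?_).trans
    (hc.sum_le_tsum s fun n _ => h0 n))
  exact (norm_coeff_le _ _ _).trans (hle n φ)

end Decay

/-! ### The block-decay norm -/

section DecayNorm

open Filter Topology

variable {ν d : ℕ}

theorem intNorm_eq_norm {n : ℕ} (l : Fin n → ℤ) :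
    intNorm l = ‖(WithLp.toLp 2 fun i => (l i : ℝ) : EuclideanSpace ℝ (Fin n))‖ := by
  rw [EuclideanSpace.norm_eq, intNorm]
  simp

theorem intNorm_nonneg {n : ℕ} (l : Fin n → ℤ) : 0 ≤ intNorm l := Real.sqrt_nonneg _

theorem intNorm_add_le {n : ℕ} (l k : Fin n → ℤ) : intNorm (l + k) ≤ intNorm l + intNorm k := by
  rw [intNorm_eq_norm, intNorm_eq_norm, intNorm_eq_norm]
  refine le_trans (le_of_eq ?_) (norm_add_le _ _)
  congr 1
  ext i
  simp

theorem one_le_intNorm {n : ℕ} {l : Fin n → ℤ} (h : l ≠ 0) : 1 ≤ intNorm l := by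
  obtain ⟨i, hi⟩ := Function.ne_iff.mp h
  refine le_trans ?_ (abs_le_intNorm l i)
  exact_mod_cast Int.one_le_abs hi

theorem Spec.one_le (α : Spec d) : 1 ≤ α.1 := by
  obtain ⟨a, j, hj⟩ := α
  change 1 ≤ a
  rw [← hj]
  exact one_le_intNorm j.2

theorem Spec.pos (α : Spec d) : 0 < α.1 := zero_lt_one.trans_le α.one_le

theorem one_le_jap (l : Fin ν → ℤ) : 1 ≤ jap l := le_max_left _ _

theorem one_le_jap3 (l : Fin ν → ℤ) (α β : Spec d) : 1 ≤ jap3 l α β :=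
  (one_le_jap l).trans (le_max_left _ _)

theorem jap3_pos (l : Fin ν → ℤ) (α β : Spec d) : 0 < jap3 l α β :=
  zero_lt_one.trans_le (one_le_jap3 l α β)

theorem jap_le_jap3 (l : Fin ν → ℤ) (α β : Spec d) : jap l ≤ jap3 l α β := le_max_left _ _

theorem left_le_jap3 (l : Fin ν → ℤ) (α β : Spec d) : α.1 ≤ jap3 l α β :=
  (le_max_left _ _).trans (le_max_right _ _)

theorem right_le_jap3 (l : Fin ν → ℤ) (α β : Spec d) : β.1 ≤ jap3 l α β :=
  (le_max_right _ _).trans (le_max_right _ _)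

theorem jap3_le_iff {l : Fin ν → ℤ} {α β : Spec d} {x : ℝ} :
    jap3 l α β ≤ x ↔ jap l ≤ x ∧ α.1 ≤ x ∧ β.1 ≤ x := by
  simp [jap3]

theorem jap_neg (l : Fin ν → ℤ) : jap (-l) = jap l := by simp [jap, intNorm_neg]

theorem jap3_neg (l : Fin ν → ℤ) (α β : Spec d) : jap3 (-l) α β = jap3 l α β := by
  simp [jap3, jap_neg]

theorem jap3_comm (l : Fin ν → ℤ) (α β : Spec d) : jap3 l α β = jap3 l β α := by
  simp [jap3, max_comm]

theorem jap3_triangle (l k : Fin ν → ℤ) (α β δ : Spec d) :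
    jap3 l α β ≤ jap3 (l - k) α δ + jap3 k δ β := by
  have h1 := jap3_pos (l - k) α δ
  have h2 := jap3_pos k δ β
  refine jap3_le_iff.mpr ⟨max_le ?_ ?_, ?_, ?_⟩
  · linarith [one_le_jap3 (l - k) α δ]
  · have h3 := intNorm_add_le (l - k) k
    rw [sub_add_cancel] at h3
    have h4 : intNorm (l - k) ≤ jap3 (l - k) α δ := (le_max_right _ _).trans (jap_le_jap3 _ _ _)
    have h5 : intNorm k ≤ jap3 k δ β := (le_max_right _ _).trans (jap_le_jap3 _ _ _)
    linarith
  · linarith [left_le_jap3 (l - k) α δ]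
  · linarith [right_le_jap3 k δ β]

/-- The weight `⟨ℓ,α,β⟩^s`. -/
def wt (s : ℝ) (l : Fin ν → ℤ) (α β : Spec d) : ℝ≥0∞ := ENNReal.ofReal (jap3 l α β ^ s)

theorem wt_mono {s t : ℝ} (h : s ≤ t) (l : Fin ν → ℤ) (α β : Spec d) : wt s l α β ≤ wt t l α β :=
  ENNReal.ofReal_le_ofReal (Real.rpow_le_rpow_of_exponent_le (one_le_jap3 _ _ _) h)

theorem wt_add (s t : ℝ) (l : Fin ν → ℤ) (α β : Spec d) :
    wt (s + t) l α β = wt s l α β * wt t l α β := by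
  rw [wt, wt, wt, Real.rpow_add (jap3_pos _ _ _),
    ENNReal.ofReal_mul (Real.rpow_nonneg (jap3_pos _ _ _).le _)]

theorem wt_zero (l : Fin ν → ℤ) (α β : Spec d) : wt 0 l α β = 1 := by simp [wt]

theorem wt_neg_mul (s : ℝ) (l : Fin ν → ℤ) (α β : Spec d) : wt (-s) l α β * wt s l α β = 1 := by
  rw [← wt_add, neg_add_cancel, wt_zero]

theorem wt_triangle {s : ℝ} (hs : 0 ≤ s) (l k : Fin ν → ℤ) (α β δ : Spec d) :
    wt s l α β ≤ ENNReal.ofReal (2 ^ s) * (wt s (l - k) α δ + wt s k δ β) := by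
  have h1 := jap3_pos (l - k) α δ
  have h2 := jap3_pos k δ β
  rw [wt, wt, wt, ← ENNReal.ofReal_add (by positivity) (by positivity),
    ← ENNReal.ofReal_mul (by positivity)]
  refine ENNReal.ofReal_le_ofReal ?_
  have h3 : jap3 l α β ≤ 2 * max (jap3 (l - k) α δ) (jap3 k δ β) := by
    have := jap3_triangle l k α β δ
    have := le_max_left (jap3 (l - k) α δ) (jap3 k δ β)
    have := le_max_right (jap3 (l - k) α δ) (jap3 k δ β)
    linarith
  refine (Real.rpow_le_rpow (jap3_pos _ _ _).le h3 hs).trans ?_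
  rw [Real.mul_rpow (by norm_num) (le_max_of_le_left h1.le)]
  refine mul_le_mul_of_nonneg_left ?_ (by positivity)
  rcases max_cases (jap3 (l - k) α δ) (jap3 k δ β) with h | h <;> rw [h.1]
  · linarith [Real.rpow_nonneg h2.le s]
  · linarith [Real.rpow_nonneg h1.le s]

/-- The contribution of one pair of eigenvalues to `|R|_s`. -/
def decayBlock (s : ℝ) (F : (Fin ν → ℝ) → Op d) (α β : Spec d) : ℝ≥0∞ :=
  l2 fun l => wt s l α β * hsENorm (hatBlock F l α β)

theorem decayNorm_eq (s : ℝ) (F : (Fin ν → ℝ) → Op d) :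
    decayNorm s F = ⨆ (α : Spec d) (β : Spec d), decayBlock s F α β := by
  unfold decayNorm decayBlock l2 wt
  simp_rw [mul_pow]
  congr! 8 with α β l
  rw [← ENNReal.ofReal_pow (Real.rpow_nonneg (jap3_pos _ _ _).le _), ← Real.rpow_mul_natCast
    (jap3_pos _ _ _).le, mul_comm]
  norm_num

theorem decayBlock_le_decayNorm (s : ℝ) (F : (Fin ν → ℝ) → Op d) (α β : Spec d) :
    decayBlock s F α β ≤ decayNorm s F := by
  rw [decayNorm_eq]
  exact le_iSup₂ (f := fun α β => decayBlock s F α β) α β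

theorem decayNorm_le {s : ℝ} {F : (Fin ν → ℝ) → Op d} {C : ℝ≥0∞}
    (h : ∀ α β, decayBlock s F α β ≤ C) : decayNorm s F ≤ C := by
  rw [decayNorm_eq]
  exact iSup₂_le h

theorem wt_mul_hsENorm_le (s : ℝ) (F : (Fin ν → ℝ) → Op d) (l : Fin ν → ℤ) (α β : Spec d) :
    wt s l α β * hsENorm (hatBlock F l α β) ≤ decayNorm s F :=
  (le_l2 (fun l => wt s l α β * hsENorm (hatBlock F l α β)) l).trans
    (decayBlock_le_decayNorm s F α β)

/-- Comparison of decay norms from a comparison of weighted blocks. -/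
theorem decayNorm_le_of_hatBlock_le {s t r : ℝ} {F G H : (Fin ν → ℝ) → Op d} {a b : ℝ≥0∞}
    (h : ∀ l α β, wt s l α β * hsENorm (hatBlock F l α β) ≤
      a * (wt t l α β * hsENorm (hatBlock G l α β)) +
        b * (wt r l α β * hsENorm (hatBlock H l α β))) :
    decayNorm s F ≤ a * decayNorm t G + b * decayNorm r H := by
  refine decayNorm_le fun α β => (l2_mono fun l => h l α β).trans ((l2_add_le _ _).trans ?_)
  rw [l2_smul, l2_smul]
  exact add_le_add (mul_le_mul_right (decayBlock_le_decayNorm t G α β) _)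
    (mul_le_mul_right (decayBlock_le_decayNorm r H α β) _)

theorem decayNorm_le_of_hatBlock_le' {s t : ℝ} {F G : (Fin ν → ℝ) → Op d} {a : ℝ≥0∞}
    (h : ∀ l α β, wt s l α β * hsENorm (hatBlock F l α β) ≤
      a * (wt t l α β * hsENorm (hatBlock G l α β))) :
    decayNorm s F ≤ a * decayNorm t G := by
  simpa using decayNorm_le_of_hatBlock_le (s := s) (t := t) (r := t) (F := F) (G := G) (H := G)
    (a := a) (b := 0) (by simpa using h)

theorem decayNorm_mono {s t : ℝ} (h : s ≤ t) (F : (Fin ν → ℝ) → Op d) :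
    decayNorm s F ≤ decayNorm t F := by
  simpa using decayNorm_le_of_hatBlock_le' (s := s) (t := t) (F := F) (G := F) (a := 1)
    (fun l α β => by simpa using mul_le_mul_left (wt_mono h l α β) _)

theorem decayNorm_add_le {s : ℝ} {F G : (Fin ν → ℝ) → Op d} (hF : Continuous F)
    (hG : Continuous G) : decayNorm s (F + G) ≤ decayNorm s F + decayNorm s G := by
  simpa using decayNorm_le_of_hatBlock_le (s := s) (t := s) (r := s) (F := F + G) (G := F) (H := G)
    (a := 1) (b := 1) (fun l α β => by
      rw [hatBlock_add hF hG, one_mul, one_mul, ← mul_add]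
      exact mul_le_mul_right (hsENorm_add_le _ _) _)

theorem decayNorm_smul_le (s : ℝ) (c : ℂ) (F : (Fin ν → ℝ) → Op d) :
    decayNorm s (c • F) ≤ ‖c‖ₑ * decayNorm s F :=
  decayNorm_le_of_hatBlock_le' fun l α β => by
    rw [hatBlock_smul, hsENorm_smul]
    exact le_of_eq (by ring)

theorem decayNorm_zero (s : ℝ) : decayNorm s (0 : (Fin ν → ℝ) → Op d) = 0 := by
  simpa using decayNorm_smul_le s 0 (0 : (Fin ν → ℝ) → Op d)

theorem decayNorm_le_tsum {F : ℕ → (Fin ν → ℝ) → Op d} {G : (Fin ν → ℝ) → Op d}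
    {c : ℕ → ℝ} (hF : ∀ n, Continuous (F n)) (hc : Summable c) (hle : ∀ n φ, ‖F n φ‖ ≤ c n)
    (h : ∀ φ, HasSum (fun n => F n φ) (G φ)) (s : ℝ) :
    decayNorm s G ≤ ∑' n, decayNorm s (F n) := by
  refine decayNorm_le fun α β => ?_
  refine (l2_mono fun l => mul_le_mul_right (hsENorm_hatBlock_le_tsum hF hc hle h l α β) _).trans ?_
  simp_rw [← ENNReal.tsum_mul_left]
  refine (l2_tsum_le _).trans (ENNReal.tsum_le_tsum fun n => ?_)
  exact decayBlock_le_decayNorm s (F n) α β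

/-! ### The product estimate -/

theorem tsum_int_rpow_lt_top {t : ℝ} (ht : 1 < t) :
    ∑' k : ℤ, ENNReal.ofReal (max 1 |(k : ℝ)| ^ (-t)) < ⊤ := by
  rw [← ENNReal.ofReal_tsum_of_nonneg]
  · exact ENNReal.ofReal_lt_top
  · intro k; positivity
  · have h := (Real.summable_abs_int_rpow ht).add (summable_of_hasFiniteSupport
      (f := fun k : ℤ => if k = 0 then (1 : ℝ) else 0)
      ((Set.finite_singleton (0 : ℤ)).subset fun k hk => by
        by_contra h0
        simp_all))
    refine Summable.of_nonneg_of_le (fun k => by positivity) (fun k => ?_) h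
    by_cases hk : k = 0
    · subst hk
      simp
      positivity
    · have : (1 : ℝ) ≤ |(k : ℝ)| := by exact_mod_cast Int.one_le_abs hk
      rw [max_eq_right this]
      simp [hk]

theorem tsum_prod_rpow_lt_top (n : ℕ) {t : ℝ} (ht : 1 < t) :
    ∑' l : Fin n → ℤ, ∏ i, ENNReal.ofReal (max 1 |(l i : ℝ)| ^ (-t)) < ⊤ := by
  induction n with
  | zero => simp
  | succ n ih =>
    rw [← (Fin.consEquiv fun _ : Fin (n + 1) => ℤ).tsum_eq, ENNReal.tsum_prod']
    simp only [Fin.consEquiv_apply, Fin.prod_univ_succ, Fin.cons_zero, Fin.cons_succ]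
    simp_rw [ENNReal.tsum_mul_left, ENNReal.tsum_mul_right]
    exact ENNReal.mul_lt_top (tsum_int_rpow_lt_top ht) ih

theorem tsum_jap_rpow_lt_top (n : ℕ) {t : ℝ} (ht : (n : ℝ) < t) :
    ∑' l : Fin n → ℤ, ENNReal.ofReal (jap l ^ (-t)) < ⊤ := by
  rcases Nat.eq_zero_or_pos n with rfl | hn
  · rw [tsum_fintype]
    exact ENNReal.sum_lt_top.mpr fun _ _ => ENNReal.ofReal_lt_top
  have hn' : (0 : ℝ) < n := by exact_mod_cast hn
  have ht1 : 1 < t / n := by rwa [lt_div_iff₀ hn', one_mul]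
  refine lt_of_le_of_lt (ENNReal.tsum_le_tsum fun l => ?_) (tsum_prod_rpow_lt_top n ht1)
  rw [← ENNReal.ofReal_prod_of_nonneg fun i _ => by positivity]
  refine ENNReal.ofReal_le_ofReal ?_
  have h1 : ∀ i, jap l ^ (-(t / n)) ≤ max 1 |(l i : ℝ)| ^ (-(t / n)) := fun i => by
    refine Real.rpow_le_rpow_of_nonpos (by positivity) ?_ (by linarith)
    exact max_le_max le_rfl (abs_le_intNorm l i)
  calc jap l ^ (-t) = ∏ _i : Fin n, jap l ^ (-(t / n)) := by
        rw [Finset.prod_const, Finset.card_univ, Fintype.card_fin, ← Real.rpow_mul_natCast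
          (zero_le_one.trans (one_le_jap l))]
        congr 1
        field_simp
    _ ≤ _ := Finset.prod_le_prod (fun i _ => Real.rpow_nonneg (zero_le_one.trans (one_le_jap l)) _)
        fun i _ => h1 i

theorem tsum_spec_rpow_lt_top {t : ℝ} (ht : (d : ℝ) < t) :
    ∑' α : Spec d, ENNReal.ofReal (α.1 ^ (-t)) < ⊤ := by
  let f : Spec d → (Fin d → ℤ) := fun α => α.2.choose.1
  have hf : ∀ α, intNorm (f α) = α.1 := fun α => α.2.choose_spec
  have hinj : Function.Injective f := fun α β h => Subtype.ext (by rw [← hf, ← hf, h])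
  refine lt_of_le_of_lt ?_ (tsum_jap_rpow_lt_top d ht)
  refine le_trans (ENNReal.tsum_le_tsum fun α => ?_)
    (ENNReal.tsum_comp_le_tsum_of_injective hinj fun l => ENNReal.ofReal (jap l ^ (-t)))
  rw [jap, hf, max_eq_right α.one_le]

/-- The constant in the product estimate, before the loss `2^s` of the weights. -/
def prodConst (ν d : ℕ) : ℝ≥0∞ :=
  ∑' δ : Spec d, l2 fun k : Fin ν → ℤ => ENNReal.ofReal (max (jap k) δ.1 ^ (-((ν : ℝ) + d)))

/-- The weight is split as `max ⟨k⟩ δ ^ (-(ν + d)) ≤ δ ^ (-(d + ν / 4)) * ⟨k⟩ ^ (-(3 * ν / 4))`: the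
first factor is summable over the spectrum and the second one is square-summable over `ℤ^ν`. -/
theorem prodConst_lt_top (hν : 1 ≤ ν) : prodConst ν d < ⊤ := by
  have hν' : (1 : ℝ) ≤ ν := by exact_mod_cast hν
  have h1 : ∀ (δ : Spec d) (k : Fin ν → ℤ),
      ENNReal.ofReal (max (jap k) δ.1 ^ (-((ν : ℝ) + d))) ≤
        ENNReal.ofReal (δ.1 ^ (-((d : ℝ) + ν / 4))) * ENNReal.ofReal (jap k ^ (-(3 * (ν : ℝ) / 4))) :=
    fun δ k => by
    have hj := zero_lt_one.trans_le (one_le_jap k)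
    have hδ := δ.pos
    rw [← ENNReal.ofReal_mul (by positivity)]
    refine ENNReal.ofReal_le_ofReal ?_
    have : -((ν : ℝ) + d) = -((d : ℝ) + ν / 4) + -(3 * (ν : ℝ) / 4) := by ring
    rw [this, Real.rpow_add (lt_max_of_lt_left hj)]
    refine mul_le_mul ?_ ?_ (by positivity) (by positivity)
    · exact Real.rpow_le_rpow_of_nonpos hδ (le_max_right _ _) (by linarith [(Nat.cast_nonneg d : (0 : ℝ) ≤ d)])
    · exact Real.rpow_le_rpow_of_nonpos hj (le_max_left _ _) (by linarith)
  have h2 : prodConst ν d ≤ ∑' δ : Spec d, ENNReal.ofReal (δ.1 ^ (-((d : ℝ) + ν / 4))) *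
      l2 fun k : Fin ν → ℤ => ENNReal.ofReal (jap k ^ (-(3 * (ν : ℝ) / 4))) := by
    refine ENNReal.tsum_le_tsum fun δ => (l2_mono (h1 δ)).trans ?_
    rw [l2_smul]
  refine h2.trans_lt ?_
  rw [ENNReal.tsum_mul_right]
  refine ENNReal.mul_lt_top (tsum_spec_rpow_lt_top (by linarith)) ?_
  refine ENNReal.rpow_lt_top_of_nonneg (by norm_num) (ne_of_lt ?_)
  refine lt_of_le_of_lt (le_of_eq ?_) (tsum_jap_rpow_lt_top ν (t := 3 * ν / 2) (by linarith))
  refine tsum_congr fun k => ?_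
  have hj := zero_lt_one.trans_le (one_le_jap k)
  rw [← ENNReal.ofReal_pow (by positivity), ← Real.rpow_mul_natCast hj.le]
  congr 2
  push_cast
  ring

/-- The `ℓ¹` norm of the Fourier coefficients of one block, by the Cauchy–Schwarz inequality with
the weight `⟨k, α, β⟩ ^ (ν + d)`. Summing the constants over `δ` gives `prodConst`. -/
theorem tsum_hsENorm_le (G : (Fin ν → ℝ) → Op d) (α β δ : Spec d) (hδ : δ = α ∨ δ = β) :
    ∑' k : Fin ν → ℤ, hsENorm (hatBlock G k α β) ≤
      (l2 fun k : Fin ν → ℤ => ENNReal.ofReal (max (jap k) δ.1 ^ (-((ν : ℝ) + d)))) *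
        decayNorm ((ν : ℝ) + d) G := by
  have h1 : ∀ k : Fin ν → ℤ, hsENorm (hatBlock G k α β) ≤
      ENNReal.ofReal (max (jap k) δ.1 ^ (-((ν : ℝ) + d))) *
        (wt ((ν : ℝ) + d) k α β * hsENorm (hatBlock G k α β)) := fun k => by
    have hj := zero_lt_one.trans_le (one_le_jap k)
    have hw : wt (-((ν : ℝ) + d)) k α β ≤
        ENNReal.ofReal (max (jap k) δ.1 ^ (-((ν : ℝ) + d))) := by
      refine ENNReal.ofReal_le_ofReal (Real.rpow_le_rpow_of_nonpos (lt_max_of_lt_left hj) ?_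
        (by linarith [(Nat.cast_nonneg d : (0 : ℝ) ≤ d), (Nat.cast_nonneg ν : (0 : ℝ) ≤ ν)]))
      refine max_le (jap_le_jap3 _ _ _) ?_
      rcases hδ with rfl | rfl
      · exact left_le_jap3 _ _ _
      · exact right_le_jap3 _ _ _
    calc hsENorm (hatBlock G k α β)
        = wt (-((ν : ℝ) + d)) k α β * (wt ((ν : ℝ) + d) k α β * hsENorm (hatBlock G k α β)) := by
          rw [← mul_assoc, wt_neg_mul, one_mul]
      _ ≤ _ := mul_le_mul_left hw _
  refine (ENNReal.tsum_le_tsum h1).trans ((tsum_mul_le_l2 _ _).trans ?_)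
  exact mul_le_mul_right (decayBlock_le_decayNorm _ G α β) _

/-- The tame estimate for the product of two families of operators. -/
theorem decayNorm_mul_le {F G : (Fin ν → ℝ) → Op d} (hF : TorusCont F) (hG : TorusCont G) {s : ℝ}
    (hs : 0 ≤ s) :
    decayNorm s (F * G) ≤ ENNReal.ofReal (2 ^ s) * prodConst ν d *
      (decayNorm s F * decayNorm ((ν : ℝ) + d) G + decayNorm ((ν : ℝ) + d) F * decayNorm s G) := by
  refine decayNorm_le fun α β => ?_
  set f : Spec d → (Fin ν → ℤ) → ℝ≥0∞ := fun δ k => hsENorm (hatBlock F k α δ) with hf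
  set g : Spec d → (Fin ν → ℤ) → ℝ≥0∞ := fun δ k => hsENorm (hatBlock G k δ β) with hg
  have h1 : ∀ l, wt s l α β * hsENorm (hatBlock (F * G) l α β) ≤ ENNReal.ofReal (2 ^ s) *
      (∑' δ, ∑' k, (wt s (l - k) α δ * f δ (l - k)) * g δ k +
        ∑' δ, ∑' k, f δ (l - k) * (wt s k δ β * g δ k)) := fun l => by
    refine (mul_le_mul_right (hsENorm_hatBlock_mul_le hF hG l α β) _).trans ?_
    rw [← ENNReal.tsum_add, ← ENNReal.tsum_mul_left, ← ENNReal.tsum_mul_left]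
    refine ENNReal.tsum_le_tsum fun δ => ?_
    rw [← ENNReal.tsum_add, ← ENNReal.tsum_mul_left, ← ENNReal.tsum_mul_left]
    refine ENNReal.tsum_le_tsum fun k => ?_
    refine (mul_le_mul_left (wt_triangle hs l k α β δ) _).trans (le_of_eq ?_)
    simp only [hf, hg]
    ring
  refine (l2_mono h1).trans ?_
  rw [l2_smul, mul_assoc]
  refine mul_le_mul_right ((l2_add_le _ _).trans ?_) _
  rw [mul_add]
  have hP : ∀ A B : ℝ≥0∞, prodConst ν d * (A * B) = ∑' δ : Spec d,
      (l2 fun k : Fin ν → ℤ => ENNReal.ofReal (max (jap k) δ.1 ^ (-((ν : ℝ) + d)))) * (A * B) :=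
    fun A B => by rw [prodConst, ENNReal.tsum_mul_right]
  rw [hP, hP]
  refine add_le_add ((l2_tsum_le _).trans (ENNReal.tsum_le_tsum fun δ => ?_))
    ((l2_tsum_le _).trans (ENNReal.tsum_le_tsum fun δ => ?_))
  · refine (l2_conv_le (fun k => wt s k α δ * f δ k) (g δ)).trans ?_
    refine (mul_le_mul' (decayBlock_le_decayNorm s F α δ)
      (tsum_hsENorm_le G δ β δ (Or.inl rfl))).trans (le_of_eq ?_)
    ring
  · refine (l2_conv_le' (f δ) (fun k => wt s k δ β * g δ k)).trans ?_
    refine (mul_le_mul' (tsum_hsENorm_le F α δ δ (Or.inr rfl))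
      (decayBlock_le_decayNorm s G δ β)).trans (le_of_eq ?_)
    ring

end DecayNorm

/-! ### Lipschitz norms -/

section Lipschitz

variable {ν : ℕ} {E : Type*} {γ : ℝ} {S T : Set (Freq ν)} {n : E → ℝ≥0∞}
  {f : Freq ν → E}

/-- The supremum in the norm `‖·‖^{Lip(γ)}`. -/
def supPart (S : Set (Freq ν)) (n : E → ℝ≥0∞) (f : Freq ν → E) : ℝ≥0∞ := ⨆ ω ∈ S, n (f ω)

theorem le_supPart {ω : Freq ν} (h : ω ∈ S) : n (f ω) ≤ supPart S n f :=
  le_iSup₂ (f := fun ω (_ : ω ∈ S) => n (f ω)) ω h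

theorem supPart_le {C : ℝ≥0∞} (h : ∀ ω ∈ S, n (f ω) ≤ C) : supPart S n f ≤ C := iSup₂_le h

variable [AddGroup E]

/-- The Lipschitz constant in the norm `‖·‖^{Lip(γ)}`. -/
def lipPart (S : Set (Freq ν)) (n : E → ℝ≥0∞) (f : Freq ν → E) : ℝ≥0∞ :=
  ⨆ ω₁ ∈ S, ⨆ ω₂ ∈ S, ⨆ _ : ω₁ ≠ ω₂, n (f ω₁ - f ω₂) / edist ω₁ ω₂

theorem lipNorm_eq (γ : ℝ) (S : Set (Freq ν)) (n : E → ℝ≥0∞) (f : Freq ν → E) :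
    lipNorm γ S n f = supPart S n f + ENNReal.ofReal γ * lipPart S n f := rfl

theorem le_lipNorm {ω : Freq ν} (h : ω ∈ S) : n (f ω) ≤ lipNorm γ S n f :=
  (le_supPart h).trans le_self_add

theorem le_lipPart (h0 : n 0 = 0) {ω₁ ω₂ : Freq ν} (h₁ : ω₁ ∈ S) (h₂ : ω₂ ∈ S) :
    n (f ω₁ - f ω₂) ≤ lipPart S n f * edist ω₁ ω₂ := by
  by_cases h : ω₁ = ω₂
  · simp [h, h0]
  · rw [← ENNReal.div_le_iff (edist_pos.mpr h).ne' (edist_ne_top _ _)]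
    refine le_iSup₂_of_le ω₁ h₁ (le_iSup₂_of_le ω₂ h₂ (le_iSup_of_le h le_rfl))

theorem lipPart_le {C : ℝ≥0∞}
    (h : ∀ ω₁ ∈ S, ∀ ω₂ ∈ S, n (f ω₁ - f ω₂) ≤ C * edist ω₁ ω₂) : lipPart S n f ≤ C := by
  refine iSup₂_le fun ω₁ h₁ => iSup₂_le fun ω₂ h₂ => iSup_le fun hne => ?_
  rw [ENNReal.div_le_iff (edist_pos.mpr hne).ne' (edist_ne_top _ _)]
  exact h ω₁ h₁ ω₂ h₂

theorem lipNorm_le {A B : ℝ≥0∞} (hA : ∀ ω ∈ S, n (f ω) ≤ A)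
    (hB : ∀ ω₁ ∈ S, ∀ ω₂ ∈ S, n (f ω₁ - f ω₂) ≤ B * edist ω₁ ω₂) :
    lipNorm γ S n f ≤ A + ENNReal.ofReal γ * B :=
  add_le_add (supPart_le hA) (mul_le_mul_right (lipPart_le hB) _)

theorem lipNorm_mono (h : S ⊆ T) : lipNorm γ S n f ≤ lipNorm γ T n f := by
  refine add_le_add (biSup_mono h) (mul_le_mul_right ?_ _)
  exact (biSup_mono h).trans (iSup₂_mono fun ω₁ _ => biSup_mono h)

theorem lipNorm_congr {g : Freq ν → E} (h : ∀ ω ∈ S, f ω = g ω) :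
    lipNorm γ S n f = lipNorm γ S n g := by
  refine congrArg₂ (· + ENNReal.ofReal γ * ·)
    (iSup_congr fun ω => iSup_congr fun hω => by rw [h ω hω])
    (iSup_congr fun ω₁ => iSup_congr fun h₁ => iSup_congr fun ω₂ => iSup_congr fun h₂ => by
      rw [h ω₁ h₁, h ω₂ h₂])

/-- Comparison of Lipschitz norms for families that are compared pointwise together with their
increments. -/
theorem lipNorm_le_of_le {E' E'' : Type*} [AddGroup E'] [AddGroup E'']
    {n' : E' → ℝ≥0∞} {n'' : E'' → ℝ≥0∞} {g : Freq ν → E'} {k : Freq ν → E''} {a b : ℝ≥0∞}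
    (h0 : n' 0 = 0) (h0' : n'' 0 = 0)
    (h : ∀ ω ∈ S, n (f ω) ≤ a * n' (g ω) + b * n'' (k ω))
    (hd : ∀ ω₁ ∈ S, ∀ ω₂ ∈ S, n (f ω₁ - f ω₂) ≤ a * n' (g ω₁ - g ω₂) + b * n'' (k ω₁ - k ω₂)) :
    lipNorm γ S n f ≤ a * lipNorm γ S n' g + b * lipNorm γ S n'' k := by
  refine (lipNorm_le (A := a * supPart S n' g + b * supPart S n'' k)
    (B := a * lipPart S n' g + b * lipPart S n'' k) (fun ω hω => (h ω hω).trans ?_)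
    (fun ω₁ h₁ ω₂ h₂ => (hd ω₁ h₁ ω₂ h₂).trans ?_)).trans (le_of_eq ?_)
  · exact add_le_add (mul_le_mul_right (le_supPart hω) _) (mul_le_mul_right (le_supPart hω) _)
  · refine (add_le_add (mul_le_mul_right (le_lipPart h0 h₁ h₂) _)
      (mul_le_mul_right (le_lipPart h0' h₁ h₂) _)).trans (le_of_eq ?_)
    ring
  · rw [lipNorm_eq, lipNorm_eq]
    ring

theorem lipNorm_le_of_le' {E' : Type*} [AddGroup E'] {n' : E' → ℝ≥0∞} {g : Freq ν → E'}
    {a : ℝ≥0∞} (h0 : n' 0 = 0) (h : ∀ ω ∈ S, n (f ω) ≤ a * n' (g ω))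
    (hd : ∀ ω₁ ∈ S, ∀ ω₂ ∈ S, n (f ω₁ - f ω₂) ≤ a * n' (g ω₁ - g ω₂)) :
    lipNorm γ S n f ≤ a * lipNorm γ S n' g := by
  simpa using lipNorm_le_of_le (γ := γ) (f := f) (n := n) (g := g) (k := g) (a := a) (b := 0)
    h0 h0 (by simpa using h) (by simpa using hd)

/-- Countable subadditivity of Lipschitz norms. -/
theorem lipNorm_le_tsum {E' : Type*} [AddGroup E'] {n' : E' → ℝ≥0∞} (h0 : n' 0 = 0)
    {g : ℕ → Freq ν → E'} (h : ∀ ω ∈ S, n (f ω) ≤ ∑' i, n' (g i ω))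
    (hd : ∀ ω₁ ∈ S, ∀ ω₂ ∈ S, n (f ω₁ - f ω₂) ≤ ∑' i, n' (g i ω₁ - g i ω₂)) :
    lipNorm γ S n f ≤ ∑' i, lipNorm γ S n' (g i) := by
  refine (lipNorm_le (A := ∑' i, supPart S n' (g i)) (B := ∑' i, lipPart S n' (g i))
    (fun ω hω => (h ω hω).trans (ENNReal.tsum_le_tsum fun i => le_supPart hω))
    (fun ω₁ h₁ ω₂ h₂ => (hd ω₁ h₁ ω₂ h₂).trans ?_)).trans (le_of_eq ?_)
  · rw [← ENNReal.tsum_mul_right]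
    exact ENNReal.tsum_le_tsum fun i => le_lipPart h0 h₁ h₂
  · rw [← ENNReal.tsum_mul_left, ← ENNReal.tsum_add]
    rfl

end Lipschitz

section LipschitzDecay

variable {ν d : ℕ} {γ : ℝ} {S : Set (Freq ν)}

theorem TorusCont.sub {E : Type*} [SeminormedAddCommGroup E] {F G : (Fin ν → ℝ) → E}
    (hF : TorusCont F) (hG : TorusCont G) : TorusCont (F - G) :=
  hF.comp₂ hG continuous_sub

theorem TorusCont.add {E : Type*} [SeminormedAddCommGroup E] {F G : (Fin ν → ℝ) → E}
    (hF : TorusCont F) (hG : TorusCont G) : TorusCont (F + G) :=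
  hF.comp₂ hG continuous_add

theorem TorusCont.neg {E : Type*} [SeminormedAddCommGroup E] {F : (Fin ν → ℝ) → E}
    (hF : TorusCont F) : TorusCont (-F) :=
  hF.comp continuous_neg

theorem TorusCont.mul {E : Type*} [SeminormedRing E] {F G : (Fin ν → ℝ) → E}
    (hF : TorusCont F) (hG : TorusCont G) : TorusCont (F * G) :=
  hF.comp₂ hG continuous_mul

theorem TorusCont.const_smul {E : Type*} [SeminormedAddCommGroup E] [NormedSpace ℂ E]
    {F : (Fin ν → ℝ) → E} (hF : TorusCont F) (c : ℂ) : TorusCont (c • F) :=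
  hF.comp (continuous_const_smul c)

theorem TorusCont.const {E : Type*} [TopologicalSpace E] (x : E) :
    TorusCont (fun _ : Fin ν → ℝ => x) :=
  ⟨continuous_const, fun _ _ => rfl⟩

/-- The tame product estimate passes to Lipschitz norms with the same constant: the product rule for
differences produces each product of a supremum and a Lipschitz constant once. -/
theorem lipNorm_decay_mul_le {X Y : Freq ν → (Fin ν → ℝ) → Op d}
    (hX : ∀ ω ∈ S, TorusCont (X ω)) (hY : ∀ ω ∈ S, TorusCont (Y ω)) {s : ℝ} (hs : 0 ≤ s) :
    lipNorm γ S (decayNorm s) (fun ω => X ω * Y ω) ≤ ENNReal.ofReal (2 ^ s) * prodConst ν d *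
      (lipNorm γ S (decayNorm s) X * lipNorm γ S (decayNorm ((ν : ℝ) + d)) Y +
        lipNorm γ S (decayNorm ((ν : ℝ) + d)) X * lipNorm γ S (decayNorm s) Y) := by
  set C := ENNReal.ofReal (2 ^ s) * prodConst ν d
  set r := (ν : ℝ) + d
  have z : ∀ t, decayNorm t (0 : (Fin ν → ℝ) → Op d) = 0 := decayNorm_zero
  let a := fun t => supPart S (decayNorm t) X
  let a' := fun t => lipPart S (decayNorm t) X
  let b := fun t => supPart S (decayNorm t) Y
  let b' := fun t => lipPart S (decayNorm t) Y
  refine (lipNorm_le (A := C * (a s * b r + a r * b s))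
    (B := C * (a' s * b r + a' r * b s) + C * (a s * b' r + a r * b' s))
    (fun ω hω => ?_) (fun ω₁ h₁ ω₂ h₂ => ?_)).trans ?_
  · refine (decayNorm_mul_le (hX ω hω) (hY ω hω) hs).trans (mul_le_mul_right ?_ _)
    exact add_le_add (mul_le_mul' (le_supPart hω) (le_supPart hω))
      (mul_le_mul' (le_supPart hω) (le_supPart hω))
  · have e : X ω₁ * Y ω₁ - X ω₂ * Y ω₂ = (X ω₁ - X ω₂) * Y ω₁ + X ω₂ * (Y ω₁ - Y ω₂) := by
      noncomm_ring
    rw [e]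
    have hX12 := (hX ω₁ h₁).sub (hX ω₂ h₂)
    have hY12 := (hY ω₁ h₁).sub (hY ω₂ h₂)
    refine (decayNorm_add_le (hX12.mul (hY ω₁ h₁)).1 ((hX ω₂ h₂).mul hY12).1).trans ?_
    refine (add_le_add (decayNorm_mul_le hX12 (hY ω₁ h₁) hs)
      (decayNorm_mul_le (hX ω₂ h₂) hY12 hs)).trans ?_
    rw [add_mul]
    refine add_le_add ?_ ?_
    · change C * _ ≤ _
      rw [mul_assoc C, add_mul]
      refine mul_le_mul_right (add_le_add ?_ ?_) _
      · exact (mul_le_mul' (le_lipPart (z s) h₁ h₂) (le_supPart h₁)).trans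
          (le_of_eq (by ring))
      · exact (mul_le_mul' (le_lipPart (z r) h₁ h₂) (le_supPart h₁)).trans
          (le_of_eq (by ring))
    · change C * _ ≤ _
      rw [mul_assoc C, add_mul]
      refine mul_le_mul_right (add_le_add ?_ ?_) _
      · exact (mul_le_mul' (le_supPart h₂) (le_lipPart (z r) h₁ h₂)).trans
          (le_of_eq (by ring))
      · exact (mul_le_mul' (le_supPart h₂) (le_lipPart (z s) h₁ h₂)).trans
          (le_of_eq (by ring))
  · simp only [lipNorm_eq]
    set g := ENNReal.ofReal γ
    calc C * (a s * b r + a r * b s) +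
          g * (C * (a' s * b r + a' r * b s) + C * (a s * b' r + a r * b' s))
        ≤ C * (a s * b r + a r * b s) +
          g * (C * (a' s * b r + a' r * b s) + C * (a s * b' r + a r * b' s)) +
          C * (g * g * (a' s * b' r + a' r * b' s)) := le_self_add
      _ = C * ((a s + g * a' s) * (b r + g * b' r) + (a r + g * a' r) * (b s + g * b' s)) := by
          ring

end LipschitzDecay

/-! ### Matrices of operators -/

section Matrices

variable {ν d : ℕ} {γ : ℝ} {S T : Set (Freq ν)}

/-- The projection of `L²₀ × L²₀` to one of its factors; `false` stands for the first one. -/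
def projCLM (a : Bool) : (L20 d × L20 d) →L[ℂ] L20 d :=
  if a then ContinuousLinearMap.snd ℂ _ _ else ContinuousLinearMap.fst ℂ _ _

/-- The inclusion of one of the factors into `L²₀ × L²₀`. -/
def injCLM (a : Bool) : L20 d →L[ℂ] (L20 d × L20 d) :=
  if a then ContinuousLinearMap.inr ℂ _ _ else ContinuousLinearMap.inl ℂ _ _

/-- The entries of a `2 × 2` matrix of operators. -/
def ent (a b : Bool) : Op2 d →L[ℂ] Op d :=
  ((ContinuousLinearMap.compL ℂ (L20 d) (L20 d × L20 d) (L20 d)) (projCLM a)).comp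
    ((ContinuousLinearMap.compL ℂ (L20 d) (L20 d × L20 d) (L20 d × L20 d)).flip (injCLM b))

theorem ent_apply (a b : Bool) (X : Op2 d) (u : L20 d) :
    ent a b X u = projCLM a (X (injCLM b u)) := rfl

theorem ent_false_false (X : Op2 d) : ent false false X = entry11 X := rfl

theorem ent_false_true (X : Op2 d) : ent false true X = entry12 X := rfl

theorem sum_inj_proj (w : L20 d × L20 d) : ∑ c : Bool, injCLM c (projCLM c w) = w := by
  simp [injCLM, projCLM]

theorem proj_inj (a b : Bool) (u : L20 d) :
    projCLM a (injCLM b u) = if a = b then u else 0 := by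
  cases a <;> cases b <;> simp [injCLM, projCLM]

theorem ent_mul (a b : Bool) (X Y : Op2 d) :
    ent a b (X * Y) = ∑ c : Bool, ent a c X * ent c b Y := by
  ext1 u
  rw [sum_apply]
  simp only [mul_apply_eq_comp, ent_apply]
  rw [← map_sum, ← map_sum, sum_inj_proj]

theorem op2_ext {X Y : Op2 d} (h : ∀ a b, ent a b X = ent a b Y) : X = Y := by
  refine ContinuousLinearMap.ext fun w => ?_
  rw [← sum_inj_proj (X w), ← sum_inj_proj (Y w)]
  refine Finset.sum_congr rfl fun a _ => congrArg _ ?_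
  rw [← sum_inj_proj w, map_sum, map_sum, map_sum, map_sum]
  exact Finset.sum_congr rfl fun b _ => congrArg (fun R : Op d => R _) (h a b)

/-- The sum over all four entries of the Lipschitz decay norms. -/
def matNorm (γ : ℝ) (S : Set (Freq ν)) (s : ℝ) (X : Freq ν → (Fin ν → ℝ) → Op2 d) : ℝ≥0∞ :=
  ∑ a : Bool, ∑ b : Bool, lipNorm γ S (decayNorm s) (fun ω φ => ent a b (X ω φ))

theorem TorusCont.ent {F : (Fin ν → ℝ) → Op2 d} (hF : TorusCont F) (a b : Bool) :
    TorusCont fun φ => KAM.ent a b (F φ) :=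
  hF.comp (KAM.ent a b).continuous

/-- Families that are continuous on the torus for every parameter in `S`. -/
def ContOn (S : Set (Freq ν)) (X : Freq ν → (Fin ν → ℝ) → Op2 d) : Prop :=
  ∀ ω ∈ S, TorusCont (X ω)

variable {X Y : Freq ν → (Fin ν → ℝ) → Op2 d}

theorem ContOn.add (hX : ContOn S X) (hY : ContOn S Y) : ContOn S (X + Y) :=
  fun ω hω => (hX ω hω).add (hY ω hω)

theorem ContOn.sub (hX : ContOn S X) (hY : ContOn S Y) : ContOn S (X - Y) :=
  fun ω hω => (hX ω hω).sub (hY ω hω)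

theorem ContOn.neg (hX : ContOn S X) : ContOn S (-X) := fun ω hω => (hX ω hω).neg

theorem ContOn.mul (hX : ContOn S X) (hY : ContOn S Y) : ContOn S (X * Y) :=
  fun ω hω => (hX ω hω).mul (hY ω hω)

theorem ContOn.const_smul (hX : ContOn S X) (c : ℂ) : ContOn S (c • X) :=
  fun ω hω => (hX ω hω).const_smul c

theorem matNorm_mono {s t : ℝ} (h : s ≤ t) : matNorm γ S s X ≤ matNorm γ S t X := by
  refine Finset.sum_le_sum fun a _ => Finset.sum_le_sum fun b _ => ?_
  simpa using lipNorm_le_of_le' (γ := γ) (S := S) (n := decayNorm s) (n' := decayNorm t) (a := 1)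
    (f := fun ω φ => ent a b (X ω φ)) (g := fun ω φ => ent a b (X ω φ)) (decayNorm_zero _)
    (fun ω _ => by simpa using decayNorm_mono h _) (fun ω₁ _ ω₂ _ => by simpa using decayNorm_mono h _)

theorem matNorm_add_le {s : ℝ} (hX : ContOn S X) (hY : ContOn S Y) :
    matNorm γ S s (X + Y) ≤ matNorm γ S s X + matNorm γ S s Y := by
  simp only [matNorm, ← Finset.sum_add_distrib]
  refine Finset.sum_le_sum fun a _ => Finset.sum_le_sum fun b _ => ?_
  have key := lipNorm_le_of_le (γ := γ) (S := S) (n := decayNorm s) (n' := decayNorm s)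
    (n'' := decayNorm s) (a := 1) (b := 1)
    (f := fun ω φ => ent a b ((X + Y) ω φ)) (g := fun ω φ => ent a b (X ω φ))
    (k := fun ω φ => ent a b (Y ω φ)) (decayNorm_zero _) (decayNorm_zero _)
    (fun ω hω => ?_) (fun ω₁ h₁ ω₂ h₂ => ?_)
  · simpa using key
  · rw [one_mul, one_mul]
    have := decayNorm_add_le (s := s) ((hX ω hω).ent a b).1 ((hY ω hω).ent a b).1
    refine le_trans (le_of_eq ?_) this
    congr 1
    ext1 φ
    simp
  · rw [one_mul, one_mul]
    have := decayNorm_add_le (s := s) (((hX ω₁ h₁).ent a b).sub ((hX ω₂ h₂).ent a b)).1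
      (((hY ω₁ h₁).ent a b).sub ((hY ω₂ h₂).ent a b)).1
    refine le_trans (le_of_eq ?_) this
    congr 1
    ext1 φ
    simp only [Pi.add_apply, Pi.sub_apply, map_add]
    abel

theorem matNorm_smul_le {s : ℝ} (c : ℂ) : matNorm γ S s (c • X) ≤ ‖c‖ₑ * matNorm γ S s X := by
  simp only [matNorm, Finset.mul_sum]
  refine Finset.sum_le_sum fun a _ => Finset.sum_le_sum fun b _ => ?_
  refine lipNorm_le_of_le' (decayNorm_zero _) (fun ω _ => ?_) (fun ω₁ _ ω₂ _ => ?_)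
  · refine le_trans (le_of_eq ?_) (decayNorm_smul_le s c _)
    congr 1
    ext1 φ
    simp
  · refine le_trans (le_of_eq ?_) (decayNorm_smul_le s c _)
    congr 1
    ext1 φ
    simp [smul_sub]

theorem sum_mul_le_mul_sum (x y : Bool → Bool → ℝ≥0∞) :
    ∑ a, ∑ b, ∑ c, x a c * y c b ≤ (∑ a, ∑ b, x a b) * ∑ a, ∑ b, y a b := by
  rw [Finset.sum_mul]
  refine Finset.sum_le_sum fun a _ => ?_
  rw [Finset.sum_comm, Finset.sum_mul]
  refine Finset.sum_le_sum fun c _ => ?_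
  rw [← Finset.mul_sum]
  exact mul_le_mul_right (Finset.single_le_sum (f := fun c => ∑ b, y c b)
    (fun _ _ => zero_le) (Finset.mem_univ c)) _

/-- The tame product estimate for `2 × 2` matrices of operators. -/
theorem matNorm_mul_le {s : ℝ} (hs : 0 ≤ s) (hX : ContOn S X) (hY : ContOn S Y) :
    matNorm γ S s (X * Y) ≤ ENNReal.ofReal (2 ^ s) * prodConst ν d *
      (matNorm γ S s X * matNorm γ S ((ν : ℝ) + d) Y +
        matNorm γ S ((ν : ℝ) + d) X * matNorm γ S s Y) := by
  set C := ENNReal.ofReal (2 ^ s) * prodConst ν d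
  set r := (ν : ℝ) + d
  let x := fun t a b => lipNorm γ S (decayNorm t) (fun ω φ => ent a b (X ω φ))
  let y := fun t a b => lipNorm γ S (decayNorm t) (fun ω φ => ent a b (Y ω φ))
  have h1 : ∀ a b, lipNorm γ S (decayNorm s) (fun ω φ => ent a b ((X * Y) ω φ)) ≤
      ∑ c : Bool, C * (x s a c * y r c b + x r a c * y s c b) := fun a b => by
    have h2 := lipNorm_le_of_le (γ := γ) (S := S) (n := decayNorm s) (n' := decayNorm s)
      (n'' := decayNorm s) (a := 1) (b := 1)
      (f := fun ω φ => ent a b ((X * Y) ω φ))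
      (g := fun ω => (fun φ => ent a true (X ω φ)) * (fun φ => ent true b (Y ω φ)))
      (k := fun ω => (fun φ => ent a false (X ω φ)) * (fun φ => ent false b (Y ω φ)))
      (decayNorm_zero _) (decayNorm_zero _)
      (fun ω hω => ?_) (fun ω₁ h₁ ω₂ h₂ => ?_)
    · refine h2.trans ?_
      rw [one_mul, one_mul, Fintype.sum_bool]
      exact add_le_add (lipNorm_decay_mul_le (fun ω hω => (hX ω hω).ent _ _)
          (fun ω hω => (hY ω hω).ent _ _) hs)
        (lipNorm_decay_mul_le (fun ω hω => (hX ω hω).ent _ _) (fun ω hω => (hY ω hω).ent _ _) hs)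
    · rw [one_mul, one_mul]
      have := decayNorm_add_le (s := s) (((hX ω hω).ent a true).mul ((hY ω hω).ent true b)).1
        (((hX ω hω).ent a false).mul ((hY ω hω).ent false b)).1
      refine le_trans (le_of_eq ?_) this
      congr 1
      ext1 φ
      simp [ent_mul]
    · rw [one_mul, one_mul]
      have := decayNorm_add_le (s := s)
        ((((hX ω₁ h₁).ent a true).mul ((hY ω₁ h₁).ent true b)).sub
          (((hX ω₂ h₂).ent a true).mul ((hY ω₂ h₂).ent true b))).1
        ((((hX ω₁ h₁).ent a false).mul ((hY ω₁ h₁).ent false b)).sub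
          (((hX ω₂ h₂).ent a false).mul ((hY ω₂ h₂).ent false b))).1
      refine le_trans (le_of_eq ?_) this
      congr 1
      ext1 φ
      simp only [Pi.sub_apply, Pi.mul_apply, Pi.add_apply, ent_mul, Fintype.sum_bool]
      abel
  refine (Finset.sum_le_sum fun a _ => Finset.sum_le_sum fun b _ => h1 a b).trans ?_
  simp_rw [← Finset.mul_sum, Finset.sum_add_distrib]
  exact mul_le_mul_right (add_le_add (sum_mul_le_mul_sum (x s) (y r))
    (sum_mul_le_mul_sum (x r) (y s))) C

theorem matNorm_le_tsum {s : ℝ} {F : ℕ → Freq ν → (Fin ν → ℝ) → Op2 d}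
    (hF : ∀ n, ContOn S (F n)) (hle : ∀ ω ∈ S, ∃ c : ℕ → ℝ, Summable c ∧ ∀ n φ, ‖F n ω φ‖ ≤ c n)
    (h : ∀ ω ∈ S, ∀ φ, HasSum (fun n => F n ω φ) (X ω φ)) :
    matNorm γ S s X ≤ ∑' n, matNorm γ S s (F n) := by
  simp only [matNorm]
  rw [Summable.tsum_finsetSum fun _ _ => ENNReal.summable]
  refine Finset.sum_le_sum fun a _ => ?_
  rw [Summable.tsum_finsetSum fun _ _ => ENNReal.summable]
  refine Finset.sum_le_sum fun b _ => ?_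
  refine lipNorm_le_tsum (decayNorm_zero s) (fun ω hω => ?_) (fun ω₁ h₁ ω₂ h₂ => ?_)
  · obtain ⟨c, hc, hcle⟩ := hle ω hω
    refine decayNorm_le_tsum (c := fun n => ‖(ent a b : Op2 d →L[ℂ] Op d)‖ * c n)
      (fun n => ((hF n ω hω).ent a b).1) (hc.mul_left _) (fun n φ => ?_)
      (fun φ => (h ω hω φ).mapL (ent a b)) s
    exact (ContinuousLinearMap.le_opNorm _ _).trans
      (mul_le_mul_of_nonneg_left (hcle n φ) (norm_nonneg _))
  · obtain ⟨c, hc, hcle⟩ := hle ω₁ h₁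
    obtain ⟨c', hc', hcle'⟩ := hle ω₂ h₂
    refine decayNorm_le_tsum (c := fun n => ‖(ent a b : Op2 d →L[ℂ] Op d)‖ * c n +
        ‖(ent a b : Op2 d →L[ℂ] Op d)‖ * c' n)
      (fun n => (((hF n ω₁ h₁).ent a b).sub ((hF n ω₂ h₂).ent a b)).1)
      ((hc.mul_left _).add (hc'.mul_left _)) (fun n φ => ?_)
      (fun φ => ((h ω₁ h₁ φ).mapL (ent a b)).sub ((h ω₂ h₂ φ).mapL (ent a b))) s
    refine (norm_sub_le _ _).trans (add_le_add ?_ ?_)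
    · exact (ContinuousLinearMap.le_opNorm _ _).trans
        (mul_le_mul_of_nonneg_left (hcle n φ) (norm_nonneg _))
    · exact (ContinuousLinearMap.le_opNorm _ _).trans
        (mul_le_mul_of_nonneg_left (hcle' n φ) (norm_nonneg _))

/-- A norm for which families of operators form a normed algebra, whatever `θ` is. The choice of
`θ` turns the algebra property into tame estimates for two indices `s ≤ t`. -/
def algNorm (γ : ℝ) (S : Set (Freq ν)) (s t : ℝ) (θ : ℝ≥0∞)
    (X : Freq ν → (Fin ν → ℝ) → Op2 d) : ℝ≥0∞ :=
  max 1 (2 * (ENNReal.ofReal (2 ^ t) * prodConst ν d)) *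
    (matNorm γ S s X + θ * matNorm γ S t X)

/-- A tame estimate turns `κ (a + θ a')` into a submultiplicative expression: the only products that
the tame estimate does not provide, `a' * b'`, occur on the right-hand side with the weight `θ²`. -/
theorem weighted_mul_le {κ C θ a a' b b' p p' : ℝ≥0∞} (hκ : C ≤ κ) (h1 : p ≤ C * (a * b))
    (h2 : p' ≤ C * (a' * b + a * b')) :
    κ * (p + θ * p') ≤ κ * (a + θ * a') * (κ * (b + θ * b')) :=
  calc κ * (p + θ * p')
      ≤ κ * (κ * (a * b) + θ * (κ * (a' * b + a * b'))) := by
        refine mul_le_mul_right (add_le_add (h1.trans ?_) (mul_le_mul_right (h2.trans ?_) _)) _ <;>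
        exact mul_le_mul_left hκ _
    _ ≤ κ * (κ * (a * b) + θ * (κ * (a' * b + a * b'))) + κ * κ * (θ * θ * (a' * b')) :=
        le_self_add
    _ = _ := by ring

/-- Submultiplicativity, with a constant that depends on neither `θ` nor the set of parameters. -/
theorem algNorm_mul_le {s t : ℝ} {θ : ℝ≥0∞} (hs : (ν : ℝ) + d ≤ s) (hst : s ≤ t)
    (hX : ContOn S X) (hY : ContOn S Y) :
    algNorm γ S s t θ (X * Y) ≤ algNorm γ S s t θ X * algNorm γ S s t θ Y := by
  have hν : (0 : ℝ) ≤ (ν : ℝ) + d := by positivity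
  let C := ENNReal.ofReal (2 ^ t) * prodConst ν d
  have h1 : matNorm γ S s (X * Y) ≤ 2 * C * (matNorm γ S s X * matNorm γ S s Y) := by
    refine (matNorm_mul_le (hν.trans hs) hX hY).trans ?_
    have hc : ENNReal.ofReal (2 ^ s) * prodConst ν d ≤ C :=
      mul_le_mul_left (ENNReal.ofReal_le_ofReal
        (Real.rpow_le_rpow_of_exponent_le (by norm_num) hst)) _
    refine (mul_le_mul' hc (add_le_add (mul_le_mul_right (matNorm_mono hs) _)
      (mul_le_mul_left (matNorm_mono hs) _))).trans (le_of_eq ?_)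
    ring
  have h2 : matNorm γ S t (X * Y) ≤ 2 * C *
      (matNorm γ S t X * matNorm γ S s Y + matNorm γ S s X * matNorm γ S t Y) := by
    refine (matNorm_mul_le (hν.trans (hs.trans hst)) hX hY).trans ?_
    refine (mul_le_mul_right (add_le_add (mul_le_mul_right (matNorm_mono hs) _)
      (mul_le_mul_left (matNorm_mono hs) _)) _).trans ?_
    refine mul_le_mul_left ?_ _
    rw [two_mul]
    exact le_self_add
  exact weighted_mul_le (le_max_right _ _) h1 h2

theorem algNorm_add_le {s t : ℝ} {θ : ℝ≥0∞} (hX : ContOn S X) (hY : ContOn S Y) :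
    algNorm γ S s t θ (X + Y) ≤ algNorm γ S s t θ X + algNorm γ S s t θ Y := by
  simp only [algNorm, ← mul_add]
  refine mul_le_mul_right ?_ _
  refine (add_le_add (matNorm_add_le hX hY) (mul_le_mul_right (matNorm_add_le hX hY) _)).trans
    (le_of_eq ?_)
  ring

theorem algNorm_smul_le {s t : ℝ} {θ : ℝ≥0∞} (c : ℂ) :
    algNorm γ S s t θ (c • X) ≤ ‖c‖ₑ * algNorm γ S s t θ X := by
  simp only [algNorm]
  refine (mul_le_mul_right (add_le_add (matNorm_smul_le c)
    (mul_le_mul_right (matNorm_smul_le c) _)) _).trans (le_of_eq ?_)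
  ring

theorem algNorm_neg_le {s t : ℝ} {θ : ℝ≥0∞} :
    algNorm γ S s t θ (-X) ≤ algNorm γ S s t θ X := by
  have h := algNorm_smul_le (γ := γ) (S := S) (s := s) (t := t) (θ := θ) (X := X) (-1)
  rw [enorm_neg, enorm_one, one_mul] at h
  convert h using 2
  exact (neg_one_smul ℂ X).symm

theorem algNorm_sub_le {s t : ℝ} {θ : ℝ≥0∞} (hX : ContOn S X) (hY : ContOn S Y) :
    algNorm γ S s t θ (X - Y) ≤ algNorm γ S s t θ X + algNorm γ S s t θ Y := by
  rw [sub_eq_add_neg]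
  exact (algNorm_add_le hX hY.neg).trans (add_le_add le_rfl algNorm_neg_le)

theorem algNorm_le_tsum {s t : ℝ} {θ : ℝ≥0∞} {F : ℕ → Freq ν → (Fin ν → ℝ) → Op2 d}
    (hF : ∀ n, ContOn S (F n)) (hle : ∀ ω ∈ S, ∃ c : ℕ → ℝ, Summable c ∧ ∀ n φ, ‖F n ω φ‖ ≤ c n)
    (h : ∀ ω ∈ S, ∀ φ, HasSum (fun n => F n ω φ) (X ω φ)) :
    algNorm γ S s t θ X ≤ ∑' n, algNorm γ S s t θ (F n) := by
  simp only [algNorm]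
  rw [ENNReal.tsum_mul_left, ENNReal.tsum_add, ENNReal.tsum_mul_left]
  exact mul_le_mul_right (add_le_add (matNorm_le_tsum hF hle h)
    (mul_le_mul_right (matNorm_le_tsum hF hle h) _)) _

end Matrices

/-! ### The exponential in a Banach algebra and its derivative -/

section Exponential

open scoped Nat

/-- The derivative of `X ↦ X ^ n` at `X` in the direction `H`. -/
def dpow {A : Type*} [Ring A] (X H : A) : ℕ → A
  | 0 => 0
  | n + 1 => X * dpow X H n + H * X ^ n

variable {A : Type*} [NormedRing A]

theorem dpow_succ_right (X H : A) (n : ℕ) : dpow X H (n + 1) = dpow X H n * X + X ^ n * H := by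
  induction n with
  | zero => simp [dpow]
  | succ n ih =>
    have e : X * (X ^ n * H) = X ^ n * (X * H) := by
      rw [← mul_assoc, ← mul_assoc, ((Commute.refl X).pow_right n).eq]
    change X * dpow X H (n + 1) + H * X ^ (n + 1) =
      (X * dpow X H n + H * X ^ n) * X + X ^ (n + 1) * H
    rw [ih, pow_succ X n]
    simp only [mul_add, add_mul, mul_assoc, e]
    abel

/-- Leibniz's rule for the commutator with a power. -/
theorem dpow_commutator (L X : A) (n : ℕ) : L * X ^ n - X ^ n * L = dpow X (L * X - X * L) n := by
  induction n with
  | zero => simp [dpow]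
  | succ n ih =>
    rw [dpow, ← ih, pow_succ' X n]
    noncomm_ring

theorem dpow_add (X H K : A) (n : ℕ) : dpow X (H + K) n = dpow X H n + dpow X K n := by
  induction n with
  | zero => simp [dpow]
  | succ n ih => simp only [dpow, ih]; noncomm_ring

theorem dpow_neg (X H : A) (n : ℕ) : dpow X (-H) n = -dpow X H n := by
  induction n with
  | zero => simp [dpow]
  | succ n ih => simp only [dpow, ih]; noncomm_ring

theorem norm_pow_le_one_mul (X : A) (n : ℕ) : ‖X ^ n‖ ≤ max 1 ‖(1 : A)‖ * ‖X‖ ^ n := by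
  induction n with
  | zero => simp
  | succ n ih =>
    rw [pow_succ X n, pow_succ ‖X‖ n, ← mul_assoc]
    exact (norm_mul_le _ _).trans (mul_le_mul_of_nonneg_right ih (norm_nonneg _))

theorem norm_dpow_le (X H : A) (n : ℕ) :
    ‖dpow X H (n + 1)‖ ≤ max 1 ‖(1 : A)‖ * ((n + 1) * ‖X‖ ^ n * ‖H‖) := by
  have hc : (1 : ℝ) ≤ max 1 ‖(1 : A)‖ := le_max_left _ _
  induction n with
  | zero =>
    simp only [dpow, mul_zero, pow_zero, mul_one, zero_add, CharP.cast_eq_zero, one_mul]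
    nlinarith [norm_nonneg H]
  | succ n ih =>
    rw [dpow]
    have h2 := norm_pow_le_one_mul X (n + 1)
    refine (norm_add_le _ _).trans ((add_le_add (norm_mul_le _ _) (norm_mul_le _ _)).trans ?_)
    refine (add_le_add (mul_le_mul_of_nonneg_left ih (norm_nonneg X))
      (mul_le_mul_of_nonneg_left h2 (norm_nonneg H))).trans (le_of_eq ?_)
    push_cast
    ring

variable [NormedAlgebra ℂ A]

theorem hasDerivAt_pow_noncomm {Y : ℝ → A} {H : A} {t : ℝ} (hY : HasDerivAt Y H t) (n : ℕ) :
    HasDerivAt (fun r => Y r ^ n) (dpow (Y t) H n) t := by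
  induction n with
  | zero => simpa [dpow] using hasDerivAt_const t (1 : A)
  | succ n ih =>
    simp_rw [pow_succ']
    rw [dpow, add_comm]
    exact hY.mul ih

/-- A summable bound for the series of `dexp X H`. -/
def dexpBound (c x h : ℝ) : ℕ → ℝ
  | 0 => 0
  | n + 1 => c * h * ((n ! : ℝ)⁻¹ * x ^ n)

theorem summable_dexpBound (c x h : ℝ) : Summable (dexpBound c x h) := by
  rw [← summable_nat_add_iff 1]
  simp only [dexpBound]
  refine Summable.mul_left _ ?_
  simpa [div_eq_inv_mul] using Real.summable_pow_div_factorial x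

theorem norm_smul_dpow_le {X H : A} {x h : ℝ} (hx : ‖X‖ ≤ x) (hh : ‖H‖ ≤ h) (n : ℕ) :
    ‖((n ! : ℂ)⁻¹) • dpow X H n‖ ≤ dexpBound (max 1 ‖(1 : A)‖) x h n := by
  cases n with
  | zero => simp [dpow, dexpBound]
  | succ n =>
    rw [norm_smul, dexpBound]
    have h1 := norm_dpow_le X H n
    have h0 : 0 ≤ x := (norm_nonneg X).trans hx
    have h2 : ‖(((n + 1)! : ℕ) : ℂ)⁻¹‖ = ((n : ℝ) + 1)⁻¹ * (n ! : ℝ)⁻¹ := by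
      rw [norm_inv, Complex.norm_natCast, Nat.factorial_succ]
      push_cast
      rw [mul_inv]
    rw [h2]
    have h3 : ‖dpow X H (n + 1)‖ ≤ max 1 ‖(1 : A)‖ * ((n + 1) * x ^ n * h) := by
      refine h1.trans ?_
      gcongr
    refine (mul_le_mul_of_nonneg_left h3 (by positivity)).trans (le_of_eq ?_)
    field_simp

variable [CompleteSpace A]

theorem hasSum_exp (X : A) : HasSum (fun n => ((n ! : ℂ)⁻¹) • X ^ n) (NormedSpace.exp X) :=
  NormedSpace.exp_series_hasSum_exp' X

/-- The derivative of the exponential at `X` in the direction `H`. -/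
def dexp (X H : A) : A := ∑' n, ((n ! : ℂ)⁻¹) • dpow X H n

theorem hasSum_dexp (X H : A) : HasSum (fun n => ((n ! : ℂ)⁻¹) • dpow X H n) (dexp X H) :=
  (Summable.of_norm_bounded (summable_dexpBound _ _ _)
    (norm_smul_dpow_le (le_refl ‖X‖) (le_refl ‖H‖))).hasSum

/-- The commutator with an exponential is the derivative of the exponential in the direction of the
commutator. Hence a solution `X` of the homological equation yields `L * exp X - exp X * L - ∂ (exp
X) = dexp X ([L, X] - ∂X)`, with no expansion in powers of `X`. -/
theorem dexp_commutator (L X : A) :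
    L * NormedSpace.exp X - NormedSpace.exp X * L = dexp X (L * X - X * L) := by
  have h1 := ((hasSum_exp X).mul_left L).sub ((hasSum_exp X).mul_right L)
  refine h1.unique ((hasSum_dexp X (L * X - X * L)).congr_fun fun n => ?_)
  rw [← dpow_commutator, smul_sub, mul_smul_comm, smul_mul_assoc]

theorem dexp_add (X H K : A) : dexp X (H + K) = dexp X H + dexp X K :=
  (hasSum_dexp X (H + K)).unique (((hasSum_dexp X H).add (hasSum_dexp X K)).congr_fun fun n => by
    rw [dpow_add, smul_add])

theorem dexp_neg (X H : A) : dexp X (-H) = -dexp X H :=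
  (hasSum_dexp X (-H)).unique ((hasSum_dexp X H).neg.congr_fun fun n => by
    rw [dpow_neg, smul_neg])

theorem differentiableAt_exp (X : A) : DifferentiableAt ℝ (NormedSpace.exp : A → A) X :=
  ((NormedSpace.exp_analytic (𝕂 := ℂ) X).differentiableAt).restrictScalars ℝ

theorem contDiff_exp : ContDiff ℝ 1 (NormedSpace.exp : A → A) :=
  contDiff_iff_contDiffAt.mpr fun X =>
    ((NormedSpace.exp_analytic (𝕂 := ℂ) X).contDiffAt (n := 1)).restrict_scalars ℝ

/-- Term-by-term differentiation of the exponential series along a line. -/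
theorem hasDerivAt_exp_line (X H : A) :
    HasDerivAt (fun r : ℝ => NormedSpace.exp (X + r • H)) (dexp X H) 0 := by
  have hlin : ∀ r : ℝ, HasDerivAt (fun r : ℝ => X + r • H) H r := fun r => by
    simpa using ((hasDerivAt_id r).smul_const H).const_add X
  have h := hasDerivAt_tsum_of_isPreconnected (𝕜 := ℝ) (F := A)
    (u := dexpBound (max 1 ‖(1 : A)‖) (‖X‖ + ‖H‖) ‖H‖)
    (g := fun n r => ((n ! : ℂ)⁻¹) • (X + r • H) ^ n)
    (g' := fun n r => ((n ! : ℂ)⁻¹) • dpow (X + r • H) H n) (t := Metric.ball 0 1) (y₀ := 0)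
    (y := 0) (summable_dexpBound _ _ _) Metric.isOpen_ball
    (convex_ball (0 : ℝ) 1).isPreconnected
    (fun n r _ => (hasDerivAt_pow_noncomm (hlin r) n).const_smul ((n ! : ℂ)⁻¹))
    (fun n r hr => norm_smul_dpow_le (by
      refine (norm_add_le _ _).trans (add_le_add le_rfl ?_)
      rw [norm_smul]
      have : ‖r‖ ≤ 1 := by simpa using (Metric.mem_ball.mp hr).le
      exact mul_le_of_le_one_left (norm_nonneg _) this) le_rfl n)
    (Metric.mem_ball_self one_pos) (hasSum_exp _).summable (Metric.mem_ball_self one_pos)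
  simpa [(hasSum_exp _).tsum_eq, dexp] using h

theorem fderiv_exp_apply (X H : A) :
    fderiv ℝ (NormedSpace.exp : A → A) X H = dexp X H := by
  have hlin : HasDerivAt (fun r : ℝ => X + r • H) H 0 := by
    simpa using ((hasDerivAt_id (0 : ℝ)).smul_const H).const_add X
  have h1 : HasFDerivAt (NormedSpace.exp : A → A) (fderiv ℝ NormedSpace.exp X)
      (X + (0 : ℝ) • H) := by
    simpa using (differentiableAt_exp X).hasFDerivAt
  exact (h1.comp_hasDerivAt (0 : ℝ) hlin).unique (hasDerivAt_exp_line X H)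

theorem exp_neg_mul_exp (X : A) : NormedSpace.exp (-X) * NormedSpace.exp X = 1 := by
  let _ : NormedAlgebra ℚ A := NormedAlgebra.restrictScalars ℚ ℂ A
  rw [← NormedSpace.exp_add_of_commute (Commute.refl X).neg_left, neg_add_cancel,
    NormedSpace.exp_zero]

theorem inverse_exp (X : A) : Ring.inverse (NormedSpace.exp X) = NormedSpace.exp (-X) := by
  let _ : NormedAlgebra ℚ A := NormedAlgebra.restrictScalars ℚ ℂ A
  exact Ring.inverse_exp X

theorem isUnit_exp (X : A) : IsUnit (NormedSpace.exp X) := by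
  let _ : NormedAlgebra ℚ A := NormedAlgebra.restrictScalars ℚ ℂ A
  exact NormedSpace.isUnit_exp X

/-- The derivative of `exp (-X) * exp X = 1` in the direction `H`. -/
theorem exp_neg_mul_dexp (X H : A) :
    NormedSpace.exp (-X) * dexp X H = dexp (-X) H * NormedSpace.exp X := by
  have h1 := hasDerivAt_exp_line X H
  have h2 := hasDerivAt_exp_line (-X) (-H)
  have h3 := h2.mul h1
  have e : (fun r : ℝ => NormedSpace.exp (-X + r • -H)) * (fun r : ℝ => NormedSpace.exp (X + r • H))
      = fun _ => 1 := by
    ext1 r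
    have : -X + r • -H = -(X + r • H) := by rw [smul_neg, neg_add]
    simp only [Pi.mul_apply]
    rw [this, exp_neg_mul_exp]
  rw [e] at h3
  have h4 := h3.unique (hasDerivAt_const (0 : ℝ) (1 : A))
  simp only [zero_smul, add_zero, dexp_neg] at h4
  rw [neg_mul, neg_add_eq_zero] at h4
  exact h4.symm

end Exponential

/-! ### The Hamiltonian structure -/

section Hamiltonian

variable {d : ℕ}

theorem conjL_apply (u : L20 d) (j : Modes d) : conjL u j = starRingEnd ℂ (u (-j)) := rfl

theorem conjL_conjL (u : L20 d) : conjL (conjL u) = u := by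
  refine lp.ext (funext fun j => ?_)
  simp [conjL_apply]

theorem conjL_add (u v : L20 d) : conjL (u + v) = conjL u + conjL v := by
  refine lp.ext (funext fun j => ?_)
  simp [conjL_apply]

theorem conjL_smul (c : ℂ) (u : L20 d) : conjL (c • u) = starRingEnd ℂ c • conjL u := by
  refine lp.ext (funext fun j => ?_)
  simp [conjL_apply]

theorem conjL_neg (u : L20 d) : conjL (-u) = -conjL u := by
  refine lp.ext (funext fun j => ?_)
  simp [conjL_apply]

theorem conjL_zero : conjL (0 : L20 d) = 0 := by
  refine lp.ext (funext fun j => ?_)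
  simp [conjL_apply]

theorem conjL_basisVec (j : Modes d) : conjL (basisVec j) = basisVec (-j) := by
  refine lp.ext (funext fun k => ?_)
  rw [conjL_apply, basisVec_apply, basisVec_apply]
  by_cases h : k = -j
  · simp [h]
  · have : -k ≠ j := fun h' => h (by rw [← h', neg_neg])
    simp [h, this]

theorem hasSum_pairing (u v : L20 d) : HasSum (fun j => u j * v (-j)) (pairing u v) := by
  have h := lp.hasSum_inner (𝕜 := ℂ) (conjL v) u
  refine h.congr_fun fun j => ?_
  simp [conjL_apply]

theorem pairing_comm (u v : L20 d) : pairing u v = pairing v u := by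
  refine (hasSum_pairing u v).unique ?_
  have h := (Equiv.neg (Modes d)).hasSum_iff.mpr (hasSum_pairing v u)
  refine h.congr_fun fun j => ?_
  simp [mul_comm]

/-- The bilinear pairing as a continuous functional of its first argument. -/
def pairingCLM (v : L20 d) : L20 d →L[ℂ] ℂ := innerSL ℂ (conjL v)

theorem pairing_conjL (u v : L20 d) :
    pairing (conjL u) (conjL v) = starRingEnd ℂ (pairing u v) := by
  rw [pairing_comm]
  change inner ℂ (conjL (conjL u)) (conjL v) = starRingEnd ℂ (inner ℂ (conjL v) u)
  rw [conjL_conjL, inner_conj_symm]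

theorem pairing_add_left (u u' v : L20 d) : pairing (u + u') v = pairing u v + pairing u' v :=
  map_add (pairingCLM v) u u'

theorem pairing_smul_left (c : ℂ) (u v : L20 d) : pairing (c • u) v = c * pairing u v :=
  map_smul (pairingCLM v) c u

theorem pairing_neg_left (u v : L20 d) : pairing (-u) v = -pairing u v :=
  map_neg (pairingCLM v) u

theorem pairing_add_right (u v v' : L20 d) : pairing u (v + v') = pairing u v + pairing u v' := by
  rw [pairing_comm, pairing_add_left, pairing_comm v, pairing_comm v']

theorem pairing_smul_right (c : ℂ) (u v : L20 d) : pairing u (c • v) = c * pairing u v := by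
  rw [pairing_comm, pairing_smul_left, pairing_comm v]

theorem pairing_neg_right (u v : L20 d) : pairing u (-v) = -pairing u v := by
  rw [pairing_comm, pairing_neg_left, pairing_comm v]

/-- The symplectic form as a continuous functional of its first argument. -/
def symplCLM (w : L20 d × L20 d) : (L20 d × L20 d) →L[ℂ] ℂ :=
  Complex.I • ((pairingCLM w.2).comp (ContinuousLinearMap.fst ℂ _ _) -
    (pairingCLM w.1).comp (ContinuousLinearMap.snd ℂ _ _))

theorem symplForm_swap (w w' : L20 d × L20 d) : symplForm w w' = -symplForm w' w := by
  rw [symplForm, symplForm, pairing_comm w.1, pairing_comm w.2]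
  ring

/-- The conjugation `(u, v) ↦ (v̄, ū)`, whose fixed points are the pairs `(u, ū)`. -/
def swapConj (w : L20 d × L20 d) : L20 d × L20 d := (conjL w.2, conjL w.1)

/-- Operators that commute with `(u, v) ↦ (v̄, ū)`: these are the matrices
`(R₁, R₂; R̄₂, R̄₁)`. -/
def IsReal (X : Op2 d) : Prop := ∀ w, X (swapConj w) = swapConj (X w)

/-- `Y` is an adjoint of `X` with respect to the symplectic form. -/
def SymplAdj (X Y : Op2 d) : Prop := ∀ w w', symplForm (X w) w' = symplForm w (Y w')

theorem swapConj_add (w w' : L20 d × L20 d) : swapConj (w + w') = swapConj w + swapConj w' := by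
  simp [swapConj, conjL_add]

theorem swapConj_neg (w : L20 d × L20 d) : swapConj (-w) = -swapConj w := by
  simp [swapConj, conjL_neg]

theorem swapConj_smul (c : ℂ) (w : L20 d × L20 d) :
    swapConj (c • w) = starRingEnd ℂ c • swapConj w := by
  simp [swapConj, conjL_smul]

theorem IsReal.one : IsReal (1 : Op2 d) := fun _ => rfl

theorem IsReal.zero : IsReal (0 : Op2 d) := fun _ => by
  simp [swapConj, conjL_zero]
  rfl

theorem IsReal.add {X Y : Op2 d} (hX : IsReal X) (hY : IsReal Y) : IsReal (X + Y) := fun w => by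
  rw [add_apply, add_apply, hX, hY, swapConj_add]

theorem IsReal.neg {X : Op2 d} (hX : IsReal X) : IsReal (-X) := fun w => by
  rw [neg_apply, neg_apply, hX, swapConj_neg]

theorem IsReal.sub {X Y : Op2 d} (hX : IsReal X) (hY : IsReal Y) : IsReal (X - Y) := by
  rw [sub_eq_add_neg]
  exact hX.add hY.neg

theorem IsReal.mul {X Y : Op2 d} (hX : IsReal X) (hY : IsReal Y) : IsReal (X * Y) := fun w => by
  rw [mul_apply_eq_comp, mul_apply_eq_comp, hY, hX]

theorem IsReal.smul {X : Op2 d} (hX : IsReal X) {c : ℂ} (hc : starRingEnd ℂ c = c) :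
    IsReal (c • X) := fun w => by
  rw [smul_apply, smul_apply, hX, swapConj_smul, hc]

theorem IsReal.pow {X : Op2 d} (hX : IsReal X) (n : ℕ) : IsReal (X ^ n) := by
  induction n with
  | zero => exact IsReal.one
  | succ n ih => rw [pow_succ]; exact ih.mul hX

theorem conj_inv_factorial (n : ℕ) :
    starRingEnd ℂ ((n.factorial : ℂ)⁻¹) = (n.factorial : ℂ)⁻¹ := by simp

theorem IsReal.hasSum {F : ℕ → Op2 d} {X : Op2 d} (hF : ∀ n, IsReal (F n)) (h : HasSum F X) :
    IsReal X := by
  intro w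
  have happ : ∀ w, HasSum (fun n => F n w) (X w) := fun w =>
    h.mapL (ContinuousLinearMap.apply ℂ (L20 d × L20 d) w)
  have h1 := happ (swapConj w)
  simp_rw [fun n => hF n w] at h1
  refine Prod.ext (lp.ext (funext fun j => ?_)) (lp.ext (funext fun j => ?_))
  · have h2 := (h1.mapL (ContinuousLinearMap.fst ℂ _ _)).mapL (evalCLM j)
    have h3 := ((happ w).mapL (ContinuousLinearMap.snd ℂ _ _)).mapL (evalCLM (-j))
    exact h2.unique (h3.map (starRingEnd ℂ) Complex.continuous_conj)
  · have h2 := (h1.mapL (ContinuousLinearMap.snd ℂ _ _)).mapL (evalCLM j)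
    have h3 := ((happ w).mapL (ContinuousLinearMap.fst ℂ _ _)).mapL (evalCLM (-j))
    exact h2.unique (h3.map (starRingEnd ℂ) Complex.continuous_conj)

theorem IsReal.exp {X : Op2 d} (hX : IsReal X) : IsReal (NormedSpace.exp X) :=
  IsReal.hasSum (fun n => (hX.pow n).smul (conj_inv_factorial n)) (hasSum_exp X)

theorem IsReal.dpow {X H : Op2 d} (hX : IsReal X) (hH : IsReal H) (n : ℕ) :
    IsReal (dpow X H n) := by
  induction n with
  | zero => exact IsReal.zero
  | succ n ih => exact (hX.mul ih).add (hH.mul (hX.pow n))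

theorem IsReal.dexp {X H : Op2 d} (hX : IsReal X) (hH : IsReal H) : IsReal (dexp X H) :=
  IsReal.hasSum (fun n => (hX.dpow hH n).smul (conj_inv_factorial n)) (hasSum_dexp X H)

theorem symplForm_add_left (w w' v : L20 d × L20 d) :
    symplForm (w + w') v = symplForm w v + symplForm w' v := map_add (symplCLM v) w w'

theorem symplForm_smul_left (c : ℂ) (w v : L20 d × L20 d) :
    symplForm (c • w) v = c * symplForm w v := map_smul (symplCLM v) c w

theorem symplForm_add_right (v w w' : L20 d × L20 d) :
    symplForm v (w + w') = symplForm v w + symplForm v w' := by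
  rw [symplForm_swap, symplForm_add_left, symplForm_swap v w, symplForm_swap v w']
  ring

theorem symplForm_smul_right (c : ℂ) (v w : L20 d × L20 d) :
    symplForm v (c • w) = c * symplForm v w := by
  rw [symplForm_swap, symplForm_smul_left, symplForm_swap v w]
  ring

theorem SymplAdj.one : SymplAdj (1 : Op2 d) 1 := fun _ _ => rfl

theorem SymplAdj.zero : SymplAdj (0 : Op2 d) 0 := fun w w' => by
  have h := symplForm_smul_left 0 w w'
  have h' := symplForm_smul_right 0 w w'
  simp only [zero_smul, zero_mul] at h h'
  simp [h, h']

theorem SymplAdj.add {X Y X' Y' : Op2 d} (h : SymplAdj X Y) (h' : SymplAdj X' Y') :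
    SymplAdj (X + X') (Y + Y') := fun w w' => by
  rw [add_apply, add_apply, symplForm_add_left, symplForm_add_right, h, h']

theorem SymplAdj.smul {X Y : Op2 d} (h : SymplAdj X Y) (c : ℂ) :
    SymplAdj (c • X) (c • Y) := fun w w' => by
  rw [smul_apply, smul_apply, symplForm_smul_left,
    symplForm_smul_right, h]

theorem SymplAdj.neg {X Y : Op2 d} (h : SymplAdj X Y) : SymplAdj (-X) (-Y) := by
  rw [← neg_one_smul ℂ X, ← neg_one_smul ℂ Y]
  exact h.smul (-1)

theorem SymplAdj.mul {X Y X' Y' : Op2 d} (h : SymplAdj X Y) (h' : SymplAdj X' Y') :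
    SymplAdj (X * X') (Y' * Y) := fun w w' => by
  rw [mul_apply_eq_comp, mul_apply_eq_comp, h, h']

theorem SymplAdj.pow {X Y : Op2 d} (h : SymplAdj X Y) (n : ℕ) : SymplAdj (X ^ n) (Y ^ n) := by
  induction n with
  | zero => exact SymplAdj.one
  | succ n ih =>
    rw [pow_succ, pow_succ']
    exact ih.mul h

theorem SymplAdj.hasSum {F G : ℕ → Op2 d} {X Y : Op2 d} (h : ∀ n, SymplAdj (F n) (G n))
    (hF : HasSum F X) (hG : HasSum G Y) : SymplAdj X Y := by
  intro w w'
  have h1 := (hF.mapL (ContinuousLinearMap.apply ℂ (L20 d × L20 d) w)).mapL (symplCLM w')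
  have h2 := ((hG.mapL (ContinuousLinearMap.apply ℂ (L20 d × L20 d) w')).mapL (symplCLM w)).neg
  refine h1.unique (Eq.subst (motive := fun x => HasSum _ x) ?_ (h2.congr_fun fun n => ?_))
  · exact (symplForm_swap w (Y w')).symm
  · exact (h n w w').trans (symplForm_swap w (G n w'))

theorem SymplAdj.exp {X Y : Op2 d} (h : SymplAdj X Y) :
    SymplAdj (NormedSpace.exp X) (NormedSpace.exp Y) :=
  SymplAdj.hasSum (fun n => (h.pow n).smul _) (hasSum_exp X) (hasSum_exp Y)

theorem SymplAdj.dpow {X Y H K : Op2 d} (h : SymplAdj X Y) (h' : SymplAdj H K) (n : ℕ) :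
    SymplAdj (dpow X H n) (dpow Y K n) := by
  induction n with
  | zero => exact SymplAdj.zero
  | succ n ih =>
    rw [dpow_succ_right Y]
    exact (h.mul ih).add (h'.mul (h.pow n))

theorem SymplAdj.dexp {X Y H K : Op2 d} (h : SymplAdj X Y) (h' : SymplAdj H K) :
    SymplAdj (dexp X H) (dexp Y K) :=
  SymplAdj.hasSum (fun n => (h.dpow h' n).smul _) (hasSum_dexp X H) (hasSum_dexp Y K)

/-- Hamiltonian operators are the real operators that are skew for the symplectic form. -/
theorem isHamiltonian_iff (X : Op2 d) : IsHamiltonian X ↔ IsReal X ∧ SymplAdj X (-X) := by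
  constructor
  · rintro ⟨R₁, R₂, h1, h2, hX⟩
    have h1' : ∀ u v, pairing (R₁ u) v = pairing u (conjL (R₁ (conjL v))) := fun u v => by
      have hs : (ContinuousLinearMap.adjoint R₁) = R₁ := h1
      have := ContinuousLinearMap.adjoint_inner_left R₁ u (conjL v)
      rw [hs] at this
      rw [pairing, pairing, conjL_conjL, this]
    have h2' : ∀ u v, pairing (conjL (R₂ (conjL u))) v = pairing u (conjL (R₂ (conjL v))) :=
      fun u v => by
        have e1 : pairing (conjL (R₂ (conjL u))) v = starRingEnd ℂ (pairing (R₂ (conjL u)) (conjL v)) := by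
          rw [← pairing_conjL, conjL_conjL]
        have e2 : pairing u (conjL (R₂ (conjL v))) = starRingEnd ℂ (pairing (conjL u) (R₂ (conjL v))) := by
          rw [← pairing_conjL, conjL_conjL]
        rw [e1, e2, h2]
    constructor
    · rintro ⟨u, v⟩
      simp only [swapConj, hX, conjL_neg, conjL_smul, conjL_add, conjL_conjL, Complex.conj_I]
      refine Prod.ext ?_ ?_
      · module
      · module
    · rintro ⟨u, v⟩ ⟨u', v'⟩
      rw [neg_apply, hX, hX]
      simp only [symplForm, Prod.fst_neg, Prod.snd_neg, pairing_neg_left, pairing_neg_right,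
        pairing_smul_left, pairing_smul_right, pairing_add_left, pairing_add_right]
      rw [h1' u v', h2 v v', h2' u u', pairing_comm (conjL (R₁ (conjL v))) u', ← h1' u' v,
        pairing_comm (R₁ u') v]
      ring
  · rintro ⟨hr, hs⟩
    have hsnd : ∀ u v, (X (u, v)).2 = conjL ((X (conjL v, conjL u)).1) := fun u v => by
      have := congrArg Prod.snd (hr (conjL v, conjL u))
      simpa [swapConj, conjL_conjL] using this
    have hsplit : ∀ u v, (X (u, v)).1 = entry11 X u + entry12 X v := fun u v => by
      have : ((u, v) : L20 d × L20 d) = (u, 0) + (0, v) := by simp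
      rw [this, map_add]
      rfl
    have h11 : ∀ u v, pairing (entry11 X u) v = -pairing u (conjL (entry11 X (conjL v))) :=
      fun u v => by
        have h := hs (u, 0) (0, v)
        simp only [symplForm, neg_apply, Prod.fst_neg, Prod.snd_neg] at h
        rw [hsnd 0 v] at h
        simp only [hsplit, conjL_zero, map_zero, add_zero, zero_add] at h
        rw [pairing_comm _ (0 : L20 d)] at h
        have z : ∀ x : L20 d, pairing 0 x = 0 := fun x => map_zero (pairingCLM x)
        simp only [z, pairing_neg_right, sub_zero] at h
        exact mul_left_cancel₀ Complex.I_ne_zero h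
    have h12 : ∀ u v, pairing (entry12 X u) v = pairing u (entry12 X v) := fun u v => by
        have h := hs (0, u) (0, v)
        simp only [symplForm, neg_apply, Prod.fst_neg, Prod.snd_neg] at h
        rw [hsnd 0 v] at h
        simp only [hsplit, conjL_zero, map_zero, add_zero, zero_add] at h
        rw [pairing_comm _ (0 : L20 d)] at h
        have z : ∀ x : L20 d, pairing 0 x = 0 := fun x => map_zero (pairingCLM x)
        simp only [z, pairing_neg_right, sub_zero, zero_sub, neg_neg] at h
        exact mul_left_cancel₀ Complex.I_ne_zero h
    refine ⟨(-Complex.I) • entry11 X, (-Complex.I) • entry12 X, ?_, fun u v => ?_, fun u v => ?_⟩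
    · rw [ContinuousLinearMap.isSelfAdjoint_iff_isSymmetric]
      intro u v
      have h := h11 v (conjL u)
      rw [pairing, pairing, conjL_conjL, conjL_conjL] at h
      simp only [ContinuousLinearMap.coe_coe, smul_apply, inner_smul_left,
        inner_smul_right, h]
      simp
    · simp only [smul_apply, pairing_smul_left, pairing_smul_right, h12]
    · refine Prod.ext ?_ ?_
      · rw [hsplit]
        simp only [smul_apply, smul_add, smul_smul, mul_neg, Complex.I_mul_I, neg_neg, one_smul]
      · rw [hsnd, hsplit]
        simp only [smul_apply, conjL_smul, conjL_add, smul_add, smul_smul, map_neg, Complex.conj_I,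
          neg_neg, Complex.I_mul_I]
        module

/-- A real operator whose symplectic adjoint is a left inverse is symplectic. -/
theorem isSymplectic_of_symplAdj {Φ Φ' : Op2 d} (hr : IsReal Φ) (h : SymplAdj Φ Φ')
    (hinv : Φ' * Φ = 1) : IsSymplectic Φ := by
  refine ⟨fun u hu => ?_, fun u _ v _ => ?_⟩
  · have h1 : swapConj u = u := by
      refine Prod.ext ?_ ?_
      · have : u.2 = conjL u.1 := hu
        simp [swapConj, this, conjL_conjL]
      · exact (hu : u.2 = conjL u.1).symm
    have h2 := hr u
    rw [h1] at h2
    exact congrArg Prod.snd h2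
  · rw [h, ← mul_apply_eq_comp, hinv]
    rfl

theorem IsHamiltonian.isSymplectic_exp {X : Op2 d} (hX : IsHamiltonian X) :
    IsSymplectic (NormedSpace.exp X) := by
  obtain ⟨hr, hs⟩ := (isHamiltonian_iff X).mp hX
  exact isSymplectic_of_symplAdj hr.exp hs.exp (exp_neg_mul_exp X)

theorem IsHamiltonian.add {X Y : Op2 d} (hX : IsHamiltonian X) (hY : IsHamiltonian Y) :
    IsHamiltonian (X + Y) := by
  rw [isHamiltonian_iff] at *
  refine ⟨hX.1.add hY.1, ?_⟩
  rw [neg_add]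
  exact hX.2.add hY.2

theorem IsHamiltonian.neg {X : Op2 d} (hX : IsHamiltonian X) : IsHamiltonian (-X) := by
  rw [isHamiltonian_iff] at *
  exact ⟨hX.1.neg, hX.2.neg⟩

theorem IsHamiltonian.sub {X Y : Op2 d} (hX : IsHamiltonian X) (hY : IsHamiltonian Y) :
    IsHamiltonian (X - Y) := by
  rw [sub_eq_add_neg]
  exact hX.add hY.neg

theorem neg_mul_mul {R : Type*} [Ring R] (a b c : R) : -(a * b * c) = a * (-b * c) := by
  noncomm_ring

/-- Conjugation by the flow of a Hamiltonian operator preserves Hamiltonian operators. -/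
theorem IsHamiltonian.exp_conj {X R : Op2 d} (hX : IsHamiltonian X) (hR : IsHamiltonian R) :
    IsHamiltonian (NormedSpace.exp (-X) * R * NormedSpace.exp X) := by
  rw [isHamiltonian_iff] at *
  refine ⟨(hX.1.neg.exp.mul hR.1).mul hX.1.exp, ?_⟩
  have h := (hX.2.neg.exp.mul hR.2).mul hX.2.exp
  rw [neg_neg] at h
  rw [neg_mul_mul]
  exact h

/-- The logarithmic derivative of the exponential preserves Hamiltonian operators. This and
`IsHamiltonian.exp_conj` keep the transformed vector field Hamiltonian. -/
theorem IsHamiltonian.exp_mul_dexp {X H : Op2 d} (hX : IsHamiltonian X) (hH : IsHamiltonian H) :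
    IsHamiltonian (NormedSpace.exp (-X) * dexp X H) := by
  rw [isHamiltonian_iff] at *
  refine ⟨hX.1.neg.exp.mul (hX.1.dexp hH.1), ?_⟩
  have h := hX.2.neg.exp.mul (hX.2.dexp hH.2)
  rw [neg_neg, dexp_neg] at h
  rw [exp_neg_mul_dexp] at h ⊢
  convert h using 1
  exact (neg_mul (dexp (-X) H) (NormedSpace.exp X)).symm

end Hamiltonian

/-! ### Exponentials of small families -/

section SmallExponential

variable {ν d : ℕ} {γ : ℝ} {S : Set (Freq ν)} {X H R : Freq ν → (Fin ν → ℝ) → Op2 d}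
  {s t : ℝ} {θ : ℝ≥0∞}

theorem ContOn.pow (hX : ContOn S X) (n : ℕ) : ContOn S (X ^ n) := fun ω hω =>
  (hX ω hω).comp (continuous_pow n)

theorem ContOn.dpow (hX : ContOn S X) (hH : ContOn S H) (n : ℕ) : ContOn S (dpow X H n) := by
  induction n with
  | zero => exact fun ω _ => TorusCont.const 0
  | succ n ih => exact (hX.mul ih).add (hH.mul (hX.pow n))

theorem dpow_apply (ω : Freq ν) (φ : Fin ν → ℝ) (n : ℕ) :
    dpow X H n ω φ = dpow (X ω φ) (H ω φ) n := by
  induction n with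
  | zero => rfl
  | succ n ih =>
    change X ω φ * dpow X H n ω φ + H ω φ * X ω φ ^ n = _
    rw [ih]
    rfl

theorem continuous_exp_op : Continuous (NormedSpace.exp : Op2 d → Op2 d) :=
  contDiff_exp.continuous

theorem ContOn.exp (hX : ContOn S X) : ContOn S (fun ω φ => NormedSpace.exp (X ω φ)) :=
  fun ω hω => (hX ω hω).comp continuous_exp_op

theorem algNorm_pow_le (hs : (ν : ℝ) + d ≤ s) (hst : s ≤ t) (hX : ContOn S X) (n : ℕ) :
    algNorm γ S s t θ (X ^ (n + 1)) ≤ algNorm γ S s t θ X ^ (n + 1) := by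
  induction n with
  | zero => simp
  | succ n ih =>
    rw [pow_succ X, pow_succ (algNorm γ S s t θ X)]
    exact (algNorm_mul_le hs hst (hX.pow _) hX).trans (mul_le_mul_left ih _)

theorem algNorm_dpow_le (hs : (ν : ℝ) + d ≤ s) (hst : s ≤ t) (hX : ContOn S X) (hH : ContOn S H)
    (n : ℕ) : algNorm γ S s t θ (dpow X H (n + 1)) ≤
      (n + 1) * algNorm γ S s t θ X ^ n * algNorm γ S s t θ H := by
  induction n with
  | zero =>
    have : dpow X H 1 = H := by simp [dpow]
    simp [this]
  | succ n ih =>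
    change algNorm γ S s t θ (X * dpow X H (n + 1) + H * X ^ (n + 1)) ≤ _
    refine (algNorm_add_le (hX.mul (hX.dpow hH _)) (hH.mul (hX.pow _))).trans ?_
    refine (add_le_add ((algNorm_mul_le hs hst hX (hX.dpow hH _)).trans (mul_le_mul_right ih _))
      ((algNorm_mul_le hs hst hH (hX.pow _)).trans
        (mul_le_mul_right (algNorm_pow_le hs hst hX n) _))).trans (le_of_eq ?_)
    push_cast
    ring

theorem two_pow_le_factorial_succ (n : ℕ) : 2 ^ n ≤ (n + 1).factorial := by
  induction n with
  | zero => simp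
  | succ n ih =>
    rw [pow_succ, Nat.factorial_succ, mul_comm]
    exact Nat.mul_le_mul (by omega) ih

theorem enorm_inv_factorial_succ_le (n : ℕ) : ‖(((n + 1).factorial : ℕ) : ℂ)⁻¹‖ₑ ≤ (2⁻¹ : ℝ≥0∞) ^ n := by
  rw [← ENNReal.inv_pow, enorm_inv (Nat.cast_ne_zero.mpr (Nat.factorial_ne_zero _))]
  refine ENNReal.inv_le_inv.mpr ?_
  have h : ((2 ^ n : ℕ) : ℝ≥0∞) ≤ (((n + 1).factorial : ℕ) : ℝ≥0∞) := by
    exact_mod_cast two_pow_le_factorial_succ n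
  have h2 : ‖(((n + 1).factorial : ℕ) : ℂ)‖ₑ = (((n + 1).factorial : ℕ) : ℝ≥0∞) := by
    rw [← ofReal_norm, Complex.norm_natCast, ENNReal.ofReal_natCast]
  rw [h2]
  simpa using h

theorem tsum_two_inv_pow : ∑' n : ℕ, (2⁻¹ : ℝ≥0∞) ^ n = 2 := by
  rw [ENNReal.tsum_geometric, ENNReal.one_sub_inv_two, inv_inv]

theorem tsum_two_inv_pow_mul (a : ℝ≥0∞) : ∑' n : ℕ, (2⁻¹ : ℝ≥0∞) ^ n * a = 2 * a := by
  rw [ENNReal.tsum_mul_right, tsum_two_inv_pow]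

/-- The exponential of a small family is close to the identity, to first order. -/
theorem algNorm_exp_sub_one_le (hs : (ν : ℝ) + d ≤ s) (hst : s ≤ t) (hX : ContOn S X)
    (hx : algNorm γ S s t θ X ≤ 1) :
    algNorm γ S s t θ (fun ω φ => NormedSpace.exp (X ω φ) - 1) ≤ 2 * algNorm γ S s t θ X := by
  have h1 := algNorm_le_tsum (γ := γ) (s := s) (t := t) (θ := θ) (S := S)
    (X := fun ω φ => NormedSpace.exp (X ω φ) - 1)
    (F := fun n => (((n + 1).factorial : ℕ) : ℂ)⁻¹ • X ^ (n + 1)) (fun n => (hX.pow _).const_smul _)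
    (fun ω hω => ?_) (fun ω hω φ => ?_)
  · refine h1.trans ?_
    refine le_trans ?_ (tsum_two_inv_pow_mul _).le
    refine ENNReal.tsum_le_tsum fun n => (algNorm_smul_le _).trans ?_
    refine mul_le_mul' (enorm_inv_factorial_succ_le n) ((algNorm_pow_le hs hst hX n).trans ?_)
    rw [pow_succ]
    exact mul_le_of_le_one_left' (pow_le_one' hx n)
  · obtain ⟨x, hx⟩ := (hX ω hω).exists_bound
    refine ⟨fun n => max 1 ‖(1 : Op2 d)‖ * (x ^ (n + 1) / ((n + 1).factorial : ℕ)),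
      ((summable_nat_add_iff 1).mpr (Real.summable_pow_div_factorial x)).mul_left _,
      fun n φ => ?_⟩
    have h2 := norm_pow_le_one_mul (X ω φ) (n + 1)
    change ‖(((n + 1).factorial : ℕ) : ℂ)⁻¹ • (X ω φ) ^ (n + 1)‖ ≤ _
    rw [norm_smul, norm_inv, Complex.norm_natCast]
    change _ ≤ max 1 ‖(1 : Op2 d)‖ * (x ^ (n + 1) / ((n + 1).factorial : ℕ))
    rw [div_eq_inv_mul, mul_left_comm]
    refine mul_le_mul_of_nonneg_left (h2.trans ?_) (by positivity)
    refine mul_le_mul_of_nonneg_left (pow_le_pow_left₀ (norm_nonneg _) (hx φ) _) (by positivity)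
  · have h2 := (hasSum_nat_add_iff' 1).mpr (hasSum_exp (X ω φ))
    simpa using h2

/-- The derivative of the exponential at a small family is close to the identity, to first order. -/
theorem algNorm_dexp_sub_le (hs : (ν : ℝ) + d ≤ s) (hst : s ≤ t) (hX : ContOn S X)
    (hH : ContOn S H) (hx : algNorm γ S s t θ X ≤ 1) :
    algNorm γ S s t θ (fun ω φ => dexp (X ω φ) (H ω φ) - H ω φ) ≤
      2 * (algNorm γ S s t θ X * algNorm γ S s t θ H) := by
  have h1 := algNorm_le_tsum (γ := γ) (s := s) (t := t) (θ := θ) (S := S)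
    (X := fun ω φ => dexp (X ω φ) (H ω φ) - H ω φ)
    (F := fun n => (((n + 2).factorial : ℕ) : ℂ)⁻¹ • dpow X H (n + 2))
    (fun n => (hX.dpow hH _).const_smul _) (fun ω hω => ?_) (fun ω hω φ => ?_)
  · refine h1.trans ?_
    refine le_trans ?_ (tsum_two_inv_pow_mul _).le
    refine ENNReal.tsum_le_tsum fun n => (algNorm_smul_le _).trans ?_
    have h3 := algNorm_dpow_le (γ := γ) (θ := θ) hs hst hX hH (n + 1)
    have h4 : ‖(((n + 2).factorial : ℕ) : ℂ)⁻¹‖ₑ * (((n + 1 : ℕ) : ℝ≥0∞) + 1) = ‖(((n + 1).factorial : ℕ) : ℂ)⁻¹‖ₑ := by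
      have h5 : (((n + 1 : ℕ) : ℝ≥0∞) + 1) = ‖((n + 2 : ℕ) : ℂ)‖ₑ := by
        rw [← ofReal_norm, Complex.norm_natCast, ENNReal.ofReal_natCast]
        push_cast
        ring
      rw [h5, ← enorm_mul, Nat.factorial_succ (n + 1)]
      congr 1
      have : ((n + 2 : ℕ) : ℂ) ≠ 0 := by exact_mod_cast (Nat.succ_ne_zero (n + 1))
      push_cast at this ⊢
      rw [mul_inv, mul_comm, ← mul_assoc]
      have h6 : (n : ℂ) + 1 + 1 = (n : ℂ) + 2 := by ring
      rw [h6, mul_inv_cancel₀ this, one_mul]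
    refine (mul_le_mul_right h3 _).trans ?_
    rw [mul_assoc, ← mul_assoc ‖_‖ₑ, h4]
    refine mul_le_mul' (enorm_inv_factorial_succ_le n) (mul_le_mul_left ?_ _)
    rw [pow_succ]
    exact mul_le_of_le_one_left' (pow_le_one' hx n)
  · obtain ⟨x, hx⟩ := (hX ω hω).exists_bound
    obtain ⟨h, hh⟩ := (hH ω hω).exists_bound
    refine ⟨fun n => dexpBound (max 1 ‖(1 : Op2 d)‖) x h (n + 2),
      (summable_nat_add_iff 2).mpr (summable_dexpBound _ _ _), fun n φ => ?_⟩
    change ‖(((n + 2).factorial : ℕ) : ℂ)⁻¹ • (dpow X H (n + 2) ω φ)‖ ≤ _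
    rw [dpow_apply]
    exact norm_smul_dpow_le (hx φ) (hh φ) (n + 2)
  · have h2 := (hasSum_nat_add_iff' 2).mpr (hasSum_dexp (X ω φ) (H ω φ))
    have h3 : ∑ i ∈ Finset.range 2, ((i.factorial : ℂ)⁻¹) • dpow (X ω φ) (H ω φ) i = H ω φ := by
      simp [Finset.sum_range_succ, dpow]
    rw [h3] at h2
    refine h2.congr_fun fun n => ?_
    rw [← dpow_apply]
    rfl

theorem ContOn.dexp_sub (hX : ContOn S X) (hH : ContOn S H) :
    ContOn S (fun ω φ => dexp (X ω φ) (H ω φ)) := by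
  intro ω hω
  have h1 : (fun φ => dexp (X ω φ) (H ω φ)) =
      fun φ => fderiv ℝ (NormedSpace.exp : Op2 d → Op2 d) (X ω φ) (H ω φ) := by
    ext1 φ
    exact (fderiv_exp_apply _ _).symm
  change TorusCont fun φ => dexp (X ω φ) (H ω φ)
  rw [h1]
  exact (hX ω hω).comp₂ (hH ω hω)
    (g := fun x h => fderiv ℝ (NormedSpace.exp : Op2 d → Op2 d) x h)
    (((contDiff_exp.continuous_fderiv one_ne_zero).comp continuous_fst).clm_apply continuous_snd)

/-- The remainder after one conjugation by the exponential of a small family is quadratic. -/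
theorem algNorm_remainder_le (hs : (ν : ℝ) + d ≤ s) (hst : s ≤ t) (hX : ContOn S X)
    (hH : ContOn S H) (hR : ContOn S R) (hx : algNorm γ S s t θ X ≤ 1) :
    algNorm γ S s t θ (fun ω φ =>
      (NormedSpace.exp (-(X ω φ)) * R ω φ * NormedSpace.exp (X ω φ) - R ω φ) -
        (NormedSpace.exp (-(X ω φ)) * dexp (X ω φ) (H ω φ) - H ω φ)) ≤
      8 * (algNorm γ S s t θ X * (algNorm γ S s t θ R + algNorm γ S s t θ H)) := by
  have hxm : algNorm γ S s t θ (-X) ≤ 1 := algNorm_neg_le.trans hx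
  set P : Freq ν → (Fin ν → ℝ) → Op2 d := fun ω φ => NormedSpace.exp (X ω φ) - 1
  set M : Freq ν → (Fin ν → ℝ) → Op2 d := fun ω φ => NormedSpace.exp (-(X ω φ)) - 1
  set Q : Freq ν → (Fin ν → ℝ) → Op2 d := fun ω φ => dexp (X ω φ) (H ω φ) - H ω φ
  have hP : ContOn S P := fun ω hω => (hX.exp ω hω).comp (continuous_id.sub continuous_const)
  have hM : ContOn S M := fun ω hω => (hX.neg.exp ω hω).comp (continuous_id.sub continuous_const)
  have hQ : ContOn S Q := (hX.dexp_sub hH).sub hH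
  have nP : algNorm γ S s t θ P ≤ 2 * algNorm γ S s t θ X := algNorm_exp_sub_one_le hs hst hX hx
  have nM : algNorm γ S s t θ M ≤ 2 * algNorm γ S s t θ X :=
    (algNorm_exp_sub_one_le hs hst hX.neg hxm).trans (mul_le_mul_right algNorm_neg_le _)
  have nQ : algNorm γ S s t θ Q ≤ 2 * (algNorm γ S s t θ X * algNorm γ S s t θ H) :=
    algNorm_dexp_sub_le hs hst hX hH hx
  have e : (fun ω φ => (NormedSpace.exp (-(X ω φ)) * R ω φ * NormedSpace.exp (X ω φ) - R ω φ) -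
        (NormedSpace.exp (-(X ω φ)) * dexp (X ω φ) (H ω φ) - H ω φ)) =
      (R * P + M * (R + R * P)) - (Q + M * (H + Q)) := by
    funext ω φ
    simp only [P, M, Q, Pi.sub_apply, Pi.add_apply, Pi.mul_apply]
    generalize NormedSpace.exp (-(X ω φ)) = E'
    generalize NormedSpace.exp (X ω φ) = E
    generalize dexp (X ω φ) (H ω φ) = T
    generalize R ω φ = r
    generalize H ω φ = h
    have : ∀ {B : Type} [Ring B] (E E' T r h : B), E' * r * E - r - (E' * T - h) =
      r * (E - 1) + (E' - 1) * (r + r * (E - 1)) - (T - h + (E' - 1) * (h + (T - h))) := by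
      intros; noncomm_ring
    exact this E E' T r h
  rw [e]
  set x := algNorm γ S s t θ X
  set r := algNorm γ S s t θ R
  set h := algNorm γ S s t θ H
  have n1 : algNorm γ S s t θ (R * P) ≤ r * (2 * x) :=
    (algNorm_mul_le hs hst hR hP).trans (mul_le_mul_right nP _)
  have n2 : algNorm γ S s t θ (M * (R + R * P)) ≤ 2 * x * (r + r * (2 * x)) :=
    (algNorm_mul_le hs hst hM (hR.add (hR.mul hP))).trans
      (mul_le_mul' nM ((algNorm_add_le hR (hR.mul hP)).trans (add_le_add le_rfl n1)))
  have n3 : algNorm γ S s t θ (M * (H + Q)) ≤ 2 * x * (h + 2 * (x * h)) :=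
    (algNorm_mul_le hs hst hM (hH.add hQ)).trans
      (mul_le_mul' nM ((algNorm_add_le hH hQ).trans (add_le_add le_rfl nQ)))
  have n4 := (algNorm_sub_le (γ := γ) (s := s) (t := t) (θ := θ)
    ((hR.mul hP).add (hM.mul (hR.add (hR.mul hP)))) (hQ.add (hM.mul (hH.add hQ)))).trans
    (add_le_add ((algNorm_add_le (hR.mul hP) (hM.mul (hR.add (hR.mul hP)))).trans
      (add_le_add n1 n2)) ((algNorm_add_le hQ (hM.mul (hH.add hQ))).trans (add_le_add nQ n3)))
  refine n4.trans ?_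
  calc r * (2 * x) + 2 * x * (r + r * (2 * x)) + (2 * (x * h) + 2 * x * (h + 2 * (x * h)))
      ≤ r * (2 * x) + 2 * x * (r + r * (2 * 1)) + (2 * (x * h) + 2 * x * (h + 2 * (1 * h))) := by
        gcongr
    _ = 8 * (x * (r + h)) := by ring

end SmallExponential

/-! ### Hamiltonian operators through their matrix coefficients -/

section Coefficients

variable {ν d : ℕ}

theorem norm_conjL (u : L20 d) : ‖conjL u‖ = ‖u‖ := by
  have h : pairing u (conjL u) = pairing (conjL u) (conjL (conjL u)) := by
    rw [conjL_conjL, pairing_comm]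
  rw [pairing, pairing, conjL_conjL, inner_self_eq_norm_sq_to_K,
    inner_self_eq_norm_sq_to_K] at h
  have h' : ‖u‖ ^ 2 = ‖conjL u‖ ^ 2 := by exact_mod_cast h
  exact ((sq_eq_sq₀ (norm_nonneg _) (norm_nonneg _)).mp h').symm

/-- The conjugate operator `R̄ u = conj (R ū)`. -/
def conjOp (R : Op d) : Op d :=
  LinearMap.mkContinuous
    { toFun := fun u => conjL (R (conjL u))
      map_add' := fun u v => by rw [conjL_add, map_add, conjL_add]
      map_smul' := fun c u => by
        rw [conjL_smul, map_smul, conjL_smul, Complex.conj_conj, RingHom.id_apply] } ‖R‖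
    fun u => by
      change ‖conjL (R (conjL u))‖ ≤ _
      rw [norm_conjL, ← norm_conjL u]
      exact R.le_opNorm _

theorem conjOp_apply (R : Op d) (u : L20 d) : conjOp R u = conjL (R (conjL u)) := rfl

theorem coeff_conjOp (R : Op d) (j j' : Modes d) :
    coeff (conjOp R) j j' = starRingEnd ℂ (coeff R (-j) (-j')) := by
  rw [coeff_eq, coeff_eq, conjOp_apply, conjL_apply, conjL_basisVec]

theorem coeff_eq_inner (R : Op d) (j j' : Modes d) :
    coeff R j j' = inner ℂ (basisVec j) (R (basisVec j')) := by
  have h := lp.hasSum_inner (𝕜 := ℂ) (basisVec j) (R (basisVec j'))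
  refine Eq.trans ?_ ((hasSum_single j fun k hk => ?_).unique h)
  rotate_left
  · rw [basisVec_apply, if_neg hk, inner_zero_left]
  · rw [coeff_eq, basisVec_apply, if_pos rfl]
    simp

theorem coeff_adjoint (R : Op d) (j j' : Modes d) :
    coeff (ContinuousLinearMap.adjoint R) j j' = starRingEnd ℂ (coeff R j' j) := by
  rw [coeff_eq_inner, coeff_eq_inner, ContinuousLinearMap.adjoint_inner_right, inner_conj_symm]

theorem swapConj_injCLM (b : Bool) (u : L20 d) :
    swapConj (injCLM b u) = injCLM (!b) (conjL u) := by
  cases b <;> simp [swapConj, injCLM, conjL_zero]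

theorem projCLM_swapConj (a : Bool) (w : L20 d × L20 d) :
    projCLM a (swapConj w) = conjL (projCLM (!a) w) := by
  cases a <;> rfl

/-- An operator is real if its second row is the conjugate of the first one. -/
theorem isReal_iff_ent (X : Op2 d) :
    IsReal X ↔ ∀ a b, ent (!a) (!b) X = conjOp (ent a b X) := by
  constructor
  · intro h a b
    ext1 u
    rw [conjOp_apply, ent_apply, ent_apply]
    have := congrArg (projCLM (!a)) (h (injCLM b (conjL u)))
    rwa [swapConj_injCLM, conjL_conjL, projCLM_swapConj, Bool.not_not] at this
  · intro h w
    have key : ∀ a, projCLM a (X (swapConj w)) = projCLM a (swapConj (X w)) := fun a => by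
      rw [projCLM_swapConj, ← sum_inj_proj (swapConj w), ← sum_inj_proj w]
      simp only [Fintype.sum_bool, map_add, conjL_add]
      have e : ∀ b, projCLM a (X (injCLM (!b) (projCLM (!b) (swapConj w)))) =
          conjL (projCLM (!a) (X (injCLM b (projCLM b w)))) := fun b => by
        have h1 := congrArg (fun R : Op d => R (projCLM (!b) (swapConj w))) (h (!a) b)
        rw [projCLM_swapConj, Bool.not_not, Bool.not_not] at h1
        rw [projCLM_swapConj, Bool.not_not]
        refine h1.trans ?_
        change conjL (projCLM (!a) (X (injCLM b (conjL (conjL (projCLM b w)))))) = _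
        rw [conjL_conjL]
      have e1 := e true
      have e2 := e false
      simp only [Bool.not_true, Bool.not_false] at e1 e2
      have e3 : ∀ z : L20 d × L20 d, injCLM true (projCLM true z) + injCLM false (projCLM false z) = z :=
        fun z => by simpa using sum_inj_proj z
      rw [e3, e1, e2, add_comm]
    rw [← sum_inj_proj (X (swapConj w)), ← sum_inj_proj (swapConj (X w))]
    exact Finset.sum_congr rfl fun a _ => congrArg _ (key a)

theorem IsHamiltonian.isReal {X : Op2 d} (h : IsHamiltonian X) : IsReal X :=
  ((isHamiltonian_iff X).mp h).1

theorem IsHamiltonian.coeff_entry11 {X : Op2 d} (h : IsHamiltonian X) (j j' : Modes d) :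
    coeff (entry11 X) j j' = -starRingEnd ℂ (coeff (entry11 X) j' j) := by
  obtain ⟨R₁, R₂, h1, -, hX⟩ := h
  have e : entry11 X = Complex.I • R₁ := by
    ext1 u
    change (X (u, 0)).1 = _
    rw [hX]
    simp
  have h1' : ContinuousLinearMap.adjoint R₁ = R₁ := h1
  have h2 := coeff_adjoint R₁ j j'
  rw [h1'] at h2
  rw [e, coeff_smul, coeff_smul, h2]
  simp

theorem IsHamiltonian.coeff_entry12 {X : Op2 d} (h : IsHamiltonian X) (j j' : Modes d) :
    coeff (entry12 X) j j' = coeff (entry12 X) (-j') (-j) := by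
  obtain ⟨R₁, R₂, -, h2, hX⟩ := h
  have e : entry12 X = Complex.I • R₂ := by
    ext1 u
    change (X (0, u)).1 = _
    rw [hX]
    simp
  have h3 := h2 (basisVec j') (basisVec (-j))
  rw [pairing, pairing_comm, pairing, conjL_basisVec, conjL_basisVec, neg_neg,
    ← coeff_eq_inner, ← coeff_eq_inner] at h3
  rw [e, coeff_smul, coeff_smul, h3]

/-- A real operator is Hamiltonian if its entry `(1,1)` is skew-adjoint and its entry `(1,2)` is
symmetric for the bilinear pairing, in terms of matrix coefficients. -/
theorem isHamiltonian_of_coeff {X : Op2 d} (hr : IsReal X)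
    (h11 : ∀ j j', coeff (entry11 X) j j' = -starRingEnd ℂ (coeff (entry11 X) j' j))
    (h12 : ∀ j j', coeff (entry12 X) j j' = coeff (entry12 X) (-j') (-j)) :
    IsHamiltonian X := by
  have hsnd : ∀ u v, (X (u, v)).2 = conjL ((X (conjL v, conjL u)).1) := fun u v => by
    have := congrArg Prod.snd (hr (conjL v, conjL u))
    simpa [swapConj, conjL_conjL] using this
  have hsplit : ∀ u v, (X (u, v)).1 = entry11 X u + entry12 X v := fun u v => by
    have : ((u, v) : L20 d × L20 d) = (u, 0) + (0, v) := by simp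
    rw [this, map_add]
    rfl
  have ha : conjOp (ContinuousLinearMap.adjoint (entry12 X)) = entry12 X := op_ext fun j j' => by
    rw [coeff_conjOp, coeff_adjoint, Complex.conj_conj, h12 j j']
  refine ⟨(-Complex.I) • entry11 X, (-Complex.I) • entry12 X, ?_, fun u v => ?_, fun u v => ?_⟩
  · change ContinuousLinearMap.adjoint ((-Complex.I) • entry11 X) = _
    refine op_ext fun j j' => ?_
    rw [coeff_adjoint, coeff_smul, coeff_smul, h11 j j']
    simp
  · have h3 : pairing (entry12 X u) v = pairing u (entry12 X v) := by
      have h4 := congrArg conjL (congrArg (fun R : Op d => R v) ha)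
      simp only [conjOp_apply, conjL_conjL] at h4
      rw [pairing, pairing, ← h4, ContinuousLinearMap.adjoint_inner_left]
    simp only [smul_apply, pairing_smul_left, pairing_smul_right, h3]
  · refine Prod.ext ?_ ?_
    · rw [hsplit]
      simp only [smul_apply, smul_add, smul_smul, mul_neg, Complex.I_mul_I, neg_neg, one_smul]
    · rw [hsnd, hsplit]
      simp only [smul_apply, conjL_smul, conjL_add, smul_add, smul_smul, map_neg, Complex.conj_I,
        neg_neg, Complex.I_mul_I]
      module

theorem hatBlock_conjOp (F : (Fin ν → ℝ) → Op d) (l : Fin ν → ℤ) (α β : Spec d) :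
    hatBlock (fun φ => conjOp (F φ)) l α β = conjBlock (hatBlock F (-l) α β) := by
  ext j j'
  change fourierCoef (fun φ => coeff (conjOp (F φ)) j.1 j'.1) l = _
  simp only [coeff_conjOp]
  rw [fourierCoef_conj]
  rfl

theorem hsENorm_conjBlock {α β : Spec d} (X : Block α β) : hsENorm (conjBlock X) = hsENorm X := by
  rw [hsENorm, hsENorm, hsNorm_conjBlock]

theorem decayNorm_conjOp (s : ℝ) (F : (Fin ν → ℝ) → Op d) :
    decayNorm s (fun φ => conjOp (F φ)) = decayNorm s F := by
  simp only [decayNorm_eq, decayBlock]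
  refine iSup_congr fun α => iSup_congr fun β => ?_
  rw [← l2_equiv (Equiv.neg _)]
  simp only [hatBlock_conjOp, hsENorm_conjBlock, Equiv.neg_apply, wt, jap3_neg, neg_neg]

theorem conjOp_sub (R T : Op d) : conjOp (R - T) = conjOp R - conjOp T := op_ext fun j j' => by
  rw [coeff_conjOp, coeff_sub, coeff_sub, coeff_conjOp, coeff_conjOp, map_sub]

theorem lipNorm_congr_norm {E E' : Type*} [Sub E] [Sub E'] {γ : ℝ} {S : Set (Freq ν)}
    {n : E → ℝ≥0∞} {n' : E' → ℝ≥0∞} {f : Freq ν → E} {g : Freq ν → E'}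
    (h : ∀ ω, n (f ω) = n' (g ω)) (hd : ∀ ω₁ ω₂, n (f ω₁ - f ω₂) = n' (g ω₁ - g ω₂)) :
    lipNorm γ S n f = lipNorm γ S n' g := by
  unfold lipNorm
  simp only [h, hd]

/-- For families of real operators the sum over the four entries is twice the norm that uses the
first row. -/
theorem matNorm_eq_decayLip {γ : ℝ} {S : Set (Freq ν)} {X : Freq ν → (Fin ν → ℝ) → Op2 d}
    (h : ∀ ω ∈ S, ∀ φ, IsReal (X ω φ)) (s : ℝ) :
    matNorm γ S s X = 2 * decayLip γ S s X := by
  have key : ∀ b, lipNorm γ S (decayNorm s) (fun ω φ => ent true (!b) (X ω φ)) =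
      lipNorm γ S (decayNorm s) (fun ω φ => ent false b (X ω φ)) := fun b => by
    have e : ∀ ω ∈ S, (fun φ => ent true (!b) (X ω φ)) = fun φ => conjOp (ent false b (X ω φ)) :=
      fun ω hω => funext fun φ => (isReal_iff_ent _).mp (h ω hω φ) false b
    rw [lipNorm_congr e]
    refine lipNorm_congr_norm (fun ω => decayNorm_conjOp _ _) fun ω₁ ω₂ => ?_
    refine Eq.trans ?_ (decayNorm_conjOp s
      ((fun φ => ent false b (X ω₁ φ)) - fun φ => ent false b (X ω₂ φ)))
    exact congrArg (decayNorm s) (funext fun φ => (conjOp_sub _ _).symm)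
  have k1 := key true
  have k2 := key false
  simp only [Bool.not_true, Bool.not_false] at k1 k2
  simp only [matNorm, Fintype.sum_bool, k1, k2, decayLip]
  simp only [ent_false_false, ent_false_true]
  ring

end Coefficients

/-! ### Trigonometric polynomials of finite-rank operators -/

section Trigonometric

variable {ν d : ℕ} {N : ℝ}

instance : DecidableEq (Spec d) := Classical.decEq _

/-- The entry `M_j^{j'}` of a family of blocks. -/
def modeEntry (M : (α β : Spec d) → Block α β) (j j' : Modes d) : ℂ :=
  M j.level j'.level j.self j'.self

theorem modeEntry_eq (M : (α β : Spec d) → Block α β) {α β : Spec d} (j : Shell α) (j' : Shell β) :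
    modeEntry M j.1 j'.1 = M α β j j' := by
  obtain ⟨a, ha⟩ := α
  obtain ⟨b, hb⟩ := β
  obtain ⟨j, hj⟩ := j
  obtain ⟨j', hj'⟩ := j'
  obtain rfl : intNorm j.1 = a := hj
  obtain rfl : intNorm j'.1 = b := hj'
  rfl

theorem finite_intNorm_le (n : ℕ) (N : ℝ) : {l : Fin n → ℤ | intNorm l ≤ N}.Finite := by
  refine (Set.Finite.pi fun _ : Fin n => Set.finite_Icc (-⌈N⌉) ⌈N⌉).subset fun l hl i _ => ?_
  have h := abs_le.mp ((abs_le_intNorm l i).trans ((show intNorm l ≤ N from hl).trans (Int.le_ceil N)))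
  constructor
  · exact_mod_cast h.1
  · exact_mod_cast h.2

theorem finite_modes_le (d : ℕ) (N : ℝ) : {j : Modes d | intNorm j.1 ≤ N}.Finite :=
  (finite_intNorm_le d N).preimage Subtype.val_injective.injOn

theorem finite_freq_le (ν : ℕ) (N : ℝ) : {l : Fin ν → ℤ | jap l ≤ N}.Finite :=
  (finite_intNorm_le ν N).subset fun l hl => le_trans (le_max_right 1 (intNorm l)) hl

/-- The modes with `|j| ≤ N`. -/
def modesLE (d : ℕ) (N : ℝ) : Finset (Modes d) := (finite_modes_le d N).toFinset

/-- The frequency indices with `⟨ℓ⟩ ≤ N`. -/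
def freqLE (ν : ℕ) (N : ℝ) : Finset (Fin ν → ℤ) := (finite_freq_le ν N).toFinset

theorem mem_modesLE {j : Modes d} : j ∈ modesLE d N ↔ intNorm j.1 ≤ N := by simp [modesLE]

theorem mem_freqLE {l : Fin ν → ℤ} : l ∈ freqLE ν N ↔ jap l ≤ N := by simp [freqLE]

theorem freqLE_sum_neg {M : Type*} [AddCommMonoid M] (f : (Fin ν → ℤ) → M) :
    ∑ l ∈ freqLE ν N, f (-l) = ∑ l ∈ freqLE ν N, f l :=
  Finset.sum_nbij' (fun l => -l) (fun l => -l) (fun l hl => by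
    rw [mem_freqLE] at *; rwa [jap_neg]) (fun l hl => by
    rw [mem_freqLE] at *; rwa [jap_neg]) (by simp) (by simp) (by simp)

/-- The operator that maps `e^{i j'·x}` to `e^{i j·x}` and the other exponentials to zero. -/
def rankOne (j j' : Modes d) : Op d := (evalCLM j').smulRight (basisVec j)

theorem rankOne_apply (j j' : Modes d) (u : L20 d) : rankOne j j' u = u j' • basisVec j := rfl

theorem coeff_rankOne (j j' k k' : Modes d) :
    coeff (rankOne j j') k k' = if k = j then if k' = j' then 1 else 0 else 0 := by
  rw [coeff_eq, rankOne_apply]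
  change basisVec k' j' * basisVec j k = _
  rw [basisVec_apply, basisVec_apply]
  by_cases h1 : k = j <;> by_cases h2 : j' = k' <;> simp [h1, h2, eq_comm]

/-- The operator-valued trigonometric polynomial with the blocks `M ℓ α β`, truncated to
`⟨ℓ, α, β⟩ ≤ N`. -/
def trigOp (N : ℝ) (M : (Fin ν → ℤ) → (α β : Spec d) → Block α β) (φ : Fin ν → ℝ) : Op d :=
  ∑ l ∈ freqLE ν N, ∑ j ∈ modesLE d N, ∑ j' ∈ modesLE d N,
    (expMode l φ * modeEntry (M l) j j') • rankOne j j'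

variable {M M' : (Fin ν → ℤ) → (α β : Spec d) → Block α β}

theorem coeff_trigOp (M : (Fin ν → ℤ) → (α β : Spec d) → Block α β) (φ : Fin ν → ℝ)
    (k k' : Modes d) :
    coeff (trigOp N M φ) k k' = ∑ l ∈ freqLE ν N, expMode l φ *
      if k ∈ modesLE d N ∧ k' ∈ modesLE d N then modeEntry (M l) k k' else 0 := by
  rw [← coeffCLM_apply, trigOp, map_sum]
  refine Finset.sum_congr rfl fun l _ => ?_
  simp only [map_sum, map_smul, coeffCLM_apply, coeff_rankOne, smul_eq_mul]
  by_cases h1 : k ∈ modesLE d N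
  · by_cases h2 : k' ∈ modesLE d N
    · simp [h1, h2]
    · simp [h1, h2]
  · simp [h1]

theorem continuous_trigOp (N : ℝ) (M : (Fin ν → ℤ) → (α β : Spec d) → Block α β) :
    Continuous (trigOp N M) := by
  unfold trigOp
  refine continuous_finsetSum _ fun l _ => continuous_finsetSum _ fun j _ =>
    continuous_finsetSum _ fun j' _ => ?_
  exact ((continuous_expMode l).mul continuous_const).smul continuous_const

theorem torusCont_trigOp (N : ℝ) (M : (Fin ν → ℤ) → (α β : Spec d) → Block α β) :
    TorusCont (trigOp N M) := by
  refine ⟨continuous_trigOp N M, fun φ n => ?_⟩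
  unfold trigOp
  simp only [expMode_periodic _ φ n]

/-- The Fourier blocks of a trigonometric polynomial are the truncated blocks it is built from. -/
theorem hatBlock_trigOp (N : ℝ) (M : (Fin ν → ℤ) → (α β : Spec d) → Block α β)
    (l : Fin ν → ℤ) (α β : Spec d) :
    hatBlock (trigOp N M) l α β = if jap3 l α β ≤ N then M l α β else 0 := by
  ext j j'
  change fourierCoef (fun φ => coeff (trigOp N M φ) j.1 j'.1) l = _
  simp only [coeff_trigOp]
  rw [fourierCoef_sum (f := fun k φ => expMode k φ *
    if j.1 ∈ modesLE d N ∧ j'.1 ∈ modesLE d N then modeEntry (M k) j.1 j'.1 else 0) _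
    fun k _ => (continuous_expMode k).mul continuous_const]
  have e : ∀ k, fourierCoef (fun φ => expMode k φ *
      if j.1 ∈ modesLE d N ∧ j'.1 ∈ modesLE d N then modeEntry (M k) j.1 j'.1 else 0) l =
      if l = k then (if j.1 ∈ modesLE d N ∧ j'.1 ∈ modesLE d N then M k α β j j' else 0) else 0 :=
    fun k => by
      simp only [mul_comm (expMode k _)]
      rw [fourierCoef_const_mul]
      have := fourierCoef_expMode k l
      change _ * fourierCoef (expMode k) l = _
      rw [this, modeEntry_eq]
      simp
  simp only [e]
  rw [Finset.sum_ite_eq]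
  have h1 : (l ∈ freqLE ν N ∧ j.1 ∈ modesLE d N ∧ j'.1 ∈ modesLE d N) ↔ jap3 l α β ≤ N := by
    rw [mem_freqLE, mem_modesLE, mem_modesLE, jap3_le_iff, j.2, j'.2]
  by_cases h : jap3 l α β ≤ N
  · obtain ⟨h2, h3⟩ := h1.mpr h
    rw [if_pos h, if_pos h2, if_pos h3]
  · rw [if_neg h]
    by_cases h2 : l ∈ freqLE ν N
    · rw [if_pos h2, if_neg fun h3 => h (h1.mp ⟨h2, h3⟩)]
      rfl
    · rw [if_neg h2]
      rfl

/-- Trigonometric polynomials only depend on the blocks with `⟨ℓ, α, β⟩ ≤ N`. -/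
theorem trigOp_congr (h : ∀ l α β, jap3 l α β ≤ N → M l α β = M' l α β) :
    trigOp N M = trigOp N M' := by
  funext φ
  refine op_ext fun j j' => ?_
  rw [coeff_trigOp, coeff_trigOp]
  refine Finset.sum_congr rfl fun l hl => ?_
  by_cases hj : j ∈ modesLE d N ∧ j' ∈ modesLE d N
  · rw [if_pos hj, if_pos hj, modeEntry, h, modeEntry]
    rw [mem_modesLE, mem_modesLE] at hj
    exact jap3_le_iff.mpr ⟨mem_freqLE.mp hl, hj⟩
  · rw [if_neg hj, if_neg hj]

theorem trigOp_add (N : ℝ) (M M' : (Fin ν → ℤ) → (α β : Spec d) → Block α β) (φ : Fin ν → ℝ) :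
    trigOp N (fun l α β => M l α β + M' l α β) φ = trigOp N M φ + trigOp N M' φ := by
  simp only [trigOp, ← Finset.sum_add_distrib, ← add_smul, ← mul_add]
  rfl

theorem trigOp_smul (N : ℝ) (c : ℂ) (M : (Fin ν → ℤ) → (α β : Spec d) → Block α β)
    (φ : Fin ν → ℝ) : trigOp N (fun l α β => c • M l α β) φ = c • trigOp N M φ := by
  simp only [trigOp, Finset.smul_sum, smul_smul]
  refine Finset.sum_congr rfl fun l _ => Finset.sum_congr rfl fun j _ =>
    Finset.sum_congr rfl fun j' _ => ?_
  congr 1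
  exact mul_left_comm _ _ _

theorem hasFDerivAt_expMode (l : Fin ν → ℤ) (φ : Fin ν → ℝ) :
    HasFDerivAt (expMode l) (expMode l φ • (Complex.I •
      (Complex.ofRealCLM.comp (∑ i, (l i : ℝ) • ContinuousLinearMap.proj (R := ℝ) i :
        (Fin ν → ℝ) →L[ℝ] ℝ)))) φ := by
  have h1 : HasFDerivAt (fun φ : Fin ν → ℝ => Complex.I * ((∑ i, (l i : ℝ) * φ i : ℝ) : ℂ))
      (Complex.I • (Complex.ofRealCLM.comp
        (∑ i, (l i : ℝ) • ContinuousLinearMap.proj (R := ℝ) i : (Fin ν → ℝ) →L[ℝ] ℝ))) φ := by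
    have h2 := (Complex.ofRealCLM.comp
        (∑ i, (l i : ℝ) • ContinuousLinearMap.proj (R := ℝ) i : (Fin ν → ℝ) →L[ℝ] ℝ)).hasFDerivAt
        (x := φ)
    have h3 := h2.const_smul Complex.I
    refine h3.congr_of_eventuallyEq (Filter.Eventually.of_forall fun ψ => ?_)
    simp [sum_apply, smul_apply]
  exact h1.cexp

theorem contDiff_trigOp (N : ℝ) (M : (Fin ν → ℤ) → (α β : Spec d) → Block α β) :
    ContDiff ℝ 1 (trigOp N M) := by
  unfold trigOp
  refine ContDiff.sum fun l _ => ContDiff.sum fun j _ => ContDiff.sum fun j' _ => ?_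
  have h1 : ContDiff ℝ 1 fun φ : Fin ν → ℝ => ∑ i, (l i : ℝ) * φ i :=
    ContDiff.sum fun i _ => contDiff_const.mul (contDiff_apply ℝ ℝ i)
  have : ContDiff ℝ 1 (expMode l) :=
    (contDiff_const.mul (Complex.ofRealCLM.contDiff.comp h1)).cexp
  exact (this.mul contDiff_const).smul contDiff_const

theorem fderiv_trigOp (N : ℝ) (M : (Fin ν → ℤ) → (α β : Spec d) → Block α β) (φ : Fin ν → ℝ)
    (ω : Freq ν) :
    fderiv ℝ (trigOp N M) φ (fun i => ω i) =
      trigOp N (fun l α β => (Complex.I * freqDot ω l) • M l α β) φ := by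
  have h : HasFDerivAt (trigOp N M) (∑ l ∈ freqLE ν N, ∑ j ∈ modesLE d N, ∑ j' ∈ modesLE d N,
      ((expMode l φ • (Complex.I •
      (Complex.ofRealCLM.comp (∑ i, (l i : ℝ) • ContinuousLinearMap.proj (R := ℝ) i :
        (Fin ν → ℝ) →L[ℝ] ℝ)))).smulRight (modeEntry (M l) j j' • rankOne j j'))) φ := by
    unfold trigOp
    refine HasFDerivAt.fun_sum fun l _ => HasFDerivAt.fun_sum fun j _ =>
      HasFDerivAt.fun_sum fun j' _ => ?_
    have := (hasFDerivAt_expMode l φ).smul_const (modeEntry (M l) j j' • rankOne j j')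
    simpa only [smul_smul] using this
  rw [h.fderiv, trigOp]
  simp only [sum_apply]
  refine Finset.sum_congr rfl fun l _ => Finset.sum_congr rfl fun j _ =>
    Finset.sum_congr rfl fun j' _ => ?_
  simp only [ContinuousLinearMap.smulRight_apply, smul_apply, smul_smul]
  congr 1
  simp only [ContinuousLinearMap.comp_apply, sum_apply, smul_apply, ContinuousLinearMap.proj_apply,
    smul_eq_mul, Complex.ofRealCLM_apply]
  have e : modeEntry (fun α β => (Complex.I * (freqDot ω l : ℂ)) • M l α β) j j' =
      (Complex.I * (freqDot ω l : ℂ)) * modeEntry (M l) j j' := rfl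
  have e2 : (∑ i, (l i : ℝ) * ω i) = freqDot ω l := by
    simp only [freqDot, mul_comm]
  rw [e, e2]
  ring

/-- The block-diagonal operator with the blocks `B α`, truncated to `α ≤ N`. -/
def diagOp (N : ℝ) (B : BlockDiag d) : Op d :=
  ∑ j ∈ modesLE d N, ∑ k : Shell j.level, B j.level j.self k • rankOne j k.1

theorem diagOp_apply (N : ℝ) (B : BlockDiag d) (u : L20 d) (i : Modes d) :
    diagOp N B u i = if i ∈ modesLE d N then blockApply B u i else 0 := by
  rw [← evalCLM_apply, diagOp, sum_apply, map_sum]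
  have e : ∀ j ∈ modesLE d N, evalCLM i ((∑ k : Shell j.level, B j.level j.self k • rankOne j k.1) u) =
      if i = j then blockApply B u j else 0 := fun j _ => by
    rw [sum_apply, map_sum]
    simp only [smul_apply, rankOne_apply, map_smul, evalCLM_apply, basisVec_apply, smul_eq_mul]
    by_cases h : i = j
    · simp [h, blockApply]
    · simp [h]
  rw [Finset.sum_congr rfl e, Finset.sum_ite_eq]

theorem coeff_diagOp_mul (N : ℝ) (B : BlockDiag d) (T : Op d) (j j' : Modes d) :
    coeff (diagOp N B * T) j j' =
      if j ∈ modesLE d N then ∑ k : Shell j.level, B j.level j.self k * coeff T k.1 j' else 0 := by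
  rw [coeff_eq, mul_apply_eq_comp, diagOp_apply]
  rfl

/-- A column of a truncated block-diagonal operator. -/
theorem diagOp_basisVec (N : ℝ) (B : BlockDiag d) (j' : Modes d) :
    diagOp N B (basisVec j') =
      if j' ∈ modesLE d N then ∑ k : Shell j'.level, B j'.level k j'.self • basisVec k.1 else 0 := by
  refine lp.ext (funext fun i => ?_)
  rw [diagOp_apply]
  have key : ∀ {α : Spec d} (k : Shell α) (k' : Modes d), k'.level = α →
      ∃ k'' : Shell α, k''.1 = k' := fun k k' h => ⟨⟨k', congrArg Subtype.val h⟩, rfl⟩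
  by_cases hl : i.level = j'.level
  · have hm : (i ∈ modesLE d N) ↔ j' ∈ modesLE d N := by
      rw [mem_modesLE, mem_modesLE]
      exact iff_of_eq (congrArg (· ≤ N) (congrArg Subtype.val hl))
    by_cases hi : j' ∈ modesLE d N
    · rw [if_pos (hm.mpr hi), if_pos hi, ← evalCLM_apply i, map_sum]
      simp only [map_smul, evalCLM_apply, basisVec_apply, blockApply, smul_eq_mul]
      obtain ⟨i', hi'⟩ := key j'.self i hl
      obtain ⟨j'', hj''⟩ := key i.self j' hl.symm
      rw [Finset.sum_eq_single j'', Finset.sum_eq_single i']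
      · rw [if_pos hj'', if_pos hi'.symm, mul_one, mul_one]
        have e1 := modeEntry_eq (fun α β => if h : α = β then (h ▸ B α : Block α β) else 0) i.self j''
        have e2 := modeEntry_eq (fun α β => if h : α = β then (h ▸ B α : Block α β) else 0) i' j'.self
        simp only [dif_pos] at e1 e2
        have e3 : i.self.1 = i'.1 := hi'.symm
        have e4 : j''.1 = j'.self.1 := hj''
        rw [e3, e4, e2] at e1
        exact e1.symm
      · intro b _ hb
        rw [if_neg, mul_zero]
        intro hib
        exact hb (Subtype.ext (hib.symm.trans hi'.symm))
      · simp
      · intro b _ hb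
        rw [if_neg, mul_zero]
        intro hib
        exact hb (Subtype.ext (hib.trans hj''.symm))
      · simp
    · rw [if_neg (fun h => hi (hm.mp h)), if_neg hi]
      rfl
  · have h1 : blockApply B (basisVec j') i = 0 := by
      refine Finset.sum_eq_zero fun k _ => ?_
      rw [basisVec_apply, if_neg, mul_zero]
      rintro rfl
      exact hl (Subtype.ext k.2.symm)
    rw [h1]
    by_cases hi : j' ∈ modesLE d N
    · rw [if_pos hi, ← evalCLM_apply i, map_sum, ite_self]
      refine (Finset.sum_eq_zero fun k _ => ?_).symm
      rw [map_smul, evalCLM_apply, basisVec_apply, if_neg, smul_zero]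
      rintro rfl
      exact hl (Subtype.ext k.2)
    · rw [if_neg hi, ite_self]
      rfl

theorem coeff_mul_diagOp (N : ℝ) (B : BlockDiag d) (T : Op d) (j j' : Modes d) :
    coeff (T * diagOp N B) j j' =
      if j' ∈ modesLE d N then ∑ k : Shell j'.level, coeff T j k.1 * B j'.level k j'.self else 0 := by
  rw [coeff_eq, mul_apply_eq_comp, diagOp_basisVec]
  by_cases h : j' ∈ modesLE d N
  · rw [if_pos h, if_pos h, map_sum, ← evalCLM_apply, map_sum]
    refine Finset.sum_congr rfl fun k _ => ?_
    rw [map_smul, map_smul, evalCLM_apply, ← coeff_eq, smul_eq_mul, mul_comm]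
  · rw [if_neg h, if_neg h, map_zero]
    rfl

theorem diagOp_mul_trigOp (N : ℝ) (B : BlockDiag d)
    (M : (Fin ν → ℤ) → (α β : Spec d) → Block α β) (φ : Fin ν → ℝ) :
    diagOp N B * trigOp N M φ = trigOp N (fun l α β => B α * M l α β) φ := by
  refine op_ext fun j j' => ?_
  rw [coeff_diagOp_mul, coeff_trigOp]
  by_cases hj : j ∈ modesLE d N
  · rw [if_pos hj]
    simp only [coeff_trigOp, Finset.mul_sum]
    rw [Finset.sum_comm]
    refine Finset.sum_congr rfl fun l _ => ?_
    by_cases hj' : j' ∈ modesLE d N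
    · rw [if_pos ⟨hj, hj'⟩]
      have e : modeEntry (fun α β => B α * M l α β) j j' =
          ∑ k : Shell j.level, B j.level j.self k * M l j.level j'.level k j'.self := rfl
      rw [e, Finset.mul_sum]
      refine Finset.sum_congr rfl fun k _ => ?_
      have hk : k.1 ∈ modesLE d N := by
        rw [mem_modesLE] at hj ⊢
        exact k.2.le.trans hj
      rw [if_pos ⟨hk, hj'⟩, show modeEntry (M l) k.1 j' = M l j.level j'.level k j'.self from
        modeEntry_eq (M l) k j'.self]
      ring
    · simp [hj']
  · simp [hj]

theorem trigOp_mul_diagOp (N : ℝ) (B : BlockDiag d)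
    (M : (Fin ν → ℤ) → (α β : Spec d) → Block α β) (φ : Fin ν → ℝ) :
    trigOp N M φ * diagOp N B = trigOp N (fun l α β => M l α β * B β) φ := by
  refine op_ext fun j j' => ?_
  rw [coeff_mul_diagOp, coeff_trigOp]
  by_cases hj' : j' ∈ modesLE d N
  · rw [if_pos hj']
    simp only [coeff_trigOp, Finset.sum_mul]
    rw [Finset.sum_comm]
    refine Finset.sum_congr rfl fun l _ => ?_
    by_cases hj : j ∈ modesLE d N
    · rw [if_pos ⟨hj, hj'⟩]
      have e : modeEntry (fun α β => M l α β * B β) j j' =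
          ∑ k : Shell j'.level, M l j.level j'.level j.self k * B j'.level k j'.self := rfl
      rw [e, Finset.mul_sum]
      refine Finset.sum_congr rfl fun k _ => ?_
      have hk : k.1 ∈ modesLE d N := by
        rw [mem_modesLE] at hj' ⊢
        exact k.2.le.trans hj'
      rw [if_pos ⟨hj, hk⟩, show modeEntry (M l) j k.1 = M l j.level j'.level j.self k from
        modeEntry_eq (M l) j.self k]
      ring
    · simp [hj]
  · simp [hj']

theorem coeff_diagOp (N : ℝ) (M : (α β : Spec d) → Block α β) (j j' : Modes d) :
    coeff (diagOp N fun α => M α α) j j' =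
      if j ∈ modesLE d N ∧ j.level = j'.level then modeEntry M j j' else 0 := by
  rw [coeff_eq, diagOp_apply]
  by_cases hj : j ∈ modesLE d N
  · rw [if_pos hj]
    unfold blockApply
    by_cases hl : j.level = j'.level
    · rw [if_pos ⟨hj, hl⟩]
      refine (Finset.sum_eq_single (⟨j', congrArg Subtype.val hl.symm⟩ : Shell j.level)
        ?_ ?_).trans ?_
      rotate_left 2
      · rw [basisVec_apply, if_pos rfl, mul_one]
        exact (modeEntry_eq M j.self (⟨j', congrArg Subtype.val hl.symm⟩ : Shell j.level)).symm
      · intro k _ hk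
        rw [basisVec_apply, if_neg, mul_zero]
        exact fun h => hk (Subtype.ext h)
      · exact fun h => absurd (Finset.mem_univ (α := Shell j.level) _) h
    · rw [if_neg (fun h => hl h.2)]
      refine Finset.sum_eq_zero fun k _ => ?_
      rw [basisVec_apply, if_neg, mul_zero]
      rintro rfl
      exact hl (Subtype.ext k.2.symm)
  · rw [if_neg hj, if_neg fun h => hj h.1]

/-- A truncated block-diagonal operator as a trigonometric polynomial that does not depend on
the angles. -/
theorem diagOp_eq_trigOp (hN : 1 ≤ N) (M : (Fin ν → ℤ) → (α β : Spec d) → Block α β)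
    (φ : Fin ν → ℝ) :
    diagOp N (fun α => M 0 α α) =
      trigOp N (fun l α β => if l = 0 ∧ α = β then M l α β else 0) φ := by
  refine op_ext fun j j' => ?_
  rw [coeff_diagOp, coeff_trigOp, Finset.sum_eq_single 0]
  · have e : expMode (0 : Fin ν → ℤ) φ = 1 := by simp [expMode]
    rw [e, one_mul]
    by_cases hl : j.level = j'.level
    · have hm : j' ∈ modesLE d N ↔ j ∈ modesLE d N := by
        rw [mem_modesLE, mem_modesLE]
        exact iff_of_eq (congrArg (· ≤ N) (congrArg Subtype.val hl).symm)
      simp [hl, hm, modeEntry]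
    · simp [hl, modeEntry]
  · intro l _ hl
    simp [hl, modeEntry]
  · intro h
    rw [mem_freqLE] at h
    exact absurd (by simpa [jap, intNorm] using hN) h

theorem conjOp_diagOp (N : ℝ) (B : BlockDiag d) :
    conjOp (diagOp N B) = diagOp N (fun α => conjBlock (B α)) := by
  ext1 u
  refine lp.ext (funext fun i => ?_)
  rw [conjOp_apply, conjL_apply, diagOp_apply, diagOp_apply]
  have h1 : (-i ∈ modesLE d N) ↔ i ∈ modesLE d N := by
    rw [mem_modesLE, mem_modesLE]
    exact iff_of_eq (congrArg (· ≤ N) (intNorm_neg i.1))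
  by_cases hi : i ∈ modesLE d N
  · rw [if_pos (h1.mpr hi), if_pos hi]
    have h2 : ∀ {α : Spec d} (j : Modes d) (hj : intNorm j.1 = α.1) (v : Modes d → ℂ),
        blockApply B v j = ∑ k : Shell α, B α ⟨j, hj⟩ k * v k.1 := by
      rintro ⟨a, ha⟩ j hj v
      obtain rfl : intNorm j.1 = a := hj
      rfl
    rw [h2 (α := i.level) (-i) (intNorm_neg i.1), map_sum, blockApply,
      ← (Shell.negEquiv i.level).sum_comp]
    refine Finset.sum_congr rfl fun k _ => ?_
    rw [map_mul]
    congr 1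
    rw [conjL_apply, Complex.conj_conj]
    change u (-(-k.1)) = _
    rw [neg_neg]
  · rw [if_neg (fun h => hi (h1.mp h)), if_neg hi, map_zero]

end Trigonometric

/-! ### Real matrices of operators -/

section RealMatrices

variable {ν d : ℕ}

theorem conjOp_add (R T : Op d) : conjOp (R + T) = conjOp R + conjOp T := op_ext fun j j' => by
  rw [coeff_conjOp, coeff_add, coeff_add, coeff_conjOp, coeff_conjOp, map_add]

theorem conjOp_zero : conjOp (0 : Op d) = 0 := op_ext fun j j' => by
  rw [coeff_conjOp]
  exact map_zero _

theorem norm_conjOp_le (R : Op d) : ‖conjOp R‖ ≤ ‖R‖ :=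
  LinearMap.mkContinuous_norm_le _ (norm_nonneg _) _

/-- Conjugation of operators, as a real-linear map. -/
def conjOpCLM : Op d →L[ℝ] Op d :=
  LinearMap.mkContinuous
    { toFun := conjOp
      map_add' := conjOp_add
      map_smul' := fun c R => by
        refine op_ext fun j j' => ?_
        change coeff (conjOp ((c : ℂ) • R)) j j' = coeff ((c : ℂ) • conjOp R) j j'
        rw [coeff_conjOp, coeff_smul, coeff_smul, coeff_conjOp, map_mul, Complex.conj_ofReal] } 1
    fun R => by rw [one_mul]; exact norm_conjOp_le R

/-- The operator that acts as `R` from the factor `b` to the factor `a` of `L²₀ × L²₀`. -/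
def placeCLM (a b : Bool) : Op d →L[ℂ] Op2 d :=
  (ContinuousLinearMap.compL ℂ (L20 d × L20 d) (L20 d) (L20 d × L20 d) (injCLM a)).comp
    ((ContinuousLinearMap.compL ℂ (L20 d × L20 d) (L20 d) (L20 d)).flip (projCLM b))

theorem ent_placeCLM (a b a' b' : Bool) (R : Op d) :
    ent a b (placeCLM a' b' R) = if a = a' ∧ b = b' then R else 0 := by
  ext1 u
  change projCLM a (injCLM a' (R (projCLM b' (injCLM b u)))) = _
  rw [proj_inj, proj_inj]
  by_cases h1 : a = a'
  · by_cases h2 : b = b'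
    · simp [h1, h2]
    · simp [h2, Ne.symm h2]
  · simp [h1]

/-- The real operator with the first row `(R₁, R₂)`, as a real-linear map. -/
def realOpCLM : (Op d × Op d) →L[ℝ] Op2 d :=
  (((placeCLM false false).restrictScalars ℝ).comp (ContinuousLinearMap.fst ℝ _ _) +
    ((placeCLM false true).restrictScalars ℝ).comp (ContinuousLinearMap.snd ℝ _ _)) +
  (((placeCLM true false).restrictScalars ℝ).comp
      (conjOpCLM.comp (ContinuousLinearMap.snd ℝ _ _)) +
    ((placeCLM true true).restrictScalars ℝ).comp
      (conjOpCLM.comp (ContinuousLinearMap.fst ℝ _ _)))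

/-- The real operator `(R₁, R₂; R̄₂, R̄₁)`. -/
def realOp (R₁ R₂ : Op d) : Op2 d := realOpCLM (R₁, R₂)

theorem ent_realOp (a b : Bool) (R₁ R₂ : Op d) :
    ent a b (realOp R₁ R₂) = if a then (if b then conjOp R₁ else conjOp R₂)
      else (if b then R₂ else R₁) := by
  change ent a b ((placeCLM false false R₁ + placeCLM false true R₂) +
    (placeCLM true false (conjOp R₂) + placeCLM true true (conjOp R₁))) = _
  simp only [map_add, ent_placeCLM]
  cases a <;> cases b <;> simp

theorem entry11_realOp (R₁ R₂ : Op d) : entry11 (realOp R₁ R₂) = R₁ := ent_realOp false false R₁ R₂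

theorem entry12_realOp (R₁ R₂ : Op d) : entry12 (realOp R₁ R₂) = R₂ := ent_realOp false true R₁ R₂

theorem conjOp_conjOp (R : Op d) : conjOp (conjOp R) = R := by
  ext1 u
  rw [conjOp_apply, conjOp_apply, conjL_conjL, conjL_conjL]

theorem isReal_realOp (R₁ R₂ : Op d) : IsReal (realOp R₁ R₂) := by
  rw [isReal_iff_ent]
  intro a b
  rw [ent_realOp, ent_realOp]
  cases a <;> cases b <;> simp [conjOp_conjOp]

theorem IsReal.eq_of_entries {X Y : Op2 d} (hX : IsReal X) (hY : IsReal Y)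
    (h1 : entry11 X = entry11 Y) (h2 : entry12 X = entry12 Y) : X = Y := by
  rw [isReal_iff_ent] at hX hY
  have e1 : ent false false X = ent false false Y := h1
  have e2 : ent false true X = ent false true Y := h2
  refine op2_ext fun a b => ?_
  cases a <;> cases b
  · exact e1
  · exact e2
  · exact (hX false true).trans ((congrArg conjOp e2).trans (hY false true).symm)
  · exact (hX false false).trans ((congrArg conjOp e1).trans (hY false false).symm)

theorem realOp_sub (R₁ R₂ T₁ T₂ : Op d) :
    realOp R₁ R₂ - realOp T₁ T₂ = realOp (R₁ - T₁) (R₂ - T₂) :=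
  (map_sub realOpCLM (R₁, R₂) (T₁, T₂)).symm

theorem realOp_neg (R₁ R₂ : Op d) : -realOp R₁ R₂ = realOp (-R₁) (-R₂) :=
  (map_neg realOpCLM (R₁, R₂)).symm

theorem realOp_zero_mul (A R₁ R₂ : Op d) :
    realOp A 0 * realOp R₁ R₂ = realOp (A * R₁) (A * R₂) := by
  refine ((isReal_realOp _ _).mul (isReal_realOp _ _)).eq_of_entries (isReal_realOp _ _) ?_ ?_
  · rw [← ent_false_false, ent_mul, Fintype.sum_bool, entry11_realOp]
    simp only [ent_realOp]
    simp
  · rw [← ent_false_true, ent_mul, Fintype.sum_bool, entry12_realOp]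
    simp only [ent_realOp]
    simp

theorem realOp_mul_zero (A R₁ R₂ : Op d) :
    realOp R₁ R₂ * realOp A 0 = realOp (R₁ * A) (R₂ * conjOp A) := by
  refine ((isReal_realOp _ _).mul (isReal_realOp _ _)).eq_of_entries (isReal_realOp _ _) ?_ ?_
  · rw [← ent_false_false, ent_mul, Fintype.sum_bool, entry11_realOp]
    simp only [ent_realOp]
    simp [conjOp_zero]
  · rw [← ent_false_true, ent_mul, Fintype.sum_bool, entry12_realOp]
    simp only [ent_realOp]
    simp

end RealMatrices

/-! ### Inverses of the Melnikov operators -/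

section Inverses

variable {ν d : ℕ} {α β : Spec d} {L L₁ L₂ : Block α β →ₗ[ℂ] Block α β} {r : ℝ}

/-- The norm `opENorm`, a supremum over the unit ball, is an operator norm. -/
theorem hsENorm_apply_le_opENorm (L : Block α β →ₗ[ℂ] Block α β) (X : Block α β) :
    hsENorm (L X) ≤ opENorm L * hsENorm X := by
  by_cases hX : X = 0
  · simp [hX, hsENorm_zero]
  have hpos : 0 < hsNorm X := (hsNorm_nonneg X).lt_of_ne fun h => hX (eq_zero_of_hsNorm_eq_zero h.symm)
  have h1 : hsNorm (((hsNorm X)⁻¹ : ℂ) • X) ≤ 1 := by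
    rw [hsNorm_smul, norm_inv, Complex.norm_real, Real.norm_of_nonneg hpos.le,
      inv_mul_cancel₀ hpos.ne']
  have h2 : hsENorm (L (((hsNorm X)⁻¹ : ℂ) • X)) ≤ opENorm L :=
    le_iSup₂ (f := fun (M : Block α β) (_ : hsNorm M ≤ 1) => hsENorm (L M)) _ h1
  have h3 : L X = ((hsNorm X : ℝ) : ℂ) • L (((hsNorm X)⁻¹ : ℂ) • X) := by
    rw [map_smul, smul_smul, mul_inv_cancel₀ (by exact_mod_cast hpos.ne'), one_smul]
  have h4 : ‖((hsNorm X : ℝ) : ℂ)‖ₑ = hsENorm X := by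
    rw [← ofReal_norm, Complex.norm_real, Real.norm_of_nonneg hpos.le, hsENorm]
  rw [h3, hsENorm_smul, mul_comm, h4]
  exact mul_le_mul_left h2 _

theorem InvBound.inverse_eq (h : InvBound L r) :
    ∃ e : Block α β ≃ₗ[ℂ] Block α β, e.toLinearMap = L ∧ Ring.inverse L = e.symm.toLinearMap ∧
      opENorm e.symm.toLinearMap ≤ ENNReal.ofReal r := by
  obtain ⟨e, he, hr⟩ := h
  refine ⟨e, he, ?_, hr⟩
  rw [← he]
  exact Ring.inverse_unit (M₀ := Module.End ℂ (Block α β))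
    ⟨e.toLinearMap, e.symm.toLinearMap, LinearMap.ext e.apply_symm_apply,
      LinearMap.ext e.symm_apply_apply⟩

theorem InvBound.apply_inverse (h : InvBound L r) (X : Block α β) : L (Ring.inverse L X) = X := by
  obtain ⟨e, he, hi, -⟩ := h.inverse_eq
  rw [hi, ← he]
  exact e.apply_symm_apply X

theorem InvBound.inverse_apply (h : InvBound L r) (X : Block α β) : Ring.inverse L (L X) = X := by
  obtain ⟨e, he, hi, -⟩ := h.inverse_eq
  rw [hi, ← he]
  exact e.symm_apply_apply X

theorem InvBound.hsENorm_inverse_le (h : InvBound L r) (X : Block α β) :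
    hsENorm (Ring.inverse L X) ≤ ENNReal.ofReal r * hsENorm X := by
  obtain ⟨e, -, hi, hr⟩ := h.inverse_eq
  rw [hi]
  exact (hsENorm_apply_le_opENorm _ X).trans (mul_le_mul_left hr _)

/-- Dependence of the solution `X = L⁻¹ Y` on `L` and `Y`. -/
theorem InvBound.hsENorm_inverse_sub_le (h₁ : InvBound L₁ r) (h₂ : InvBound L₂ r) {κ : ℝ≥0∞}
    (hκ : ∀ X, hsENorm (L₁ X - L₂ X) ≤ κ * hsENorm X) (Y₁ Y₂ : Block α β) :
    hsENorm (Ring.inverse L₁ Y₁ - Ring.inverse L₂ Y₂) ≤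
      ENNReal.ofReal r * hsENorm (Y₁ - Y₂) + ENNReal.ofReal r * κ * ENNReal.ofReal r * hsENorm Y₂ := by
  set X₂ := Ring.inverse L₂ Y₂
  have e : Ring.inverse L₁ Y₁ - X₂ =
      Ring.inverse L₁ (Y₁ - Y₂) - Ring.inverse L₁ (L₁ X₂ - L₂ X₂) := by
    rw [map_sub, map_sub, h₁.inverse_apply, h₂.apply_inverse]
    abel
  rw [e]
  refine (hsENorm_sub_le _ _).trans (add_le_add (h₁.hsENorm_inverse_le _) ?_)
  refine (h₁.hsENorm_inverse_le _).trans ?_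
  rw [mul_assoc, mul_assoc]
  exact mul_le_mul_right ((hκ _).trans (mul_le_mul_right (h₂.hsENorm_inverse_le _) _)) _

theorem conjBlock_mul {δ : Spec d} (X : Block α δ) (Y : Block δ β) :
    conjBlock (X * Y) = conjBlock X * conjBlock Y := by
  ext j j'
  change starRingEnd ℂ (∑ k, X j.neg k * Y k j'.neg) = ∑ k, _
  rw [map_sum, ← (Shell.negEquiv δ).sum_comp]
  exact Finset.sum_congr rfl fun k _ => map_mul _ _ _

theorem conjBlock_sub (X Y : Block α β) : conjBlock (X - Y) = conjBlock X - conjBlock Y := by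
  ext j j'
  exact map_sub (starRingEnd ℂ) _ _

theorem conjBlock_smul (c : ℂ) (X : Block α β) :
    conjBlock (c • X) = starRingEnd ℂ c • conjBlock X := by
  ext j j'
  exact map_mul (starRingEnd ℂ) _ _

theorem hsENorm_conjTranspose (X : Block α β) : hsENorm X.conjTranspose = hsENorm X := by
  rw [hsENorm, hsENorm, hsNorm_conjTranspose]

/-- The transpose of a block with respect to the bilinear pairing: `(Xᵀ)_j^{j'} = X_{-j'}^{-j}`. -/
def flipBlock (X : Block α β) : Block β α := Matrix.of fun j j' => X j'.neg j.neg

theorem flipBlock_mul {δ : Spec d} (X : Block α δ) (Y : Block δ β) :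
    flipBlock (X * Y) = flipBlock Y * flipBlock X := by
  ext j j'
  change ∑ k, X j'.neg k * Y k j.neg = ∑ k, _
  rw [← (Shell.negEquiv δ).sum_comp]
  exact Finset.sum_congr rfl fun k _ => mul_comm _ _

theorem flipBlock_of_isHermitian {B : Block α α} (h : B.IsHermitian) :
    flipBlock B = conjBlock B := by
  ext j j'
  exact (h.apply j'.neg j.neg).symm

theorem flipBlock_conjBlock_of_isHermitian {B : Block α α} (h : B.IsHermitian) :
    flipBlock (conjBlock B) = B := by
  ext j j'
  change starRingEnd ℂ (B j'.neg.neg j.neg.neg) = _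
  rw [Shell.neg_neg, Shell.neg_neg]
  exact h.apply j j'

variable {D : BlockDiag d} {ω : Freq ν}

theorem melnikovMinus_apply (D : BlockDiag d) (ω : Freq ν) (l : Fin ν → ℤ) (X : Block α β) :
    melnikovMinus D ω l α β X = (freqDot ω l : ℂ) • X + D α * X - X * D β := rfl

theorem melnikovPlus_apply (D : BlockDiag d) (ω : Freq ν) (l : Fin ν → ℤ) (X : Block α β) :
    melnikovPlus D ω l α β X = (freqDot ω l : ℂ) • X + D α * X + X * conjBlock (D β) := rfl

theorem freqDot_neg (ω : Freq ν) (l : Fin ν → ℤ) : freqDot ω (-l) = -freqDot ω l := by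
  simp [freqDot]

theorem melnikovMinus_conjTranspose (hD : ∀ α, (D α).IsHermitian) (l : Fin ν → ℤ)
    (X : Block β α) : melnikovMinus D ω l α β (-X.conjTranspose) =
      (melnikovMinus D ω (-l) β α X).conjTranspose := by
  have h1 : (D α).conjTranspose = D α := hD α
  have h2 : (D β).conjTranspose = D β := hD β
  rw [melnikovMinus_apply, melnikovMinus_apply, freqDot_neg, Matrix.conjTranspose_sub,
    Matrix.conjTranspose_add, Matrix.conjTranspose_smul, Matrix.conjTranspose_mul,
    Matrix.conjTranspose_mul, h1, h2]
  have e : star (((-freqDot ω l : ℝ)) : ℂ) = -(freqDot ω l : ℂ) := by simp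
  rw [e, smul_neg, neg_smul, Matrix.mul_neg, Matrix.neg_mul]
  abel

theorem flipBlock_add (X Y : Block α β) : flipBlock (X + Y) = flipBlock X + flipBlock Y := rfl

theorem flipBlock_smul (c : ℂ) (X : Block α β) : flipBlock (c • X) = c • flipBlock X := rfl

theorem melnikovPlus_flipBlock (hD : ∀ α, (D α).IsHermitian) (l : Fin ν → ℤ)
    (X : Block β α) : melnikovPlus D ω l α β (flipBlock X) =
      flipBlock (melnikovPlus D ω l β α X) := by
  rw [melnikovPlus_apply, melnikovPlus_apply, flipBlock_add, flipBlock_add, flipBlock_smul,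
    flipBlock_mul, flipBlock_mul, flipBlock_of_isHermitian (hD β),
    flipBlock_conjBlock_of_isHermitian (hD α)]
  abel

end Inverses

/-! ### The homological equation -/

section Homological

variable {ν d : ℕ} {γ τ e N : ℝ} {D : BlockDiag d} {ω : Freq ν} {F : (Fin ν → ℝ) → Op2 d}

/-- The Fourier blocks of the entry `(1,1)`. -/
def block11 (F : (Fin ν → ℝ) → Op2 d) (l : Fin ν → ℤ) (α β : Spec d) : Block α β :=
  hatBlock (fun φ => entry11 (F φ)) l α β

/-- The Fourier blocks of the entry `(1,2)`. -/
def block12 (F : (Fin ν → ℝ) → Op2 d) (l : Fin ν → ℤ) (α β : Spec d) : Block α β :=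
  hatBlock (fun φ => entry12 (F φ)) l α β

/-- The part of a real family `F` with `⟨ℓ, α, β⟩ ≤ N`. -/
def truncOp (N : ℝ) (F : (Fin ν → ℝ) → Op2 d) (φ : Fin ν → ℝ) : Op2 d :=
  realOp (trigOp N (block11 F) φ) (trigOp N (block12 F) φ)

/-- The resonant part of `F`: the diagonal blocks of the average of the diagonal entries. -/
def meanOp (N : ℝ) (F : (Fin ν → ℝ) → Op2 d) : Op2 d :=
  realOp (diagOp N fun α => block11 F 0 α α) 0

/-- The blocks of the entry `(1,1)` of the generator. -/
def genBlock11 (D : BlockDiag d) (ω : Freq ν) (F : (Fin ν → ℝ) → Op2 d) (l : Fin ν → ℤ)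
    (α β : Spec d) : Block α β :=
  if l = 0 ∧ α = β then 0
  else Ring.inverse (melnikovMinus D ω l α β) ((-Complex.I) • block11 F l α β)

/-- The blocks of the entry `(1,2)` of the generator. -/
def genBlock12 (D : BlockDiag d) (ω : Freq ν) (F : (Fin ν → ℝ) → Op2 d) (l : Fin ν → ℤ)
    (α β : Spec d) : Block α β :=
  Ring.inverse (melnikovPlus D ω l α β) ((-Complex.I) • block12 F l α β)

/-- The solution `Ψ` of the homological equation with right-hand side `F`. -/
def generator (N : ℝ) (D : BlockDiag d) (ω : Freq ν) (F : (Fin ν → ℝ) → Op2 d)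
    (φ : Fin ν → ℝ) : Op2 d :=
  realOp (trigOp N (genBlock11 D ω F) φ) (trigOp N (genBlock12 D ω F) φ)

/-- The truncation of the diagonal field `i (-D, 0; 0, D̄)`. -/
def diagField (N : ℝ) (D : BlockDiag d) : Op2 d :=
  realOp (diagOp N fun α => (-Complex.I) • D α) 0

theorem trigOp_neg (N : ℝ) (M : (Fin ν → ℤ) → (α β : Spec d) → Block α β) (φ : Fin ν → ℝ) :
    trigOp N (fun l α β => -M l α β) φ = -trigOp N M φ := by
  have := trigOp_smul N (-1) M φ
  simpa using this

theorem trigOp_sub (N : ℝ) (M M' : (Fin ν → ℤ) → (α β : Spec d) → Block α β) (φ : Fin ν → ℝ) :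
    trigOp N (fun l α β => M l α β - M' l α β) φ = trigOp N M φ - trigOp N M' φ := by
  simp only [sub_eq_add_neg]
  rw [trigOp_add N M (fun l α β => -M' l α β), trigOp_neg]

theorem contDiff_realTrigOp (N : ℝ) (M M' : (Fin ν → ℤ) → (α β : Spec d) → Block α β) :
    ContDiff ℝ 1 fun φ => realOp (trigOp N M φ) (trigOp N M' φ) :=
  realOpCLM.contDiff.comp ((contDiff_trigOp N M).prodMk (contDiff_trigOp N M'))

theorem torusCont_realTrigOp (N : ℝ) (M M' : (Fin ν → ℤ) → (α β : Spec d) → Block α β) :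
    TorusCont fun φ => realOp (trigOp N M φ) (trigOp N M' φ) :=
  (torusCont_trigOp N M).comp₂ (torusCont_trigOp N M') realOpCLM.continuous

theorem omegaDeriv_realTrigOp (N : ℝ) (M M' : (Fin ν → ℤ) → (α β : Spec d) → Block α β)
    (ω : Freq ν) (φ : Fin ν → ℝ) :
    omegaDeriv ω (fun φ => realOp (trigOp N M φ) (trigOp N M' φ)) φ =
      realOp (trigOp N (fun l α β => (Complex.I * freqDot ω l) • M l α β) φ)
        (trigOp N (fun l α β => (Complex.I * freqDot ω l) • M' l α β) φ) := by
  have h1 := ((contDiff_trigOp N M).differentiable one_ne_zero φ).hasFDerivAt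
  have h2 := ((contDiff_trigOp N M').differentiable one_ne_zero φ).hasFDerivAt
  have h := (realOpCLM (d := d)).hasFDerivAt.comp φ (h1.prodMk h2)
  have h' : fderiv ℝ (fun φ => realOp (trigOp N M φ) (trigOp N M' φ)) φ = _ := h.fderiv
  rw [omegaDeriv, h', ← fderiv_trigOp, ← fderiv_trigOp]
  rfl

/-- One block of the homological equation in the entry `(1,1)`. -/
theorem block_identity_minus {ι κ : Type*} [Fintype ι] [Fintype κ] {B : Matrix ι ι ℂ}
    {B' : Matrix κ κ ℂ} {X Y : Matrix ι κ ℂ} {c : ℂ}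
    (h : c • X + B * X - X * B' = (-Complex.I) • Y) :
    ((-Complex.I) • B) * X - X * ((-Complex.I) • B') - (Complex.I * c) • X = -Y := by
  have h2 : (-Complex.I) • (-Complex.I) • Y = -Y := by
    rw [smul_smul, neg_mul_neg, Complex.I_mul_I, neg_one_smul]
  rw [← h2, ← h, Matrix.smul_mul, Matrix.mul_smul]
  module

/-- One block of the homological equation in the entry `(1,2)`; the second diagonal entry of the
unperturbed field has the opposite sign, which turns the commutator into an anticommutator. -/
theorem block_identity_plus {ι κ : Type*} [Fintype ι] [Fintype κ] {B : Matrix ι ι ℂ}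
    {B' : Matrix κ κ ℂ} {X Y : Matrix ι κ ℂ} {c : ℂ}
    (h : c • X + B * X + X * B' = (-Complex.I) • Y) :
    ((-Complex.I) • B) * X - X * (Complex.I • B') - (Complex.I * c) • X = -Y := by
  have h2 : (-Complex.I) • (-Complex.I) • Y = -Y := by
    rw [smul_smul, neg_mul_neg, Complex.I_mul_I, neg_one_smul]
  rw [← h2, ← h, Matrix.smul_mul, Matrix.mul_smul]
  module

/-- The generator solves `[D, Ψ] - ω·∂Ψ = -(ΠF - Z)`, where `Z` is the resonant part of `F`. -/
theorem homological_equation (hN : 1 ≤ N) (h : MelnikovCond γ τ e N D ω) (φ : Fin ν → ℝ) :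
    diagField N D * generator N D ω F φ - generator N D ω F φ * diagField N D -
      omegaDeriv ω (generator N D ω F) φ = -(truncOp N F φ - meanOp N F) := by
  have e0 : omegaDeriv ω (generator N D ω F) φ = _ :=
    omegaDeriv_realTrigOp N (genBlock11 D ω F) (genBlock12 D ω F) ω φ
  rw [e0]
  unfold diagField generator truncOp meanOp
  rw [realOp_zero_mul, realOp_mul_zero, realOp_sub, realOp_sub, realOp_sub, realOp_neg,
    conjOp_diagOp, diagOp_mul_trigOp, diagOp_mul_trigOp, trigOp_mul_diagOp, trigOp_mul_diagOp,
    ← trigOp_sub, ← trigOp_sub, ← trigOp_sub, ← trigOp_sub, sub_zero,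
    diagOp_eq_trigOp hN (block11 F) φ, ← trigOp_sub, ← trigOp_neg, ← trigOp_neg]
  congr 1
  · refine congrFun (trigOp_congr fun l α β hle => ?_) φ
    by_cases h0 : l = 0 ∧ α = β
    · simp [genBlock11, h0]
    · simp only [genBlock11, if_neg h0, sub_zero]
      exact block_identity_minus ((h.1 l α β h0 hle).apply_inverse ((-Complex.I) • block11 F l α β))
  · refine congrFun (trigOp_congr fun l α β hle => ?_) φ
    rw [conjBlock_smul, map_neg, Complex.conj_I, neg_neg]
    exact block_identity_plus ((h.2 l α β hle).apply_inverse ((-Complex.I) • block12 F l α β))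

/-- The Hamiltonian structure of a trigonometric polynomial in terms of its blocks. -/
theorem isHamiltonian_realTrigOp {M M' : (Fin ν → ℤ) → (α β : Spec d) → Block α β}
    (h11 : ∀ l α β, jap3 l α β ≤ N → M l α β = -(M (-l) β α).conjTranspose)
    (h12 : ∀ l α β, jap3 l α β ≤ N → M' l α β = flipBlock (M' l β α)) (φ : Fin ν → ℝ) :
    IsHamiltonian (realOp (trigOp N M φ) (trigOp N M' φ)) := by
  refine isHamiltonian_of_coeff (isReal_realOp _ _) (fun j j' => ?_) (fun j j' => ?_)
  · rw [entry11_realOp, coeff_trigOp, coeff_trigOp, map_sum, ← freqLE_sum_neg, ← Finset.sum_neg_distrib]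
    refine Finset.sum_congr rfl fun l hl => ?_
    rw [expMode_neg, map_mul, ← mul_neg]
    congr 1
    by_cases hj : j ∈ modesLE d N ∧ j' ∈ modesLE d N
    · rw [if_pos hj, if_pos hj.symm, modeEntry, modeEntry, h11, neg_neg]
      · rfl
      · rw [jap3_neg]
        exact jap3_le_iff.mpr ⟨mem_freqLE.mp hl, mem_modesLE.mp hj.1, mem_modesLE.mp hj.2⟩
    · rw [if_neg hj, if_neg fun h => hj h.symm, map_zero, neg_zero]
  · rw [entry12_realOp, coeff_trigOp, coeff_trigOp]
    have hm : ∀ j : Modes d, -j ∈ modesLE d N ↔ j ∈ modesLE d N := fun j => by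
      rw [mem_modesLE, mem_modesLE]
      exact iff_of_eq (congrArg (· ≤ N) (intNorm_neg j.1))
    refine Finset.sum_congr rfl fun l hl => ?_
    congr 1
    by_cases hj : j ∈ modesLE d N ∧ j' ∈ modesLE d N
    · rw [if_pos hj, if_pos ⟨(hm j').mpr hj.2, (hm j).mpr hj.1⟩, modeEntry, h12]
      · exact (modeEntry_eq (M' l) j'.self.neg j.self.neg).symm
      · exact jap3_le_iff.mpr ⟨mem_freqLE.mp hl, mem_modesLE.mp hj.1, mem_modesLE.mp hj.2⟩
    · rw [if_neg hj, if_neg fun h => hj ⟨(hm j).mp h.2, (hm j').mp h.1⟩]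

theorem fourierCoef_neg_conj (f : (Fin ν → ℝ) → ℂ) (l : Fin ν → ℤ) :
    fourierCoef (fun φ => -starRingEnd ℂ (f φ)) l = -starRingEnd ℂ (fourierCoef f (-l)) := by
  rw [← fourierCoef_conj]
  have := fourierCoef_const_mul (-1) (fun φ => starRingEnd ℂ (f φ)) l
  simpa using this

theorem block11_of_isHamiltonian (hF : ∀ φ, IsHamiltonian (F φ)) (l : Fin ν → ℤ) (α β : Spec d) :
    block11 F l α β = -(block11 F (-l) β α).conjTranspose := by
  ext j j'
  change fourierCoef (fun φ => coeff (entry11 (F φ)) j.1 j'.1) l =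
    -starRingEnd ℂ (fourierCoef (fun φ => coeff (entry11 (F φ)) j'.1 j.1) (-l))
  rw [← fourierCoef_neg_conj]
  congr 1
  funext φ
  exact (hF φ).coeff_entry11 _ _

theorem block12_of_isHamiltonian (hF : ∀ φ, IsHamiltonian (F φ)) (l : Fin ν → ℤ) (α β : Spec d) :
    block12 F l α β = flipBlock (block12 F l β α) := by
  ext j j'
  change fourierCoef (fun φ => coeff (entry12 (F φ)) j.1 j'.1) l =
    fourierCoef (fun φ => coeff (entry12 (F φ)) (-j'.1) (-j.1)) l
  congr 1
  funext φ
  exact (hF φ).coeff_entry12 _ _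

theorem isHamiltonian_truncOp (hF : ∀ φ, IsHamiltonian (F φ)) (φ : Fin ν → ℝ) :
    IsHamiltonian (truncOp N F φ) :=
  isHamiltonian_realTrigOp (fun l α β _ => block11_of_isHamiltonian hF l α β)
    (fun l α β _ => block12_of_isHamiltonian hF l α β) φ

theorem meanOp_eq_realTrigOp (hN : 1 ≤ N) (F : (Fin ν → ℝ) → Op2 d) (φ : Fin ν → ℝ) :
    meanOp N F = realOp (trigOp N (fun l α β => if l = 0 ∧ α = β then block11 F l α β else 0) φ)
      (trigOp N (fun _ _ _ => 0) φ) := by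
  have h0 : trigOp N (fun (_ : Fin ν → ℤ) (α β : Spec d) => (0 : Block α β)) φ = 0 := by
    have := trigOp_smul N 0 (fun (_ : Fin ν → ℤ) (α β : Spec d) => (0 : Block α β)) φ
    simpa using this
  rw [meanOp, diagOp_eq_trigOp hN (block11 F) φ, h0]

theorem isHamiltonian_meanOp (hN : 1 ≤ N) (hF : ∀ φ, IsHamiltonian (F φ)) :
    IsHamiltonian (meanOp N F) := by
  rw [meanOp_eq_realTrigOp hN F 0]
  refine isHamiltonian_realTrigOp (fun l α β _ => ?_) (fun l α β _ => rfl) 0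
  by_cases h : l = 0 ∧ α = β
  · have h' : -l = 0 ∧ β = α := ⟨by rw [h.1, neg_zero], h.2.symm⟩
    rw [if_pos h, if_pos h']
    exact block11_of_isHamiltonian hF l α β
  · have h' : ¬(-l = 0 ∧ β = α) := fun h' => h ⟨neg_eq_zero.mp h'.1, h'.2.symm⟩
    rw [if_neg h, if_neg h']
    simp

/-- The Melnikov operators intertwine the symmetries of Hamiltonian blocks, so the unique solution
of the homological equation inherits them from `F`. -/
theorem isHamiltonian_generator (hD : ∀ α, (D α).IsHermitian) (h : MelnikovCond γ τ e N D ω)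
    (hF : ∀ φ, IsHamiltonian (F φ)) (φ : Fin ν → ℝ) :
    IsHamiltonian (generator N D ω F φ) := by
  refine isHamiltonian_realTrigOp (fun l α β hle => ?_) (fun l α β hle => ?_) φ
  · by_cases h0 : l = 0 ∧ α = β
    · have h0' : -l = 0 ∧ β = α := ⟨by rw [h0.1, neg_zero], h0.2.symm⟩
      rw [genBlock11, genBlock11, if_pos h0, if_pos h0']
      simp
    · have h0' : ¬(-l = 0 ∧ β = α) := fun h' => h0 ⟨neg_eq_zero.mp h'.1, h'.2.symm⟩
      rw [genBlock11, genBlock11, if_neg h0, if_neg h0']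
      have hle' : jap3 (-l) β α ≤ N := by rwa [jap3_neg, jap3_comm]
      have hb := h.1 l α β h0 hle
      rw [← hb.inverse_apply (-_), melnikovMinus_conjTranspose hD,
        (h.1 (-l) β α h0' hle').apply_inverse, block11_of_isHamiltonian hF l α β,
        Matrix.conjTranspose_smul]
      congr 1
      simp
  · have hle' : jap3 l β α ≤ N := by rwa [jap3_comm]
    rw [genBlock12, genBlock12, ← (h.2 l α β hle).inverse_apply (flipBlock _),
      melnikovPlus_flipBlock hD, (h.2 l β α hle').apply_inverse, flipBlock_smul,
      ← block12_of_isHamiltonian hF]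

/-! ### Estimates for the homological equation -/

/-- For Hermitian blocks, bounds for multiplication from the left and from the right are equivalent.
-/
theorem hsENorm_mul_of_left (hD : ∀ α, (D α).IsHermitian) {κ : ℝ≥0∞} {α β : Spec d}
    (h : ∀ X : Block β α, hsENorm (D β * X) ≤ κ * hsENorm X) (X : Block α β) :
    hsENorm (X * D β) ≤ κ * hsENorm X := by
  have h1 : (D β).conjTranspose = D β := hD β
  rw [← hsENorm_conjTranspose, Matrix.conjTranspose_mul, h1, ← hsENorm_conjTranspose X]
  exact h _

theorem freqDot_sub_enorm_le (ω₁ ω₂ : Freq ν) (l : Fin ν → ℤ) :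
    ‖((freqDot ω₁ l : ℂ) - (freqDot ω₂ l : ℂ))‖ₑ ≤ ENNReal.ofReal (intNorm l) * edist ω₁ ω₂ := by
  have h1 : freqDot ω₁ l - freqDot ω₂ l =
      inner ℝ (WithLp.toLp 2 fun i => (l i : ℝ) : Freq ν) (ω₁ - ω₂) := by
    rw [PiLp.inner_apply, freqDot, freqDot, ← Finset.sum_sub_distrib]
    refine Finset.sum_congr rfl fun i _ => ?_
    simp [sub_mul]
  have h2 := abs_real_inner_le_norm (WithLp.toLp 2 fun i => (l i : ℝ) : Freq ν) (ω₁ - ω₂)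
  rw [← h1, ← intNorm_eq_norm] at h2
  rw [← Complex.ofReal_sub, ← ofReal_norm, Complex.norm_real, Real.norm_eq_abs,
    edist_dist, dist_eq_norm, ← ENNReal.ofReal_mul (intNorm_nonneg l)]
  exact ENNReal.ofReal_le_ofReal h2

/-- The Lipschitz dependence of the Melnikov operators on `ω`. -/
theorem hsENorm_melnikov_sub_le {D₁ D₂ : BlockDiag d} {ω₁ ω₂ : Freq ν}
    (h₁ : ∀ α, (D₁ α).IsHermitian) (h₂ : ∀ α, (D₂ α).IsHermitian)
    (h : ∀ (α β : Spec d) (X : Block α β), hsENorm ((D₁ α - D₂ α) * X) ≤ edist ω₁ ω₂ * hsENorm X)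
    (l : Fin ν → ℤ) (α β : Spec d) (X : Block α β) :
    hsENorm (melnikovMinus D₁ ω₁ l α β X - melnikovMinus D₂ ω₂ l α β X) ≤
        3 * ENNReal.ofReal (jap3 l α β) * edist ω₁ ω₂ * hsENorm X ∧
      hsENorm (melnikovPlus D₁ ω₁ l α β X - melnikovPlus D₂ ω₂ l α β X) ≤
        3 * ENNReal.ofReal (jap3 l α β) * edist ω₁ ω₂ * hsENorm X := by
  set j := ENNReal.ofReal (jap3 l α β)
  have hj1 : 1 ≤ j := ENNReal.one_le_ofReal.mpr (one_le_jap3 _ _ _)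
  have hjl : ENNReal.ofReal (intNorm l) ≤ j :=
    ENNReal.ofReal_le_ofReal ((le_max_right _ _).trans (jap_le_jap3 l α β))
  have n1 : hsENorm (((freqDot ω₁ l : ℂ) - (freqDot ω₂ l : ℂ)) • X) ≤
      j * edist ω₁ ω₂ * hsENorm X := by
    rw [hsENorm_smul]
    exact mul_le_mul_left ((freqDot_sub_enorm_le ω₁ ω₂ l).trans (mul_le_mul_left hjl _)) _
  have n2 : hsENorm ((D₁ α - D₂ α) * X) ≤ j * edist ω₁ ω₂ * hsENorm X :=
    (h α β X).trans (mul_le_mul_left (le_mul_of_one_le_left' hj1) _)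
  have hr : ∀ Y : Block α β, hsENorm (Y * (D₁ β - D₂ β)) ≤ edist ω₁ ω₂ * hsENorm Y :=
    hsENorm_mul_of_left (D := fun α => D₁ α - D₂ α) (fun α => (h₁ α).sub (h₂ α)) (h β α)
  have n3 : hsENorm (X * (D₁ β - D₂ β)) ≤ j * edist ω₁ ω₂ * hsENorm X :=
    (hr X).trans (mul_le_mul_left (le_mul_of_one_le_left' hj1) _)
  have n4 : hsENorm (X * conjBlock (D₁ β - D₂ β)) ≤ j * edist ω₁ ω₂ * hsENorm X := by
    rw [← conjBlock_conjBlock X, ← conjBlock_mul, hsENorm_conjBlock, hsENorm_conjBlock]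
    exact (hr _).trans (mul_le_mul_left (le_mul_of_one_le_left' hj1) _)
  have tri : ∀ {A B C : Block α β} {r : ℝ≥0∞}, hsENorm A ≤ r → hsENorm B ≤ r → hsENorm C ≤ r →
      hsENorm (A + B + C) ≤ 3 * r := fun {A B C r} hA hB hC => by
    refine (hsENorm_add_le _ _).trans ((add_le_add ((hsENorm_add_le _ _).trans
      (add_le_add hA hB)) hC).trans (le_of_eq (by ring)))
  constructor
  · have e1 : melnikovMinus D₁ ω₁ l α β X - melnikovMinus D₂ ω₂ l α β X =
        ((freqDot ω₁ l : ℂ) - (freqDot ω₂ l : ℂ)) • X + (D₁ α - D₂ α) * X +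
          -(X * (D₁ β - D₂ β)) := by
      rw [melnikovMinus_apply, melnikovMinus_apply, Matrix.sub_mul, Matrix.mul_sub]
      module
    rw [e1]
    refine (tri n1 n2 (by rwa [hsENorm_neg])).trans (le_of_eq (by ring))
  · have e1 : melnikovPlus D₁ ω₁ l α β X - melnikovPlus D₂ ω₂ l α β X =
        ((freqDot ω₁ l : ℂ) - (freqDot ω₂ l : ℂ)) • X + (D₁ α - D₂ α) * X +
          X * conjBlock (D₁ β - D₂ β) := by
      rw [melnikovPlus_apply, melnikovPlus_apply, Matrix.sub_mul, conjBlock_sub, Matrix.mul_sub]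
      module
    rw [e1]
    refine (tri n1 n2 n4).trans (le_of_eq (by ring))

/-- The bounds of the second Melnikov conditions, with a common power of `⟨ℓ, α, β⟩`. -/
theorem melnikov_bound_le (hγ : 0 < γ) (hτ : 0 ≤ τ) (he : 0 ≤ e) (l : Fin ν → ℤ) (α β : Spec d) :
    α.1 ^ e * β.1 ^ e * jap l ^ τ / γ ≤ γ⁻¹ * jap3 l α β ^ (τ + 2 * e) ∧
      jap l ^ τ / (γ * max 1 (α.1 + β.1)) ≤ γ⁻¹ * jap3 l α β ^ (τ + 2 * e) := by
  have hj := jap3_pos l α β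
  have hl : (0 : ℝ) < jap l := zero_lt_one.trans_le (one_le_jap l)
  have hα := α.pos
  have hβ := β.pos
  have h1 : jap l ^ τ ≤ jap3 l α β ^ τ := Real.rpow_le_rpow hl.le (jap_le_jap3 _ _ _) hτ
  constructor
  · have h2 : α.1 ^ e ≤ jap3 l α β ^ e := Real.rpow_le_rpow hα.le (left_le_jap3 _ _ _) he
    have h3 : β.1 ^ e ≤ jap3 l α β ^ e := Real.rpow_le_rpow hβ.le (right_le_jap3 _ _ _) he
    have e1 : jap3 l α β ^ (τ + 2 * e) = jap3 l α β ^ e * jap3 l α β ^ e * jap3 l α β ^ τ := by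
      rw [← Real.rpow_add hj, ← Real.rpow_add hj]
      congr 1
      ring
    rw [e1, div_eq_inv_mul]
    gcongr
  · have h2 : jap3 l α β ^ τ ≤ jap3 l α β ^ (τ + 2 * e) :=
      Real.rpow_le_rpow_of_exponent_le (one_le_jap3 _ _ _) (by linarith)
    rw [div_eq_inv_mul]
    refine mul_le_mul ?_ (h1.trans h2) (by positivity) (by positivity)
    refine inv_anti₀ hγ (le_mul_of_one_le_right hγ.le (le_max_left _ _))

end Homological

section GeneratorEstimates

variable {ν d : ℕ} {γ τ e N : ℝ} {S : Set (Freq ν)} {D : Freq ν → BlockDiag d}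
  {F : Freq ν → (Fin ν → ℝ) → Op2 d}

/-- Lipschitz decay norms of trigonometric polynomials whose blocks lose the power `m` of
`⟨ℓ, α, β⟩` and one factor `γ⁻¹` for each inverse of a Melnikov operator. -/
theorem lipNorm_trigOp_le {M : Freq ν → (Fin ν → ℤ) → (α β : Spec d) → Block α β}
    {G : Freq ν → (Fin ν → ℝ) → Op d} (hγ : 0 < γ) (hG : ∀ ω ∈ S, Continuous (G ω)) {m s t : ℝ}
    {K : ℝ≥0∞}
    (hK : ∀ (l : Fin ν → ℤ) (α β : Spec d), jap3 l α β ≤ N →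
      wt m l α β * wt s l α β ≤ K * wt t l α β)
    (h1 : ∀ ω ∈ S, ∀ l α β, jap3 l α β ≤ N → hsENorm (M ω l α β) ≤
      ENNReal.ofReal γ⁻¹ * wt m l α β * hsENorm (hatBlock (G ω) l α β))
    (h2 : ∀ ω₁ ∈ S, ∀ ω₂ ∈ S, ∀ l α β, jap3 l α β ≤ N →
      hsENorm (M ω₁ l α β - M ω₂ l α β) ≤
        ENNReal.ofReal γ⁻¹ * wt m l α β *
          hsENorm (hatBlock (G ω₁) l α β - hatBlock (G ω₂) l α β) +
        3 * ENNReal.ofReal γ⁻¹ * ENNReal.ofReal γ⁻¹ * wt m l α β * edist ω₁ ω₂ *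
          hsENorm (hatBlock (G ω₂) l α β)) :
    lipNorm γ S (decayNorm s) (fun ω => trigOp N (M ω)) ≤
      4 * ENNReal.ofReal γ⁻¹ * K * lipNorm γ S (decayNorm t) G := by
  set g := ENNReal.ofReal γ⁻¹
  have hg : ENNReal.ofReal γ * g = 1 := by
    rw [← ENNReal.ofReal_mul hγ.le, mul_inv_cancel₀ hγ.ne', ENNReal.ofReal_one]
  refine (lipNorm_le (A := g * K * supPart S (decayNorm t) G)
    (B := g * K * lipPart S (decayNorm t) G + 3 * g * g * K * supPart S (decayNorm t) G)
    (fun ω hω => ?_) (fun ω₁ hω₁ ω₂ hω₂ => ?_)).trans ?_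
  · refine le_trans ?_ (mul_le_mul_right (le_supPart hω) _)
    refine decayNorm_le_of_hatBlock_le' fun l α β => ?_
    rw [hatBlock_trigOp]
    by_cases hle : jap3 l α β ≤ N
    · rw [if_pos hle]
      calc wt s l α β * hsENorm (M ω l α β)
          ≤ wt s l α β * (g * wt m l α β * hsENorm (hatBlock (G ω) l α β)) :=
            mul_le_mul_right (h1 ω hω l α β hle) _
        _ = g * (wt m l α β * wt s l α β) * hsENorm (hatBlock (G ω) l α β) := by ring
        _ ≤ g * (K * wt t l α β) * hsENorm (hatBlock (G ω) l α β) :=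
            mul_le_mul_left (mul_le_mul_right (hK l α β hle) _) _
        _ = _ := by ring
    · rw [if_neg hle, hsENorm_zero, mul_zero]
      exact zero_le
  · have key : decayNorm s (trigOp N (M ω₁) - trigOp N (M ω₂)) ≤
        g * K * decayNorm t (G ω₁ - G ω₂) +
          (3 * g * g * K * edist ω₁ ω₂) * decayNorm t (G ω₂) := by
      refine decayNorm_le_of_hatBlock_le fun l α β => ?_
      rw [hatBlock_sub (continuous_trigOp _ _) (continuous_trigOp _ _), hatBlock_trigOp,
        hatBlock_trigOp, hatBlock_sub (hG ω₁ hω₁) (hG ω₂ hω₂)]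
      by_cases hle : jap3 l α β ≤ N
      · rw [if_pos hle, if_pos hle]
        refine (mul_le_mul_right (h2 ω₁ hω₁ ω₂ hω₂ l α β hle) _).trans ?_
        set x := hsENorm (hatBlock (G ω₁) l α β - hatBlock (G ω₂) l α β)
        set y := hsENorm (hatBlock (G ω₂) l α β)
        calc wt s l α β * (g * wt m l α β * x + 3 * g * g * wt m l α β * edist ω₁ ω₂ * y)
            = g * (wt m l α β * wt s l α β) * x +
              3 * g * g * (wt m l α β * wt s l α β) * edist ω₁ ω₂ * y := by ring
          _ ≤ g * (K * wt t l α β) * x + 3 * g * g * (K * wt t l α β) * edist ω₁ ω₂ * y := by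
              have := hK l α β hle
              gcongr
          _ = _ := by ring
      · rw [if_neg hle, if_neg hle, sub_zero, hsENorm_zero, mul_zero]
        exact zero_le
    refine key.trans ?_
    rw [add_mul]
    refine add_le_add ?_ ?_
    · rw [mul_assoc (g * K)]
      exact mul_le_mul_right (le_lipPart (decayNorm_zero t) hω₁ hω₂) _
    · refine (mul_le_mul_right (le_supPart hω₂) _).trans (le_of_eq (by ring))
  · rw [lipNorm_eq]
    set a := supPart S (decayNorm t) G
    set b := lipPart S (decayNorm t) G
    calc g * K * a + ENNReal.ofReal γ * (g * K * b + 3 * g * g * K * a)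
        = g * K * a + ENNReal.ofReal γ * g * K * b + 3 * (ENNReal.ofReal γ * g) * g * K * a := by
          ring
      _ = 4 * g * K * a + 1 * (K * b) := by rw [hg]; ring
      _ ≤ 4 * g * K * a + 4 * (g * ENNReal.ofReal γ) * (K * b) := by
          rw [mul_comm g, hg, mul_one]
          gcongr
          norm_num
      _ = 4 * g * K * (a + ENNReal.ofReal γ * b) := by ring

/-- The power of `⟨ℓ, α, β⟩` that is lost in the homological equation. -/
def lossExp (τ e : ℝ) : ℝ := 2 * τ + 4 * e + 1

/-- Estimate of the solution of the homological equation. -/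
theorem decayLip_generator_le (hγ : 0 < γ) (hτ : 0 ≤ τ) (he : 0 ≤ e)
    (hmel : ∀ ω ∈ S, MelnikovCond γ τ e N (D ω) ω) (hD : ∀ ω ∈ S, ∀ α, (D ω α).IsHermitian)
    (hlip : ∀ ω₁ ∈ S, ∀ ω₂ ∈ S, ∀ (α β : Spec d) (X : Block α β),
      hsENorm ((D ω₁ α - D ω₂ α) * X) ≤ edist ω₁ ω₂ * hsENorm X)
    (hF : ContOn S F) {s t : ℝ} {K : ℝ≥0∞}
    (hK : ∀ (l : Fin ν → ℤ) (α β : Spec d), jap3 l α β ≤ N →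
      wt (lossExp τ e) l α β * wt s l α β ≤ K * wt t l α β) :
    decayLip γ S s (fun ω => generator N (D ω) ω (F ω)) ≤
      4 * ENNReal.ofReal γ⁻¹ * K * decayLip γ S t F := by
  set g := ENNReal.ofReal γ⁻¹
  have hγ' : 0 ≤ γ⁻¹ := inv_nonneg.mpr hγ.le
  have hb : ∀ (l : Fin ν → ℤ) (α β : Spec d) (r : ℝ), r ≤ γ⁻¹ * jap3 l α β ^ (τ + 2 * e) →
      ENNReal.ofReal r ≤ g * wt (τ + 2 * e) l α β := fun l α β r hr => by
    rw [wt, ← ENNReal.ofReal_mul hγ']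
    exact ENNReal.ofReal_le_ofReal hr
  have hle : ∀ (l : Fin ν → ℤ) (α β : Spec d),
      wt (τ + 2 * e) l α β ≤ wt (lossExp τ e) l α β := fun l α β =>
    wt_mono (by unfold lossExp; linarith) l α β
  -- `L⁻¹` varies with `ω` through two inverses and the variation `⟨ℓ, α, β⟩` of `L`, which together
  -- lose the power `2 (τ + 2 e) + 1`
  have hsq : ∀ (l : Fin ν → ℤ) (α β : Spec d),
      wt (τ + 2 * e) l α β * ENNReal.ofReal (jap3 l α β) * wt (τ + 2 * e) l α β =
        wt (lossExp τ e) l α β := fun l α β => by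
    have : ENNReal.ofReal (jap3 l α β) = wt 1 l α β := by rw [wt, Real.rpow_one]
    rw [this, ← wt_add, ← wt_add]
    congr 1
    unfold lossExp
    ring
  have hI : ∀ {α β : Spec d} (Y : Block α β), hsENorm ((-Complex.I) • Y) = hsENorm Y := fun Y => by
    rw [hsENorm_smul]
    simp [enorm_eq_nnnorm]
  have single : ∀ {α β : Spec d} {L : Block α β →ₗ[ℂ] Block α β} {r : ℝ} (l : Fin ν → ℤ)
      (_ : InvBound L r) (_ : r ≤ γ⁻¹ * jap3 l α β ^ (τ + 2 * e)) (Y : Block α β),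
      hsENorm (Ring.inverse L ((-Complex.I) • Y)) ≤ g * wt (lossExp τ e) l α β * hsENorm Y :=
    fun l hL hr Y => by
      refine (hL.hsENorm_inverse_le _).trans ?_
      rw [hI]
      exact mul_le_mul_left ((hb l _ _ _ hr).trans (mul_le_mul_right (hle l _ _) _)) _
  have diff : ∀ {α β : Spec d} {L₁ L₂ : Block α β →ₗ[ℂ] Block α β} {r : ℝ} (l : Fin ν → ℤ)
      (ω₁ ω₂ : Freq ν) (_ : InvBound L₁ r) (_ : InvBound L₂ r)
      (_ : r ≤ γ⁻¹ * jap3 l α β ^ (τ + 2 * e))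
      (_ : ∀ X, hsENorm (L₁ X - L₂ X) ≤
        3 * ENNReal.ofReal (jap3 l α β) * edist ω₁ ω₂ * hsENorm X) (Y₁ Y₂ : Block α β),
      hsENorm (Ring.inverse L₁ ((-Complex.I) • Y₁) - Ring.inverse L₂ ((-Complex.I) • Y₂)) ≤
        g * wt (lossExp τ e) l α β * hsENorm (Y₁ - Y₂) +
          3 * g * g * wt (lossExp τ e) l α β * edist ω₁ ω₂ * hsENorm Y₂ :=
    fun {α β L₁ L₂ r} l ω₁ ω₂ hL₁ hL₂ hr hκ Y₁ Y₂ => by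
      refine (hL₁.hsENorm_inverse_sub_le hL₂ hκ _ _).trans ?_
      rw [← smul_sub, hI, hI]
      have h3 := hb l _ _ _ hr
      refine add_le_add (mul_le_mul_left (h3.trans (mul_le_mul_right (hle l _ _) _)) _)
        (mul_le_mul_left ?_ _)
      calc ENNReal.ofReal r * (3 * ENNReal.ofReal (jap3 l α β) * edist ω₁ ω₂) * ENNReal.ofReal r
          ≤ (g * wt (τ + 2 * e) l α β) * (3 * ENNReal.ofReal (jap3 l α β) * edist ω₁ ω₂) *
            (g * wt (τ + 2 * e) l α β) := by gcongr
        _ = 3 * g * g * (wt (τ + 2 * e) l α β * ENNReal.ofReal (jap3 l α β) *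
              wt (τ + 2 * e) l α β) * edist ω₁ ω₂ := by ring
        _ = _ := by rw [hsq]
  have c11 : ∀ ω ∈ S, Continuous fun φ => entry11 (F ω φ) := fun ω hω => ((hF ω hω).ent false false).1
  have c12 : ∀ ω ∈ S, Continuous fun φ => entry12 (F ω φ) := fun ω hω => ((hF ω hω).ent false true).1
  have mel : ∀ ω₁ ∈ S, ∀ ω₂ ∈ S, ∀ (l : Fin ν → ℤ) (α β : Spec d) (X : Block α β), _ :=
    fun ω₁ h₁ ω₂ h₂ l α β X =>
      hsENorm_melnikov_sub_le (hD ω₁ h₁) (hD ω₂ h₂) (hlip ω₁ h₁ ω₂ h₂) l α β X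
  unfold decayLip generator
  simp only [entry11_realOp, entry12_realOp]
  rw [mul_add]
  refine add_le_add ?_ ?_
  · refine lipNorm_trigOp_le (m := lossExp τ e) hγ c11 hK (fun ω hω l α β hN => ?_)
      (fun ω₁ h₁ ω₂ h₂ l α β hN => ?_)
    · by_cases h0 : l = 0 ∧ α = β
      · rw [genBlock11, if_pos h0, hsENorm_zero]
        exact zero_le
      · rw [genBlock11, if_neg h0]
        exact single l ((hmel ω hω).1 l α β h0 hN) (melnikov_bound_le hγ hτ he l α β).1 _
    · by_cases h0 : l = 0 ∧ α = β
      · rw [genBlock11, genBlock11, if_pos h0, if_pos h0, sub_zero, hsENorm_zero]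
        exact zero_le
      · rw [genBlock11, genBlock11, if_neg h0, if_neg h0]
        exact diff l ω₁ ω₂ ((hmel ω₁ h₁).1 l α β h0 hN) ((hmel ω₂ h₂).1 l α β h0 hN)
          (melnikov_bound_le hγ hτ he l α β).1 (fun X => (mel ω₁ h₁ ω₂ h₂ l α β X).1) _ _
  · refine lipNorm_trigOp_le (m := lossExp τ e) hγ c12 hK (fun ω hω l α β hN => ?_)
      (fun ω₁ h₁ ω₂ h₂ l α β hN => ?_)
    · exact single l ((hmel ω hω).2 l α β hN) (melnikov_bound_le hγ hτ he l α β).2 _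
    · exact diff l ω₁ ω₂ ((hmel ω₁ h₁).2 l α β hN) ((hmel ω₂ h₂).2 l α β hN)
        (melnikov_bound_le hγ hτ he l α β).2 (fun X => (mel ω₁ h₁ ω₂ h₂ l α β X).2) _ _

/-- Norms of families that are obtained by a selection of Fourier blocks. -/
theorem lipNorm_le_of_select {T G : Freq ν → (Fin ν → ℝ) → Op d}
    (hT : ∀ ω ∈ S, Continuous (T ω)) (hG : ∀ ω ∈ S, Continuous (G ω))
    {P : (Fin ν → ℤ) → Spec d → Spec d → Prop} {s t : ℝ} {c : ℝ≥0∞}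
    (h1 : ∀ ω ∈ S, ∀ l α β, P l α β → hatBlock (T ω) l α β = hatBlock (G ω) l α β)
    (h0 : ∀ ω ∈ S, ∀ l α β, ¬P l α β → hatBlock (T ω) l α β = 0)
    (hw : ∀ l α β, P l α β → wt s l α β ≤ c * wt t l α β) :
    lipNorm γ S (decayNorm s) T ≤ c * lipNorm γ S (decayNorm t) G := by
  refine lipNorm_le_of_le' (decayNorm_zero t) (fun ω hω => ?_) (fun ω₁ hω₁ ω₂ hω₂ => ?_)
  · refine decayNorm_le_of_hatBlock_le' fun l α β => ?_
    by_cases hP : P l α β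
    · rw [h1 ω hω l α β hP, ← mul_assoc]
      exact mul_le_mul_left (hw l α β hP) _
    · rw [h0 ω hω l α β hP, hsENorm_zero, mul_zero]
      exact zero_le
  · refine decayNorm_le_of_hatBlock_le' fun l α β => ?_
    rw [hatBlock_sub (hT ω₁ hω₁) (hT ω₂ hω₂), hatBlock_sub (hG ω₁ hω₁) (hG ω₂ hω₂)]
    by_cases hP : P l α β
    · rw [h1 ω₁ hω₁ l α β hP, h1 ω₂ hω₂ l α β hP, ← mul_assoc]
      exact mul_le_mul_left (hw l α β hP) _
    · rw [h0 ω₁ hω₁ l α β hP, h0 ω₂ hω₂ l α β hP, sub_zero, hsENorm_zero, mul_zero]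
      exact zero_le

theorem torusCont_truncOp (N : ℝ) (F : (Fin ν → ℝ) → Op2 d) : TorusCont (truncOp N F) :=
  torusCont_realTrigOp N _ _

theorem torusCont_generator (N : ℝ) (D : BlockDiag d) (ω : Freq ν) (F : (Fin ν → ℝ) → Op2 d) :
    TorusCont (generator N D ω F) :=
  torusCont_realTrigOp N _ _

/-- Smoothing estimate for the high modes. -/
theorem decayLip_sub_truncOp_le (hF : ContOn S F) (hN : 0 < N) (s : ℝ) {b : ℝ} (hb : 0 ≤ b) :
    decayLip γ S s (fun ω φ => F ω φ - truncOp N (F ω) φ) ≤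
      ENNReal.ofReal (N ^ (-b)) * decayLip γ S (s + b) F := by
  have hw : ∀ (l : Fin ν → ℤ) (α β : Spec d), ¬jap3 l α β ≤ N →
      wt s l α β ≤ ENNReal.ofReal (N ^ (-b)) * wt (s + b) l α β := fun l α β h => by
    have h1 : wt (-b) l α β ≤ ENNReal.ofReal (N ^ (-b)) :=
      ENNReal.ofReal_le_ofReal (Real.rpow_le_rpow_of_nonpos hN (not_le.mp h).le (by linarith))
    refine le_trans (le_of_eq ?_) (mul_le_mul_left h1 _)
    rw [← wt_add]
    congr 1
    ring
  have c11 : ∀ ω ∈ S, Continuous fun φ => entry11 (F ω φ) := fun ω hω => ((hF ω hω).ent false false).1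
  have c12 : ∀ ω ∈ S, Continuous fun φ => entry12 (F ω φ) := fun ω hω => ((hF ω hω).ent false true).1
  have d11 : ∀ ω φ, entry11 (F ω φ - truncOp N (F ω) φ) =
      entry11 (F ω φ) - trigOp N (block11 (F ω)) φ := fun ω φ => by
    rw [← ent_false_false, map_sub, ent_false_false, ent_false_false, truncOp, entry11_realOp]
  have d12 : ∀ ω φ, entry12 (F ω φ - truncOp N (F ω) φ) =
      entry12 (F ω φ) - trigOp N (block12 (F ω)) φ := fun ω φ => by
    rw [← ent_false_true, map_sub, ent_false_true, ent_false_true, truncOp, entry12_realOp]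
  unfold decayLip
  simp only [d11, d12]
  rw [mul_add]
  refine add_le_add
    (lipNorm_le_of_select (fun ω hω => (c11 ω hω).sub (continuous_trigOp _ _)) c11
      (P := fun l α β => ¬jap3 l α β ≤ N) (fun ω hω l α β hP => ?_) (fun ω hω l α β hP => ?_) hw)
    (lipNorm_le_of_select (fun ω hω => (c12 ω hω).sub (continuous_trigOp _ _)) c12
      (P := fun l α β => ¬jap3 l α β ≤ N) (fun ω hω l α β hP => ?_) (fun ω hω l α β hP => ?_) hw)
  · refine (hatBlock_sub (c11 ω hω) (continuous_trigOp _ _) l α β).trans ?_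
    rw [hatBlock_trigOp, if_neg hP, sub_zero]
  · refine (hatBlock_sub (c11 ω hω) (continuous_trigOp _ _) l α β).trans ?_
    rw [hatBlock_trigOp, if_pos (not_not.mp hP)]
    exact sub_self _
  · refine (hatBlock_sub (c12 ω hω) (continuous_trigOp _ _) l α β).trans ?_
    rw [hatBlock_trigOp, if_neg hP, sub_zero]
  · refine (hatBlock_sub (c12 ω hω) (continuous_trigOp _ _) l α β).trans ?_
    rw [hatBlock_trigOp, if_pos (not_not.mp hP)]
    exact sub_self _

/-- The truncation without the resonant part selects Fourier blocks, hence its norm is at most the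
norm of `F`. -/
theorem decayLip_truncOp_sub_meanOp_le (hF : ContOn S F) (hN : 1 ≤ N) (s : ℝ) :
    decayLip γ S s (fun ω φ => truncOp N (F ω) φ - meanOp N (F ω)) ≤ decayLip γ S s F := by
  have c11 : ∀ ω ∈ S, Continuous fun φ => entry11 (F ω φ) := fun ω hω => ((hF ω hω).ent false false).1
  have c12 : ∀ ω ∈ S, Continuous fun φ => entry12 (F ω φ) := fun ω hω => ((hF ω hω).ent false true).1
  have d11 : ∀ ω φ, entry11 (truncOp N (F ω) φ - meanOp N (F ω)) =
      trigOp N (fun l α β => block11 (F ω) l α β -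
        if l = 0 ∧ α = β then block11 (F ω) l α β else 0) φ := fun ω φ => by
    rw [← ent_false_false, map_sub, ent_false_false, ent_false_false, truncOp, entry11_realOp,
      meanOp_eq_realTrigOp hN (F ω) φ, entry11_realOp, ← trigOp_sub]
  have d12 : ∀ ω φ, entry12 (truncOp N (F ω) φ - meanOp N (F ω)) =
      trigOp N (block12 (F ω)) φ := fun ω φ => by
    rw [← ent_false_true, map_sub, ent_false_true, ent_false_true, truncOp, entry12_realOp,
      meanOp, entry12_realOp, sub_zero]
  unfold decayLip
  simp only [d11, d12]
  refine add_le_add ?_ ?_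
  · refine (lipNorm_le_of_select (fun ω hω => continuous_trigOp _ _) c11 (s := s) (t := s) (c := 1)
      (P := fun l α β => jap3 l α β ≤ N ∧ ¬(l = 0 ∧ α = β)) (fun ω hω l α β hP => ?_)
      (fun ω hω l α β hP => ?_) fun l α β _ => (one_mul _).ge).trans (one_mul _).le
    · refine (hatBlock_trigOp N _ l α β).trans ?_
      rw [if_pos hP.1, if_neg hP.2, sub_zero]
      rfl
    · refine (hatBlock_trigOp N _ l α β).trans ?_
      by_cases hle : jap3 l α β ≤ N
      · rw [if_pos hle, if_pos (not_not.mp fun h => hP ⟨hle, h⟩), sub_self]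
      · rw [if_neg hle]
  · refine (lipNorm_le_of_select (fun ω hω => continuous_trigOp _ _) c12 (s := s) (t := s) (c := 1)
      (P := fun l α β => jap3 l α β ≤ N) (fun ω hω l α β hP => ?_)
      (fun ω hω l α β hP => ?_) fun l α β _ => (one_mul _).ge).trans (one_mul _).le
    · refine (hatBlock_trigOp N _ l α β).trans ?_
      rw [if_pos hP]
      rfl
    · refine (hatBlock_trigOp N _ l α β).trans ?_
      rw [if_neg hP]

/-- The average of the diagonal blocks decays in `α`. -/
theorem lipNorm_block11_le (hF : ContOn S F) (s : ℝ) (α : Spec d) :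
    lipNorm γ S hsENorm (fun ω => block11 (F ω) 0 α α) ≤
      ENNReal.ofReal (α.1 ^ (-s)) * decayLip γ S s F := by
  have c11 : ∀ ω ∈ S, Continuous fun φ => entry11 (F ω φ) := fun ω hω => ((hF ω hω).ent false false).1
  have hw : ENNReal.ofReal (α.1 ^ (-s)) * wt s (0 : Fin ν → ℤ) α α = 1 := by
    have h0 : jap3 (0 : Fin ν → ℤ) α α = α.1 := by
      have h1 : jap (0 : Fin ν → ℤ) = 1 := by simp [jap, intNorm]
      rw [jap3, h1, max_self, max_eq_right α.one_le]
    rw [wt, h0, ← ENNReal.ofReal_mul (Real.rpow_nonneg α.pos.le _), ← Real.rpow_add α.pos,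
      neg_add_cancel, Real.rpow_zero, ENNReal.ofReal_one]
  have key : ∀ G : (Fin ν → ℝ) → Op d, hsENorm (hatBlock G 0 α α) ≤
      ENNReal.ofReal (α.1 ^ (-s)) * decayNorm s G := fun G => by
    refine le_trans (le_of_eq ?_) (mul_le_mul_right (wt_mul_hsENorm_le s G 0 α α) _)
    rw [← mul_assoc, hw, one_mul]
  refine (lipNorm_le_of_le' (n' := decayNorm s) (g := fun ω φ => entry11 (F ω φ)) (decayNorm_zero s)
    (fun ω hω => key _) (fun ω₁ h₁ ω₂ h₂ => ?_)).trans (mul_le_mul_right le_self_add _)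
  refine le_trans (le_of_eq ?_) (key _)
  rw [hatBlock_sub (c11 ω₁ h₁) (c11 ω₂ h₂)]

end GeneratorEstimates

/-! ### The push-forward by the exponential of the generator -/

section PushForward

variable {ν d : ℕ} {γ τ e N : ℝ}

theorem trigOp_apply_eq_zero (M : (Fin ν → ℤ) → (α β : Spec d) → Block α β) (φ : Fin ν → ℝ)
    {u : L20 d} (h : ∀ j ∈ modesLE d N, u j = 0) : trigOp N M φ u = 0 := by
  rw [trigOp, sum_apply]
  refine Finset.sum_eq_zero fun l _ => ?_
  rw [sum_apply]
  refine Finset.sum_eq_zero fun j _ => ?_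
  rw [sum_apply]
  refine Finset.sum_eq_zero fun j' hj' => ?_
  rw [smul_apply, rankOne_apply, h j' hj', zero_smul, smul_zero]

theorem trigOp_apply_of_notMem (M : (Fin ν → ℤ) → (α β : Spec d) → Block α β) (φ : Fin ν → ℝ)
    (u : L20 d) {k : Modes d} (hk : k ∉ modesLE d N) : trigOp N M φ u k = 0 := by
  rw [← evalCLM_apply, trigOp, sum_apply, map_sum]
  refine Finset.sum_eq_zero fun l _ => ?_
  rw [sum_apply, map_sum]
  refine Finset.sum_eq_zero fun j hj => ?_
  rw [sum_apply, map_sum]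
  refine Finset.sum_eq_zero fun j' _ => ?_
  rw [smul_apply, rankOne_apply, map_smul, map_smul, evalCLM_apply, basisVec_apply, if_neg]
  · simp
  · rintro rfl
    exact hk hj

theorem neg_mem_modesLE {j : Modes d} : -j ∈ modesLE d N ↔ j ∈ modesLE d N := by
  rw [mem_modesLE, mem_modesLE]
  exact iff_of_eq (congrArg (· ≤ N) (intNorm_neg j.1))

theorem realOp_fst (R₁ R₂ : Op d) (w : L20 d × L20 d) :
    (realOp R₁ R₂ w).1 = R₁ w.1 + R₂ w.2 := by
  change ((placeCLM false false R₁ + placeCLM false true R₂) w +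
    (placeCLM true false (conjOp R₂) + placeCLM true true (conjOp R₁)) w).1 = _
  simp [add_apply, placeCLM, injCLM, projCLM]

theorem realOp_snd (R₁ R₂ : Op d) (w : L20 d × L20 d) :
    (realOp R₁ R₂ w).2 = conjOp R₂ w.1 + conjOp R₁ w.2 := by
  change ((placeCLM false false R₁ + placeCLM false true R₂) w +
    (placeCLM true false (conjOp R₂) + placeCLM true true (conjOp R₁)) w).2 = _
  simp [add_apply, placeCLM, injCLM, projCLM]

theorem realTrigOp_apply_eq_zero (M M' : (Fin ν → ℤ) → (α β : Spec d) → Block α β)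
    (φ : Fin ν → ℝ) {w : L20 d × L20 d} (h1 : ∀ j ∈ modesLE d N, w.1 j = 0)
    (h2 : ∀ j ∈ modesLE d N, w.2 j = 0) : realOp (trigOp N M φ) (trigOp N M' φ) w = 0 := by
  have hc : ∀ {u : L20 d}, (∀ j ∈ modesLE d N, u j = 0) → ∀ j ∈ modesLE d N, conjL u j = 0 :=
    fun h j hj => by rw [conjL_apply, h _ (neg_mem_modesLE.mpr hj), map_zero]
  refine Prod.ext ?_ ?_
  · rw [realOp_fst, trigOp_apply_eq_zero M φ h1, trigOp_apply_eq_zero M' φ h2]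
    exact add_zero 0
  · rw [realOp_snd, conjOp_apply, conjOp_apply, trigOp_apply_eq_zero M φ (hc h2),
      trigOp_apply_eq_zero M' φ (hc h1), conjL_zero]
    exact add_zero 0

theorem realTrigOp_apply_of_notMem (M M' : (Fin ν → ℤ) → (α β : Spec d) → Block α β)
    (φ : Fin ν → ℝ) (w : L20 d × L20 d) {k : Modes d} (hk : k ∉ modesLE d N) :
    (realOp (trigOp N M φ) (trigOp N M' φ) w).1 k = 0 ∧
      (realOp (trigOp N M φ) (trigOp N M' φ) w).2 k = 0 := by
  constructor
  · rw [realOp_fst, ← evalCLM_apply, map_add, evalCLM_apply, evalCLM_apply,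
      trigOp_apply_of_notMem M φ _ hk, trigOp_apply_of_notMem M' φ _ hk, add_zero]
  · have hk' : -k ∉ modesLE d N := fun h => hk (neg_mem_modesLE.mp h)
    rw [realOp_snd, ← evalCLM_apply, map_add, evalCLM_apply, evalCLM_apply, conjOp_apply,
      conjOp_apply, conjL_apply, conjL_apply, trigOp_apply_of_notMem M φ _ hk',
      trigOp_apply_of_notMem M' φ _ hk', map_zero, add_zero]

/-- The exponential fixes the kernel. -/
theorem exp_apply_of_apply_eq_zero {X : Op2 d} {w : L20 d × L20 d} (h : X w = 0) :
    NormedSpace.exp X w = w := by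
  have h1 : HasSum (fun n => ((n.factorial : ℂ)⁻¹ • X ^ n) w) (NormedSpace.exp X w) :=
    (hasSum_exp X).mapL (ContinuousLinearMap.apply ℂ (L20 d × L20 d) w)
  refine h1.unique ?_
  have h2 := hasSum_single (f := fun n => ((n.factorial : ℂ)⁻¹ • X ^ n) w) 0 fun n hn => by
    obtain ⟨m, rfl⟩ := Nat.exists_eq_succ_of_ne_zero hn
    rw [smul_apply, pow_succ, mul_apply_eq_comp, h, map_zero, smul_zero]
  simpa using h2

/-- The exponential does not change the functionals that vanish on the range; applied to Fourier
coefficients outside the truncation. -/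
theorem map_exp_apply {X : Op2 d} {f : (L20 d × L20 d) →L[ℂ] ℂ} (h : ∀ w, f (X w) = 0)
    (w : L20 d × L20 d) : f (NormedSpace.exp X w) = f w := by
  have h1 : HasSum (fun n => f (((n.factorial : ℂ)⁻¹ • X ^ n) w)) (f (NormedSpace.exp X w)) :=
    (hasSum_exp X).mapL (f.comp (ContinuousLinearMap.apply ℂ (L20 d × L20 d) w))
  refine h1.unique ?_
  have h2 := hasSum_single (f := fun n => f (((n.factorial : ℂ)⁻¹ • X ^ n) w)) 0 fun n hn => by
    obtain ⟨m, rfl⟩ := Nat.exists_eq_succ_of_ne_zero hn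
    rw [smul_apply, pow_succ', mul_apply_eq_comp, map_smul, h, smul_zero]
  simpa using h2

theorem blockApply_add (B : BlockDiag d) (u v : Modes d → ℂ) :
    blockApply B (u + v) = blockApply B u + blockApply B v := by
  funext j
  simp [blockApply, mul_add, Finset.sum_add_distrib]

theorem blockApply_smul_left (c : ℂ) (B : BlockDiag d) (u : Modes d → ℂ) (j : Modes d) :
    blockApply (fun α => c • B α) u j = c * blockApply B u j := by
  simp [blockApply, Finset.mul_sum, mul_assoc]

theorem blockApply_eq_zero (B : BlockDiag d) {u : Modes d → ℂ} {j : Modes d}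
    (h : ∀ k : Shell j.level, u k.1 = 0) : blockApply B u j = 0 :=
  Finset.sum_eq_zero fun k _ => by rw [h, mul_zero]

theorem shell_mem_modesLE {j : Modes d} (k : Shell j.level) :
    k.1 ∈ modesLE d N ↔ j ∈ modesLE d N := by
  rw [mem_modesLE, mem_modesLE]
  exact iff_of_eq (congrArg (· ≤ N) k.2)

/-- Block-diagonal operators that are scalar, with a bound linear in `α`, on all but finitely many
shells. They map `H¹₀` into `L²₀`; every normal form of the scheme is of this kind, because a step
changes finitely many blocks. -/
def IsAlmostScalar (D : BlockDiag d) : Prop :=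
  ∃ C M : ℝ, ∀ α : Spec d, M < α.1 → ∃ c : ℂ, D α = c • (1 : Block α α) ∧ ‖c‖ ≤ C * α.1

theorem blockApply_of_eq_smul_one {D : BlockDiag d} {j : Modes d} {c : ℂ}
    (h : D j.level = c • (1 : Block j.level j.level)) (u : Modes d → ℂ) :
    blockApply D u j = c * u j := by
  have h1 : ∀ k : Shell j.level, D j.level j.self k * u k.1 = if j.self = k then c * u k.1 else 0 :=
    fun k => by
      rw [h, Matrix.smul_apply, Matrix.one_apply]
      split_ifs <;> simp
  rw [blockApply, Finset.sum_congr rfl fun k _ => h1 k, Finset.sum_ite_eq,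
    if_pos (Finset.mem_univ _)]
  rfl

theorem IsAlmostScalar.exists_blockApply {D : BlockDiag d} (hD : IsAlmostScalar D) {u : L20 d}
    (hu : MemH1 u) : ∃ y : L20 d, (y : Modes d → ℂ) = blockApply D u := by
  obtain ⟨C, M, h⟩ := hD
  have hsum : Summable fun j : Modes d => ‖blockApply D u j‖ ^ (2 : ℝ) := by
    refine Summable.of_norm_bounded_eventually (hu.mul_left (C ^ 2)) ?_
    refine (finite_modes_le d M).subset fun j hj => ?_
    by_contra hM
    refine hj ?_
    obtain ⟨c, hc, hc'⟩ := h j.level (not_le.mp hM)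
    change ‖‖blockApply D u j‖ ^ (2 : ℝ)‖ ≤ C ^ 2 * (intNorm j.1 * ‖u j‖) ^ 2
    rw [blockApply_of_eq_smul_one hc, norm_mul, Real.rpow_two, norm_pow, norm_mul, norm_norm,
      norm_norm, mul_pow ‖c‖, mul_pow (intNorm j.1), ← mul_assoc, ← mul_pow C]
    exact mul_le_mul_of_nonneg_right (pow_le_pow_left₀ (norm_nonneg _) hc' 2) (sq_nonneg _)
  have h2 : (2 : ℝ≥0∞).toReal = 2 := by norm_num
  exact ⟨⟨blockApply D u, (memℓp_gen_iff (p := 2) (by norm_num)).mpr (by rw [h2]; exact hsum)⟩, rfl⟩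

theorem IsAlmostScalar.conjBlock {D : BlockDiag d} (hD : IsAlmostScalar D) :
    IsAlmostScalar fun α => conjBlock (D α) := by
  obtain ⟨C, M, h⟩ := hD
  refine ⟨C, M, fun α hα => ?_⟩
  obtain ⟨c, hc, hc'⟩ := h α hα
  refine ⟨starRingEnd ℂ c, ?_, by rwa [RCLike.norm_conj]⟩
  change KAM.conjBlock (D α) = _
  rw [hc, conjBlock_smul]
  congr 1
  ext j j'
  change starRingEnd ℂ ((1 : Block α α) j.neg j'.neg) = _
  rw [Matrix.one_apply, Matrix.one_apply]
  have : j.neg = j'.neg ↔ j = j' := (Shell.negEquiv α).injective.eq_iff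
  simp [this]

theorem MemH1.of_eq_off_finite {u v : L20 d} (hu : MemH1 u) (h : ∀ j, j ∉ modesLE d N → v j = u j) :
    MemH1 v := by
  refine Summable.of_norm_bounded_eventually hu ?_
  refine (modesLE d N).finite_toSet.subset fun j hj => ?_
  by_contra hM
  refine hj ?_
  change ‖(intNorm j.1 * ‖v j‖) ^ 2‖ ≤ (intNorm j.1 * ‖u j‖) ^ 2
  rw [h j hM, Real.norm_of_nonneg (by positivity)]

/-- The diagonal part after one step. -/
def nextDiag (N : ℝ) (D : BlockDiag d) (F : (Fin ν → ℝ) → Op2 d) : BlockDiag d := fun α =>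
  if α.1 ≤ N then D α + Complex.I • block11 F 0 α α else D α

/-- The operator `ΠF - Z` that the generator removes: the low modes of `F` without their resonant
part. -/
def homRhs (N : ℝ) (F : (Fin ν → ℝ) → Op2 d) (φ : Fin ν → ℝ) : Op2 d :=
  truncOp N F φ - meanOp N F

/-- The perturbation after one step. -/
def nextPert (N : ℝ) (D : BlockDiag d) (ω : Freq ν) (F : (Fin ν → ℝ) → Op2 d)
    (φ : Fin ν → ℝ) : Op2 d :=
  NormedSpace.exp (-generator N D ω F φ) * F φ * NormedSpace.exp (generator N D ω F φ) -
    NormedSpace.exp (-generator N D ω F φ) * dexp (generator N D ω F φ) (homRhs N F φ) - meanOp N F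

theorem nextDiag_isHermitian {D : BlockDiag d} (hD : ∀ α, (D α).IsHermitian)
    {F : (Fin ν → ℝ) → Op2 d} (hF : ∀ φ, IsHamiltonian (F φ)) (α : Spec d) :
    (nextDiag N D F α).IsHermitian := by
  unfold nextDiag
  split_ifs
  · refine (hD α).add ?_
    have h := block11_of_isHamiltonian hF 0 α α
    rw [neg_zero] at h
    have h2 : (block11 F 0 α α).conjTranspose = -block11 F 0 α α := by
      rw [eq_neg_iff_add_eq_zero, add_comm, ← eq_neg_iff_add_eq_zero]
      exact h
    rw [Matrix.IsHermitian, Matrix.conjTranspose_smul, h2]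
    simp
  · exact hD α

theorem IsAlmostScalar.nextDiag {D : BlockDiag d} (hD : IsAlmostScalar D) (N : ℝ)
    (F : (Fin ν → ℝ) → Op2 d) : IsAlmostScalar (nextDiag N D F) := by
  obtain ⟨C, M, h⟩ := hD
  refine ⟨C, max M N, fun α hα => ?_⟩
  rw [max_lt_iff] at hα
  rw [KAM.nextDiag, if_neg (not_le.mpr hα.2)]
  exact h α hα.1

theorem isHamiltonian_nextPert {D : BlockDiag d} (hD : ∀ α, (D α).IsHermitian) (hN : 1 ≤ N)
    {F : (Fin ν → ℝ) → Op2 d} (hF : ∀ φ, IsHamiltonian (F φ)) {ω : Freq ν}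
    (h : MelnikovCond γ τ e N D ω) (φ : Fin ν → ℝ) : IsHamiltonian (nextPert N D ω F φ) :=
  have hΨ := isHamiltonian_generator hD h hF φ
  have hZ := isHamiltonian_meanOp hN hF
  ((hΨ.exp_conj (hF φ)).sub (hΨ.exp_mul_dexp ((isHamiltonian_truncOp hF φ).sub hZ))).sub hZ

theorem diagField_apply (N : ℝ) (D : BlockDiag d) (w : L20 d × L20 d) (j : Modes d) :
    (diagField N D w).1 j =
        (if j ∈ modesLE d N then -(Complex.I * blockApply D w.1 j) else 0) ∧
      (diagField N D w).2 j =
        if j ∈ modesLE d N then Complex.I * blockApply (fun α => conjBlock (D α)) w.2 j else 0 := by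
  constructor
  · rw [diagField, realOp_fst]
    change (diagOp N (fun α => (-Complex.I) • D α) w.1 + 0) j = _
    rw [add_zero, diagOp_apply, blockApply_smul_left, neg_mul]
  · rw [diagField, realOp_snd, conjOp_zero, conjOp_diagOp]
    change (0 + diagOp N (fun α => conjBlock ((-Complex.I) • D α)) w.2) j = _
    simp only [conjBlock_smul, map_neg, Complex.conj_I, neg_neg]
    rw [zero_add, diagOp_apply, blockApply_smul_left]

/-- Algebra of one step: on vectors `w`, with `y = D w`, `A` the truncation of `D`, `E = exp Ψ`. -/
theorem pushForward_algebra {A E E' T F : Op2 d} (hE : E' * E = 1) {w y : L20 d × L20 d}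
    (hy : E' (y - A w) = y - A w) :
    E' (y + A (E w - w) + F (E w)) - E' (T w) =
      y + (E' * F * E) w + (E' * (A * E - E * A - T)) w := by
  have h1 : E' (E (A w)) = A w := by rw [← mul_apply_eq_comp, hE]; rfl
  have h2 : E' y = y - A w + E' (A w) := by
    rw [← hy, ← map_add, sub_add_cancel]
  simp only [map_add, map_sub, mul_apply_eq_comp, sub_apply, h1, h2]
  abel

/-- The exponential of the generator conjugates `D + F` to `nextDiag + nextPert`. -/
theorem isPushForward_exp_generator {D : BlockDiag d} (hD : IsAlmostScalar D) (hN : 1 ≤ N)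
    (F : (Fin ν → ℝ) → Op2 d) {ω : Freq ν} (h : MelnikovCond γ τ e N D ω) :
    IsPushForward ω (fun φ => NormedSpace.exp (generator N D ω F φ)) D F
      (nextDiag N D F) (nextPert N D ω F) := by
  intro φ
  refine ⟨isUnit_exp _, fun w hw1 hw2 => ?_⟩
  set Ψ := generator N D ω F φ with hΨ
  set E := NormedSpace.exp Ψ with hE
  -- `Ψ` acts on finitely many modes only, so `E` is the identity off these modes
  have hoff : ∀ j, j ∉ modesLE d N → (E w).1 j = w.1 j ∧ (E w).2 j = w.2 j := fun j hj => by
    constructor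
    · exact map_exp_apply (f := (evalCLM j).comp (ContinuousLinearMap.fst ℂ _ _))
        (fun w => (realTrigOp_apply_of_notMem _ _ φ w hj).1) w
    · exact map_exp_apply (f := (evalCLM j).comp (ContinuousLinearMap.snd ℂ _ _))
        (fun w => (realTrigOp_apply_of_notMem _ _ φ w hj).2) w
  refine ⟨hw1.of_eq_off_finite fun j hj => (hoff j hj).1,
    hw2.of_eq_off_finite fun j hj => (hoff j hj).2, ?_⟩
  -- `D` is unbounded; on `w` it acts as the vector `y`, and on `E w - w` as its truncation `A`
  obtain ⟨y₁, hy₁⟩ := hD.exists_blockApply hw1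
  obtain ⟨y₂, hy₂⟩ := hD.conjBlock.exists_blockApply hw2
  let y : L20 d × L20 d := ((-Complex.I) • y₁, Complex.I • y₂)
  have hy1 : ∀ j, y.1 j = -(Complex.I * blockApply D w.1 j) := fun j => by
    rw [← congrFun hy₁ j, ← neg_mul]
    rfl
  have hy2 : ∀ j, y.2 j = Complex.I * blockApply (fun α => conjBlock (D α)) w.2 j := fun j => by
    rw [← congrFun hy₂ j]
    rfl
  let A := diagField N D
  have hdiff1 : ∀ j, (E w).1 j = w.1 j + (E w - w).1 j := fun j =>
    (add_sub_cancel (w.1 j) ((E w).1 j)).symm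
  have hdiff2 : ∀ j, (E w).2 j = w.2 j + (E w - w).2 j := fun j =>
    (add_sub_cancel (w.2 j) ((E w).2 j)).symm
  have hz1 : ∀ j, j ∉ modesLE d N → (E w - w).1 j = 0 := fun j hj => sub_eq_zero.mpr (hoff j hj).1
  have hz2 : ∀ j, j ∉ modesLE d N → (E w - w).2 j = 0 := fun j hj => sub_eq_zero.mpr (hoff j hj).2
  refine ⟨y + A (E w - w) + F φ (E w), y + meanOp N F w + nextPert N D ω F φ w, ?_, ?_, ?_⟩
  · refine Prod.ext (funext fun j => ?_) (funext fun j => ?_)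
    · change y.1 j + (A (E w - w)).1 j + (F φ (E w)).1 j =
        -(Complex.I * blockApply D (E w).1 j) + (F φ (E w)).1 j
      have e1 : blockApply D (E w).1 j = blockApply D w.1 j + blockApply D (E w - w).1 j := by
        rw [← Pi.add_apply, ← blockApply_add]
        exact congrArg (fun u => blockApply D u j) (funext hdiff1)
      rw [hy1, e1, (diagField_apply N D _ j).1]
      by_cases hj : j ∈ modesLE d N
      · rw [if_pos hj]
        ring
      · rw [if_neg hj, blockApply_eq_zero D (u := (E w - w).1) (j := j)
          fun k => hz1 k.1 fun hk => hj ((shell_mem_modesLE k).mp hk)]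
        ring
    · change y.2 j + (A (E w - w)).2 j + (F φ (E w)).2 j =
        Complex.I * blockApply (fun α => conjBlock (D α)) (E w).2 j + (F φ (E w)).2 j
      have e1 : blockApply (fun α => conjBlock (D α)) (E w).2 j =
          blockApply (fun α => conjBlock (D α)) w.2 j +
            blockApply (fun α => conjBlock (D α)) (E w - w).2 j := by
        rw [← Pi.add_apply, ← blockApply_add]
        exact congrArg (fun u => blockApply (fun α => conjBlock (D α)) u j) (funext hdiff2)
      rw [hy2, e1, (diagField_apply N D _ j).2]
      by_cases hj : j ∈ modesLE d N
      · rw [if_pos hj]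
        ring
      · rw [if_neg hj, blockApply_eq_zero (fun α => conjBlock (D α)) (u := (E w - w).2) (j := j)
          fun k => hz2 k.1 fun hk => hj ((shell_mem_modesLE k).mp hk)]
        ring
  · have hnext : ∀ j : Modes d, nextDiag N D F j.level = if j ∈ modesLE d N then
        D j.level + Complex.I • block11 F 0 j.level j.level else D j.level := fun j => by
      unfold nextDiag
      refine if_congr ?_ rfl rfl
      rw [mem_modesLE]
      rfl
    have hI : ∀ x : ℂ, Complex.I * (Complex.I * x) = -x := fun x => by
      rw [← mul_assoc, Complex.I_mul_I, neg_one_mul]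
    refine Prod.ext (funext fun j => ?_) (funext fun j => ?_)
    · change y.1 j + (meanOp N F w).1 j + (nextPert N D ω F φ w).1 j =
        -(Complex.I * blockApply (nextDiag N D F) w.1 j) + (nextPert N D ω F φ w).1 j
      congr 1
      have e1 : (meanOp N F w).1 j =
          if j ∈ modesLE d N then blockApply (fun α => block11 F 0 α α) w.1 j else 0 := by
        rw [meanOp, realOp_fst]
        change (diagOp N (fun α => block11 F 0 α α) w.1 + 0) j = _
        rw [add_zero, diagOp_apply]
      rw [hy1, e1]
      simp only [blockApply, hnext]
      by_cases hj : j ∈ modesLE d N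
      · simp only [if_pos hj, Matrix.add_apply, Matrix.smul_apply, add_mul,
          Finset.sum_add_distrib, smul_eq_mul, mul_assoc, ← Finset.mul_sum, mul_add, hI]
        ring
      · simp only [if_neg hj, add_zero]
    · change y.2 j + (meanOp N F w).2 j + (nextPert N D ω F φ w).2 j =
        Complex.I * blockApply (fun α => conjBlock (nextDiag N D F α)) w.2 j +
          (nextPert N D ω F φ w).2 j
      congr 1
      have e1 : (meanOp N F w).2 j = if j ∈ modesLE d N then
          blockApply (fun α => conjBlock (block11 F 0 α α)) w.2 j else 0 := by
        rw [meanOp, realOp_snd, conjOp_zero, conjOp_diagOp]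
        change (0 + diagOp N (fun α => conjBlock (block11 F 0 α α)) w.2) j = _
        rw [zero_add, diagOp_apply]
      rw [hy2, e1]
      simp only [blockApply, hnext]
      by_cases hj : j ∈ modesLE d N
      · have e2 : ∀ k k' : Shell j.level, conjBlock (D j.level + Complex.I • block11 F 0 j.level j.level) k k' =
            conjBlock (D j.level) k k' - Complex.I * conjBlock (block11 F 0 j.level j.level) k k' :=
          fun k k' => by
            change starRingEnd ℂ (D j.level k.neg k'.neg + Complex.I * block11 F 0 j.level j.level k.neg k'.neg) = _
            rw [map_add, map_mul, Complex.conj_I, neg_mul, ← sub_eq_add_neg]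
            rfl
        simp only [if_pos hj, e2, sub_mul, Finset.sum_sub_distrib, mul_assoc,
          ← Finset.mul_sum, mul_sub, hI]
        ring
      · simp only [if_neg hj, add_zero]
  · have hlow : NormedSpace.exp (-Ψ) (y - A w) = y - A w := by
      refine exp_apply_of_apply_eq_zero ?_
      rw [neg_apply, neg_eq_zero]
      refine realTrigOp_apply_eq_zero _ _ φ (fun j hj => ?_) (fun j hj => ?_)
      · change y.1 j - (A w).1 j = 0
        rw [hy1, (diagField_apply N D w j).1, if_pos hj, sub_self]
      · change y.2 j - (A w).2 j = 0
        rw [hy2, (diagField_apply N D w j).2, if_pos hj, sub_self]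
    have hder : omegaDeriv ω (fun φ => NormedSpace.exp (generator N D ω F φ)) φ =
        dexp Ψ (omegaDeriv ω (generator N D ω F) φ) := by
      have h1 : HasFDerivAt (generator N D ω F) (fderiv ℝ (generator N D ω F) φ) φ :=
        ((contDiff_realTrigOp N (genBlock11 D ω F) (genBlock12 D ω F)).differentiable
          one_ne_zero φ).hasFDerivAt
      have h2 := ((differentiableAt_exp Ψ).hasFDerivAt).comp φ h1
      have h3 : fderiv ℝ (fun φ => NormedSpace.exp (generator N D ω F φ)) φ = _ := h2.fderiv
      rw [omegaDeriv, h3, omegaDeriv, ← fderiv_exp_apply]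
      rfl
    have hinv : Ring.inverse E = NormedSpace.exp (-Ψ) := inverse_exp Ψ
    have hcomm : A * E - E * A - omegaDeriv ω (fun φ => NormedSpace.exp (generator N D ω F φ)) φ =
        -dexp Ψ (homRhs N F φ) := by
      rw [hder, hE, dexp_commutator, sub_eq_add_neg, ← dexp_neg, ← dexp_add, ← dexp_neg]
      congr 1
      rw [← sub_eq_add_neg]
      exact homological_equation hN h φ
    change _ = Ring.inverse E _ - Ring.inverse E _
    rw [hinv]
    refine Eq.trans ?_ (pushForward_algebra (exp_neg_mul_exp Ψ) hlow).symm
    rw [hcomm]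
    have e5 : nextPert N D ω F φ w = (NormedSpace.exp (-Ψ) * F φ * E) w -
      (NormedSpace.exp (-Ψ) * dexp Ψ (homRhs N F φ)) w - meanOp N F w := rfl
    have e6 : (NormedSpace.exp (-Ψ) * -dexp Ψ (homRhs N F φ)) w =
        -((NormedSpace.exp (-Ψ) * dexp Ψ (homRhs N F φ)) w) := by
      rw [mul_apply_eq_comp, mul_apply_eq_comp, neg_apply, map_neg]
    rw [e5, e6]
    abel

end PushForward

/-! ### Estimates of one step -/

section StepEstimates

variable {ν d : ℕ} {γ τ e N : ℝ} {S : Set (Freq ν)}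

/-- The constant that makes the weighted norm submultiplicative. -/
def algConst (ν d : ℕ) (t : ℝ) : ℝ≥0∞ := max 1 (2 * (ENNReal.ofReal (2 ^ t) * prodConst ν d))

theorem algConst_lt_top (hν : 1 ≤ ν) (t : ℝ) : algConst ν d t < ⊤ :=
  max_lt ENNReal.one_lt_top (ENNReal.mul_lt_top (by simp)
    (ENNReal.mul_lt_top ENNReal.ofReal_lt_top (prodConst_lt_top hν)))

theorem one_le_algConst (t : ℝ) : 1 ≤ algConst ν d t := le_max_left _ _

/-- The combination `|X|_s + θ |X|_t` of a low and a high norm. -/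
def mixLip (γ : ℝ) (S : Set (Freq ν)) (s t : ℝ) (θ : ℝ≥0∞)
    (X : Freq ν → (Fin ν → ℝ) → Op2 d) : ℝ≥0∞ := decayLip γ S s X + θ * decayLip γ S t X

theorem algNorm_eq_mixLip {X : Freq ν → (Fin ν → ℝ) → Op2 d}
    (h : ∀ ω ∈ S, ∀ φ, IsReal (X ω φ)) (s t : ℝ) (θ : ℝ≥0∞) :
    algNorm γ S s t θ X = 2 * algConst ν d t * mixLip γ S s t θ X := by
  rw [algNorm, matNorm_eq_decayLip h, matNorm_eq_decayLip h, mixLip, algConst]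
  ring

theorem decayLip_add_le {X Y : Freq ν → (Fin ν → ℝ) → Op2 d} (hX : ContOn S X) (hY : ContOn S Y)
    (hX' : ∀ ω ∈ S, ∀ φ, IsReal (X ω φ)) (hY' : ∀ ω ∈ S, ∀ φ, IsReal (Y ω φ)) (s : ℝ) :
    decayLip γ S s (X + Y) ≤ decayLip γ S s X + decayLip γ S s Y := by
  have h := matNorm_add_le (γ := γ) (s := s) hX hY
  have e : matNorm γ S s (X + Y) = 2 * decayLip γ S s (X + Y) :=
    matNorm_eq_decayLip (fun ω hω φ => (hX' ω hω φ).add (hY' ω hω φ)) s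
  rw [matNorm_eq_decayLip hX', matNorm_eq_decayLip hY', e, ← mul_add] at h
  exact (ENNReal.mul_le_mul_iff_right two_ne_zero ENNReal.ofNat_ne_top).mp h

variable {D : Freq ν → BlockDiag d} {F : Freq ν → (Fin ν → ℝ) → Op2 d}

/-- The quadratic part of the perturbation after one step. -/
def quadPert (N : ℝ) (D : BlockDiag d) (ω : Freq ν) (F : (Fin ν → ℝ) → Op2 d)
    (φ : Fin ν → ℝ) : Op2 d :=
  (NormedSpace.exp (-generator N D ω F φ) * F φ * NormedSpace.exp (generator N D ω F φ) - F φ) -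
    (NormedSpace.exp (-generator N D ω F φ) * dexp (generator N D ω F φ) (homRhs N F φ) -
      homRhs N F φ)

theorem nextPert_eq (N : ℝ) (D : BlockDiag d) (ω : Freq ν) (F : (Fin ν → ℝ) → Op2 d)
    (φ : Fin ν → ℝ) :
    nextPert N D ω F φ = (F φ - truncOp N F φ) + quadPert N D ω F φ := by
  rw [nextPert, quadPert]
  conv_rhs => rw [show homRhs N F φ = truncOp N F φ - meanOp N F from rfl]
  change _ - NormedSpace.exp (-generator N D ω F φ) *
    dexp (generator N D ω F φ) (truncOp N F φ - meanOp N F) - _ = _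
  abel

theorem contOn_generator (N : ℝ) (D : Freq ν → BlockDiag d)
    (F : Freq ν → (Fin ν → ℝ) → Op2 d) : ContOn S fun ω => generator N (D ω) ω (F ω) :=
  fun ω _ => torusCont_generator N (D ω) ω (F ω)

theorem contOn_homRhs (N : ℝ) (F : Freq ν → (Fin ν → ℝ) → Op2 d) :
    ContOn S fun ω => homRhs N (F ω) :=
  fun ω _ => (torusCont_truncOp N (F ω)).sub (TorusCont.const _)

theorem contOn_quadPert (hF : ContOn S F) : ContOn S fun ω => quadPert N (D ω) ω (F ω) := by
  have hΨ := contOn_generator (S := S) N D F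
  exact (((hΨ.neg.exp.mul hF).mul hΨ.exp).sub hF).sub
    ((hΨ.neg.exp.mul (hΨ.dexp_sub (contOn_homRhs N F))).sub (contOn_homRhs N F))

theorem contOn_nextPert (hF : ContOn S F) : ContOn S fun ω => nextPert N (D ω) ω (F ω) := by
  have h : (fun ω => nextPert N (D ω) ω (F ω)) =
      (F - fun ω => truncOp N (F ω)) + fun ω => quadPert N (D ω) ω (F ω) :=
    funext fun ω => funext fun φ => nextPert_eq N (D ω) ω (F ω) φ
  rw [h]
  exact (hF.sub fun ω _ => torusCont_truncOp N (F ω)).add (contOn_quadPert hF)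

theorem isReal_homRhs (N : ℝ) (F : (Fin ν → ℝ) → Op2 d) (φ : Fin ν → ℝ) :
    IsReal (homRhs N F φ) := (isReal_realOp _ _).sub (isReal_realOp _ _)

theorem isReal_quadPert {D : BlockDiag d} {ω : Freq ν} {F : (Fin ν → ℝ) → Op2 d}
    {φ : Fin ν → ℝ} (hF : IsReal (F φ)) : IsReal (quadPert N D ω F φ) := by
  have hΨ : IsReal (generator N D ω F φ) := isReal_realOp _ _
  exact (((hΨ.neg.exp.mul hF).mul hΨ.exp).sub hF).sub
    ((hΨ.neg.exp.mul (hΨ.dexp (isReal_homRhs N F φ))).sub (isReal_homRhs N F φ))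

/-- The quadratic part in the mixed norm. With `θ = 0` this is an estimate in the low norm alone,
and with `θ > 0` it is a tame estimate for the high norm. -/
theorem mixLip_quadPert_le (hν : 1 ≤ ν) (hN : 1 ≤ N) (hF : ContOn S F)
    (hFr : ∀ ω ∈ S, ∀ φ, IsReal (F ω φ)) {s t : ℝ} (hs : (ν : ℝ) + d ≤ s) (hst : s ≤ t)
    (θ : ℝ≥0∞) (hsmall : 2 * algConst ν d t *
      mixLip γ S s t θ (fun ω => generator N (D ω) ω (F ω)) ≤ 1) :
    mixLip γ S s t θ (fun ω => quadPert N (D ω) ω (F ω)) ≤ 32 * algConst ν d t *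
      mixLip γ S s t θ (fun ω => generator N (D ω) ω (F ω)) * mixLip γ S s t θ F := by
  have hΨr : ∀ ω ∈ S, ∀ φ, IsReal (generator N (D ω) ω (F ω) φ) := fun ω _ φ => isReal_realOp _ _
  have hHr : ∀ ω ∈ S, ∀ φ, IsReal (homRhs N (F ω) φ) := fun ω _ φ => isReal_homRhs N (F ω) φ
  have h := algNorm_remainder_le (γ := γ) (θ := θ) hs hst (contOn_generator N D F)
    (contOn_homRhs N F) hF (by rwa [algNorm_eq_mixLip hΨr])
  rw [algNorm_eq_mixLip hΨr, algNorm_eq_mixLip hHr, algNorm_eq_mixLip hFr] at h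
  have e1 : algNorm γ S s t θ (fun ω => quadPert N (D ω) ω (F ω)) = _ :=
    algNorm_eq_mixLip (fun ω hω φ => isReal_quadPert (hFr ω hω φ)) s t θ
  have hH : mixLip γ S s t θ (fun ω => homRhs N (F ω)) ≤ mixLip γ S s t θ F :=
    add_le_add (decayLip_truncOp_sub_meanOp_le hF hN s)
      (mul_le_mul_right (decayLip_truncOp_sub_meanOp_le hF hN t) _)
  set κ := 2 * algConst ν d t
  have hκ0 : κ ≠ 0 := mul_ne_zero two_ne_zero (zero_lt_one.trans_le (one_le_algConst t)).ne'
  have hκT : κ ≠ ⊤ := ENNReal.mul_ne_top ENNReal.ofNat_ne_top (algConst_lt_top hν t).ne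
  set x := mixLip γ S s t θ (fun ω => generator N (D ω) ω (F ω))
  set y := mixLip γ S s t θ F
  refine (ENNReal.mul_le_mul_iff_right hκ0 hκT).mp ?_
  rw [← e1]
  refine h.trans ?_
  calc 8 * (κ * x * (κ * y + κ * mixLip γ S s t θ (fun ω => homRhs N (F ω))))
      ≤ 8 * (κ * x * (κ * y + κ * y)) := by gcongr
    _ = κ * (16 * κ * x * y) := by ring
    _ = κ * (32 * algConst ν d t * x * y) := by
        simp only [κ]
        ring

/-- Interpolation of the norm `|F|_{s+m}` between `|F|_s` and `|F|_{s+b}`. -/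
theorem decayLip_interpolation (F : Freq ν → (Fin ν → ℝ) → Op2 d) {M m b : ℝ} (hM : 0 < M) (hm : 0 ≤ m)
    (hmb : m ≤ b) (s : ℝ) :
    decayLip γ S (s + m) F ≤ ENNReal.ofReal (M ^ m) * decayLip γ S s F +
      ENNReal.ofReal (M ^ (m - b)) * decayLip γ S (s + b) F := by
  have hw : ∀ (l : Fin ν → ℤ) (α β : Spec d) (x : ℝ≥0∞), wt (s + m) l α β * x ≤
      ENNReal.ofReal (M ^ m) * (wt s l α β * x) +
        ENNReal.ofReal (M ^ (m - b)) * (wt (s + b) l α β * x) := fun l α β x => by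
    rcases le_total (jap3 l α β) M with h | h
    · refine le_trans ?_ le_self_add
      rw [wt_add, ← mul_assoc, mul_comm (wt s l α β)]
      exact mul_le_mul_left (mul_le_mul_left (ENNReal.ofReal_le_ofReal
        (Real.rpow_le_rpow (jap3_pos _ _ _).le h hm)) _) _
    · refine le_trans ?_ le_add_self
      have e : s + m = (m - b) + (s + b) := by ring
      rw [e, wt_add, ← mul_assoc]
      exact mul_le_mul_left (mul_le_mul_left (ENNReal.ofReal_le_ofReal
        (Real.rpow_le_rpow_of_nonpos hM h (by linarith))) _) _
  have key : ∀ G : Freq ν → (Fin ν → ℝ) → Op d,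
      lipNorm γ S (decayNorm (s + m)) G ≤ ENNReal.ofReal (M ^ m) * lipNorm γ S (decayNorm s) G +
        ENNReal.ofReal (M ^ (m - b)) * lipNorm γ S (decayNorm (s + b)) G := fun G =>
    lipNorm_le_of_le (decayNorm_zero _) (decayNorm_zero _)
      (fun ω _ => decayNorm_le_of_hatBlock_le fun l α β => hw l α β _)
      (fun ω₁ _ ω₂ _ => decayNorm_le_of_hatBlock_le fun l α β => hw l α β _)
  unfold decayLip
  refine (add_le_add (key _) (key _)).trans (le_of_eq ?_)
  ring

theorem aExp_eq (τ e : ℝ) : aExp τ e = 2 * lossExp τ e + 1 := by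
  unfold aExp lossExp
  ring

set_option maxHeartbeats 400000 in
/-- One step of the scheme, from the scale `M` to the scale `N`. The high modes contribute
`N ^ (-b) * (x * M)` to the low norm, which is small because `b = a + 1`; the quadratic part
contributes `M ^ (m - 2 * a)` with `m = lossExp τ e`, which `N ^ (-a)` dominates for `N = M ^ (3/2)`
because `a = 2 * m + 1`. The factors `N₀` in the relations between the scales allow for the first
step, with `M = 1` and `N = N₀`. -/
theorem step_estimates (hν : 1 ≤ ν) (hγ : 0 < γ) (hτ : 0 ≤ τ) (he : 0 ≤ e) {s M N₀ x κ : ℝ}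
    (hs : (ν : ℝ) + d ≤ s) (hκ : algConst ν d (s + bExp τ e) ≤ ENNReal.ofReal κ)
    (hM : 1 ≤ M) (hN₀ : 64 ≤ N₀) (hMN : N₀ ^ ((1 : ℝ) / 2) * M ≤ N) (hNM : N ≤ N₀ * M ^ ((3 : ℝ) / 2))
    (hx : 0 ≤ x) (hsmall : γ⁻¹ * x * (768 * κ * N₀ ^ aExp τ e) ≤ 1)
    (hF : ContOn S F) (hham : ∀ ω ∈ S, ∀ φ, IsHamiltonian (F ω φ))
    (hmel : ∀ ω ∈ S, MelnikovCond γ τ e N (D ω) ω) (hD : ∀ ω ∈ S, ∀ α, (D ω α).IsHermitian)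
    (hlip : ∀ ω₁ ∈ S, ∀ ω₂ ∈ S, ∀ (α β : Spec d) (X : Block α β),
      hsENorm ((D ω₁ α - D ω₂ α) * X) ≤ edist ω₁ ω₂ * hsENorm X)
    (hlow : decayLip γ S s F ≤ ENNReal.ofReal (x * M ^ (-aExp τ e)))
    (hhigh : decayLip γ S (s + bExp τ e) F ≤ ENNReal.ofReal (x * M)) :
    decayLip γ S s (fun ω => generator N (D ω) ω (F ω)) ≤
        ENNReal.ofReal (x * (γ⁻¹ * N ^ lossExp τ e * M ^ (-aExp τ e))) ∧
      decayLip γ S s (fun ω => nextPert N (D ω) ω (F ω)) ≤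
        ENNReal.ofReal (x * N ^ (-aExp τ e)) ∧
      decayLip γ S (s + bExp τ e) (fun ω => nextPert N (D ω) ω (F ω)) ≤ ENNReal.ofReal (x * N) := by
  have hγ' : 0 ≤ γ⁻¹ := inv_nonneg.mpr hγ.le
  have ham := aExp_eq τ e
  have hba : bExp τ e = aExp τ e + 1 := rfl
  have hm1 : 1 ≤ lossExp τ e := by unfold lossExp; linarith
  set m := lossExp τ e with hm
  set a := aExp τ e with ha
  set b := bExp τ e with hb
  have hM0 : 0 < M := by linarith
  have hN₀0 : 0 < N₀ := by linarith
  have hN₀1 : 1 ≤ N₀ := by linarith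
  have h8 : 8 ≤ N₀ ^ ((1 : ℝ) / 2) := by
    have : (64 : ℝ) ^ ((1 : ℝ) / 2) = 8 := by
      rw [← Real.sqrt_eq_rpow, show (64 : ℝ) = 8 ^ 2 by norm_num]
      exact Real.sqrt_sq (by norm_num)
    rw [← this]
    exact Real.rpow_le_rpow (by norm_num) hN₀ (by norm_num)
  have h8M : 8 * M ≤ N := (mul_le_mul_of_nonneg_right h8 hM0.le).trans hMN
  have hN1 : 1 ≤ N := by linarith
  have hN0 : 0 < N := by linarith
  have hκ1 : 1 ≤ κ := by
    have := (one_le_algConst (ν := ν) (d := d) (s + b)).trans hκ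
    exact ENNReal.one_le_ofReal.mp this
  have hκ0 : 0 < κ := by linarith
  have hA0 : 0 < N₀ ^ a := Real.rpow_pos_of_pos hN₀0 _
  have hMa : 0 < M ^ (-a) := Real.rpow_pos_of_pos hM0 _
  have hNm : 0 < N ^ m := Real.rpow_pos_of_pos hN0 _
  -- the three comparisons of powers of the scales
  have hp1 : 8 * M ^ m ≤ N ^ m := by
    have h1 : 8 ≤ (8 : ℝ) ^ m := by
      simpa using Real.rpow_le_rpow_of_exponent_le (by norm_num : (1 : ℝ) ≤ 8) hm1
    calc 8 * M ^ m ≤ 8 ^ m * M ^ m := by gcongr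
      _ = (8 * M) ^ m := (Real.mul_rpow (by norm_num) hM0.le).symm
      _ ≤ N ^ m := Real.rpow_le_rpow (by positivity) h8M (by linarith)
  have hpow : ∀ r : ℝ, 0 ≤ r → N ^ r ≤ N₀ ^ r * M ^ (3 / 2 * r) := fun r hr => by
    rw [Real.rpow_mul hM0.le, ← Real.mul_rpow hN₀0.le (Real.rpow_nonneg hM0.le _)]
    exact Real.rpow_le_rpow hN0.le hNM hr
  have hp2 : N ^ m * M ^ (-a) ≤ N₀ ^ a := by
    calc N ^ m * M ^ (-a) ≤ N₀ ^ m * M ^ (3 / 2 * m) * M ^ (-a) := by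
          have := hpow m (by linarith)
          gcongr
      _ = N₀ ^ m * M ^ (3 / 2 * m + -a) := by rw [mul_assoc, ← Real.rpow_add hM0]
      _ ≤ N₀ ^ a * 1 := by
          refine mul_le_mul (Real.rpow_le_rpow_of_exponent_le hN₀1 (by linarith))
            (Real.rpow_le_one_of_one_le_of_nonpos hM (by linarith)) (by positivity) hA0.le
      _ = N₀ ^ a := mul_one _
  have hp3 : M ^ (m - a) * M ^ (-a) ≤ N₀ ^ a * N ^ (-a) := by
    have h1 : N ^ a * (M ^ (m - a) * M ^ (-a)) ≤ N₀ ^ a := by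
      calc N ^ a * (M ^ (m - a) * M ^ (-a))
          ≤ N₀ ^ a * M ^ (3 / 2 * a) * (M ^ (m - a) * M ^ (-a)) := by
            have := hpow a (by linarith)
            gcongr
        _ = N₀ ^ a * M ^ (3 / 2 * a + (m - a + -a)) := by
            rw [mul_assoc, ← Real.rpow_add hM0, ← Real.rpow_add hM0]
        _ ≤ N₀ ^ a * 1 := by
            gcongr
            exact Real.rpow_le_one_of_one_le_of_nonpos hM (by linarith)
        _ = N₀ ^ a := mul_one _
    have h2 : N ^ (-a) * N ^ a = 1 := by
      rw [← Real.rpow_add hN0, neg_add_cancel, Real.rpow_zero]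
    have h3 := mul_le_mul_of_nonneg_left h1 (Real.rpow_nonneg hN0.le (-a))
    rw [← mul_assoc, h2, one_mul] at h3
    rwa [mul_comm (N₀ ^ a)]
  -- the low norm of the generator
  have hΨ1 : decayLip γ S s (fun ω => generator N (D ω) ω (F ω)) ≤
      ENNReal.ofReal (8 * (γ⁻¹ * x) * M ^ (m - a)) := by
    have h1 := decayLip_generator_le (D := D) hγ hτ he hmel hD hlip hF (s := s) (t := s + m)
      (K := 1) (fun l α β _ => by rw [one_mul, ← wt_add, add_comm])
    refine h1.trans ?_
    have h2 := decayLip_interpolation (γ := γ) (S := S) F hM0 (by linarith : (0 : ℝ) ≤ m)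
      (by linarith : m ≤ b) s
    have h3 : decayLip γ S (s + m) F ≤ ENNReal.ofReal (2 * x * M ^ (m - a)) := by
      refine h2.trans ((add_le_add (mul_le_mul_right hlow _) (mul_le_mul_right hhigh _)).trans ?_)
      rw [← ENNReal.ofReal_mul (by positivity), ← ENNReal.ofReal_mul (by positivity),
        ← ENNReal.ofReal_add (by positivity) (by positivity)]
      refine ENNReal.ofReal_le_ofReal (le_of_eq ?_)
      have e1 : M ^ m * M ^ (-a) = M ^ (m - a) := by rw [← Real.rpow_add hM0]; rfl
      have e2 : M ^ (m - b) * M = M ^ (m - a) := by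
        rw [← Real.rpow_add_one hM0.ne']
        congr 1
        rw [hba]
        ring
      calc M ^ m * (x * M ^ (-a)) + M ^ (m - b) * (x * M)
          = x * (M ^ m * M ^ (-a)) + x * (M ^ (m - b) * M) := by ring
        _ = _ := by rw [e1, e2]; ring
    refine (mul_le_mul_right h3 _).trans ?_
    have e4 : (4 : ℝ≥0∞) = ENNReal.ofReal 4 := by simp
    rw [mul_one, e4, ← ENNReal.ofReal_mul (by norm_num), ← ENNReal.ofReal_mul (by positivity)]
    exact ENNReal.ofReal_le_ofReal (le_of_eq (by ring))
  have hΨ2 : ENNReal.ofReal (8 * (γ⁻¹ * x) * M ^ (m - a)) ≤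
      ENNReal.ofReal (x * (γ⁻¹ * N ^ m * M ^ (-a))) := by
    refine ENNReal.ofReal_le_ofReal ?_
    have e1 : M ^ (m - a) = M ^ m * M ^ (-a) := by rw [← Real.rpow_add hM0]; rfl
    rw [e1]
    calc 8 * (γ⁻¹ * x) * (M ^ m * M ^ (-a)) = x * (γ⁻¹ * (8 * M ^ m) * M ^ (-a)) := by ring
      _ ≤ _ := by gcongr
  -- the high norm of the generator
  have hΨ3 : decayLip γ S (s + b) (fun ω => generator N (D ω) ω (F ω)) ≤
      ENNReal.ofReal (4 * (γ⁻¹ * x) * N ^ m * M) := by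
    have h1 := decayLip_generator_le (D := D) hγ hτ he hmel hD hlip hF (s := s + b) (t := s + b)
      (K := ENNReal.ofReal (N ^ m)) (fun l α β hle => mul_le_mul_left (ENNReal.ofReal_le_ofReal
        (Real.rpow_le_rpow (jap3_pos _ _ _).le hle (by linarith))) _)
    refine h1.trans ((mul_le_mul_right hhigh _).trans ?_)
    have e4 : (4 : ℝ≥0∞) = ENNReal.ofReal 4 := by simp
    rw [e4, ← ENNReal.ofReal_mul (by norm_num), ← ENNReal.ofReal_mul (by positivity),
      ← ENNReal.ofReal_mul (by positivity)]
    exact ENNReal.ofReal_le_ofReal (le_of_eq (by ring))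
  have hreal : ∀ ω ∈ S, ∀ φ, IsReal (F ω φ) := fun ω hω φ => (hham ω hω φ).isReal
  have hsb : s ≤ s + b := by linarith
  have key : ∀ r, decayLip γ S r (fun ω => nextPert N (D ω) ω (F ω)) ≤
      decayLip γ S r (fun ω φ => F ω φ - truncOp N (F ω) φ) +
        decayLip γ S r (fun ω => quadPert N (D ω) ω (F ω)) := fun r => by
    have h : (fun ω => nextPert N (D ω) ω (F ω)) =
        (F - fun ω => truncOp N (F ω)) + fun ω => quadPert N (D ω) ω (F ω) :=
      funext fun ω => funext fun φ => nextPert_eq N (D ω) ω (F ω) φ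
    rw [h]
    exact decayLip_add_le (hF.sub fun ω _ => torusCont_truncOp N (F ω)) (contOn_quadPert hF)
      (fun ω hω φ => (hreal ω hω φ).sub (isReal_realOp _ _))
      (fun ω hω φ => isReal_quadPert (hreal ω hω φ)) r
  have hT1 := decayLip_sub_truncOp_le (γ := γ) hF hN0 s (b := b) (by linarith)
  have hT2 := decayLip_sub_truncOp_le (γ := γ) hF hN0 (s + b) (b := 0) le_rfl
  rw [neg_zero, Real.rpow_zero, ENNReal.ofReal_one, one_mul, add_zero] at hT2
  have e32 : (32 : ℝ≥0∞) = ENNReal.ofReal 32 := by simp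
  have e2' : (2 : ℝ≥0∞) = ENNReal.ofReal 2 := by simp
  refine ⟨hΨ1.trans hΨ2, ?_, ?_⟩
  · -- low norm: the quadratic part with the weight `θ = 0`
    have hq := mixLip_quadPert_le (γ := γ) (D := D) (N := N) hν hN1 hF hreal hs hsb 0 ?_
    · simp only [mixLip, zero_mul, add_zero] at hq
      refine (key s).trans ((add_le_add (hT1.trans (mul_le_mul_right hhigh _)) (hq.trans
        (mul_le_mul' (mul_le_mul' (mul_le_mul_right hκ _) hΨ1) hlow))).trans ?_)
      rw [e32, ← ENNReal.ofReal_mul (by positivity), ← ENNReal.ofReal_mul (by positivity),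
        ← ENNReal.ofReal_mul (by positivity), ← ENNReal.ofReal_mul (by positivity),
        ← ENNReal.ofReal_add (by positivity) (by positivity)]
      refine ENNReal.ofReal_le_ofReal ?_
      have hNa : 0 < N ^ (-a) := Real.rpow_pos_of_pos hN0 _
      have h1 : N ^ (-b) * (x * M) ≤ x * N ^ (-a) * (1 / 8) := by
        have e1 : N ^ (-b) * N = N ^ (-a) := by
          rw [← Real.rpow_add_one hN0.ne']
          congr 1
          rw [hba]
          ring
        have hNb : 0 < N ^ (-b) := Real.rpow_pos_of_pos hN0 _
        calc N ^ (-b) * (x * M) ≤ N ^ (-b) * (x * (N / 8)) := by gcongr; linarith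
          _ = x * (N ^ (-b) * N) * (1 / 8) := by ring
          _ = _ := by rw [e1]
      have h2 : 32 * κ * (8 * (γ⁻¹ * x) * M ^ (m - a)) * (x * M ^ (-a)) ≤ x * N ^ (-a) * (1 / 2) := by
        calc 32 * κ * (8 * (γ⁻¹ * x) * M ^ (m - a)) * (x * M ^ (-a))
            = 256 * κ * (γ⁻¹ * x) * x * (M ^ (m - a) * M ^ (-a)) := by ring
          _ ≤ 256 * κ * (γ⁻¹ * x) * x * (N₀ ^ a * N ^ (-a)) := by gcongr
          _ = (γ⁻¹ * x * (768 * κ * N₀ ^ a)) * (x * N ^ (-a)) * (1 / 3) := by ring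
          _ ≤ 1 * (x * N ^ (-a)) * (1 / 3) := by gcongr
          _ ≤ _ := by nlinarith [mul_nonneg hx hNa.le]
      nlinarith [mul_nonneg hx hNa.le]
    · simp only [mixLip, zero_mul, add_zero]
      refine (mul_le_mul' (mul_le_mul_right hκ _) (hΨ1.trans hΨ2)).trans ?_
      rw [e2', ← ENNReal.ofReal_mul (by positivity), ← ENNReal.ofReal_mul (by positivity)]
      refine ENNReal.ofReal_le_one.mpr ?_
      calc 2 * κ * (x * (γ⁻¹ * N ^ m * M ^ (-a))) = 2 * κ * (γ⁻¹ * x) * (N ^ m * M ^ (-a)) := by ring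
        _ ≤ 2 * κ * (γ⁻¹ * x) * N₀ ^ a := by gcongr
        _ = (γ⁻¹ * x * (768 * κ * N₀ ^ a)) * (1 / 384) := by ring
        _ ≤ 1 * (1 / 384) := by gcongr
        _ ≤ 1 := by norm_num
  · -- high norm: the weight `θ = M ^ (-b)` balances the two norms
    have hMb : 0 < M ^ (-b) := Real.rpow_pos_of_pos hM0 _
    have eMb : M ^ (-b) * M = M ^ (-a) := by
      rw [← Real.rpow_add_one hM0.ne']
      congr 1
      rw [hba]
      ring
    have eMb' : M ^ b * M ^ (-b) = 1 := by
      rw [← Real.rpow_add hM0, add_neg_cancel, Real.rpow_zero]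
    have eMab : M ^ b * M ^ (-a) = M := by
      rw [← Real.rpow_add hM0]
      have : b + -a = 1 := by rw [hba]; ring
      rw [this, Real.rpow_one]
    set θ := ENNReal.ofReal (M ^ (-b))
    have hmixΨ : mixLip γ S s (s + b) θ (fun ω => generator N (D ω) ω (F ω)) ≤
        ENNReal.ofReal (5 * (γ⁻¹ * x) * (N ^ m * M ^ (-a))) := by
      refine (add_le_add (hΨ1.trans hΨ2) (mul_le_mul_right hΨ3 _)).trans ?_
      rw [← ENNReal.ofReal_mul hMb.le, ← ENNReal.ofReal_add (by positivity) (by positivity)]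
      refine ENNReal.ofReal_le_ofReal (le_of_eq ?_)
      rw [← eMb]
      ring
    have hmixF : mixLip γ S s (s + b) θ F ≤ ENNReal.ofReal (2 * x * M ^ (-a)) := by
      refine (add_le_add hlow (mul_le_mul_right hhigh _)).trans ?_
      rw [← ENNReal.ofReal_mul hMb.le, ← ENNReal.ofReal_add (by positivity) (by positivity)]
      refine ENNReal.ofReal_le_ofReal (le_of_eq ?_)
      rw [← eMb]
      ring
    have hq := mixLip_quadPert_le (γ := γ) (D := D) (N := N) hν hN1 hF hreal hs hsb θ ?_
    · have hq2 : decayLip γ S (s + b) (fun ω => quadPert N (D ω) ω (F ω)) ≤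
          ENNReal.ofReal (M ^ b) * mixLip γ S s (s + b) θ (fun ω => quadPert N (D ω) ω (F ω)) := by
        refine le_trans (le_of_eq ?_) (mul_le_mul_right (b := θ * decayLip γ S (s + b) _) le_add_self _)
        rw [← mul_assoc, ← ENNReal.ofReal_mul (Real.rpow_nonneg hM0.le _), eMb', ENNReal.ofReal_one,
          one_mul]
      refine (key (s + b)).trans ((add_le_add (hT2.trans hhigh) (hq2.trans (mul_le_mul_right (hq.trans
        (mul_le_mul' (mul_le_mul' (mul_le_mul_right hκ _) hmixΨ) hmixF)) _))).trans ?_)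
      rw [e32, ← ENNReal.ofReal_mul (by positivity), ← ENNReal.ofReal_mul (by positivity),
        ← ENNReal.ofReal_mul (by positivity), ← ENNReal.ofReal_mul (by positivity),
        ← ENNReal.ofReal_add (by positivity) (by positivity)]
      refine ENNReal.ofReal_le_ofReal ?_
      have h2 : M ^ b * (32 * κ * (5 * (γ⁻¹ * x) * (N ^ m * M ^ (-a))) * (2 * x * M ^ (-a))) ≤
          x * M := by
        calc M ^ b * (32 * κ * (5 * (γ⁻¹ * x) * (N ^ m * M ^ (-a))) * (2 * x * M ^ (-a)))
            = 320 * κ * (γ⁻¹ * x) * (N ^ m * M ^ (-a)) * (x * (M ^ b * M ^ (-a))) := by ring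
          _ = 320 * κ * (γ⁻¹ * x) * (N ^ m * M ^ (-a)) * (x * M) := by rw [eMab]
          _ ≤ 320 * κ * (γ⁻¹ * x) * N₀ ^ a * (x * M) := by gcongr
          _ = (γ⁻¹ * x * (768 * κ * N₀ ^ a)) * (x * M) * (320 / 768) := by ring
          _ ≤ 1 * (x * M) * (320 / 768) := by gcongr
          _ ≤ x * M := by nlinarith [mul_nonneg hx hM0.le]
      have h3 : x * (8 * M) ≤ x * N := mul_le_mul_of_nonneg_left h8M hx
      refine (add_le_add le_rfl h2).trans (le_trans ?_ h3)
      linarith [mul_nonneg hx hM0.le]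
    · refine (mul_le_mul' (mul_le_mul_right hκ _) hmixΨ).trans ?_
      rw [e2', ← ENNReal.ofReal_mul (by positivity), ← ENNReal.ofReal_mul (by positivity)]
      refine ENNReal.ofReal_le_one.mpr ?_
      calc 2 * κ * (5 * (γ⁻¹ * x) * (N ^ m * M ^ (-a)))
          ≤ 2 * κ * (5 * (γ⁻¹ * x) * N₀ ^ a) := by gcongr
        _ = (γ⁻¹ * x * (768 * κ * N₀ ^ a)) * (10 / 768) := by ring
        _ ≤ 1 * (10 / 768) := by gcongr
        _ ≤ 1 := by norm_num

end StepEstimates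

/-! ### Extension of Lipschitz maps between Hilbert spaces -/

section Kirszbraun

variable {E F ι : Type*} [NormedAddCommGroup E] [InnerProductSpace ℝ E]
  [NormedAddCommGroup F] [InnerProductSpace ℝ F]

/-- The variance identity for the barycentre `∑ t_i x_i`, seen from the point `p`. -/
theorem sum_mul_sq_dist [Fintype ι] {t : ι → ℝ} (ht : ∑ i, t i = 1) (x : ι → E) (p : E) :
    ∑ i, t i * ‖x i - p‖ ^ 2 =
      (1 / 2) * ∑ i, ∑ j, t i * t j * ‖x i - x j‖ ^ 2 + ‖∑ i, t i • x i - p‖ ^ 2 := by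
  have h1 : ∑ i, t i • x i - p = ∑ i, t i • (x i - p) := by
    simp only [smul_sub, Finset.sum_sub_distrib, ← Finset.sum_smul, ht, one_smul]
  have h2 : ‖∑ i, t i • (x i - p)‖ ^ 2 =
      ∑ i, ∑ j, t i * t j * inner ℝ (x i - p) (x j - p) := by
    rw [← real_inner_self_eq_norm_sq, sum_inner]
    refine Finset.sum_congr rfl fun i _ => ?_
    rw [inner_sum]
    refine Finset.sum_congr rfl fun j _ => ?_
    rw [real_inner_smul_left, real_inner_smul_right]
    ring
  have h3 : ∀ i j, t i * t j * ‖x i - x j‖ ^ 2 = t j * (t i * ‖x i - p‖ ^ 2) +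
      t i * (t j * ‖x j - p‖ ^ 2) - 2 * (t i * t j * inner ℝ (x i - p) (x j - p)) := fun i j => by
    have : x i - x j = (x i - p) - (x j - p) := by abel
    rw [this, norm_sub_sq_real]
    ring
  rw [h1, h2]
  simp only [h3, Finset.sum_sub_distrib, Finset.sum_add_distrib, ← Finset.mul_sum, ← Finset.sum_mul,
    ht]
  ring

/-- The one-point extension for finitely many points: the maximum over the simplex of
`t ↦ ∑ t_i (|y_i|² - r_i²) - |∑ t_i y_i|²` is attained at a point whose barycentre `∑ t_i y_i`
lies in all the balls. -/
theorem exists_mem_convexHull_norm_sub_le [Fintype ι] [Nonempty ι] {L : ℝ} (x : ι → E) (y : ι → F)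
    (h : ∀ i j, ‖y i - y j‖ ≤ L * ‖x i - x j‖) (p : E) :
    ∃ z ∈ convexHull ℝ (Set.range y), ∀ i, ‖z - y i‖ ≤ |L| * ‖p - x i‖ := by
  classical
  set G : (ι → ℝ) → ℝ := fun t =>
    ∑ i, t i * (‖y i‖ ^ 2 - (|L| * ‖p - x i‖) ^ 2) - ‖∑ i, t i • y i‖ ^ 2 with hG
  have hGc : Continuous G := by
    rw [hG]
    fun_prop
  obtain ⟨t, ht, hmax⟩ := (isCompact_stdSimplex ℝ ι).exists_isMaxOn
    ⟨_, single_mem_stdSimplex ℝ (Classical.arbitrary ι)⟩ hGc.continuousOn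
  have ht1 : ∑ i, t i = 1 := ht.2
  have ht0 : ∀ i, 0 ≤ t i := ht.1
  set z := ∑ i, t i • y i with hz
  refine ⟨z, mem_convexHull_of_exists_fintype t y ht0 ht1 (fun i => Set.mem_range_self i) rfl,
    fun i => ?_⟩
  -- the value at the maximum is at most `-L² |p - ∑ t_i x_i|²`
  have hle : G t ≤ 0 := by
    have e1 := sum_mul_sq_dist ht1 y 0
    have e2 := sum_mul_sq_dist ht1 x p
    simp only [sub_zero] at e1
    have e3 : ∑ i, ∑ j, t i * t j * ‖y i - y j‖ ^ 2 ≤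
        L ^ 2 * ∑ i, ∑ j, t i * t j * ‖x i - x j‖ ^ 2 := by
      rw [Finset.mul_sum]
      refine Finset.sum_le_sum fun i _ => ?_
      rw [Finset.mul_sum]
      refine Finset.sum_le_sum fun j _ => ?_
      have := mul_nonneg (ht0 i) (ht0 j)
      have hsq : ‖y i - y j‖ ^ 2 ≤ (L * ‖x i - x j‖) ^ 2 :=
        pow_le_pow_left₀ (norm_nonneg _) (h i j) 2
      calc t i * t j * ‖y i - y j‖ ^ 2 ≤ t i * t j * (L * ‖x i - x j‖) ^ 2 := by gcongr
        _ = _ := by ring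
    have e4 : G t = ∑ i, t i * ‖y i‖ ^ 2 - L ^ 2 * ∑ i, t i * ‖x i - p‖ ^ 2 - ‖z‖ ^ 2 := by
      simp only [hG, mul_sub, Finset.sum_sub_distrib, Finset.mul_sum, mul_pow, sq_abs]
      congr 2
      refine Finset.sum_congr rfl fun i _ => ?_
      rw [norm_sub_rev]
      ring
    rw [e4, e1, e2]
    nlinarith [mul_nonneg (sq_nonneg L) (sq_nonneg ‖∑ i, t i • x i - p‖)]
  -- the derivative in the direction of the `i`-th vertex is not positive
  have hder : ‖z - y i‖ ^ 2 - (|L| * ‖p - x i‖) ^ 2 ≤ G t := by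
    set A := ‖z - y i‖ ^ 2 - (|L| * ‖p - x i‖) ^ 2 - G t with hA
    have hq : ∀ r : ℝ, 0 < r → r ≤ 1 → A ≤ r * ‖y i - z‖ ^ 2 := fun r hr hr1 => by
      set v : ι → ℝ := (1 - r) • t + r • Pi.single i (1 : ℝ) with hv
      have hmem : v ∈ stdSimplex ℝ ι :=
        convex_stdSimplex ℝ ι ht (single_mem_stdSimplex ℝ i) (by linarith) hr.le (by ring)
      have hm : G v ≤ G t := hmax hmem
      have s1 : ∀ f : ι → ℝ, ∑ j, v j * f j =
          (1 - r) * ∑ j, t j * f j + r * f i := fun f => by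
        simp [hv, add_mul, Finset.sum_add_distrib, Finset.mul_sum, Pi.single_apply, mul_assoc]
      have s2 : ∑ j, v j • y j = z + r • (y i - z) := by
        have : ∑ j, v j • y j = (1 - r) • z + r • y i := by
          simp [hv, add_smul, Finset.sum_add_distrib, Finset.smul_sum, hz, Pi.single_apply, mul_smul]
        rw [this]
        module
      have s3 : ‖z + r • (y i - z)‖ ^ 2 = ‖z‖ ^ 2 + 2 * r * inner ℝ z (y i - z) +
          r ^ 2 * ‖y i - z‖ ^ 2 := by
        rw [norm_add_sq_real, real_inner_smul_right, norm_smul, mul_pow, Real.norm_eq_abs, sq_abs]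
        ring
      have s4 : ‖y i‖ ^ 2 = ‖z‖ ^ 2 + 2 * inner ℝ z (y i - z) + ‖y i - z‖ ^ 2 := by
        rw [← norm_add_sq_real]
        congr 2
        abel
      have hGt : G t = ∑ i, t i * (‖y i‖ ^ 2 - (|L| * ‖p - x i‖) ^ 2) - ‖z‖ ^ 2 := rfl
      have hG' : G v =
          (1 - r) * (G t + ‖z‖ ^ 2) + r * (‖y i‖ ^ 2 - (|L| * ‖p - x i‖) ^ 2) -
            (‖z‖ ^ 2 + 2 * r * inner ℝ z (y i - z) + r ^ 2 * ‖y i - z‖ ^ 2) := by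
        rw [← s3, ← s2, hGt, sub_add_cancel, ← s1]
      rw [hG', s4] at hm
      rw [hA, norm_sub_rev z]
      have : r * (‖y i - z‖ ^ 2 - (|L| * ‖p - x i‖) ^ 2 - G t) ≤ r * (r * ‖y i - z‖ ^ 2) := by
        nlinarith
      exact le_of_mul_le_mul_left this hr
    by_contra hcon
    have hApos : 0 < A := by
      rw [hA]
      linarith [not_le.mp hcon]
    have hB : 0 ≤ ‖y i - z‖ ^ 2 := sq_nonneg _
    have h1 := hq (min 1 (A / (2 * (‖y i - z‖ ^ 2 + 1)))) (by positivity) (min_le_left _ _)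
    have h2 : min 1 (A / (2 * (‖y i - z‖ ^ 2 + 1))) * ‖y i - z‖ ^ 2 ≤ A / 2 := by
      calc _ ≤ A / (2 * (‖y i - z‖ ^ 2 + 1)) * (‖y i - z‖ ^ 2 + 1) := by
            gcongr
            · exact min_le_right _ _
            · linarith
        _ = A / 2 := by field_simp
    linarith
  exact abs_le_of_sq_le_sq' (by linarith) (by positivity) |>.2

variable [ProperSpace F]

/-- The one-point extension for arbitrary families, by compactness of closed balls: the finite
subfamilies of balls meet inside the closed ball of radius `M`, since barycentres stay there. -/
theorem exists_norm_sub_le {L M : ℝ} (hM : 0 ≤ M) (x : ι → E) (y : ι → F)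
    (h : ∀ i j, ‖y i - y j‖ ≤ L * ‖x i - x j‖) (hy : ∀ i, ‖y i‖ ≤ M) (p : E) :
    ∃ z : F, ‖z‖ ≤ M ∧ ∀ i, ‖z - y i‖ ≤ |L| * ‖p - x i‖ := by
  have key := (isCompact_closedBall (0 : F) M).inter_iInter_nonempty
    (fun i => Metric.closedBall (y i) (|L| * ‖p - x i‖)) (fun i => Metric.isClosed_closedBall)
    (fun u => by
      rcases u.eq_empty_or_nonempty with rfl | hu
      · exact ⟨0, by simpa using hM⟩
      · have : Nonempty u := hu.to_subtype
        obtain ⟨z, hz, hz'⟩ := exists_mem_convexHull_norm_sub_le (fun i : u => x i)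
          (fun i : u => y i) (fun i j => h i j) p
        refine ⟨z, ?_, ?_⟩
        · refine convexHull_min ?_ (convex_closedBall (0 : F) M) hz
          rintro _ ⟨i, rfl⟩
          simpa using hy i
        · simp only [Set.mem_iInter, Metric.mem_closedBall, dist_eq_norm]
          exact fun i hi => hz' ⟨i, hi⟩)
  obtain ⟨z, hz, hz'⟩ := key
  simp only [Set.mem_iInter, Metric.mem_closedBall, dist_eq_norm] at hz'
  exact ⟨z, by simpa using hz, hz'⟩

/-- Kirszbraun's extension theorem, for maps with values in a ball. -/
theorem exists_lipschitz_extension {L M : ℝ} (hM : 0 ≤ M) (S : Set E) (f : E → F)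
    (h : ∀ x ∈ S, ∀ y ∈ S, ‖f x - f y‖ ≤ L * ‖x - y‖) (hf : ∀ x ∈ S, ‖f x‖ ≤ M) :
    ∃ g : E → F, (∀ x ∈ S, g x = f x) ∧ (∀ x, ‖g x‖ ≤ M) ∧
      ∀ x y, ‖g x - g y‖ ≤ |L| * ‖x - y‖ := by
  -- a maximal graph among the graphs of Lipschitz maps
  let P : Set (Set (E × F)) := {G | (∀ a ∈ G, ‖a.2‖ ≤ M) ∧
    ∀ a ∈ G, ∀ b ∈ G, ‖a.2 - b.2‖ ≤ |L| * ‖a.1 - b.1‖}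
  have hP : (fun x => (x, f x)) '' S ∈ P := by
    refine ⟨?_, ?_⟩
    · rintro _ ⟨x, hx, rfl⟩
      exact hf x hx
    · rintro _ ⟨x, hx, rfl⟩ _ ⟨y, hy, rfl⟩
      exact (h x hx y hy).trans (mul_le_mul_of_nonneg_right (le_abs_self L) (norm_nonneg _))
  obtain ⟨G, hG0, hG⟩ := zorn_subset_nonempty P (fun c hc hchain hne => by
    refine ⟨⋃₀ c, ⟨?_, ?_⟩, fun s hs => Set.subset_sUnion_of_mem hs⟩
    · rintro a ⟨s, hs, ha⟩
      exact (hc hs).1 a ha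
    · rintro a ⟨s, hs, ha⟩ b ⟨s', hs', hb⟩
      rcases hchain.total hs hs' with hss | hss
      · exact (hc hs').2 a (hss ha) b hb
      · exact (hc hs).2 a ha b (hss hb)) _ hP
  have hdom : ∀ p : E, ∃ z : F, (p, z) ∈ G := fun p => by
    obtain ⟨z, hz, hz'⟩ := exists_norm_sub_le (L := |L|) hM (fun a : G => a.1.1) (fun a : G => a.1.2)
      (fun a b => hG.prop.2 a a.2 b b.2) (fun a => hG.prop.1 a a.2) p
    refine ⟨z, hG.le_of_ge (y := insert (p, z) G) ⟨?_, ?_⟩ (Set.subset_insert _ _)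
      (Set.mem_insert _ _)⟩
    · rintro a (rfl | ha)
      exacts [hz, hG.prop.1 a ha]
    · rw [abs_abs] at hz'
      rintro a (rfl | ha) b (rfl | hb)
      · simp
      · exact hz' ⟨b, hb⟩
      · rw [norm_sub_rev, norm_sub_rev a.1]
        exact hz' ⟨a, ha⟩
      · exact hG.prop.2 a ha b hb
  choose g hg using hdom
  refine ⟨g, fun x hx => ?_, fun x => hG.prop.1 _ (hg x), fun x y => hG.prop.2 _ (hg x) _ (hg y)⟩
  have := hG.prop.2 _ (hg x) _ (hG0 ⟨x, hx, rfl⟩)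
  rw [sub_self, norm_zero, mul_zero] at this
  exact sub_eq_zero.mp (norm_le_zero_iff.mp this)

end Kirszbraun

/-- A Lipschitz family of Hermitian blocks extends from `S` to all frequencies without increasing
the norm: the blocks form a Euclidean space, and taking the Hermitian part is a contraction. -/
theorem exists_hermitian_extension {ν d : ℕ} {γ : ℝ} (hγ : 0 < γ) (S : Set (Freq ν)) {α : Spec d}
    (f : Freq ν → Block α α) (hf : ∀ ω ∈ S, (f ω).IsHermitian)
    (hfin : lipNorm γ S hsENorm f ≠ ⊤) :
    ∃ g : Freq ν → Block α α, (∀ ω ∈ S, g ω = f ω) ∧ (∀ ω, (g ω).IsHermitian) ∧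
      ∀ T, lipNorm γ T hsENorm g ≤ lipNorm γ S hsENorm f := by
  have hγ0 : ENNReal.ofReal γ ≠ 0 := by simpa using hγ
  rw [lipNorm_eq] at hfin ⊢
  have hA : supPart S hsENorm f ≠ ⊤ := ne_top_of_le_ne_top hfin le_self_add
  have hB : lipPart S hsENorm f ≠ ⊤ := fun h => by
    rw [h, ENNReal.mul_top hγ0, add_top] at hfin
    exact hfin rfl
  set M := (supPart S hsENorm f).toReal with hM
  set L := (lipPart S hsENorm f).toReal with hL
  have hM0 : 0 ≤ M := ENNReal.toReal_nonneg
  have hL0 : 0 ≤ L := ENNReal.toReal_nonneg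
  have : InnerProductSpace ℝ (EuclideanSpace ℂ (Shell α × Shell α)) :=
    InnerProductSpace.complexToReal
  obtain ⟨g, hgS, hgM, hgL⟩ := exists_lipschitz_extension (L := L) hM0 S
    (fun ω => blockVec α α (f ω))
    (fun ω₁ h₁ ω₂ h₂ => by
      rw [← map_sub, norm_blockVec]
      refine (ENNReal.ofReal_le_ofReal_iff (by positivity)).mp ?_
      rw [ENNReal.ofReal_mul hL0, hL, ENNReal.ofReal_toReal hB, ← dist_eq_norm, ← edist_dist]
      exact le_lipPart hsENorm_zero h₁ h₂)
    (fun ω h => by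
      rw [norm_blockVec]
      refine (ENNReal.ofReal_le_ofReal_iff hM0).mp ?_
      rw [hM, ENNReal.ofReal_toReal hA]
      exact le_supPart h)
  set G : Freq ν → Block α α := fun ω => (blockVec α α).symm (g ω) with hG
  have hGn : ∀ X : EuclideanSpace ℂ (Shell α × Shell α), hsENorm ((blockVec α α).symm X) = ‖X‖ₑ :=
    fun X => by rw [hsENorm_eq, LinearEquiv.apply_symm_apply]
  have half : ∀ X : Block α α, hsENorm ((1 / 2 : ℂ) • (X + X.conjTranspose)) ≤ hsENorm X :=
    fun X => by
    rw [hsENorm_smul]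
    refine (mul_le_mul_right (hsENorm_add_le _ _) _).trans (le_of_eq ?_)
    rw [hsENorm_conjTranspose, ← two_mul, ← mul_assoc]
    have : ‖(1 / 2 : ℂ)‖ₑ * 2 = 1 := by
      rw [← ofReal_norm, ← ENNReal.ofReal_ofNat 2, ← ENNReal.ofReal_mul (norm_nonneg _)]
      norm_num
    rw [this, one_mul]
  refine ⟨fun ω => (1 / 2 : ℂ) • (G ω + (G ω).conjTranspose), fun ω h => ?_, fun ω => ?_,
    fun T => ?_⟩
  · have e : G ω = f ω := by simp only [hG, hgS ω h, LinearEquiv.symm_apply_apply]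
    change (1 / 2 : ℂ) • (G ω + (G ω).conjTranspose) = f ω
    rw [e, (hf ω h).eq]
    module
  · change Matrix.conjTranspose _ = _
    rw [Matrix.conjTranspose_smul, Matrix.conjTranspose_add, Matrix.conjTranspose_conjTranspose,
      add_comm]
    simp
  · refine lipNorm_le (fun ω _ => (half _).trans ?_) fun ω₁ _ ω₂ _ => ?_
    · rw [hG, hGn, ← ofReal_norm]
      refine (ENNReal.ofReal_le_ofReal (hgM ω)).trans (le_of_eq ?_)
      rw [hM, ENNReal.ofReal_toReal hA]
    · have e : (1 / 2 : ℂ) • (G ω₁ + (G ω₁).conjTranspose) -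
          (1 / 2 : ℂ) • (G ω₂ + (G ω₂).conjTranspose) =
          (1 / 2 : ℂ) • ((G ω₁ - G ω₂) + (G ω₁ - G ω₂).conjTranspose) := by
        rw [Matrix.conjTranspose_sub]
        module
      rw [e]
      refine (half _).trans ?_
      rw [hG, ← map_sub, hGn, ← ofReal_norm]
      refine (ENNReal.ofReal_le_ofReal (hgL ω₁ ω₂)).trans (le_of_eq ?_)
      rw [abs_of_nonneg hL0, ENNReal.ofReal_mul hL0, hL, ENNReal.ofReal_toReal hB,
        ← dist_eq_norm, ← edist_dist]

/-! ### The scales -/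

section Scales

variable {N₀ : ℕ}

theorem scale_succ (k : ℕ) : scale N₀ (k + 1) = scale N₀ k ^ ((3 : ℝ) / 2) := by
  rw [scale, scale, ← Real.rpow_mul (Nat.cast_nonneg _), pow_succ]

theorem one_le_scale (h : 1 ≤ N₀) (k : ℕ) : 1 ≤ scale N₀ k :=
  Real.one_le_rpow (by exact_mod_cast h) (by positivity)

theorem one_le_scalePred (h : 1 ≤ N₀) : ∀ k, 1 ≤ scalePred N₀ k
  | 0 => le_rfl
  | k + 1 => one_le_scale h k

/-- With the factor `N₀` the relation `N_k = N_{k-1} ^ (3/2)` persists for `k = 0`, where `N_{-1} =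
1`. -/
theorem scale_le_mul_scalePred (h : 1 ≤ N₀) (k : ℕ) :
    scale N₀ k ≤ N₀ * scalePred N₀ k ^ ((3 : ℝ) / 2) := by
  have hN : (1 : ℝ) ≤ N₀ := by exact_mod_cast h
  cases k with
  | zero => simp [scale, scalePred]
  | succ k =>
    rw [scale_succ, scalePred]
    exact le_mul_of_one_le_left (Real.rpow_nonneg (by linarith [one_le_scale h k]) _) hN

theorem mul_scalePred_le_scale (h : 1 ≤ N₀) (k : ℕ) :
    (N₀ : ℝ) ^ ((1 : ℝ) / 2) * scalePred N₀ k ≤ scale N₀ k := by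
  have hN : (1 : ℝ) ≤ N₀ := by exact_mod_cast h
  cases k with
  | zero =>
    simp only [scale, scalePred, mul_one, pow_zero]
    exact Real.rpow_le_rpow_of_exponent_le hN (by norm_num)
  | succ k =>
    have h1 : (1 : ℝ) ≤ (3 / 2) ^ k := one_le_pow₀ (by norm_num)
    rw [scalePred, scale, scale, ← Real.rpow_add (by linarith), pow_succ]
    exact Real.rpow_le_rpow_of_exponent_le hN (by linarith)

theorem two_pow_le_scalePred (h : 64 ≤ N₀) (k : ℕ) : (2 : ℝ) ^ k ≤ scalePred N₀ k := by
  induction k with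
  | zero => simp [scalePred]
  | succ k ih =>
    have hN : (64 : ℝ) ≤ N₀ := by exact_mod_cast h
    have h2 : (2 : ℝ) ≤ (N₀ : ℝ) ^ ((1 : ℝ) / 2) := by
      rw [← Real.sqrt_eq_rpow]
      exact Real.le_sqrt_of_sq_le (by linarith)
    calc (2 : ℝ) ^ (k + 1) = 2 * 2 ^ k := by ring
      _ ≤ (N₀ : ℝ) ^ ((1 : ℝ) / 2) * scalePred N₀ k := by gcongr
      _ ≤ scalePred N₀ (k + 1) := mul_scalePred_le_scale (by lia) k

theorem scalePred_rpow_neg_le (h : 64 ≤ N₀) {a : ℝ} (ha : 1 ≤ a) (k : ℕ) :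
    scalePred N₀ k ^ (-a) ≤ (1 / 2) ^ k := by
  have h1 := one_le_scalePred (N₀ := N₀) (by lia) k
  have h2 := two_pow_le_scalePred h k
  calc scalePred N₀ k ^ (-a) ≤ scalePred N₀ k ^ (-1 : ℝ) :=
        Real.rpow_le_rpow_of_exponent_le h1 (by linarith)
    _ = (scalePred N₀ k)⁻¹ := Real.rpow_neg_one _
    _ ≤ ((2 : ℝ) ^ k)⁻¹ := by gcongr
    _ = (1 / 2) ^ k := by rw [one_div, inv_pow]

end Scales

/-! ### The iteration -/

section Iteration

variable {ν d : ℕ} {γ τ e : ℝ} {S T : Set (Freq ν)}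

theorem decayLip_mono_set (h : S ⊆ T) (s : ℝ) (X : Freq ν → (Fin ν → ℝ) → Op2 d) :
    decayLip γ S s X ≤ decayLip γ T s X := add_le_add (lipNorm_mono h) (lipNorm_mono h)

theorem decayLip_mono_exponent {s t : ℝ} (h : s ≤ t) (X : Freq ν → (Fin ν → ℝ) → Op2 d) :
    decayLip γ S s X ≤ decayLip γ S t X := by
  have key : ∀ G : Freq ν → (Fin ν → ℝ) → Op d,
      lipNorm γ S (decayNorm s) G ≤ lipNorm γ S (decayNorm t) G := fun G => by
    have hw : ∀ F : (Fin ν → ℝ) → Op d, decayNorm s F ≤ 1 * decayNorm t F := fun F =>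
      decayNorm_le_of_hatBlock_le' fun l α β => by
        rw [one_mul]
        exact mul_le_mul_left (wt_mono h l α β) _
    simpa using lipNorm_le_of_le' (γ := γ) (S := S) (a := 1) (f := G) (g := G) (decayNorm_zero t)
      (fun ω _ => hw _) (fun ω₁ _ ω₂ _ => hw _)
  exact add_le_add (key _) (key _)

theorem algConst_mono {s t : ℝ} (h : s ≤ t) : algConst ν d s ≤ algConst ν d t := by
  unfold algConst
  gcongr
  norm_num

theorem lipNorm_block_add_le {α β : Spec d} (f g : Freq ν → Block α β) :
    lipNorm γ S hsENorm (fun ω => f ω + g ω) ≤ lipNorm γ S hsENorm f + lipNorm γ S hsENorm g := by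
  have h := lipNorm_le_of_le (γ := γ) (S := S) (n := hsENorm) (f := fun ω => f ω + g ω) (g := f)
    (k := g) (a := 1) (b := 1) hsENorm_zero hsENorm_zero
    (fun ω _ => by simpa using hsENorm_add_le (f ω) (g ω))
    (fun ω₁ _ ω₂ _ => by
      rw [add_sub_add_comm]
      simpa using hsENorm_add_le (f ω₁ - f ω₂) (g ω₁ - g ω₂))
  simpa using h

/-- The increment of the normal form is the average of a diagonal block, which decays in `α`. -/
theorem lipNorm_nextDiag_sub_le (N : ℝ) (D : Freq ν → BlockDiag d)
    {F : Freq ν → (Fin ν → ℝ) → Op2 d} (hF : ContOn S F) (s : ℝ) (α : Spec d) :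
    lipNorm γ S hsENorm (fun ω => nextDiag N (D ω) (F ω) α - D ω α) ≤
      ENNReal.ofReal (α.1 ^ (-s)) * decayLip γ S s F := by
  by_cases h : α.1 ≤ N
  · have e : (fun ω => nextDiag N (D ω) (F ω) α - D ω α) =
        fun ω => Complex.I • block11 (F ω) 0 α α := funext fun ω => by
      rw [nextDiag, if_pos h, add_sub_cancel_left]
    have hI : ∀ X : Block α α, hsENorm (Complex.I • X) ≤ 1 * hsENorm X := fun X => by
      rw [hsENorm_smul, ← ofReal_norm, Complex.norm_I, ENNReal.ofReal_one]
    rw [e]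
    refine (lipNorm_le_of_le' (a := 1) (g := fun ω => block11 (F ω) 0 α α) hsENorm_zero
      (fun ω _ => hI _) (fun ω₁ _ ω₂ _ => ?_)).trans ((one_mul _).trans_le
        (lipNorm_block11_le hF s α))
    rw [← smul_sub]
    exact hI _
  · have e : (fun ω => nextDiag N (D ω) (F ω) α - D ω α) = fun _ => (0 : Block α α) :=
      funext fun ω => by rw [nextDiag, if_neg h, sub_self]
    rw [e]
    refine le_trans (le_of_eq ?_) (zero_le)
    simp [lipNorm, hsENorm_zero]

/-- The iterates `(D_k, R_k)`, defined by the same formulas for every `ω`; they are meaningful on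
the set where the Melnikov conditions hold. -/
def kamIter (N₀ : ℕ) (D₀ : Freq ν → BlockDiag d) (R₀ : Freq ν → (Fin ν → ℝ) → Op2 d) :
    ℕ → Freq ν → BlockDiag d × ((Fin ν → ℝ) → Op2 d)
  | 0, ω => (D₀ ω, R₀ ω)
  | k + 1, ω => (nextDiag (scale N₀ k) (kamIter N₀ D₀ R₀ k ω).1 (kamIter N₀ D₀ R₀ k ω).2,
      nextPert (scale N₀ k) (kamIter N₀ D₀ R₀ k ω).1 ω (kamIter N₀ D₀ R₀ k ω).2)

/-- The normal form `D_k`. -/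
def kamDiag (N₀ : ℕ) (D₀ : Freq ν → BlockDiag d) (R₀ : Freq ν → (Fin ν → ℝ) → Op2 d) (k : ℕ)
    (ω : Freq ν) : BlockDiag d := (kamIter N₀ D₀ R₀ k ω).1

/-- The perturbation `R_k`. -/
def kamPert (N₀ : ℕ) (D₀ : Freq ν → BlockDiag d) (R₀ : Freq ν → (Fin ν → ℝ) → Op2 d) (k : ℕ)
    (ω : Freq ν) : (Fin ν → ℝ) → Op2 d := (kamIter N₀ D₀ R₀ k ω).2

/-- The parameters for which `k` steps can be performed. -/
abbrev kamSet (Ω : Set (Freq ν)) (γ τ e : ℝ) (N₀ : ℕ) (D₀ : Freq ν → BlockDiag d)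
    (R₀ : Freq ν → (Fin ν → ℝ) → Op2 d) (k : ℕ) : Set (Freq ν) :=
  goodSet Ω γ τ e N₀ (kamDiag N₀ D₀ R₀) k

variable {Ω : Set (Freq ν)} {N₀ : ℕ} {D₀ : Freq ν → BlockDiag d}
  {R₀ : Freq ν → (Fin ν → ℝ) → Op2 d}

theorem kamSet_succ_subset (k : ℕ) :
    kamSet Ω γ τ e N₀ D₀ R₀ (k + 1) ⊆ kamSet Ω γ τ e N₀ D₀ R₀ k := fun _ h => h.1

theorem kamSet_subset : ∀ k, kamSet Ω γ τ e N₀ D₀ R₀ k ⊆ DC Ω γ τ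
  | 0 => subset_rfl
  | k + 1 => (kamSet_succ_subset k).trans (kamSet_subset k)

/-- All iterates are self-adjoint normal forms with Hamiltonian perturbations, continuous on the
torus. -/
theorem kam_structure (hN₀ : 1 ≤ N₀) (hD₀ : ∀ ω ∈ DC Ω γ τ, ∀ α, (D₀ ω α).IsHermitian)
    (hscal : ∀ ω ∈ DC Ω γ τ, IsAlmostScalar (D₀ ω)) (hcont : ContOn (DC Ω γ τ) R₀)
    (hham : ∀ ω ∈ DC Ω γ τ, ∀ φ, IsHamiltonian (R₀ ω φ)) (k : ℕ) :
    ∀ ω ∈ kamSet Ω γ τ e N₀ D₀ R₀ k, (∀ α, (kamDiag N₀ D₀ R₀ k ω α).IsHermitian) ∧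
      IsAlmostScalar (kamDiag N₀ D₀ R₀ k ω) ∧ TorusCont (kamPert N₀ D₀ R₀ k ω) ∧
      ∀ φ, IsHamiltonian (kamPert N₀ D₀ R₀ k ω φ) := by
  induction k with
  | zero => exact fun ω h => ⟨hD₀ ω h, hscal ω h, hcont ω h, hham ω h⟩
  | succ k ih =>
    intro ω h
    obtain ⟨h1, h2, h3, h4⟩ := ih ω h.1
    refine ⟨nextDiag_isHermitian h1 h4, h2.nextDiag _ _, ?_,
      isHamiltonian_nextPert h1 (one_le_scale hN₀ k) h4 h.2⟩
    exact contOn_nextPert (S := {ω}) (N := scale N₀ k) (D := kamDiag N₀ D₀ R₀ k)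
      (F := kamPert N₀ D₀ R₀ k) (fun ω' h' => by rwa [Set.mem_singleton_iff.mp h']) ω rfl

/-- The normal forms stay close to the initial one: the increments are summable because the
scales grow at least geometrically. -/
theorem lipNorm_kamDiag_sub_le (hN₀ : 64 ≤ N₀) {s x a : ℝ} (hx : 0 ≤ x) (ha : 1 ≤ a) (k : ℕ)
    (hcont : ∀ i < k, ContOn (kamSet Ω γ τ e N₀ D₀ R₀ i) (kamPert N₀ D₀ R₀ i))
    (hlow : ∀ i < k, decayLip γ (kamSet Ω γ τ e N₀ D₀ R₀ i) s (kamPert N₀ D₀ R₀ i) ≤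
      ENNReal.ofReal (x * scalePred N₀ i ^ (-a))) (α : Spec d) :
    lipNorm γ (kamSet Ω γ τ e N₀ D₀ R₀ k) hsENorm
        (fun ω => kamDiag N₀ D₀ R₀ k ω α - kamDiag N₀ D₀ R₀ 0 ω α) ≤
      ENNReal.ofReal (2 * x * α.1 ^ (-s)) := by
  have hα : 0 ≤ α.1 ^ (-s) := Real.rpow_nonneg α.pos.le _
  have key : lipNorm γ (kamSet Ω γ τ e N₀ D₀ R₀ k) hsENorm
        (fun ω => kamDiag N₀ D₀ R₀ k ω α - kamDiag N₀ D₀ R₀ 0 ω α) ≤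
      ENNReal.ofReal (α.1 ^ (-s) * x * (2 * (1 - (1 / 2) ^ k))) := by
    induction k with
    | zero => simp [lipNorm, hsENorm_zero]
    | succ k ih =>
      have e1 : (fun ω => kamDiag N₀ D₀ R₀ (k + 1) ω α - kamDiag N₀ D₀ R₀ 0 ω α) =
          fun ω => (kamDiag N₀ D₀ R₀ k ω α - kamDiag N₀ D₀ R₀ 0 ω α) +
            (kamDiag N₀ D₀ R₀ (k + 1) ω α - kamDiag N₀ D₀ R₀ k ω α) := funext fun ω => by abel
      have h1 := (lipNorm_mono (γ := γ) (n := hsENorm) (kamSet_succ_subset (Ω := Ω) (γ := γ) (τ := τ)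
        (e := e) (N₀ := N₀) (D₀ := D₀) (R₀ := R₀) k)).trans
          (ih (fun i hi => hcont i (by lia)) (fun i hi => hlow i (by lia)))
      have h2 := (lipNorm_mono (γ := γ) (n := hsENorm) (kamSet_succ_subset (Ω := Ω) (γ := γ) (τ := τ)
        (e := e) (N₀ := N₀) (D₀ := D₀) (R₀ := R₀) k)).trans
          ((lipNorm_nextDiag_sub_le (γ := γ) (scale N₀ k) (kamDiag N₀ D₀ R₀ k)
            (hcont k (by lia)) s α).trans (mul_le_mul_right (hlow k (by lia)) _))
      have hpow : (1 / 2 : ℝ) ^ k ≤ 1 := pow_le_one₀ (by norm_num) (by norm_num)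
      have hM := scalePred_rpow_neg_le hN₀ ha k
      have hM0 : 0 ≤ scalePred N₀ k ^ (-a) :=
        Real.rpow_nonneg (by linarith [one_le_scalePred (N₀ := N₀) (by lia) k]) _
      rw [e1]
      refine (lipNorm_block_add_le _ _).trans ((add_le_add h1 h2).trans ?_)
      rw [← ENNReal.ofReal_mul hα, ← ENNReal.ofReal_add
        (mul_nonneg (mul_nonneg hα hx) (by linarith)) (by positivity)]
      refine ENNReal.ofReal_le_ofReal ?_
      have h3 : α.1 ^ (-s) * x * scalePred N₀ k ^ (-a) ≤ α.1 ^ (-s) * x * (1 / 2) ^ k := by gcongr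
      rw [pow_succ]
      linarith
  refine key.trans (ENNReal.ofReal_le_ofReal ?_)
  have hpow : (0 : ℝ) ≤ (1 / 2 : ℝ) ^ k := by positivity
  nlinarith [mul_nonneg (mul_nonneg hα hx) hpow]

/-- The diagonal operators `(m α + c(α)) + Y` have a small Lipschitz constant in `ω`. -/
theorem hsENorm_diag_sub_mul_le (hγ : 0 < γ) {A B : ℝ} (hA : 0 ≤ A) (hB : 0 ≤ B)
    (hAB : γ⁻¹ * (A + B) ≤ 1) {m : ℝ}
    {c : Freq ν → ℝ} {α β : Spec d} {Y : Freq ν → Block α α}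
    (hc : lipNorm γ S (fun x : ℝ => ‖x‖ₑ) c ≤ ENNReal.ofReal A)
    (hY : lipNorm γ S hsENorm (fun ω => Y ω - ((m * α.1 + c ω : ℝ) : ℂ) • (1 : Block α α)) ≤
      ENNReal.ofReal B)
    {ω₁ ω₂ : Freq ν} (h₁ : ω₁ ∈ S) (h₂ : ω₂ ∈ S) (X : Block α β) :
    hsENorm ((Y ω₁ - Y ω₂) * X) ≤ edist ω₁ ω₂ * hsENorm X := by
  have hγ0 : ENNReal.ofReal γ ≠ 0 := by simpa using hγ
  set Z : Freq ν → Block α α := fun ω => Y ω - ((m * α.1 + c ω : ℝ) : ℂ) • (1 : Block α α) with hZ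
  have e : Y ω₁ - Y ω₂ = ((c ω₁ - c ω₂ : ℝ) : ℂ) • (1 : Block α α) + (Z ω₁ - Z ω₂) := by
    simp only [hZ]
    push_cast
    module
  have h1 := le_lipPart (n := fun x : ℝ => ‖x‖ₑ) (f := c) (by simp) h₁ h₂
  have h2 := le_lipPart (n := hsENorm) (f := Z) hsENorm_zero h₁ h₂
  have h3 : lipPart S (fun x : ℝ => ‖x‖ₑ) c + lipPart S hsENorm Z ≤ 1 := by
    refine (ENNReal.mul_le_mul_iff_right hγ0 ENNReal.ofReal_ne_top).mp ?_
    rw [mul_add, mul_one]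
    refine (add_le_add (le_add_self.trans hc) (le_add_self.trans hY)).trans ?_
    rw [← ENNReal.ofReal_add hA hB]
    refine ENNReal.ofReal_le_ofReal ?_
    have := mul_le_mul_of_nonneg_left hAB hγ.le
    rwa [← mul_assoc, mul_inv_cancel₀ hγ.ne', one_mul, mul_one] at this
  have hc' : ‖((c ω₁ - c ω₂ : ℝ) : ℂ)‖ₑ = ‖c ω₁ - c ω₂‖ₑ := by
    rw [← ofReal_norm, ← ofReal_norm, Complex.norm_real]
  rw [e, Matrix.add_mul, Matrix.smul_mul, Matrix.one_mul]
  calc hsENorm (((c ω₁ - c ω₂ : ℝ) : ℂ) • X + (Z ω₁ - Z ω₂) * X)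
      ≤ ‖c ω₁ - c ω₂‖ₑ * hsENorm X + hsENorm (Z ω₁ - Z ω₂) * hsENorm X := by
        refine (hsENorm_add_le _ _).trans (add_le_add (le_of_eq ?_) (hsENorm_mul_le _ _))
        rw [hsENorm_smul, hc']
    _ ≤ (lipPart S (fun x : ℝ => ‖x‖ₑ) c * edist ω₁ ω₂ + lipPart S hsENorm Z * edist ω₁ ω₂) *
        hsENorm X := by
        rw [← add_mul]
        gcongr
    _ = (lipPart S (fun x : ℝ => ‖x‖ₑ) c + lipPart S hsENorm Z) * (edist ω₁ ω₂ * hsENorm X) := by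
        ring
    _ ≤ 1 * (edist ω₁ ω₂ * hsENorm X) := mul_le_mul_left h3 _
    _ = _ := one_mul _

end Iteration

/-! ### Estimates of the iterates -/

section Estimates

variable {ν d : ℕ} {γ τ e : ℝ} {Ω : Set (Freq ν)} {N₀ : ℕ} {m A κ t : ℝ}
  {c : Spec d → Freq ν → ℝ} {R₀ : Freq ν → (Fin ν → ℝ) → Op2 d}

/-- The initial normal form `diag (m α + c(α))`. -/
def initDiag (m : ℝ) (c : Spec d → Freq ν → ℝ) (ω : Freq ν) : BlockDiag d := fun α =>
  ((m * α.1 + c α ω : ℝ) : ℂ) • (1 : Block α α)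

theorem initDiag_isHermitian (m : ℝ) (c : Spec d → Freq ν → ℝ) (ω : Freq ν) (α : Spec d) :
    (initDiag m c ω α).IsHermitian := by
  rw [Matrix.IsHermitian, initDiag, Matrix.conjTranspose_smul, Matrix.conjTranspose_one,
    Complex.star_def, Complex.conj_ofReal]

theorem isAlmostScalar_initDiag {S : Set (Freq ν)} (hA : 0 ≤ A)
    (hc : ∀ α, lipNorm γ S (fun x : ℝ => ‖x‖ₑ) (c α) ≤ ENNReal.ofReal A) {ω : Freq ν}
    (hω : ω ∈ S) : IsAlmostScalar (initDiag m c ω) := by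
  refine ⟨|m| + A, 0, fun α _ => ⟨_, rfl, ?_⟩⟩
  have h1 : ‖c α ω‖ ≤ A := by
    have h := (le_lipNorm (γ := γ) (n := fun x : ℝ => ‖x‖ₑ) (f := c α) hω).trans (hc α)
    rw [← ofReal_norm] at h
    exact (ENNReal.ofReal_le_ofReal_iff hA).mp h
  rw [Complex.norm_real]
  calc ‖m * α.1 + c α ω‖ ≤ ‖m * α.1‖ + ‖c α ω‖ := norm_add_le _ _
    _ ≤ |m| * α.1 + A * α.1 := by
        rw [norm_mul, Real.norm_of_nonneg α.pos.le]
        exact add_le_add le_rfl (h1.trans (le_mul_of_one_le_right hA α.one_le))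
    _ = _ := by ring

theorem lipNorm_initDiag_lt_top {S : Set (Freq ν)} {α : Spec d}
    (hc : lipNorm γ S (fun x : ℝ => ‖x‖ₑ) (c α) ≤ ENNReal.ofReal A) :
    lipNorm γ S hsENorm (fun ω => initDiag m c ω α) < ⊤ := by
  have hc' : ∀ x : ℝ, ‖(x : ℂ)‖ₑ = ‖x‖ₑ := fun x => by
    rw [← ofReal_norm, ← ofReal_norm, Complex.norm_real]
  have h1 : ∀ ω ∈ S, hsENorm (initDiag m c ω α) ≤
      (‖m * α.1‖ₑ + ENNReal.ofReal A) * hsENorm (1 : Block α α) := fun ω hω => by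
    rw [initDiag, hsENorm_smul, hc']
    refine mul_le_mul_left ((enorm_add_le _ _).trans (add_le_add le_rfl ?_)) _
    exact (le_lipNorm (γ := γ) (n := fun x : ℝ => ‖x‖ₑ) (f := c α) hω).trans hc
  have h2 : ∀ ω₁ ∈ S, ∀ ω₂ ∈ S, hsENorm (initDiag m c ω₁ α - initDiag m c ω₂ α) ≤
      lipPart S (fun x : ℝ => ‖x‖ₑ) (c α) * hsENorm (1 : Block α α) * edist ω₁ ω₂ :=
    fun ω₁ hω₁ ω₂ hω₂ => by
    have e1 : initDiag m c ω₁ α - initDiag m c ω₂ α =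
        ((c α ω₁ - c α ω₂ : ℝ) : ℂ) • (1 : Block α α) := by
      simp only [initDiag]
      push_cast
      module
    rw [e1, hsENorm_smul, hc', mul_right_comm]
    exact mul_le_mul_left (le_lipPart (n := fun x : ℝ => ‖x‖ₑ) (by simp) hω₁ hω₂) _
  refine (lipNorm_le h1 h2).trans_lt ?_
  rw [← mul_assoc]
  refine ENNReal.add_lt_top.mpr ⟨?_, ?_⟩
  · exact ENNReal.mul_lt_top (ENNReal.add_lt_top.mpr ⟨enorm_lt_top, ENNReal.ofReal_lt_top⟩)
      (hsENorm_lt_top _)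
  · exact ENNReal.mul_lt_top ((le_add_self.trans hc).trans_lt ENNReal.ofReal_lt_top)
      (hsENorm_lt_top _)

/-- The data of the iteration: regularity, Hamiltonian structure and smallness of the initial
vector field, for the exponents `ν + d ≤ s ≤ t`. -/
structure KamData (Ω : Set (Freq ν)) (γ τ e : ℝ) (N₀ : ℕ) (c : Spec d → Freq ν → ℝ)
    (R₀ : Freq ν → (Fin ν → ℝ) → Op2 d) (A κ t : ℝ) : Prop where
  one_le_dim : 1 ≤ ν
  gamma_pos : 0 < γ
  tau_nonneg : 0 ≤ τ
  loss_nonneg : 0 ≤ e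
  scale_le : 64 ≤ N₀
  bound_nonneg : 0 ≤ A
  cont : ContOn (DC Ω γ τ) R₀
  ham : ∀ ω ∈ DC Ω γ τ, ∀ φ, IsHamiltonian (R₀ ω φ)
  diag_le : ∀ α, lipNorm γ (DC Ω γ τ) (fun x : ℝ => ‖x‖ₑ) (c α) ≤ ENNReal.ofReal A
  pert_le : ∀ s, (ν : ℝ) + d ≤ s → s ≤ t →
    decayLip γ (DC Ω γ τ) (s + bExp τ e) R₀ ≤ ENNReal.ofReal A
  exponent_le : (ν : ℝ) + d ≤ t
  algConst_le : algConst ν d (t + bExp τ e) ≤ ENNReal.ofReal κ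
  small : γ⁻¹ * A * (768 * κ * (N₀ : ℝ) ^ aExp τ e) ≤ 1
  small' : γ⁻¹ * (A + 2 * A) ≤ 1

namespace KamData

/-- The size `|R₀|_{s+b}` of the initial perturbation. -/
def size (Ω : Set (Freq ν)) (γ τ e : ℝ) (R₀ : Freq ν → (Fin ν → ℝ) → Op2 d) (s : ℝ) : ℝ :=
  (decayLip γ (DC Ω γ τ) (s + bExp τ e) R₀).toReal

theorem size_nonneg (s : ℝ) : 0 ≤ size Ω γ τ e R₀ s := ENNReal.toReal_nonneg

theorem ofReal_size (h : KamData Ω γ τ e N₀ c R₀ A κ t) {s : ℝ} (hs : (ν : ℝ) + d ≤ s)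
    (hst : s ≤ t) :
    ENNReal.ofReal (size Ω γ τ e R₀ s) = decayLip γ (DC Ω γ τ) (s + bExp τ e) R₀ :=
  ENNReal.ofReal_toReal (ne_top_of_le_ne_top ENNReal.ofReal_ne_top (h.pert_le s hs hst))

theorem size_le (h : KamData Ω γ τ e N₀ c R₀ A κ t) {s : ℝ} (hs : (ν : ℝ) + d ≤ s)
    (hst : s ≤ t) : size Ω γ τ e R₀ s ≤ A :=
  ENNReal.toReal_le_of_le_ofReal h.bound_nonneg (h.pert_le s hs hst)

/-- The structure of the iterates that start from the data of the theorem. -/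
theorem structure_spec (h : KamData Ω γ τ e N₀ c R₀ A κ t) (m : ℝ) (k : ℕ) :
    ∀ ω ∈ kamSet Ω γ τ e N₀ (initDiag m c) R₀ k,
      (∀ α, (kamDiag N₀ (initDiag m c) R₀ k ω α).IsHermitian) ∧
      IsAlmostScalar (kamDiag N₀ (initDiag m c) R₀ k ω) ∧
      TorusCont (kamPert N₀ (initDiag m c) R₀ k ω) ∧
      ∀ φ, IsHamiltonian (kamPert N₀ (initDiag m c) R₀ k ω φ) :=
  kam_structure (by linarith [h.scale_le]) (fun ω _ => initDiag_isHermitian m c ω)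
    (fun _ hω => isAlmostScalar_initDiag h.bound_nonneg h.diag_le hω) h.cont h.ham k

/-- The bounds on the `k`-th perturbation in the norms of exponents `s` and `s + b`. -/
def PertBound (Ω : Set (Freq ν)) (γ τ e : ℝ) (N₀ : ℕ) (D₀ : Freq ν → BlockDiag d)
    (R₀ : Freq ν → (Fin ν → ℝ) → Op2 d) (k : ℕ) (s : ℝ) : Prop :=
  decayLip γ (kamSet Ω γ τ e N₀ D₀ R₀ k) s (kamPert N₀ D₀ R₀ k) ≤
      ENNReal.ofReal (size Ω γ τ e R₀ s * scalePred N₀ k ^ (-aExp τ e)) ∧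
    decayLip γ (kamSet Ω γ τ e N₀ D₀ R₀ k) (s + bExp τ e) (kamPert N₀ D₀ R₀ k) ≤
      ENNReal.ofReal (size Ω γ τ e R₀ s * scalePred N₀ k)

theorem one_le_aExp (h : KamData Ω γ τ e N₀ c R₀ A κ t) : 1 ≤ aExp τ e := by
  unfold aExp
  linarith [h.tau_nonneg, h.loss_nonneg]

/-- The normal forms stay close to the initial one, as long as the bounds on the perturbations hold.
-/
theorem lipNorm_diag_sub_le (h : KamData Ω γ τ e N₀ c R₀ A κ t) (m : ℝ) (k : ℕ)
    (hb : ∀ i < k, PertBound Ω γ τ e N₀ (initDiag m c) R₀ i t) (α : Spec d) :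
    lipNorm γ (kamSet Ω γ τ e N₀ (initDiag m c) R₀ k) hsENorm
        (fun ω => kamDiag N₀ (initDiag m c) R₀ k ω α - kamDiag N₀ (initDiag m c) R₀ 0 ω α) ≤
      ENNReal.ofReal (2 * A * α.1 ^ (-t)) := by
  refine (lipNorm_kamDiag_sub_le h.scale_le (size_nonneg (Ω := Ω) t) h.one_le_aExp k
    (fun i _ ω hω => (h.structure_spec m i ω hω).2.2.1) (fun i hi => (hb i hi).1) α).trans ?_
  refine ENNReal.ofReal_le_ofReal ?_
  have := h.size_le h.exponent_le le_rfl
  have hα : 0 ≤ α.1 ^ (-t) := Real.rpow_nonneg α.pos.le _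
  gcongr

/-- One step: the bound on the generator and the bounds on the next perturbation. The bounds on all
earlier perturbations, in the exponent `t`, control the dependence of the normal form on `ω`. -/
theorem step (h : KamData Ω γ τ e N₀ c R₀ A κ t) (m : ℝ) (k : ℕ)
    (hb : ∀ i < k, PertBound Ω γ τ e N₀ (initDiag m c) R₀ i t) {s : ℝ}
    (hs : (ν : ℝ) + d ≤ s) (hst : s ≤ t) (hk : PertBound Ω γ τ e N₀ (initDiag m c) R₀ k s) :
    decayLip γ (kamSet Ω γ τ e N₀ (initDiag m c) R₀ (k + 1)) s
        (fun ω => generator (scale N₀ k) (kamDiag N₀ (initDiag m c) R₀ k ω) ω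
          (kamPert N₀ (initDiag m c) R₀ k ω)) ≤
      ENNReal.ofReal (size Ω γ τ e R₀ s *
        (γ⁻¹ * scale N₀ k ^ lossExp τ e * scalePred N₀ k ^ (-aExp τ e))) ∧
    PertBound Ω γ τ e N₀ (initDiag m c) R₀ (k + 1) s := by
  have hN₀ : 1 ≤ N₀ := by linarith [h.scale_le]
  have hγ := h.gamma_pos
  have hA := h.bound_nonneg
  have hκ : algConst ν d (s + bExp τ e) ≤ ENNReal.ofReal κ :=
    (algConst_mono (by linarith)).trans h.algConst_le
  have hκ0 : 0 ≤ κ := by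
    have := (one_le_algConst (ν := ν) (d := d) (t + bExp τ e)).trans h.algConst_le
    linarith [ENNReal.one_le_ofReal.mp this]
  have hsub := kamSet_succ_subset (Ω := Ω) (γ := γ) (τ := τ) (e := e) (N₀ := N₀)
    (D₀ := initDiag m c) (R₀ := R₀) k
  have hspec := h.structure_spec m k
  have h1 := step_estimates (γ := γ) (τ := τ) (e := e)
    (S := kamSet Ω γ τ e N₀ (initDiag m c) R₀ (k + 1)) (s := s) (N := scale N₀ k)
    (D := kamDiag N₀ (initDiag m c) R₀ k) (F := kamPert N₀ (initDiag m c) R₀ k)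
    h.one_le_dim hγ h.tau_nonneg h.loss_nonneg hs hκ (one_le_scalePred hN₀ k)
    (N₀ := N₀) (by exact_mod_cast h.scale_le) (mul_scalePred_le_scale hN₀ k)
    (scale_le_mul_scalePred hN₀ k) (size_nonneg (Ω := Ω) (γ := γ) (R₀ := R₀) s) ?_
    (fun ω hω => (hspec ω (hsub hω)).2.2.1) (fun ω hω => (hspec ω (hsub hω)).2.2.2)
    (fun ω hω => hω.2) (fun ω hω => (hspec ω (hsub hω)).1) ?_
    ((decayLip_mono_set hsub _ _).trans hk.1) ((decayLip_mono_set hsub _ _).trans hk.2)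
  · exact ⟨h1.1, h1.2.1, h1.2.2⟩
  · refine le_trans ?_ h.small
    have := h.size_le hs hst
    have hp : (0 : ℝ) ≤ (N₀ : ℝ) ^ aExp τ e := Real.rpow_nonneg (Nat.cast_nonneg _) _
    gcongr
  · intro ω₁ h₁ ω₂ h₂ α β X
    refine hsENorm_diag_sub_mul_le (S := kamSet Ω γ τ e N₀ (initDiag m c) R₀ k) hγ hA
      (by linarith) h.small' (m := m) (c := c α) (Y := fun ω => kamDiag N₀ (initDiag m c) R₀ k ω α)
      ((lipNorm_mono (kamSet_subset k)).trans (h.diag_le α)) ?_ (hsub h₁) (hsub h₂) X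
    refine (h.lipNorm_diag_sub_le m k hb α).trans (ENNReal.ofReal_le_ofReal ?_)
    refine mul_le_of_le_one_right (by linarith)
      (Real.rpow_le_one_of_one_le_of_nonpos α.one_le ?_)
    have := h.exponent_le
    have h2 : (0 : ℝ) ≤ (ν : ℝ) + d := by positivity
    linarith

/-- The bounds hold for all iterates, and for all exponents `s` with one and the same smallness
condition. -/
theorem pertBound (h : KamData Ω γ τ e N₀ c R₀ A κ t) (m : ℝ) (k : ℕ) :
    ∀ s, (ν : ℝ) + d ≤ s → s ≤ t → PertBound Ω γ τ e N₀ (initDiag m c) R₀ k s := by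
  induction k using Nat.strong_induction_on with
  | _ k ih =>
    intro s hs hst
    cases k with
    | zero =>
      have hb : 0 ≤ bExp τ e := by
        unfold bExp
        linarith [h.one_le_aExp]
      simp only [PertBound, scalePred, Real.one_rpow, mul_one, h.ofReal_size hs hst]
      exact ⟨decayLip_mono_exponent (by linarith) R₀, le_rfl⟩
    | succ k =>
      exact (h.step m k (fun i hi => ih i (by lia) t h.exponent_le le_rfl) hs hst
        (ih k (by lia) s hs hst)).2

end KamData

/-! ### Convergence of the extended blocks -/

/-- A series of blocks whose Lipschitz norms are summable converges in the Lipschitz norm. -/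
theorem tendsto_lipNorm_partialSum {S : Set (Freq ν)} {α β : Spec d}
    {g : ℕ → Freq ν → Block α β}
    (hg : ∑' i, lipNorm γ S hsENorm (g i) ≠ ⊤) :
    Filter.Tendsto (fun k => lipNorm γ S hsENorm
      (fun ω => ∑ i ∈ Finset.range k, g i ω - ∑' i, g i ω)) Filter.atTop (nhds 0) := by
  have hsum : ∀ ω ∈ S, HasSum (fun i => g i ω) (∑' i, g i ω) := fun ω hω => by
    refine Summable.hasSum ?_
    have h1 : ∑' i, hsENorm (g i ω) ≠ ⊤ :=
      ne_top_of_le_ne_top hg (ENNReal.tsum_le_tsum fun i => le_lipNorm hω)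
    have h2 : Summable fun i => hsNorm (g i ω) := by
      refine (ENNReal.summable_toReal h1).congr fun i => ?_
      exact ENNReal.toReal_ofReal (hsNorm_nonneg _)
    exact Pi.summable.mpr fun j => Pi.summable.mpr fun j' =>
      Summable.of_norm_bounded h2 fun i => norm_entry_le_hsNorm _ j j'
  have htail : ∀ k, ∀ ω ∈ S, HasSum (fun i => -g (i + k) ω)
      (∑ i ∈ Finset.range k, g i ω - ∑' i, g i ω) := fun k ω hω => by
    have := ((hasSum_nat_add_iff' k).mpr (hsum ω hω)).neg
    rwa [neg_sub] at this
  have hentry : ∀ {f : ℕ → Block α β} {X : Block α β}, HasSum f X →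
      ∀ j j', HasSum (fun i => f i j j') (X j j') := fun hf j j' =>
    Pi.hasSum.mp (Pi.hasSum.mp hf j) j'
  refine tendsto_of_tendsto_of_tendsto_of_le_of_le tendsto_const_nhds
    (ENNReal.tendsto_sum_nat_add (fun i => lipNorm γ S hsENorm (g i)) hg) (fun _ => zero_le)
    fun k => ?_
  refine lipNorm_le_tsum (g := fun i ω => g (i + k) ω) hsENorm_zero (fun ω hω => ?_)
    fun ω₁ h₁ ω₂ h₂ => ?_
  · refine (hsENorm_le_tsum_of_hasSum (hentry (htail k ω hω))).trans (le_of_eq ?_)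
    simp only [hsENorm_neg]
  · refine (hsENorm_le_tsum_of_hasSum (hentry ((htail k ω₁ h₁).sub (htail k ω₂ h₂)))).trans
      (le_of_eq (tsum_congr fun i => ?_))
    rw [← hsENorm_neg]
    congr 1
    abel

end Estimates

end KAM

end

/-! ### The reducibility theorem -/

/-- The exponents `s ≥ 2 s₀` admit the product estimate, with one unit to spare. -/
theorem KAM.natCast_add_le_two_mul_sZero (ν d : ℕ) : (ν : ℝ) + d + 1 ≤ 2 * KAM.sZero ν d := by
  unfold KAM.sZero
  have h : ν + d + 1 ≤ 2 * ((ν + d) / 2 + 1) := by lia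
  exact_mod_cast h

theorem KAM.sZero_le (ν d : ℕ) : KAM.sZero ν d ≤ (ν : ℝ) + d + 1 := by
  unfold KAM.sZero
  have h : (ν + d) / 2 + 1 ≤ ν + d + 1 := by lia
  exact_mod_cast h

theorem theorem4p1 (ν d : ℕ) (hν : 1 ≤ ν) (hd : 1 ≤ d) (τ e σ : ℝ)
    (hτ : 0 < τ) (he : 0 < e) (hσ : 0 < σ) :
    -- `e` is the exponent of the loss of space derivatives in the Melnikov conditions;
    -- `C₁` is the constant in the estimate of the Lipschitz extensions
    ∃ C₁ : ℝ, 0 < C₁ ∧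
    ∀ q : ℝ, 2 * (2 * KAM.sZero ν d + KAM.muBar d σ τ + KAM.bExp τ e) < q →
    -- `K` is the constant in the bounds on the data `m`, `c`, `R₀`
    ∀ K : ℝ, 0 < K →
    ∃ (C : ℝ) (Nmin : ℕ), 0 < C ∧ ∀ N₀ : ℕ, Nmin ≤ N₀ →
    ∃ δ : ℝ, 0 < δ ∧ δ < 1 ∧
    ∀ (γ ε : ℝ), 0 < γ → γ < 1 → 0 < ε → ε * γ⁻¹ ≤ δ →
    ∀ (Ω : Set (KAM.Freq ν)), IsCompact Ω →
    ∀ (m : ℝ) (c : KAM.Spec d → KAM.Freq ν → ℝ)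
      (R₀ : KAM.Freq ν → (Fin ν → ℝ) → KAM.Op2 d),
    |m - 1| ≤ K * ε →
    (∀ α, KAM.lipNorm γ (KAM.DC Ω γ τ) (fun x : ℝ => ‖x‖ₑ) (c α) * ENNReal.ofReal α.1
      ≤ ENNReal.ofReal (K * ε)) →
    (∀ ω ∈ KAM.DC Ω γ τ, KAM.TorusPeriodic (R₀ ω) ∧ Continuous (R₀ ω) ∧
      ∀ φ, KAM.IsHamiltonian (R₀ ω φ)) →
    (∀ s : ℝ, KAM.sZero ν d ≤ s → s ≤ (⌊q / 2⌋ : ℝ) - KAM.muBar d σ τ →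
      KAM.decayLip γ (KAM.DC Ω γ τ) s R₀ ≤ ENNReal.ofReal (K * ε)) →
    ∃ (D : ℕ → KAM.Freq ν → KAM.BlockDiag d)
      (R Ψ : ℕ → KAM.Freq ν → (Fin ν → ℝ) → KAM.Op2 d)
      (Dext : ℕ → KAM.Freq ν → KAM.BlockDiag d),
      -- the starting point
      (∀ ω ∈ KAM.DC Ω γ τ,
        (∀ α, D 0 ω α = ((m * α.1 + c α ω : ℝ) : ℂ) • (1 : KAM.Block α α)) ∧ R 0 ω = R₀ ω) ∧
      -- the Hamiltonian vector fields `D_k + R_k` on `Ω_k`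
      (∀ k, ∀ ω ∈ KAM.goodSet Ω γ τ e N₀ D k,
        (∀ α, (D k ω α).IsHermitian) ∧
        KAM.TorusPeriodic (R k ω) ∧ Continuous (R k ω) ∧ ∀ φ, KAM.IsHamiltonian (R k ω φ)) ∧
      (∀ k α, KAM.lipNorm γ (KAM.goodSet Ω γ τ e N₀ D k) KAM.hsENorm
          (fun ω => D k ω α - D 0 ω α)
        ≤ ENNReal.ofReal (C * ε * α.1 ^ (-KAM.sTop d σ τ e q))) ∧
      (∀ k, ∀ s : ℝ, 2 * KAM.sZero ν d ≤ s → s ≤ KAM.sTop d σ τ e q →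
        KAM.decayLip γ (KAM.goodSet Ω γ τ e N₀ D k) s (R k)
          ≤ KAM.decayLip γ (KAM.DC Ω γ τ) (s + KAM.bExp τ e) R₀ *
            ENNReal.ofReal (KAM.scalePred N₀ k ^ (-KAM.aExp τ e)) ∧
        KAM.decayLip γ (KAM.goodSet Ω γ τ e N₀ D k) (s + KAM.bExp τ e) (R k)
          ≤ KAM.decayLip γ (KAM.DC Ω γ τ) (s + KAM.bExp τ e) R₀ *
            ENNReal.ofReal (KAM.scalePred N₀ k)) ∧
      -- the symplectic conjugation `Φ_k = exp Ψ_k` from step `k` to step `k + 1`, on `Ω_{k+1}`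
      (∀ k, ∀ ω ∈ KAM.goodSet Ω γ τ e N₀ D (k + 1),
        KAM.TorusPeriodic (Ψ k ω) ∧ ContDiff ℝ 1 (Ψ k ω) ∧
        (∀ φ, KAM.IsHamiltonian (Ψ k ω φ)) ∧
        (∀ φ, KAM.IsSymplectic (NormedSpace.exp (Ψ k ω φ))) ∧
        KAM.IsPushForward ω (fun φ => NormedSpace.exp (Ψ k ω φ))
          (D k ω) (R k ω) (D (k + 1) ω) (R (k + 1) ω)) ∧
      (∀ k, ∀ s : ℝ, 2 * KAM.sZero ν d ≤ s → s ≤ KAM.sTop d σ τ e q →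
        KAM.decayLip γ (KAM.goodSet Ω γ τ e N₀ D (k + 1)) s (Ψ k)
          ≤ KAM.decayLip γ (KAM.DC Ω γ τ) (s + KAM.bExp τ e) R₀ *
            ENNReal.ofReal (γ⁻¹ * KAM.scale N₀ k ^ (2 * τ + 4 * e + 1) *
              KAM.scalePred N₀ k ^ (-KAM.aExp τ e))) ∧
      -- the Lipschitz extensions of the blocks to `DC(γ, τ)`
      (∀ k, ∀ ω ∈ KAM.DC Ω γ τ, ∀ α, (Dext k ω α).IsHermitian) ∧
      (∀ k, ∀ ω ∈ KAM.goodSet Ω γ τ e N₀ D k, ∀ α, Dext k ω α = D k ω α) ∧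
      (∀ k α, KAM.lipNorm γ (KAM.DC Ω γ τ) KAM.hsENorm (fun ω => Dext k ω α) < ⊤) ∧
      (∀ k α,
        KAM.lipNorm γ (KAM.DC Ω γ τ) KAM.hsENorm (fun ω => Dext (k + 1) ω α - Dext k ω α)
          ≤ ENNReal.ofReal (C₁ * α.1 ^ (-KAM.sTop d σ τ e q)) *
            KAM.decayLip γ (KAM.goodSet Ω γ τ e N₀ D k) (KAM.sTop d σ τ e q) (R k) ∧
        ENNReal.ofReal (α.1 ^ (-KAM.sTop d σ τ e q)) *
            KAM.decayLip γ (KAM.goodSet Ω γ τ e N₀ D k) (KAM.sTop d σ τ e q) (R k)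
          ≤ ENNReal.ofReal (C₁ * KAM.scalePred N₀ k ^ (-KAM.aExp τ e) *
              α.1 ^ (-KAM.sTop d σ τ e q)) *
            KAM.decayLip γ (KAM.DC Ω γ τ) (KAM.sTop d σ τ e q + KAM.bExp τ e) R₀) ∧
      -- convergence of the extended blocks
      (∃ Dlim : KAM.Freq ν → KAM.BlockDiag d,
        (∀ ω ∈ KAM.DC Ω γ τ, ∀ α, (Dlim ω α).IsHermitian) ∧
        ∀ α, Filter.Tendsto (fun k => KAM.lipNorm γ (KAM.DC Ω γ τ) KAM.hsENorm
          (fun ω => Dext k ω α - Dlim ω α)) Filter.atTop (nhds 0)) := by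
  -- the extensions do not increase norms, which gives `C₁ = 1`
  refine ⟨1, one_pos, fun q hq K hK => ⟨2 * K, 64, by positivity, fun N₀ hN₀ => ?_⟩⟩
  set t := KAM.sTop d σ τ e q with ht
  set a := KAM.aExp τ e with ha
  set b := KAM.bExp τ e with hb
  set κ := (KAM.algConst ν d (t + b)).toReal with hκ
  have ha3 : 3 ≤ a := by
    simp only [ha, KAM.aExp]
    linarith
  have hb4 : 4 ≤ b := by
    simp only [hb, KAM.bExp]
    linarith
  have hs0 := KAM.natCast_add_le_two_mul_sZero ν d
  have htop : t + b = (⌊q / 2⌋ : ℝ) - KAM.muBar d σ τ := by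
    simp only [ht, KAM.sTop, hb]
    ring
  have hνt : (ν : ℝ) + d ≤ t := by
    have h1 := Int.sub_one_lt_floor (q / 2)
    linarith
  have hP : 0 ≤ 768 * κ * (N₀ : ℝ) ^ a :=
    mul_nonneg (mul_nonneg (by norm_num) ENNReal.toReal_nonneg)
      (Real.rpow_nonneg (Nat.cast_nonneg _) _)
  -- `Q` bounds the coefficients of `ε γ⁻¹` in both smallness conditions of the iteration
  set Q := 2 + 3 * K + K * (768 * κ * (N₀ : ℝ) ^ a) with hQ
  have hKP := mul_nonneg hK.le hP
  have hQ2 : 2 ≤ Q := by linarith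
  have hQ0 : 0 < Q := by linarith
  refine ⟨Q⁻¹, inv_pos.mpr hQ0, inv_lt_one_of_one_lt₀ (by linarith), ?_⟩
  intro γ ε hγ _ hε hδ Ω _ m c R₀ _ hc hR hRs
  have hA : 0 ≤ K * ε := by positivity
  have hδ' : ∀ r, 0 ≤ r → K * r ≤ Q → γ⁻¹ * (K * ε) * r ≤ 1 := fun r hr hrQ => by
    calc γ⁻¹ * (K * ε) * r = ε * γ⁻¹ * (K * r) := by ring
      _ ≤ Q⁻¹ * Q := mul_le_mul hδ hrQ (mul_nonneg hK.le hr) (inv_nonneg.mpr hQ0.le)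
      _ = 1 := inv_mul_cancel₀ hQ0.ne'
  have h : KAM.KamData Ω γ τ e N₀ c R₀ (K * ε) κ t :=
    { one_le_dim := hν
      gamma_pos := hγ
      tau_nonneg := hτ.le
      loss_nonneg := he.le
      scale_le := hN₀
      bound_nonneg := hA
      cont := fun ω hω => ⟨(hR ω hω).2.1, (hR ω hω).1⟩
      ham := fun ω hω => (hR ω hω).2.2
      diag_le := fun α => (le_mul_of_one_le_right' (by simpa using α.one_le)).trans (hc α)
      -- the exponents `s + b` lie in the range of the hypothesis because `b ≥ 4` and `s ≥ ν + d`
      pert_le := fun s hs hst => hRs _ (by linarith [KAM.sZero_le ν d]) (by linarith)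
      exponent_le := hνt
      algConst_le := (ENNReal.ofReal_toReal (KAM.algConst_lt_top hν _).ne).ge
      small := hδ' _ hP (by linarith)
      small' := by
        have := hδ' 3 (by norm_num) (by linarith)
        linarith }
  set D₀ := KAM.initDiag m c with hD₀
  have hbound := h.pertBound m
  have hbt : ∀ i, KAM.KamData.PertBound Ω γ τ e N₀ D₀ R₀ i t := fun i => hbound i t hνt le_rfl
  have hspec := h.structure_spec m
  have hcont : ∀ k, KAM.ContOn (KAM.kamSet Ω γ τ e N₀ D₀ R₀ k) (KAM.kamPert N₀ D₀ R₀ k) :=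
    fun k ω hω => (hspec k ω hω).2.2.1
  have hN1 : 1 ≤ N₀ := by linarith
  have hM : ∀ k, 0 ≤ KAM.scalePred N₀ k := fun k => by linarith [KAM.one_le_scalePred hN1 k]
  -- the increments of the normal form and their extensions
  have hincr : ∀ k α, KAM.lipNorm γ (KAM.kamSet Ω γ τ e N₀ D₀ R₀ k) KAM.hsENorm
      (fun ω => KAM.kamDiag N₀ D₀ R₀ (k + 1) ω α - KAM.kamDiag N₀ D₀ R₀ k ω α) ≤
      ENNReal.ofReal (α.1 ^ (-t)) *
        KAM.decayLip γ (KAM.kamSet Ω γ τ e N₀ D₀ R₀ k) t (KAM.kamPert N₀ D₀ R₀ k) :=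
    fun k α => KAM.lipNorm_nextDiag_sub_le (KAM.scale N₀ k) (KAM.kamDiag N₀ D₀ R₀ k) (hcont k) t α
  have hfin : ∀ k (α : KAM.Spec d), ENNReal.ofReal (α.1 ^ (-t)) *
      KAM.decayLip γ (KAM.kamSet Ω γ τ e N₀ D₀ R₀ k) t (KAM.kamPert N₀ D₀ R₀ k) ≠ ⊤ :=
    fun k α => ENNReal.mul_ne_top ENNReal.ofReal_ne_top
      (ne_top_of_le_ne_top ENNReal.ofReal_ne_top (hbt k).1)
  have hext : ∀ k (α : KAM.Spec d), ∃ g : KAM.Freq ν → KAM.Block α α,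
      (∀ ω ∈ KAM.kamSet Ω γ τ e N₀ D₀ R₀ k,
        g ω = KAM.kamDiag N₀ D₀ R₀ (k + 1) ω α - KAM.kamDiag N₀ D₀ R₀ k ω α) ∧
      (∀ ω, (g ω).IsHermitian) ∧ KAM.lipNorm γ (KAM.DC Ω γ τ) KAM.hsENorm g ≤
        ENNReal.ofReal (α.1 ^ (-t)) *
          KAM.decayLip γ (KAM.kamSet Ω γ τ e N₀ D₀ R₀ k) t (KAM.kamPert N₀ D₀ R₀ k) := fun k α => by
    obtain ⟨g, hg1, hg2, hg3⟩ := KAM.exists_hermitian_extension hγ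
      (KAM.kamSet Ω γ τ e N₀ D₀ R₀ k)
      (fun ω => KAM.kamDiag N₀ D₀ R₀ (k + 1) ω α - KAM.kamDiag N₀ D₀ R₀ k ω α)
      (fun ω hω => by
        refine Matrix.IsHermitian.sub ?_ ((hspec k ω hω).1 α)
        exact KAM.nextDiag_isHermitian (hspec k ω hω).1 (hspec k ω hω).2.2.2 α)
      (ne_top_of_le_ne_top (hfin k α) (hincr k α))
    exact ⟨g, hg1, hg2, (hg3 _).trans (hincr k α)⟩
  choose g hgeq hgherm hgle using hext
  -- the extended increments are dominated by a geometric series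
  have hsumm : ∀ α, ∑' i, KAM.lipNorm γ (KAM.DC Ω γ τ) KAM.hsENorm (g i α) ≠ ⊤ := fun α => by
    have hle : ∀ i, KAM.lipNorm γ (KAM.DC Ω γ τ) KAM.hsENorm (g i α) ≤
        ENNReal.ofReal (α.1 ^ (-t) * KAM.KamData.size Ω γ τ e R₀ t) *
          ENNReal.ofReal (1 / 2) ^ i := fun i => by
      have hα : 0 ≤ α.1 ^ (-t) := Real.rpow_nonneg α.pos.le _
      have hx := KAM.KamData.size_nonneg (Ω := Ω) (γ := γ) (τ := τ) (e := e) (R₀ := R₀) t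
      refine (hgle i α).trans ((mul_le_mul_right (hbt i).1 _).trans ?_)
      rw [← ENNReal.ofReal_mul hα, ← ENNReal.ofReal_pow (by norm_num), ← ENNReal.ofReal_mul
        (mul_nonneg hα hx), mul_assoc]
      refine ENNReal.ofReal_le_ofReal ?_
      have := KAM.scalePred_rpow_neg_le hN₀ (by linarith : 1 ≤ a) i
      gcongr
    refine ne_top_of_le_ne_top ?_ (ENNReal.tsum_le_tsum hle)
    rw [ENNReal.tsum_mul_left, ENNReal.tsum_geometric]
    refine ENNReal.mul_ne_top ENNReal.ofReal_ne_top (ENNReal.inv_ne_top.mpr ?_)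
    rw [← ENNReal.ofReal_one, ← ENNReal.ofReal_sub _ (by norm_num)]
    simp only [ne_eq, ENNReal.ofReal_eq_zero, not_le]
    norm_num
  have hstep : ∀ s : ℝ, 2 * KAM.sZero ν d ≤ s → s ≤ t → (ν : ℝ) + d ≤ s := fun s hs _ => by linarith
  refine ⟨KAM.kamDiag N₀ D₀ R₀, KAM.kamPert N₀ D₀ R₀,
    fun k ω => KAM.generator (KAM.scale N₀ k) (KAM.kamDiag N₀ D₀ R₀ k ω) ω
      (KAM.kamPert N₀ D₀ R₀ k ω),
    fun k ω α => D₀ ω α + ∑ i ∈ Finset.range k, g i α ω,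
    fun ω _ => ⟨fun α => rfl, rfl⟩, ?_, ?_, ?_, ?_, ?_, ?_, ?_, ?_, ?_, ?_⟩
  · exact fun k ω hω => ⟨(hspec k ω hω).1, (hcont k ω hω).2, (hcont k ω hω).1, (hspec k ω hω).2.2.2⟩
  · intro k α
    refine (h.lipNorm_diag_sub_le m k (fun i _ => hbt i) α).trans (le_of_eq ?_)
    rw [mul_assoc 2 K ε]
  · intro k s hs hst
    have hs' := hstep s hs hst
    rw [← h.ofReal_size hs' hst, ← ENNReal.ofReal_mul (KAM.KamData.size_nonneg s),
      ← ENNReal.ofReal_mul (KAM.KamData.size_nonneg s)]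
    exact hbound k s hs' hst
  · intro k ω hω
    obtain ⟨h1, h2, -, h4⟩ := hspec k ω hω.1
    have hΨ := KAM.isHamiltonian_generator h1 hω.2 h4
    exact ⟨(KAM.torusCont_generator _ _ _ _).2, KAM.contDiff_realTrigOp _ _ _, hΨ,
      fun φ => (hΨ φ).isSymplectic_exp,
      KAM.isPushForward_exp_generator h2 (KAM.one_le_scale hN1 k) _ hω.2⟩
  · intro k s hs hst
    have hs' := hstep s hs hst
    rw [← h.ofReal_size hs' hst, ← ENNReal.ofReal_mul (KAM.KamData.size_nonneg s)]
    exact (h.step m k (fun i _ => hbt i) hs' hst (hbound k s hs' hst)).1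
  · intro k ω _ α
    refine (KAM.initDiag_isHermitian m c ω α).add ?_
    rw [Matrix.IsHermitian, Matrix.conjTranspose_sum]
    exact Finset.sum_congr rfl fun i _ => hgherm i α ω
  · intro k
    induction k with
    | zero =>
      intro ω _ α
      simp only [Finset.range_zero, Finset.sum_empty, add_zero]
      rfl
    | succ k ih =>
      intro ω hω α
      have h1 : D₀ ω α + ∑ i ∈ Finset.range k, g i α ω = KAM.kamDiag N₀ D₀ R₀ k ω α := ih ω hω.1 α
      change D₀ ω α + ∑ i ∈ Finset.range (k + 1), g i α ω = _
      rw [Finset.sum_range_succ, ← add_assoc, h1, hgeq k α ω hω.1, add_sub_cancel]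
  · intro k α
    induction k with
    | zero =>
      simp only [Finset.range_zero, Finset.sum_empty, add_zero]
      exact KAM.lipNorm_initDiag_lt_top (h.diag_le α)
    | succ k ih =>
      simp only [Finset.sum_range_succ, ← add_assoc]
      refine (KAM.lipNorm_block_add_le _ _).trans_lt (ENNReal.add_lt_top.mpr ⟨ih, ?_⟩)
      exact (hgle k α).trans_lt (hfin k α).lt_top
  · intro k α
    constructor
    · have e1 : (fun ω => D₀ ω α + ∑ i ∈ Finset.range (k + 1), g i α ω -
          (D₀ ω α + ∑ i ∈ Finset.range k, g i α ω)) = g k α := funext fun ω => by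
        rw [Finset.sum_range_succ]
        abel
      rw [e1, one_mul]
      exact hgle k α
    · refine (mul_le_mul_right (hbt k).1 _).trans (le_of_eq ?_)
      rw [← h.ofReal_size hνt le_rfl, one_mul, ENNReal.ofReal_mul (KAM.KamData.size_nonneg t),
        ENNReal.ofReal_mul (Real.rpow_nonneg (hM k) _)]
      ring
  · refine ⟨fun ω α => D₀ ω α + ∑' i, g i α ω, fun ω _ α => ?_, fun α => ?_⟩
    · refine (KAM.initDiag_isHermitian m c ω α).add ?_
      rw [Matrix.IsHermitian, Matrix.conjTranspose_tsum]
      exact tsum_congr fun i => hgherm i α ω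
    · simp only [add_sub_add_left_eq_sub]
      exact KAM.tendsto_lipNorm_partialSum (hsumm α)
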